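/- Notation. $\langle T\rangle=(1+T^2)^{1/2}$, $W^{s,p}=(1-\partial^2)^{-s/2}L^p(\mathbb R)$ with its natural norm, and $H^s=W^{s,2}$. For $\sigma\in\mathbb R$, $H^\sigma_0(\mathbb R^+)$ is the space of $f\in H^\sigma(\mathbb R)$ supported in $[0,\infty)$, with the norm of $H^\sigma(\mathbb R)$ (for $\sigma\ge 0$: the functions on $\mathbb R^+$ whose extension by zero is in $H^\sigma(\mathbb R)$), and $C^\infty_{0,c}(\mathbb R^+)$ is the space of $f\in C_c^\infty(\mathbb R)$ supported in $[0,\infty)$. For $f\in C^\infty_{0,c}(\mathbb R^+)$ the boundary forcing operator is $$\mathcal Lf(x,t)=\frac1{\sqrt\pi}\int_0^t (t-t')^{-1/2}\exp\Big(\frac{ix^2}{4(t-t')}\Big)\,\mathcal I_{-1/2}f(t')\,dt',\qquad \mathcal I_{-1/2}f(t)=\frac{d}{dt}\,\frac1{\Gamma(1/2)}\int_0^t(t-t')^{-1/2}f(t')\,dt',$$ for $x,t\in\mathbb R$. Fix $\theta\in C_c^\infty(\mathbb R)$ with $\theta=1$ on $[-1,1]$ and $\operatorname{supp}\theta\subset[-2,2]$,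 and put $\theta_T(t)=\theta(t/T)$ for $T>0$. Statement. For every $\sigma\in\mathbb R$, $\mathcal L$ extends by density to $H_0^\sigma(\mathbb R^+)$: for every $f\in H^\sigma_0(\mathbb R^+)$ there is exactly one tempered distribution $\mathcal Lf$ on $\mathbb R_x\times\mathbb R_t$ such that $\mathcal Lf_n\to\mathcal Lf$ in the sense of tempered distributions whenever $f_n\in C^\infty_{0,c}(\mathbb R^+)$ and $f_n\to f$ in $H^\sigma(\mathbb R)$. Moreover, for $f\in H_0^{\frac{2s+1}{4}}(\mathbb R^+)$: 1. Space traces: if $-\frac12<s<\frac32$, there is $c=c(s,\theta)$ such that for all $T>0$ and all $f$, $\theta_T(t)\mathcal Lf\in C(\mathbb R_t;H^s_x)$ and $\sup_t\|\theta_T(t)\mathcal Lf(\cdot,t)\|_{H^s_x}\le c\,\langle T\rangle^{1/4}\|f\|_{H_0^{\frac{2s+1}4}(\mathbb R^+)}$. 2. Time traces: if $s\in\mathbb R$, there is $c=c(s)$ such that for all $f$, $\mathcal Lf\in C(\mathbb R_x;H_0^{\frac{2s+1}4}(\mathbb R_t^+))$ and $\sup_x\|\mathcal Lf(x,\cdot)\|_{H_0^{\frac{2s+1}4}(\mathbb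 R^+)}\le c\,\|f\|_{H_0^{\frac{2s+1}4}(\mathbb R^+)}$. 3. Mixed norm: if $0\le s\le1$, $2\le q\le\infty$, $2\le r<\infty$ and $\frac1q+\frac1{2r}=\frac14$, there is $c=c(s,q,r)$ such that for all $f$, $\mathcal Lf\in L^q_t(\mathbb R;W^{s,r}_x)$ and $\|\mathcal Lf\|_{L^q_tW^{s,r}_x}\le c\,\|f\|_{H_0^{\frac{2s+1}4}(\mathbb R^+)}$. -/

import Mathlib

open MeasureTheory Filter Topology Set
open scoped ENNReal NNReal SchwartzMap ContDiff

noncomputable section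

namespace NLSHalfLine

/-! ### Sobolev spaces of tempered distributions on the line -/

/-- The operator `(1 - ∂²)^(s/2)` on tempered distributions on the line. The factor `2π` in the
symbol accounts for the normalization `e^{-2πixξ}` of Mathlib's Fourier transform. -/
def bessel (s : ℝ) : 𝓢'(ℝ, ℂ) →L[ℂ] 𝓢'(ℝ, ℂ) :=
  TemperedDistribution.fourierMultiplierCLM ℂ
    (fun ξ : ℝ => (((1 + (2 * Real.pi * ξ) ^ 2) ^ (s / 2) : ℝ) : ℂ))

/-- The norm of `W^{s,p} = (1 - ∂²)^(-s/2) L^p`; it is `∞` exactly off `W^{s,p}`. -/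
def sobolevENorm (s : ℝ) (p : ℝ≥0∞) [Fact (1 ≤ p)] (u : 𝓢'(ℝ, ℂ)) : ℝ≥0∞ :=
  ⨅ (v : Lp ℂ p (volume : Measure ℝ)) (_ : bessel s u = (v : 𝓢'(ℝ, ℂ))), ‖v‖ₑ

/-- The norm of `H^s = W^{s,2}`. -/
def hENorm (s : ℝ) (u : 𝓢'(ℝ, ℂ)) : ℝ≥0∞ := sobolevENorm s 2 u

/-- Membership in `H_0^σ(ℝ⁺)`, for every real `σ`: the element is identified with its extension by
zero, which is an element of `H^σ(ℝ)` supported in `[0, ∞)`. Its norm is `hENorm σ`. -/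
def MemH0 (σ : ℝ) (f : 𝓢'(ℝ, ℂ)) : Prop :=
  hENorm σ f < ⊤ ∧ Distribution.dsupport f ⊆ Ici 0

/-- `y ↦ u y` belongs to `C(ℝ; H^s)`. -/
def ContinuousIntoH (s : ℝ) (u : ℝ → 𝓢'(ℝ, ℂ)) : Prop :=
  (∀ y, hENorm s (u y) < ⊤) ∧
    ∀ y₀, Tendsto (fun y => hENorm s (u y - u y₀)) (𝓝 y₀) (𝓝 0)

/-- The norm of `L^q(ℝ; W^{s,r})`; it is `∞` if `u` is not a.e. `W^{s,r}`-valued or not strongly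
measurable as a map into `W^{s,r}`. -/
def mixedENorm (q : ℝ≥0∞) (s : ℝ) (r : ℝ≥0∞) [Fact (1 ≤ r)] (u : ℝ → 𝓢'(ℝ, ℂ)) : ℝ≥0∞ :=
  ⨅ (v : ℝ → Lp ℂ r (volume : Measure ℝ)) (_ : AEStronglyMeasurable v volume)
    (_ : ∀ᵐ t, bessel s (u t) = (v t : 𝓢'(ℝ, ℂ))), eLpNorm v q volume

/-! ### Slices of space-time distributions; the variables are `(x, t)` -/

/-- The slice `x ↦ Ψ (x, t)` of a test function at time `t`. -/
def timeSlice (t : ℝ) : 𝓢(ℝ × ℝ, ℂ) →L[ℂ] 𝓢(ℝ, ℂ) :=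
  SchwartzMap.compCLM ℂ (g := fun x : ℝ => (x, t))
    (by simpa [Pi.add_def] using (ContinuousLinearMap.inl ℝ ℝ ℝ).hasTemperateGrowth.add
          (Function.HasTemperateGrowth.const ((0 : ℝ), t)))
    ⟨1, 1, fun x => by
      have h : ‖x‖ ≤ ‖(x, t)‖ := norm_fst_le (x, t)
      rw [pow_one, one_mul]
      linarith⟩

/-- The slice `t ↦ Ψ (x, t)` of a test function at the point `x`. -/
def spaceSlice (x : ℝ) : 𝓢(ℝ × ℝ, ℂ) →L[ℂ] 𝓢(ℝ, ℂ) :=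
  SchwartzMap.compCLM ℂ (g := fun t : ℝ => (x, t))
    (by simpa [Pi.add_def] using (ContinuousLinearMap.inr ℝ ℝ ℝ).hasTemperateGrowth.add
          (Function.HasTemperateGrowth.const (x, (0 : ℝ))))
    ⟨1, 1, fun t => by
      have h : ‖t‖ ≤ ‖(x, t)‖ := norm_snd_le (x, t)
      rw [pow_one, one_mul]
      linarith⟩

/-- The distribution `U(x, t)` is the family `t ↦ u t = U(·, t)` of distributions in `x`. -/
def HasTimeSlices (U : 𝓢'(ℝ × ℝ, ℂ)) (u : ℝ → 𝓢'(ℝ, ℂ)) : Prop :=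
  ∀ Ψ : 𝓢(ℝ × ℝ, ℂ), Integrable (fun t => u t (timeSlice t Ψ)) ∧
    U Ψ = ∫ t, u t (timeSlice t Ψ)

/-- The distribution `U(x, t)` is the family `x ↦ w x = U(x, ·)` of distributions in `t`. -/
def HasSpaceSlices (U : 𝓢'(ℝ × ℝ, ℂ)) (w : ℝ → 𝓢'(ℝ, ℂ)) : Prop :=
  ∀ Ψ : 𝓢(ℝ × ℝ, ℂ), Integrable (fun x => w x (spaceSlice x Ψ)) ∧
    U Ψ = ∫ x, w x (spaceSlice x Ψ)

/-! ### The boundary forcing operator -/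

/-- The Riemann-Liouville integral `I_α f(t) = Γ(α)⁻¹ ∫₀ᵗ (t - s)^(α-1) f(s) ds` for `α > 0`. -/
def riemannLiouville (α : ℝ) (f : ℝ → ℂ) (t : ℝ) : ℂ :=
  ((Real.Gamma α)⁻¹ : ℝ) * ∫ s in (0 : ℝ)..t, (((t - s) ^ (α - 1) : ℝ) : ℂ) * f s

/-- `I_{-1/2} f = ∂_t I_{1/2} f`. -/
def halfDeriv (f : ℝ → ℂ) (t : ℝ) : ℂ := deriv (riemannLiouville (1 / 2) f) t

/-- The boundary forcing operator on smooth `f` supported in `[0, ∞)`: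
`π^(-1/2) ∫₀ᵗ (t - t')^(-1/2) exp (i x² / (4 (t - t'))) I_{-1/2} f(t') dt'`. -/
def forcing (f : ℝ → ℂ) (x t : ℝ) : ℂ :=
  ((1 / Real.sqrt Real.pi : ℝ) : ℂ) * ∫ t' in (0 : ℝ)..t,
    (((t - t') ^ (-(1 / 2) : ℝ) : ℝ) : ℂ) *
      Complex.exp (Complex.I * ((x ^ 2 / (4 * (t - t')) : ℝ) : ℂ)) * halfDeriv f t'

/-- `C_{0,c}^∞(ℝ⁺)`: smooth compactly supported functions on the line with support in `[0, ∞)`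
(a compactly supported smooth function is a Schwartz function). -/
def IsTestHalfLine (g : 𝓢(ℝ, ℂ)) : Prop :=
  HasCompactSupport g ∧ tsupport g ⊆ Ici 0

/-- The extension by density of the boundary forcing operator to `H_0^σ(ℝ⁺)`: the space-time
distribution `U` is the limit of the classical `ℒ g_n`, whenever `g_n ∈ C_{0,c}^∞(ℝ⁺)` converges to
`f` in `H_0^σ(ℝ⁺)`. -/
def IsForcing (σ : ℝ) (f : 𝓢'(ℝ, ℂ)) (U : 𝓢'(ℝ × ℝ, ℂ)) : Prop :=
  ∀ g : ℕ → 𝓢(ℝ, ℂ), (∀ n, IsTestHalfLine (g n)) →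
    Tendsto (fun n => hENorm σ ((g n : 𝓢'(ℝ, ℂ)) - f)) atTop (𝓝 0) →
    ∀ Ψ : 𝓢(ℝ × ℝ, ℂ),
      (∀ n, Integrable (fun z : ℝ × ℝ => Ψ z * forcing (g n) z.1 z.2)) ∧
      Tendsto (fun n => ∫ z : ℝ × ℝ, Ψ z * forcing (g n) z.1 z.2) atTop (𝓝 (U Ψ))

/-- The Japanese bracket `⟨T⟩ = (1 + T²)^(1/2)`. -/
def bracket (T : ℝ) : ℝ := Real.sqrt (1 + T ^ 2)

end NLSHalfLine

end

noncomputable section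

namespace NLSHalfLine

/-! ### Bessel potentials, and `H^σ` parametrized by `L²` data. -/

open FourierTransform

/-! The operator is diagonalized by the Fourier transform in time. An element of `H^σ` is written as
`J^(-σ)` of an inverse Fourier transform of some `Φ ∈ L²` (`ofData`), and its norm is `‖Φ‖`. With `p
= q²`, the Laplace transform of `t^(-1/2) e^{ix²/(4t)}` is `√π q⁻¹ exp(-e^{-iπ/4} q |x|)`
(`laplace_kernel`), and the half derivative contributes a factor `q`. Hence the forcing multiplies
the Laplace transform of a test function by `exp(-e^{-iπ/4} q |x|)` (`laplace_forcing`). Letting `p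
→ 2πiτ` along `Re p > 0` gives the multiplier `symb x τ = exp(-|x| kap τ)`, of modulus at most one
because `Re kap ≥ 0` (`integral_test_mul_forcing`). This defines `ℒf` for all data and every `σ`,
and gives the time traces with constant one. Uniqueness, and the support of the traces in `[0, ∞)`,
follow from the density of test functions in `H_0^σ` (`exists_test_tendsto`).

For fixed time, substitute `τ = -2πη|η|`. The symbol becomes the travelling wave `e^{2πiη|x|}` for
`η > 0` and the decaying profile `e^{-2π|η||x|}` for `η < 0`, while the time factor becomes a
Schrödinger phase. The exponent `(2s+1)/4` is exactly what makes the weights match the Jacobian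
`4π|η|` (`dataFactor_sq_le`). The remaining difficulty is that `J^s` acts on functions of `|x|`.
Tested against `ψ`, and after division by the weight at `η`, it gives a half-line Fourier transform
plus a correction `∫ M(z, η) (𝓕⁻ψ)(ηz) dz` with `|M| ≤ (2 + |z|^s)/(1 + z²)`
(`integral_symb_besselS_neg`, `integral_symb_besselS_pos`, `norm_spaceKer_le`). Dilation by `z`
costs `|z|^(-1/2)` in `L²`, so Minkowski's inequality bounds the correction when `-1/2 < s < 3/2`.
Thus `J^s ℒf(·, t)` is the transpose of a fixed bounded operator applied to data carrying a
unimodular phase, with a bound uniform in `t` (`space_traces`).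

The mixed norm is a Strichartz estimate for these profiles, proved by duality. Marcinkiewicz
interpolation gives the dispersive decay, and the `TT*` argument with the Hardy-Littlewood-Sobolev
inequality gives the dual bound for a free evolution of any speed. A dilation by `z` changes the
speed to `±z⁻²`, and the dual bound then scales like `|z|^(-1/r)`, so the correction kernel is still
integrable for `0 ≤ s ≤ 1` (`IsNice.lintegral_kerAdj_sq_le`). The case `r = 2`, `q = ∞` is the
uniform `L²` bound itself. -/

/-- The symbol `(1 + (2πk)²)^(s/2)` of `(1 - ∂²)^(s/2)`. -/
def jw (s k : ℝ) : ℝ := (1 + (2 * Real.pi * k) ^ 2) ^ (s / 2)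

lemma jw_pos (s k : ℝ) : 0 < jw s k := by unfold jw; positivity

lemma jw_ne_zero (s k : ℝ) : jw s k ≠ 0 := (jw_pos s k).ne'

lemma jw_mul (s s' k : ℝ) : jw s k * jw s' k = jw (s + s') k := by
  unfold jw
  rw [← Real.rpow_add (by positivity)]
  ring_nf

lemma jw_zero (k : ℝ) : jw 0 k = 1 := by simp [jw]

lemma jw_neg_mul (s k : ℝ) : jw (-s) k * jw s k = 1 := by
  rw [jw_mul]; simp [jw_zero]

lemma jw_hasTemperateGrowth (s : ℝ) : (jw s).HasTemperateGrowth := by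
  have h := (Function.hasTemperateGrowth_one_add_norm_sq_rpow ℝ (s / 2)).comp
    (ContinuousLinearMap.hasTemperateGrowth ((2 * Real.pi) • ContinuousLinearMap.id ℝ ℝ))
  have e : jw s = (fun x : ℝ => (1 + ‖x‖ ^ 2) ^ (s / 2)) ∘
      ((2 * Real.pi) • ContinuousLinearMap.id ℝ ℝ) := by
    funext k
    simp only [jw, Function.comp_apply, smul_apply,
      ContinuousLinearMap.id_apply, smul_eq_mul, Real.norm_eq_abs, sq_abs]
  rw [e]
  exact h

lemma jwC_hasTemperateGrowth (s : ℝ) : (fun k => (jw s k : ℂ)).HasTemperateGrowth :=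
  Function.HasTemperateGrowth.comp (g := (Complex.ofRealCLM : ℝ → ℂ))
    (Complex.ofRealCLM.hasTemperateGrowth) (jw_hasTemperateGrowth s)

lemma continuous_jw (s : ℝ) : Continuous (jw s) := (jw_hasTemperateGrowth s).1.continuous

lemma bessel_eq (s : ℝ) :
    bessel s = TemperedDistribution.fourierMultiplierCLM ℂ (fun k => (jw s k : ℂ)) := rfl

lemma bessel_bessel (s s' : ℝ) (u : 𝓢'(ℝ, ℂ)) : bessel s (bessel s' u) = bessel (s + s') u := by
  rw [bessel_eq, bessel_eq, bessel_eq,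
    TemperedDistribution.fourierMultiplierCLM_fourierMultiplierCLM_apply
      (jwC_hasTemperateGrowth _) (jwC_hasTemperateGrowth _)]
  congr 2
  ext k
  simp only [Pi.mul_apply]
  rw [← jw_mul s s']
  push_cast
  ring

lemma bessel_zero (u : 𝓢'(ℝ, ℂ)) : bessel 0 u = u := by
  rw [bessel_eq]
  simp [jw_zero]

/-- `(1 - ∂²)^(s/2)` on Schwartz functions. -/
def besselS (s : ℝ) (ψ : 𝓢(ℝ, ℂ)) : 𝓢(ℝ, ℂ) :=
  𝓕 (SchwartzMap.smulLeftCLM ℂ (fun k => (jw s k : ℂ)) (𝓕⁻ ψ))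

lemma bessel_apply (s : ℝ) (u : 𝓢'(ℝ, ℂ)) (ψ : 𝓢(ℝ, ℂ)) : bessel s u ψ = u (besselS s ψ) := rfl

lemma fourierInv_besselS (s : ℝ) (ψ : 𝓢(ℝ, ℂ)) (k : ℝ) :
    (𝓕⁻ (besselS s ψ) : 𝓢(ℝ, ℂ)) k = (jw s k : ℂ) * (𝓕⁻ ψ : 𝓢(ℝ, ℂ)) k := by
  rw [besselS, fourierInv_fourier_eq,
    SchwartzMap.smulLeftCLM_apply_apply (jwC_hasTemperateGrowth s), smul_eq_mul]

lemma besselS_besselS (s s' : ℝ) (ψ : 𝓢(ℝ, ℂ)) :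
    besselS s (besselS s' ψ) = besselS (s + s') ψ := by
  have h : 𝓕⁻ (besselS s (besselS s' ψ)) = 𝓕⁻ (besselS (s + s') ψ) := by
    ext k
    simp only [fourierInv_besselS]
    rw [← jw_mul]; push_cast; ring
  simpa using congrArg (fun g : 𝓢(ℝ, ℂ) => 𝓕 g) h

lemma besselS_zero (ψ : 𝓢(ℝ, ℂ)) : besselS 0 ψ = ψ := by
  have h : 𝓕⁻ (besselS 0 ψ) = 𝓕⁻ ψ := by
    ext k
    simp only [fourierInv_besselS]
    simp [jw_zero]
  simpa using congrArg (fun g : 𝓢(ℝ, ℂ) => 𝓕 g) h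

/-- Continuous linear version of `besselS`. -/
def besselSCLM (s : ℝ) : 𝓢(ℝ, ℂ) →L[ℂ] 𝓢(ℝ, ℂ) :=
  fourierCLM ℂ 𝓢(ℝ, ℂ) ∘L SchwartzMap.smulLeftCLM ℂ (fun k => (jw s k : ℂ)) ∘L
    fourierInvCLM ℂ 𝓢(ℝ, ℂ)

lemma besselSCLM_apply (s : ℝ) (ψ : 𝓢(ℝ, ℂ)) : besselSCLM s ψ = besselS s ψ := rfl

/-- Makes the infimum in `sobolevENorm` range over at most one element, so that the norm can be
computed from any representative. -/
lemma lp_toTD_injective (p : ℝ≥0∞) [Fact (1 ≤ p)] :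
    Function.Injective (fun v : Lp ℂ p (volume : Measure ℝ) => (v : 𝓢'(ℝ, ℂ))) := by
  have h := Lp.ker_toTemperedDistributionCLM_eq_bot (F := ℂ) (μ := (volume : Measure ℝ)) (p := p)
  intro v w hvw
  have := LinearMap.ker_eq_bot.1 h
  exact this hvw

lemma sobolevENorm_eq {s : ℝ} {p : ℝ≥0∞} [Fact (1 ≤ p)] {u : 𝓢'(ℝ, ℂ)}
    {v : Lp ℂ p (volume : Measure ℝ)} (h : bessel s u = (v : 𝓢'(ℝ, ℂ))) :
    sobolevENorm s p u = ‖v‖ₑ := by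
  unfold sobolevENorm
  apply le_antisymm
  · exact iInf₂_le v h
  · refine le_iInf₂ fun w hw => ?_
    have : v = w := lp_toTD_injective p (h.symm.trans hw)
    rw [this]

lemma hENorm_eq {s : ℝ} {u : 𝓢'(ℝ, ℂ)}
    {v : Lp ℂ 2 (volume : Measure ℝ)} (h : bessel s u = (v : 𝓢'(ℝ, ℂ))) :
    hENorm s u = ‖v‖ₑ := sobolevENorm_eq h

lemma exists_of_hENorm_lt_top {s : ℝ} {u : 𝓢'(ℝ, ℂ)} (h : hENorm s u < ⊤) :
    ∃ v : Lp ℂ 2 (volume : Measure ℝ), bessel s u = (v : 𝓢'(ℝ, ℂ)) := by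
  unfold hENorm sobolevENorm at h
  simp only [iInf_lt_iff] at h
  obtain ⟨v, hv, -⟩ := h
  exact ⟨v, hv⟩

/-- The distribution in `H^σ` with Fourier transform `(1 + (2πτ)²)^(-σ/2) Φ`. -/
def ofData (σ : ℝ) : Lp ℂ 2 (volume : Measure ℝ) →ₗ[ℂ] 𝓢'(ℝ, ℂ) where
  toFun Φ := bessel (-σ) (Lp.toTemperedDistributionCLM ℂ volume 2 (𝓕⁻ Φ))
  map_add' Φ Φ' := by rw [fourierInv_add, map_add, map_add]
  map_smul' c Φ := by rw [fourierInv_smul, map_smul, map_smul]; rfl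

lemma bessel_ofData (σ : ℝ) (Φ : Lp ℂ 2 (volume : Measure ℝ)) :
    bessel σ (ofData σ Φ) = ((𝓕⁻ Φ : Lp ℂ 2 (volume : Measure ℝ)) : 𝓢'(ℝ, ℂ)) := by
  change bessel σ (bessel (-σ) _) = _
  rw [bessel_bessel, add_neg_cancel, bessel_zero]
  rfl

/-- Plancherel. From here on every `H^σ` statement is a statement about `L²` data. -/
lemma hENorm_ofData (σ : ℝ) (Φ : Lp ℂ 2 (volume : Measure ℝ)) :
    hENorm σ (ofData σ Φ) = ‖Φ‖ₑ := by
  rw [hENorm_eq (bessel_ofData σ Φ)]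
  have : ‖(𝓕⁻ Φ : Lp ℂ 2 (volume : Measure ℝ))‖ = ‖Φ‖ := by
    rw [← Lp.norm_fourier_eq, fourier_fourierInv_eq]
  rw [← ofReal_norm, ← ofReal_norm, this]

lemma exists_ofData {σ : ℝ} {f : 𝓢'(ℝ, ℂ)} (h : hENorm σ f < ⊤) :
    ∃ Φ : Lp ℂ 2 (volume : Measure ℝ), f = ofData σ Φ := by
  obtain ⟨v, hv⟩ := exists_of_hENorm_lt_top h
  refine ⟨𝓕 v, ?_⟩
  change f = bessel (-σ) (Lp.toTemperedDistributionCLM ℂ volume 2 (𝓕⁻ (𝓕 v)))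
  rw [fourierInv_fourier_eq]
  change f = bessel (-σ) (v : 𝓢'(ℝ, ℂ))
  rw [← hv, bessel_bessel, neg_add_cancel, bessel_zero]

lemma ofData_apply (σ : ℝ) (Φ : Lp ℂ 2 (volume : Measure ℝ)) (ψ : 𝓢(ℝ, ℂ)) :
    ofData σ Φ ψ = ∫ τ, ((jw (-σ) τ : ℂ) * (𝓕⁻ ψ : 𝓢(ℝ, ℂ)) τ) * Φ τ := by
  change bessel (-σ) ((𝓕⁻ Φ : Lp ℂ 2 (volume : Measure ℝ)) : 𝓢'(ℝ, ℂ)) ψ = _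
  rw [bessel_apply, ← Lp.fourierInv_toTemperedDistribution_eq,
    TemperedDistribution.fourierInv_apply, Lp.toTemperedDistribution_apply]
  simp only [fourierInv_besselS, smul_eq_mul]

/-- The data of a Schwartz function. -/
def schwartzData (σ : ℝ) (g : 𝓢(ℝ, ℂ)) : Lp ℂ 2 (volume : Measure ℝ) :=
  (SchwartzMap.smulLeftCLM ℂ (fun k => (jw σ k : ℂ)) (𝓕 g)).toLp 2

lemma schwartzData_coe (σ : ℝ) (g : 𝓢(ℝ, ℂ)) :
    schwartzData σ g =ᵐ[volume] fun τ => (jw σ τ : ℂ) * (𝓕 g : 𝓢(ℝ, ℂ)) τ := by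
  filter_upwards [(SchwartzMap.smulLeftCLM ℂ (fun k => (jw σ k : ℂ)) (𝓕 g)).coeFn_toLp 2 volume]
    with τ hτ
  rw [schwartzData, hτ, SchwartzMap.smulLeftCLM_apply_apply (jwC_hasTemperateGrowth σ), smul_eq_mul]

lemma ofData_schwartzData (σ : ℝ) (g : 𝓢(ℝ, ℂ)) :
    ofData σ (schwartzData σ g) = (g : 𝓢'(ℝ, ℂ)) := by
  ext ψ
  rw [ofData_apply, SchwartzMap.coe_apply]
  have h : ∫ τ, ((jw (-σ) τ : ℂ) * (𝓕⁻ ψ : 𝓢(ℝ, ℂ)) τ) * schwartzData σ g τ = ∫ τ, (𝓕⁻ ψ) τ • (𝓕 g) τ := by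
    apply integral_congr_ae
    filter_upwards [schwartzData_coe σ g] with τ hτ
    rw [hτ, smul_eq_mul]
    have := jw_neg_mul σ τ
    have h2 : ((jw (-σ) τ : ℂ)) * (jw σ τ : ℂ) = 1 := by exact_mod_cast this
    linear_combination (𝓕⁻ ψ) τ * (𝓕 g) τ * h2
  rw [h, ← SchwartzMap.integral_fourier_smul_eq]
  simp

/-! ### Slices of Schwartz functions -/

/-- For an affine inner map the chain rule has a single term, with one factor `A` in each slot. -/
lemma norm_iteratedFDeriv_comp_affine_le (Ψ : 𝓢(ℝ × ℝ, ℂ)) (A : ℝ →L[ℝ] ℝ × ℝ) (hA : ‖A‖ ≤ 1)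
    (b : ℝ × ℝ) (n : ℕ) (y : ℝ) :
    ‖iteratedFDeriv ℝ n (fun y => Ψ (b + A y)) y‖ ≤ ‖iteratedFDeriv ℝ n Ψ (b + A y)‖ := by
  have h1 : (fun y => Ψ (b + A y)) = (fun z => Ψ (b + z)) ∘ A := rfl
  have hc : ContDiff ℝ n (fun z => Ψ (b + z)) :=
    (Ψ.smooth n).comp (contDiff_const.add contDiff_id)
  rw [h1, A.iteratedFDeriv_comp_right hc y le_rfl, iteratedFDeriv_comp_add_left]
  refine (ContinuousMultilinearMap.norm_compContinuousLinearMap_le _ _).trans ?_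
  have : ∏ _i : Fin n, ‖A‖ ≤ 1 := Finset.prod_le_one (fun _ _ => norm_nonneg _) (fun _ _ => hA)
  exact mul_le_of_le_one_right (norm_nonneg _) this

lemma timeSlice_apply (t : ℝ) (Ψ : 𝓢(ℝ × ℝ, ℂ)) (x : ℝ) : timeSlice t Ψ x = Ψ (x, t) := rfl

lemma spaceSlice_apply (x : ℝ) (Ψ : 𝓢(ℝ × ℝ, ℂ)) (t : ℝ) : spaceSlice x Ψ t = Ψ (x, t) := rfl

lemma timeSlice_seminorm_le (t : ℝ) (Ψ : 𝓢(ℝ × ℝ, ℂ)) (k n : ℕ) :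
    SchwartzMap.seminorm ℂ k n (timeSlice t Ψ) ≤ SchwartzMap.seminorm ℂ k n Ψ := by
  refine SchwartzMap.seminorm_le_bound ℂ k n _ (by positivity) fun x => ?_
  have h := norm_iteratedFDeriv_comp_affine_le Ψ (ContinuousLinearMap.inl ℝ ℝ ℝ)
    (ContinuousLinearMap.norm_inl_le_one ℝ ℝ ℝ) (0, t) n x
  have e : (fun y => Ψ ((0, t) + ContinuousLinearMap.inl ℝ ℝ ℝ y)) = timeSlice t Ψ := by
    funext y; simp [timeSlice_apply]
  rw [e] at h
  have e2 : ((0, t) + ContinuousLinearMap.inl ℝ ℝ ℝ x) = (x, t) := by simp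
  rw [e2] at h
  refine le_trans ?_ (SchwartzMap.le_seminorm ℂ k n Ψ (x, t))
  gcongr
  exact norm_fst_le (x, t)

lemma spaceSlice_seminorm_le (x : ℝ) (Ψ : 𝓢(ℝ × ℝ, ℂ)) (k n : ℕ) :
    SchwartzMap.seminorm ℂ k n (spaceSlice x Ψ) ≤ SchwartzMap.seminorm ℂ k n Ψ := by
  refine SchwartzMap.seminorm_le_bound ℂ k n _ (by positivity) fun t => ?_
  have h := norm_iteratedFDeriv_comp_affine_le Ψ (ContinuousLinearMap.inr ℝ ℝ ℝ)
    (ContinuousLinearMap.norm_inr_le_one ℝ ℝ ℝ) (x, 0) n t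
  have e : (fun y => Ψ ((x, 0) + ContinuousLinearMap.inr ℝ ℝ ℝ y)) = spaceSlice x Ψ := by
    funext y; simp [spaceSlice_apply]
  rw [e] at h
  have e2 : ((x, 0) + ContinuousLinearMap.inr ℝ ℝ ℝ t) = (x, t) := by simp
  rw [e2] at h
  refine le_trans ?_ (SchwartzMap.le_seminorm ℂ k n Ψ (x, t))
  gcongr
  exact norm_snd_le (x, t)

/-- A continuous linear map applied to a uniformly bounded family of maps `𝓢(ℝ²) → 𝓢(ℝ)`. -/
lemma exists_uniform_seminorm_bound {G : Type*} [NormedAddCommGroup G] [NormedSpace ℂ G]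
    (L : 𝓢(ℝ, ℂ) →L[ℂ] G) (S : ℝ → 𝓢(ℝ × ℝ, ℂ) →L[ℂ] 𝓢(ℝ, ℂ))
    (hS : ∀ y Ψ k n, SchwartzMap.seminorm ℂ k n (S y Ψ) ≤ SchwartzMap.seminorm ℂ k n Ψ) :
    ∃ (s : Finset (ℕ × ℕ)) (C : ℝ≥0), ∀ y Ψ,
      ‖L (S y Ψ)‖ ≤ C * s.sup (schwartzSeminormFamily ℂ (ℝ × ℝ) ℂ) Ψ := by
  have hq : Continuous ((normSeminorm ℂ G).comp L.toLinearMap) := by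
    change Continuous fun ψ => ‖L ψ‖
    exact L.continuous.norm
  obtain ⟨s, C, -, h⟩ := Seminorm.bound_of_continuous (schwartz_withSeminorms ℂ ℝ ℂ) _ hq
  refine ⟨s, C, fun y Ψ => ?_⟩
  have h1 := h (S y Ψ)
  simp only [Seminorm.comp_apply, coe_normSeminorm, smul_apply, NNReal.smul_def,
    smul_eq_mul] at h1
  refine h1.trans ?_
  gcongr
  refine Seminorm.finset_sup_apply_le (by positivity) fun i hi => ?_
  refine (hS y Ψ i.1 i.2).trans ?_
  exact Seminorm.le_finset_sup_apply (p := schwartzSeminormFamily ℂ (ℝ × ℝ) ℂ) hi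

lemma one_add_sq_coord_hasTemperateGrowth (A : ℝ × ℝ →L[ℝ] ℝ) :
    (fun z : ℝ × ℝ => ((1 + (A z) ^ 2 : ℝ) : ℂ)).HasTemperateGrowth := by
  have h : (fun z : ℝ × ℝ => (1 + (A z) ^ 2 : ℝ)).HasTemperateGrowth := by
    have hA := A.hasTemperateGrowth
    have := (Function.HasTemperateGrowth.const (E := ℝ × ℝ) (1 : ℝ)).add (hA.mul hA)
    convert this using 1
    funext z
    simp [sq]
  exact Function.HasTemperateGrowth.comp (g := (Complex.ofRealCLM : ℝ → ℂ))
    (Complex.ofRealCLM.hasTemperateGrowth) h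

/-- Decay of slices: a continuous linear map applied to slices of `Ψ` is `O(1/(1+y²))`, with
constant controlled by seminorms of `Ψ`. -/
lemma exists_slice_bound {G : Type*} [NormedAddCommGroup G] [NormedSpace ℂ G]
    (L : 𝓢(ℝ, ℂ) →L[ℂ] G) (S : ℝ → 𝓢(ℝ × ℝ, ℂ) →L[ℂ] 𝓢(ℝ, ℂ)) (A : ℝ × ℝ →L[ℝ] ℝ)
    (hS : ∀ y Ψ k n, SchwartzMap.seminorm ℂ k n (S y Ψ) ≤ SchwartzMap.seminorm ℂ k n Ψ)
    (hA : ∀ y Ψ, S y (SchwartzMap.smulLeftCLM ℂ (fun z => ((1 + (A z) ^ 2 : ℝ) : ℂ)) Ψ) =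
      ((1 + y ^ 2 : ℝ) : ℂ) • S y Ψ) :
    ∃ (p : Seminorm ℂ 𝓢(ℝ × ℝ, ℂ)), Continuous p ∧ ∀ y Ψ,
      ‖L (S y Ψ)‖ ≤ p Ψ * (1 + y ^ 2)⁻¹ := by
  obtain ⟨s, C, h⟩ := exists_uniform_seminorm_bound L S hS
  set M : 𝓢(ℝ × ℝ, ℂ) →L[ℂ] 𝓢(ℝ × ℝ, ℂ) :=
    SchwartzMap.smulLeftCLM ℂ (fun z : ℝ × ℝ => ((1 + (A z) ^ 2 : ℝ) : ℂ))
  set Q : Seminorm ℂ 𝓢(ℝ × ℝ, ℂ) := s.sup (schwartzSeminormFamily ℂ (ℝ × ℝ) ℂ) with hQ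
  refine ⟨(C • Q).comp M.toLinearMap, ?_, fun y Ψ => ?_⟩
  · have h1 : Continuous Q :=
      Seminorm.continuous_finsetSup fun i _ =>
        (schwartz_withSeminorms ℂ (ℝ × ℝ) ℂ).continuous_seminorm i
    change Continuous fun Ψ => C * Q (M Ψ)
    exact continuous_const.mul (h1.comp M.continuous)
  · change _ ≤ (C * Q (M Ψ)) * _
    -- The decay comes from testing with `(1 + A²)Ψ`, whose slice at `y` is `1 + y²` times the slice
    -- of `Ψ`.
    have h1 := h y (M Ψ)
    rw [hA, map_smul, norm_smul, Complex.norm_real, Real.norm_of_nonneg (by positivity)] at h1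
    rw [← div_eq_mul_inv, le_div_iff₀ (by positivity)]
    linarith

lemma exists_timeSlice_bound {G : Type*} [NormedAddCommGroup G] [NormedSpace ℂ G]
    (L : 𝓢(ℝ, ℂ) →L[ℂ] G) :
    ∃ (p : Seminorm ℂ 𝓢(ℝ × ℝ, ℂ)), Continuous p ∧ ∀ t Ψ,
      ‖L (timeSlice t Ψ)‖ ≤ p Ψ * (1 + t ^ 2)⁻¹ := by
  refine exists_slice_bound L timeSlice (ContinuousLinearMap.snd ℝ ℝ ℝ)
    timeSlice_seminorm_le fun y Ψ => ?_
  ext x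
  rw [timeSlice_apply,
    SchwartzMap.smulLeftCLM_apply_apply (one_add_sq_coord_hasTemperateGrowth _)]
  rfl

lemma exists_spaceSlice_bound {G : Type*} [NormedAddCommGroup G] [NormedSpace ℂ G]
    (L : 𝓢(ℝ, ℂ) →L[ℂ] G) :
    ∃ (p : Seminorm ℂ 𝓢(ℝ × ℝ, ℂ)), Continuous p ∧ ∀ x Ψ,
      ‖L (spaceSlice x Ψ)‖ ≤ p Ψ * (1 + x ^ 2)⁻¹ := by
  refine exists_slice_bound L spaceSlice (ContinuousLinearMap.fst ℝ ℝ ℝ)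
    spaceSlice_seminorm_le fun y Ψ => ?_
  ext x
  rw [spaceSlice_apply,
    SchwartzMap.smulLeftCLM_apply_apply (one_add_sq_coord_hasTemperateGrowth _)]
  rfl

/-! ### The Fourier transform on `L¹ ∩ L²` -/

lemma integral_fourierInv_mul_eq {f g : ℝ → ℂ} (hf : Integrable f) (hg : Integrable g) :
    ∫ x, (𝓕⁻ f) x * g x = ∫ x, f x * (𝓕⁻ g) x := by
  have h := VectorFourier.integral_fourierIntegral_smul_eq_flip (μ := (volume : Measure ℝ))
    (ν := (volume : Measure ℝ)) (e := Real.fourierChar) (L := -innerₗ ℝ)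
    (Real.continuous_fourierChar) (by fun_prop) hf hg
  have e : (-innerₗ ℝ : ℝ →ₗ[ℝ] ℝ →ₗ[ℝ] ℝ).flip = -innerₗ ℝ := by
    ext; simp
  rw [e] at h
  simpa [Real.fourierInv_eq, VectorFourier.fourierIntegral] using h

lemma integral_fourier_mul_eq {f g : ℝ → ℂ} (hf : Integrable f) (hg : Integrable g) :
    ∫ x, (𝓕 f) x * g x = ∫ x, f x * (𝓕 g) x := by
  have h := VectorFourier.integral_fourierIntegral_smul_eq_flip (μ := (volume : Measure ℝ))
    (ν := (volume : Measure ℝ)) (e := Real.fourierChar) (L := innerₗ ℝ)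
    (Real.continuous_fourierChar) (by fun_prop) hf hg
  have e : (innerₗ ℝ : ℝ →ₗ[ℝ] ℝ →ₗ[ℝ] ℝ).flip = innerₗ ℝ := by
    ext; simp
  rw [e] at h
  simpa [Real.fourier_eq, VectorFourier.fourierIntegral] using h

lemma continuous_fourier {f : ℝ → ℂ} (hf : Integrable f) : Continuous (𝓕 f) :=
  VectorFourier.fourierIntegral_continuous Real.continuous_fourierChar (by fun_prop) hf

lemma continuous_fourierInv {f : ℝ → ℂ} (hf : Integrable f) : Continuous (𝓕⁻ f) := by
  have : 𝓕⁻ f = fun w => 𝓕 f (-w) := by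
    funext w; exact Real.fourierInv_eq_fourier_neg f w
  rw [this]
  exact (continuous_fourier hf).comp continuous_neg

lemma norm_fourierInv_le (f : ℝ → ℂ) (w : ℝ) : ‖(𝓕⁻ f) w‖ ≤ ∫ x, ‖f x‖ := by
  rw [Real.fourierInv_eq_fourier_neg]
  exact VectorFourier.norm_fourierIntegral_le_integral_norm _ _ _ _ _

/-- The `L²` transform is defined by extension and the other one by an integral. Both have the same
pairing with smooth compactly supported functions, because the transform can be moved to the test
function. -/
lemma lp_fourierInv_ae_eq {f : ℝ → ℂ} (h1 : Integrable f) (h2 : MemLp f 2) :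
    (𝓕⁻ (h2.toLp f) : Lp ℂ 2 (volume : Measure ℝ)) =ᵐ[volume] 𝓕⁻ f := by
  refine ae_eq_of_integral_contDiff_smul_eq ?_ ?_ ?_
  · exact (Lp.memLp _).locallyIntegrable (by norm_num)
  · exact (continuous_fourierInv h1).locallyIntegrable
  intro g hg hgc
  have hg₁ : HasCompactSupport (Complex.ofRealCLM ∘ g) := hgc.comp_left rfl
  have hg₂ : ContDiff ℝ ∞ (Complex.ofRealCLM ∘ g) := by fun_prop
  set ψ := hg₁.toSchwartzMap hg₂ with hψ
  have e1 : ((𝓕⁻ (h2.toLp f) : Lp ℂ 2 (volume : Measure ℝ)) : 𝓢'(ℝ, ℂ)) ψ =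
      ∫ x, (𝓕⁻ ψ : 𝓢(ℝ, ℂ)) x * f x := by
    rw [← Lp.fourierInv_toTemperedDistribution_eq, TemperedDistribution.fourierInv_apply,
      Lp.toTemperedDistribution_apply]
    apply integral_congr_ae
    filter_upwards [h2.coeFn_toLp] with x hx
    rw [hx, smul_eq_mul]
  rw [Lp.toTemperedDistribution_apply] at e1
  have e2 : ∀ x, ψ x = (g x : ℂ) := fun x => rfl
  simp only [e2, smul_eq_mul] at e1
  have e3 := integral_fourierInv_mul_eq h1 ψ.integrable
  have e4 : ∀ x, (𝓕⁻ ψ : 𝓢(ℝ, ℂ)) x = (𝓕⁻ (ψ : ℝ → ℂ)) x := fun x => by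
    rw [SchwartzMap.fourierInv_coe]
  simp only [e4] at e1
  simp only [Complex.real_smul]
  rw [e1]
  simp only [e2] at e3
  calc _ = ∫ x, f x * (𝓕⁻ (ψ : ℝ → ℂ)) x := by congr 1; ext x; ring
    _ = _ := by rw [← e3]; congr 1; ext x; ring

lemma lp_fourier_ae_eq {f : ℝ → ℂ} (h1 : Integrable f) (h2 : MemLp f 2) :
    (𝓕 (h2.toLp f) : Lp ℂ 2 (volume : Measure ℝ)) =ᵐ[volume] 𝓕 f := by
  refine ae_eq_of_integral_contDiff_smul_eq ?_ ?_ ?_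
  · exact (Lp.memLp _).locallyIntegrable (by norm_num)
  · exact (continuous_fourier h1).locallyIntegrable
  intro g hg hgc
  have hg₁ : HasCompactSupport (Complex.ofRealCLM ∘ g) := hgc.comp_left rfl
  have hg₂ : ContDiff ℝ ∞ (Complex.ofRealCLM ∘ g) := by fun_prop
  set ψ := hg₁.toSchwartzMap hg₂ with hψ
  have e1 : ((𝓕 (h2.toLp f) : Lp ℂ 2 (volume : Measure ℝ)) : 𝓢'(ℝ, ℂ)) ψ =
      ∫ x, (𝓕 ψ : 𝓢(ℝ, ℂ)) x * f x := by
    rw [← Lp.fourier_toTemperedDistribution_eq, TemperedDistribution.fourier_apply,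
      Lp.toTemperedDistribution_apply]
    apply integral_congr_ae
    filter_upwards [h2.coeFn_toLp] with x hx
    rw [hx, smul_eq_mul]
  rw [Lp.toTemperedDistribution_apply] at e1
  have e2 : ∀ x, ψ x = (g x : ℂ) := fun x => rfl
  simp only [e2, smul_eq_mul] at e1
  have e3 := integral_fourier_mul_eq h1 ψ.integrable
  have e4 : ∀ x, (𝓕 ψ : 𝓢(ℝ, ℂ)) x = (𝓕 (ψ : ℝ → ℂ)) x := fun x => by
    rw [SchwartzMap.fourier_coe]
  simp only [e4] at e1
  simp only [Complex.real_smul]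
  rw [e1]
  simp only [e2] at e3
  calc _ = ∫ x, f x * (𝓕 (ψ : ℝ → ℂ)) x := by congr 1; ext x; ring
    _ = _ := by rw [← e3]; congr 1; ext x; ring

lemma norm_lp_fourierInv (Φ : Lp ℂ 2 (volume : Measure ℝ)) : ‖𝓕⁻ Φ‖ = ‖Φ‖ := by
  rw [← Lp.norm_fourier_eq, fourier_fourierInv_eq]

lemma eLpNorm_fourierInv {f : ℝ → ℂ} (h1 : Integrable f) (h2 : MemLp f 2) :
    eLpNorm (𝓕⁻ f) 2 volume = eLpNorm f 2 volume := by
  rw [← eLpNorm_congr_ae (lp_fourierInv_ae_eq h1 h2), ← eLpNorm_congr_ae h2.coeFn_toLp,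
    ← Lp.enorm_def, ← Lp.enorm_def, ← ofReal_norm, ← ofReal_norm, norm_lp_fourierInv]

lemma memLp_fourierInv {f : ℝ → ℂ} (h1 : Integrable f) (h2 : MemLp f 2) :
    MemLp (𝓕⁻ f) 2 volume :=
  ⟨(continuous_fourierInv h1).aestronglyMeasurable, by
    rw [eLpNorm_fourierInv h1 h2]; exact h2.2⟩

/-! ### Multiplication by bounded functions on `L²` -/

lemma memLp_mul_of_bound {m : ℝ → ℂ} (hm : Measurable m) {C : ℝ} (hb : ∀ τ, ‖m τ‖ ≤ C)
    {Φ : ℝ → ℂ} (hΦ : MemLp Φ 2) : MemLp (fun τ => m τ * Φ τ) 2 :=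
  MemLp.of_le_mul (c := C) hΦ (hm.aestronglyMeasurable.mul hΦ.1) (ae_of_all _ fun τ => by
    rw [norm_mul]; gcongr; exact hb τ)

/-- Multiplication by a measurable function bounded by `C`. -/
def bmul (m : ℝ → ℂ) (hm : Measurable m) (C : ℝ) (hb : ∀ τ, ‖m τ‖ ≤ C) :
    Lp ℂ 2 (volume : Measure ℝ) →L[ℂ] Lp ℂ 2 (volume : Measure ℝ) :=
  LinearMap.mkContinuous
    { toFun := fun Φ => (memLp_mul_of_bound hm hb (Lp.memLp Φ)).toLp _
      map_add' := fun Φ Φ' => by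
        rw [← MemLp.toLp_add]
        apply MemLp.toLp_congr
        filter_upwards [Lp.coeFn_add Φ Φ'] with τ hτ
        simp only [hτ, Pi.add_apply]; ring
      map_smul' := fun c Φ => by
        rw [RingHom.id_apply, ← MemLp.toLp_const_smul]
        apply MemLp.toLp_congr
        filter_upwards [Lp.coeFn_smul c Φ] with τ hτ
        simp only [hτ, Pi.smul_apply, smul_eq_mul]; ring } C fun Φ => by
    refine Lp.norm_le_mul_norm_of_ae_le_mul ?_
    filter_upwards [(memLp_mul_of_bound hm hb (Lp.memLp Φ)).coeFn_toLp] with τ hτ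
    change ‖(memLp_mul_of_bound hm hb (Lp.memLp Φ)).toLp _ τ‖ ≤ _
    rw [hτ, norm_mul]; gcongr; exact hb τ

lemma bmul_coe (m : ℝ → ℂ) (hm : Measurable m) (C : ℝ) (hb : ∀ τ, ‖m τ‖ ≤ C)
    (Φ : Lp ℂ 2 (volume : Measure ℝ)) :
    bmul m hm C hb Φ =ᵐ[volume] fun τ => m τ * Φ τ :=
  (memLp_mul_of_bound hm hb (Lp.memLp Φ)).coeFn_toLp

lemma norm_bmul_le (m : ℝ → ℂ) (hm : Measurable m) (C : ℝ) (hb : ∀ τ, ‖m τ‖ ≤ C)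
    (Φ : Lp ℂ 2 (volume : Measure ℝ)) : ‖bmul m hm C hb Φ‖ ≤ C * ‖Φ‖ := by
  refine Lp.norm_le_mul_norm_of_ae_le_mul ?_
  filter_upwards [bmul_coe m hm C hb Φ] with τ hτ
  rw [hτ, norm_mul]; gcongr; exact hb τ

lemma norm_sq_eq_integral (Φ : Lp ℂ 2 (volume : Measure ℝ)) : ‖Φ‖ ^ 2 = ∫ τ, ‖Φ τ‖ ^ 2 := by
  have h := L2.inner_def (𝕜 := ℂ) Φ Φ
  rw [inner_self_eq_norm_sq_to_K] at h
  have h2 : ∫ τ, inner ℂ (Φ τ) (Φ τ) = ((∫ τ, ‖Φ τ‖ ^ 2 : ℝ) : ℂ) := by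
    refine Eq.trans ?_ (integral_ofReal (𝕜 := ℂ) (f := fun τ => ‖Φ τ‖ ^ 2))
    congr 1; ext τ
    rw [inner_self_eq_norm_sq_to_K]; norm_cast
  rw [h2] at h
  apply Complex.ofReal_injective
  rw [← h]
  norm_cast

/-- Dominated convergence for `|(m i - m₀) Φ|²`, with majorant `(2C)² |Φ|²`. Pointwise convergence
of the symbols gives strong convergence only, which is all that continuity of the traces needs. -/
lemma tendsto_bmul {ι : Type*} {l : Filter ι} [l.IsCountablyGenerated] {m : ι → ℝ → ℂ}
    {m₀ : ℝ → ℂ} (hm : ∀ i, Measurable (m i)) (hm₀ : Measurable m₀) {C : ℝ}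
    (hb : ∀ i τ, ‖m i τ‖ ≤ C) (hb₀ : ∀ τ, ‖m₀ τ‖ ≤ C)
    (h : ∀ᵐ τ, Tendsto (fun i => m i τ) l (𝓝 (m₀ τ))) (Φ : Lp ℂ 2 (volume : Measure ℝ)) :
    Tendsto (fun i => bmul (m i) (hm i) C (hb i) Φ) l (𝓝 (bmul m₀ hm₀ C hb₀ Φ)) := by
  rw [tendsto_iff_norm_sub_tendsto_zero]
  have key : ∀ i, ‖bmul (m i) (hm i) C (hb i) Φ - bmul m₀ hm₀ C hb₀ Φ‖ ^ 2 =
      ∫ τ, ‖(m i τ - m₀ τ) * Φ τ‖ ^ 2 := by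
    intro i
    rw [norm_sq_eq_integral]
    apply integral_congr_ae
    filter_upwards [Lp.coeFn_sub (bmul (m i) (hm i) C (hb i) Φ) (bmul m₀ hm₀ C hb₀ Φ),
      bmul_coe (m i) (hm i) C (hb i) Φ, bmul_coe m₀ hm₀ C hb₀ Φ] with τ h1 h2 h3
    rw [h1, Pi.sub_apply, h2, h3]; ring_nf
  have hlim : Tendsto (fun i => ∫ τ, ‖(m i τ - m₀ τ) * Φ τ‖ ^ 2) l (𝓝 (∫ τ : ℝ, (0 : ℝ))) := by
    refine tendsto_integral_filter_of_dominated_convergence (fun τ => (2 * C) ^ 2 * ‖Φ τ‖ ^ 2)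
      ?_ ?_ ?_ ?_
    · refine Eventually.of_forall fun i => ?_
      exact ((((hm i).sub hm₀).aestronglyMeasurable.mul (Lp.aestronglyMeasurable Φ)).norm.pow 2)
    · refine Eventually.of_forall fun i => ae_of_all _ fun τ => ?_
      rw [Real.norm_of_nonneg (by positivity), norm_mul, mul_pow]
      gcongr
      exact (norm_sub_le _ _).trans (by linarith [hb i τ, hb₀ τ])
    · exact ((Lp.memLp Φ).integrable_norm_pow (by norm_num)).const_mul _
    · filter_upwards [h] with τ hτ
      have h1 : Tendsto (fun i => ‖(m i τ - m₀ τ) * Φ τ‖ ^ 2) l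
          (𝓝 (‖(m₀ τ - m₀ τ) * Φ τ‖ ^ 2)) :=
        (((hτ.sub_const _).mul_const _).norm).pow 2
      simpa using h1
  rw [integral_zero] at hlim
  have h3 := (Real.continuous_sqrt.tendsto 0).comp hlim
  rw [Real.sqrt_zero] at h3
  refine h3.congr fun i => ?_
  simp only [Function.comp_apply]
  rw [← key i, Real.sqrt_sq (norm_nonneg _)]

/-! ### The symbol of the boundary forcing operator -/

/-- `e^{-iπ/4} √(2πiτ)`. -/
def kap (τ : ℝ) : ℂ := (Real.sqrt (2 * Real.pi * τ) : ℂ) -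
  Complex.I * (Real.sqrt (-(2 * Real.pi * τ)) : ℂ)

lemma kap_re (τ : ℝ) : 0 ≤ (kap τ).re := by simp [kap]

lemma continuous_kap : Continuous kap := by unfold kap; fun_prop

/-- The time-frequency symbol of `f ↦ ℒ f (x, ·)`. -/
def symb (x τ : ℝ) : ℂ := Complex.exp (-(|x| : ℝ) * kap τ)

lemma continuous_symb : Continuous (fun z : ℝ × ℝ => symb z.1 z.2) := by
  have := continuous_kap
  unfold symb
  fun_prop

lemma norm_symb_le (x τ : ℝ) : ‖symb x τ‖ ≤ 1 := by
  rw [symb, Complex.norm_exp, Real.exp_le_one_iff]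
  have := mul_nonneg (abs_nonneg x) (kap_re τ)
  simpa using this

lemma measurable_symb (x : ℝ) : Measurable (symb x) :=
  (continuous_symb.comp (Continuous.prodMk_right x)).measurable

/-- The data of the time trace at `x`. -/
def traceData (x : ℝ) (Φ : Lp ℂ 2 (volume : Measure ℝ)) : Lp ℂ 2 (volume : Measure ℝ) :=
  bmul (symb x) (measurable_symb x) 1 (norm_symb_le x) Φ

lemma norm_traceData_le (x : ℝ) (Φ : Lp ℂ 2 (volume : Measure ℝ)) : ‖traceData x Φ‖ ≤ ‖Φ‖ := by
  have h := norm_bmul_le (symb x) (measurable_symb x) 1 (norm_symb_le x) Φ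
  rwa [one_mul] at h

lemma continuous_traceData (Φ : Lp ℂ 2 (volume : Measure ℝ)) :
    Continuous fun x => traceData x Φ := by
  rw [continuous_iff_continuousAt]
  intro x₀
  refine tendsto_bmul measurable_symb (measurable_symb x₀) norm_symb_le (norm_symb_le x₀)
    (ae_of_all _ fun τ => ?_) Φ
  exact (continuous_symb.comp (Continuous.prodMk_left τ)).tendsto x₀

/-! ### The space-time distribution attached to given data. -/

/-- Duality of `H^σ` and `H^(-σ)`: Cauchy-Schwarz after moving `J^(-σ)` to the test function. The
conjugate in the proof turns the bilinear pairing into an inner product. -/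
lemma norm_ofData_apply_le (σ : ℝ) (Φ : Lp ℂ 2 (volume : Measure ℝ)) (ψ : 𝓢(ℝ, ℂ)) :
    ‖ofData σ Φ ψ‖ ≤ ‖Φ‖ * ‖SchwartzMap.toLpCLM ℂ ℂ 2 volume (besselSCLM (-σ) ψ)‖ := by
  change ‖bessel (-σ) ((𝓕⁻ Φ : Lp ℂ 2 (volume : Measure ℝ)) : 𝓢'(ℝ, ℂ)) ψ‖ ≤ _
  rw [bessel_apply, besselSCLM_apply, ← norm_lp_fourierInv Φ, SchwartzMap.toLpCLM_apply,
    Lp.toTemperedDistribution_apply]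
  set g := besselS (-σ) ψ
  set v : Lp ℂ 2 (volume : Measure ℝ) := 𝓕⁻ Φ
  have hs : MemLp (fun x => (starRingEnd ℂ) (g x)) 2 (volume : Measure ℝ) :=
    MemLp.of_le (g.memLp 2 volume)
      (Complex.continuous_conj.comp g.continuous).aestronglyMeasurable
      (ae_of_all _ fun x => by simp)
  have e : ∫ x, g x • v x = inner ℂ (hs.toLp _) v := by
    rw [L2.inner_def]
    apply integral_congr_ae
    filter_upwards [hs.coeFn_toLp] with x hx
    rw [hx, RCLike.inner_apply]
    simp [mul_comm]
  rw [e]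
  refine (norm_inner_le_norm _ _).trans ?_
  rw [mul_comm]
  have : ‖hs.toLp _‖ = ‖g.toLp 2 volume‖ := by
    rw [Lp.norm_toLp, SchwartzMap.norm_toLp]
    congr 1
    refine eLpNorm_congr_norm_ae (ae_of_all _ fun x => ?_)
    simp
  rw [this]

/-- The partial inverse Fourier transform of a test function in the second variable. -/
lemma stronglyMeasurable_fourierInv_spaceSlice (Ψ : 𝓢(ℝ × ℝ, ℂ)) :
    StronglyMeasurable fun z : ℝ × ℝ => (𝓕⁻ (spaceSlice z.1 Ψ) : 𝓢(ℝ, ℂ)) z.2 := by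
  have h : ∀ z : ℝ × ℝ, (𝓕⁻ (spaceSlice z.1 Ψ) : 𝓢(ℝ, ℂ)) z.2 =
      ∫ t, Real.fourierChar (t * z.2) • Ψ (z.1, t) := by
    intro z
    rw [SchwartzMap.fourierInv_coe, Real.fourierInv_eq]
    simp [mul_comm, spaceSlice_apply]
  simp only [h]
  refine StronglyMeasurable.integral_prod_right
    (f := fun (z : ℝ × ℝ) (t : ℝ) => Real.fourierChar (t * z.2) • Ψ (z.1, t)) ?_
  refine Continuous.stronglyMeasurable ?_
  have h1 := Ψ.continuous
  have h2 := Real.continuous_fourierChar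
  change Continuous fun x : (ℝ × ℝ) × ℝ => Real.fourierChar (x.2 * x.1.2) • Ψ (x.1.1, x.2)
  exact (h2.comp (by fun_prop)).smul (h1.comp (by fun_prop))

lemma ofData_traceData_apply (σ x : ℝ) (Φ : Lp ℂ 2 (volume : Measure ℝ)) (ψ : 𝓢(ℝ, ℂ)) :
    ofData σ (traceData x Φ) ψ =
      ∫ τ, ((jw (-σ) τ : ℂ) * (𝓕⁻ ψ : 𝓢(ℝ, ℂ)) τ) * (symb x τ * Φ τ) := by
  rw [ofData_apply]
  apply integral_congr_ae
  filter_upwards [bmul_coe (symb x) (measurable_symb x) 1 (norm_symb_le x) Φ] with τ hτ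
  rw [traceData, hτ]

lemma stronglyMeasurable_trace_apply (σ : ℝ) (Φ : Lp ℂ 2 (volume : Measure ℝ))
    (Ψ : 𝓢(ℝ × ℝ, ℂ)) :
    StronglyMeasurable fun x => ofData σ (traceData x Φ) (spaceSlice x Ψ) := by
  simp only [ofData_traceData_apply]
  refine StronglyMeasurable.integral_prod_right (f := fun (x τ : ℝ) =>
    ((jw (-σ) τ : ℂ) * (𝓕⁻ (spaceSlice x Ψ) : 𝓢(ℝ, ℂ)) τ) * (symb x τ * Φ τ)) ?_
  have h1 : StronglyMeasurable fun z : ℝ × ℝ => (jw (-σ) z.2 : ℂ) :=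
    (Complex.continuous_ofReal.comp ((continuous_jw _).comp continuous_snd)).stronglyMeasurable
  have h2 : StronglyMeasurable fun z : ℝ × ℝ => Φ z.2 :=
    (Lp.stronglyMeasurable Φ).comp_measurable measurable_snd
  exact (h1.mul (stronglyMeasurable_fourierInv_spaceSlice Ψ)).mul
    (continuous_symb.stronglyMeasurable.mul h2)

/-- The decay in `x` comes from the slices of `Ψ` alone, since the multiplier `symb x` is a
contraction. The factor `‖Φ‖` gives continuity in the data, the seminorm continuity in `Ψ`. -/
lemma exists_trace_bound (σ : ℝ) :
    ∃ (p : Seminorm ℂ 𝓢(ℝ × ℝ, ℂ)), Continuous p ∧ ∀ (Φ : Lp ℂ 2 (volume : Measure ℝ)) x Ψ,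
      ‖ofData σ (traceData x Φ) (spaceSlice x Ψ)‖ ≤ ‖Φ‖ * p Ψ * (1 + x ^ 2)⁻¹ := by
  obtain ⟨p, hp, h⟩ := exists_spaceSlice_bound
    (SchwartzMap.toLpCLM ℂ ℂ 2 (volume : Measure ℝ) ∘L besselSCLM (-σ))
  refine ⟨p, hp, fun Φ x Ψ => ?_⟩
  refine (norm_ofData_apply_le _ _ _).trans ?_
  have h1 := h x Ψ
  rw [ContinuousLinearMap.comp_apply] at h1
  calc _ ≤ ‖Φ‖ * (p Ψ * (1 + x ^ 2)⁻¹) := by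
        gcongr
        exact norm_traceData_le x Φ
    _ = _ := by ring

lemma integrable_trace_apply (σ : ℝ) (Φ : Lp ℂ 2 (volume : Measure ℝ)) (Ψ : 𝓢(ℝ × ℝ, ℂ)) :
    Integrable fun x => ofData σ (traceData x Φ) (spaceSlice x Ψ) := by
  obtain ⟨p, -, h⟩ := exists_trace_bound σ
  refine Integrable.mono' ((integrable_inv_one_add_sq).const_mul (‖Φ‖ * p Ψ))
    (stronglyMeasurable_trace_apply σ Φ Ψ).aestronglyMeasurable (ae_of_all _ fun x => h Φ x Ψ)

lemma exists_forcingDist_bound (σ : ℝ) :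
    ∃ (p : Seminorm ℂ 𝓢(ℝ × ℝ, ℂ)), Continuous p ∧ ∀ (Φ : Lp ℂ 2 (volume : Measure ℝ)) Ψ,
      ‖∫ x, ofData σ (traceData x Φ) (spaceSlice x Ψ)‖ ≤ ‖Φ‖ * p Ψ := by
  obtain ⟨p, hp, h⟩ := exists_trace_bound σ
  -- The factor `π` is the integral of `(1 + x²)⁻¹`.
  refine ⟨(Real.toNNReal Real.pi) • p, continuous_const.mul hp, fun Φ Ψ => ?_⟩
  refine (norm_integral_le_of_norm_le ((integrable_inv_one_add_sq).const_mul (‖Φ‖ * p Ψ))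
    (ae_of_all _ fun x => h Φ x Ψ)).trans ?_
  rw [integral_const_mul, integral_univ_inv_one_add_sq]
  change _ ≤ ‖Φ‖ * (((Real.toNNReal Real.pi : ℝ≥0) : ℝ) * p Ψ)
  rw [Real.coe_toNNReal _ Real.pi_pos.le]
  linarith

/-- The space-time distribution `ℒ f`, for `f` with data `Φ`. -/
def forcingDist (σ : ℝ) (Φ : Lp ℂ 2 (volume : Measure ℝ)) : 𝓢'(ℝ × ℝ, ℂ) :=
  ContinuousLinearMap.toPointwiseConvergenceCLM _ _ _ _
    { toFun := fun Ψ => ∫ x, ofData σ (traceData x Φ) (spaceSlice x Ψ)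
      map_add' := fun Ψ Ψ' => by
        rw [← integral_add (integrable_trace_apply σ Φ Ψ) (integrable_trace_apply σ Φ Ψ')]
        simp
      map_smul' := fun c Ψ => by
        rw [RingHom.id_apply, ← integral_smul]
        simp
      cont := by
        obtain ⟨p, hp, h⟩ := exists_forcingDist_bound σ
        let A : 𝓢(ℝ × ℝ, ℂ) →ₗ[ℂ] ℂ :=
          { toFun := fun Ψ => ∫ x, ofData σ (traceData x Φ) (spaceSlice x Ψ)
            map_add' := fun Ψ Ψ' => by
              rw [← integral_add (integrable_trace_apply σ Φ Ψ) (integrable_trace_apply σ Φ Ψ')]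
              simp
            map_smul' := fun c Ψ => by
              rw [RingHom.id_apply, ← integral_smul]
              simp }
        change Continuous A
        refine continuous_of_continuousAt_zero A ?_
        rw [ContinuousAt, map_zero]
        refine squeeze_zero_norm (fun Ψ => h Φ Ψ) ?_
        have : Continuous fun Ψ => ‖Φ‖ * p Ψ := continuous_const.mul hp
        simpa using this.tendsto 0 }

lemma forcingDist_apply (σ : ℝ) (Φ : Lp ℂ 2 (volume : Measure ℝ)) (Ψ : 𝓢(ℝ × ℝ, ℂ)) :
    forcingDist σ Φ Ψ = ∫ x, ofData σ (traceData x Φ) (spaceSlice x Ψ) := rfl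

lemma traceData_sub (x : ℝ) (Φ Φ' : Lp ℂ 2 (volume : Measure ℝ)) :
    traceData x (Φ - Φ') = traceData x Φ - traceData x Φ' := map_sub _ _ _

lemma tendsto_forcingDist {σ : ℝ} {Φ : ℕ → Lp ℂ 2 (volume : Measure ℝ)}
    {Φ₀ : Lp ℂ 2 (volume : Measure ℝ)} (h : Tendsto Φ atTop (𝓝 Φ₀)) (Ψ : 𝓢(ℝ × ℝ, ℂ)) :
    Tendsto (fun n => forcingDist σ (Φ n) Ψ) atTop (𝓝 (forcingDist σ Φ₀ Ψ)) := by
  obtain ⟨p, -, hp⟩ := exists_forcingDist_bound σ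
  rw [tendsto_iff_norm_sub_tendsto_zero] at h ⊢
  refine squeeze_zero (fun _ => norm_nonneg _) (fun n => ?_)
    (by simpa using h.mul_const (p Ψ))
  refine le_trans (le_of_eq ?_) (hp (Φ n - Φ₀) Ψ)
  rw [forcingDist_apply, forcingDist_apply,
    ← integral_sub (integrable_trace_apply σ _ Ψ) (integrable_trace_apply σ _ Ψ)]
  simp [traceData_sub]

lemma hasSpaceSlices_forcingDist (σ : ℝ) (Φ : Lp ℂ 2 (volume : Measure ℝ)) :
    HasSpaceSlices (forcingDist σ Φ) (fun x => ofData σ (traceData x Φ)) :=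
  fun Ψ => ⟨integrable_trace_apply σ Φ Ψ, rfl⟩

lemma continuousIntoH_ofData {σ : ℝ} {Φ : ℝ → Lp ℂ 2 (volume : Measure ℝ)} (h : Continuous Φ) :
    ContinuousIntoH σ (fun y => ofData σ (Φ y)) := by
  refine ⟨fun y => by rw [hENorm_ofData]; exact enorm_lt_top, fun y₀ => ?_⟩
  have h1 : ∀ y, hENorm σ (ofData σ (Φ y) - ofData σ (Φ y₀)) = ‖Φ y - Φ y₀‖ₑ := fun y => by
    rw [← map_sub, hENorm_ofData]
  simp only [h1]
  have h2 : Tendsto (fun y => ‖Φ y - Φ y₀‖ₑ) (𝓝 y₀) (𝓝 ‖Φ y₀ - Φ y₀‖ₑ) :=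
    ((h.sub continuous_const).enorm).tendsto y₀
  simpa using h2

/-! ### The Fourier transform of `e^{-w|x|}` -/

lemma norm_exp_abs (w : ℂ) (x : ℝ) : ‖Complex.exp (-w * (|x| : ℝ))‖ = Real.exp (-w.re * |x|) := by
  rw [Complex.norm_exp]; simp

lemma integrable_exp_neg_abs {w : ℂ} (hw : 0 < w.re) :
    Integrable fun x : ℝ => Complex.exp (-w * (|x| : ℝ)) := by
  rw [← integrableOn_univ, ← Iic_union_Ioi (a := (0 : ℝ)), integrableOn_union]
  constructor
  · refine (integrableOn_exp_mul_complex_Iic (a := w) hw 0).congr_fun (fun x hx => ?_)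
      measurableSet_Iic
    simp only [mem_Iic] at hx
    simp [abs_of_nonpos hx]
  · refine (integrableOn_exp_mul_complex_Ioi (a := -w) (by simpa using hw) 0).congr_fun
      (fun x hx => ?_) measurableSet_Ioi
    simp only [mem_Ioi] at hx
    simp [abs_of_pos hx]

lemma ne_zero_of_re_pos {w : ℂ} (hw : 0 < w.re) : w ≠ 0 := by
  rintro rfl; simp at hw

lemma sq_add_sq_factor (w : ℂ) (y : ℝ) :
    w ^ 2 + (y : ℂ) ^ 2 = (w + Complex.I * y) * (w - Complex.I * y) := by
  linear_combination ((y : ℂ) ^ 2) * Complex.I_sq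

lemma sq_add_sq_ne_zero {w : ℂ} (hw : 0 < w.re) (y : ℝ) : w ^ 2 + (y : ℂ) ^ 2 ≠ 0 := by
  rw [sq_add_sq_factor]
  exact mul_ne_zero (ne_zero_of_re_pos (by simpa using hw)) (ne_zero_of_re_pos (by simpa using hw))

lemma fourier_exp_neg_abs {w : ℂ} (hw : 0 < w.re) (k : ℝ) :
    𝓕 (fun x : ℝ => Complex.exp (-w * (|x| : ℝ))) k =
      2 * w / (w ^ 2 + ((2 * Real.pi * k : ℝ) : ℂ) ^ 2) := by
  rw [Real.fourier_real_eq_integral_exp_smul]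
  set y : ℝ := 2 * Real.pi * k with hy
  have hinteg : Integrable fun x : ℝ => Complex.exp (↑(-2 * Real.pi * x * k) * Complex.I) •
      Complex.exp (-w * (|x| : ℝ)) := by
    have := (Real.fourierIntegral_convergent_iff (μ := volume) k).2 (integrable_exp_neg_abs hw)
    refine (integrable_exp_neg_abs hw).bdd_mul (c := 1)
      (Continuous.aestronglyMeasurable (by fun_prop)) (ae_of_all _ fun x => ?_)
    rw [Complex.norm_exp_ofReal_mul_I]
  rw [← setIntegral_univ, ← Iic_union_Ioi (a := (0 : ℝ)),
    setIntegral_union (Iic_disjoint_Ioi le_rfl) measurableSet_Ioi hinteg.integrableOn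
      hinteg.integrableOn]
  have h1 : ∫ x in Iic (0 : ℝ), Complex.exp (↑(-2 * Real.pi * x * k) * Complex.I) •
      Complex.exp (-w * (|x| : ℝ)) = 1 / (w - Complex.I * y) := by
    have e := integral_exp_mul_complex_Iic (a := w - Complex.I * y) (by simpa using hw) 0
    simp only [Complex.ofReal_zero, mul_zero, Complex.exp_zero] at e
    rw [← e]
    refine setIntegral_congr_fun measurableSet_Iic fun x hx => ?_
    simp only [mem_Iic] at hx
    simp only [abs_of_nonpos hx, smul_eq_mul, ← Complex.exp_add, hy]
    congr 1
    push_cast; ring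
  have h2 : ∫ x in Ioi (0 : ℝ), Complex.exp (↑(-2 * Real.pi * x * k) * Complex.I) •
      Complex.exp (-w * (|x| : ℝ)) = 1 / (w + Complex.I * y) := by
    have e := integral_exp_mul_complex_Ioi (a := -(w + Complex.I * y)) (by simpa using hw) 0
    simp only [Complex.ofReal_zero, mul_zero, Complex.exp_zero, neg_div_neg_eq] at e
    rw [← e]
    refine setIntegral_congr_fun measurableSet_Ioi fun x hx => ?_
    simp only [mem_Ioi] at hx
    simp only [abs_of_pos hx, smul_eq_mul, ← Complex.exp_add, hy]
    congr 1
    push_cast; ring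
  rw [h1, h2, sq_add_sq_factor]
  have a1 : w + Complex.I * y ≠ 0 := ne_zero_of_re_pos (by simpa using hw)
  have a2 : w - Complex.I * y ≠ 0 := ne_zero_of_re_pos (by simpa using hw)
  field_simp
  ring

/-- The factors `w ± iy` have real part `Re w > 0`, so the square of each modulus dominates `1 + y²`
up to a constant. The product of these two bounds is the square of the claim. -/
lemma norm_sq_add_sq_ge {w : ℂ} (hw : 0 < w.re) :
    ∃ K : ℝ, 0 < K ∧ ∀ y : ℝ, 1 + y ^ 2 ≤ K * ‖w ^ 2 + (y : ℂ) ^ 2‖ := by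
  set K : ℝ := (1 + 2 * w.im ^ 2) / w.re ^ 2 + 2 with hK
  have hKpos : 0 < K := by positivity
  have key : ∀ v y : ℝ, v ^ 2 = w.im ^ 2 → 1 + y ^ 2 ≤ K * (w.re ^ 2 + (v - y) ^ 2) := by
    intro v y hv
    have h1 : (1 + 2 * w.im ^ 2) / w.re ^ 2 * w.re ^ 2 = 1 + 2 * w.im ^ 2 := by field_simp
    have h2 : 0 ≤ (1 + 2 * w.im ^ 2) / w.re ^ 2 * (v - y) ^ 2 := by positivity
    have h3 : y ^ 2 ≤ 2 * (v - y) ^ 2 + 2 * w.im ^ 2 := by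
      rw [← hv]; nlinarith [sq_nonneg (2 * v - y)]
    rw [hK]
    nlinarith [sq_nonneg w.re]
  refine ⟨K, hKpos, fun y => ?_⟩
  rw [sq_add_sq_factor, norm_mul]
  have n1 : ‖w + Complex.I * y‖ ^ 2 = w.re ^ 2 + (-w.im - y) ^ 2 := by
    rw [Complex.sq_norm, Complex.normSq_apply]; simp; ring
  have n2 : ‖w - Complex.I * y‖ ^ 2 = w.re ^ 2 + (w.im - y) ^ 2 := by
    rw [Complex.sq_norm, Complex.normSq_apply]; simp; ring
  have k1 := key (-w.im) y (by ring)
  have k2 := key w.im y rfl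
  rw [← n1] at k1
  rw [← n2] at k2
  refine abs_le_of_sq_le_sq' ?_ (by positivity) |>.2
  calc (1 + y ^ 2) ^ 2 = (1 + y ^ 2) * (1 + y ^ 2) := by ring
    _ ≤ (K * ‖w + Complex.I * y‖ ^ 2) * (K * ‖w - Complex.I * y‖ ^ 2) := by gcongr
    _ = _ := by ring

lemma integrable_lorentz {w : ℂ} (hw : 0 < w.re) :
    Integrable fun k : ℝ => 2 * w / (w ^ 2 + ((2 * Real.pi * k : ℝ) : ℂ) ^ 2) := by
  have h : Integrable fun y : ℝ => 2 * w / (w ^ 2 + (y : ℂ) ^ 2) := by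
    obtain ⟨K, hK, h⟩ := norm_sq_add_sq_ge hw
    refine Integrable.mono' (integrable_inv_one_add_sq.const_mul (‖2 * w‖ * K)) ?_ ?_
    · refine Continuous.aestronglyMeasurable ?_
      exact continuous_const.div (by fun_prop) fun y => sq_add_sq_ne_zero hw y
    · refine ae_of_all _ fun y => ?_
      rw [norm_div, div_eq_mul_inv, mul_assoc]
      gcongr
      rw [← div_eq_mul_inv, ← one_div, div_le_div_iff₀
        (norm_pos_iff.2 (sq_add_sq_ne_zero hw y)) (by positivity)]
      linarith [h y]
  exact h.comp_mul_left' (by positivity : 2 * Real.pi ≠ 0)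

lemma fourierInv_lorentz {w : ℂ} (hw : 0 < w.re) (x : ℝ) :
    (𝓕⁻ (fun k : ℝ => 2 * w / (w ^ 2 + ((2 * Real.pi * k : ℝ) : ℂ) ^ 2) : ℝ → ℂ) : ℝ → ℂ) x =
      Complex.exp (-w * (|x| : ℝ)) := by
  have e : 𝓕 (fun x : ℝ => Complex.exp (-w * (|x| : ℝ))) =
      fun k : ℝ => 2 * w / (w ^ 2 + ((2 * Real.pi * k : ℝ) : ℂ) ^ 2) :=
    funext (fourier_exp_neg_abs hw)
  have h := Continuous.fourierInv_fourier_eq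
    (f := fun x : ℝ => Complex.exp (-w * (|x| : ℝ))) (by fun_prop) (integrable_exp_neg_abs hw)
    (by rw [e]; exact integrable_lorentz hw)
  rw [e] at h
  exact congrFun h x

lemma integral_lorentz_exp {w : ℂ} (hw : 0 < w.re) (y : ℝ) :
    ∫ ξ : ℝ, Complex.exp (Complex.I * (2 * y : ℝ) * ξ) / (w ^ 2 + (ξ : ℂ) ^ 2) =
      Real.pi / w * Complex.exp (-w * (2 * |y| : ℝ)) := by
  have h := fourierInv_lorentz hw (2 * y)
  rw [Real.fourierInv_eq'] at h
  have hs := Measure.integral_comp_mul_left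
    (fun ξ : ℝ => Complex.exp (Complex.I * (2 * y : ℝ) * ξ) / (w ^ 2 + (ξ : ℂ) ^ 2)) (2 * Real.pi)
  have hw0 := ne_zero_of_re_pos hw
  have hpi : (Real.pi : ℂ) ≠ 0 := by exact_mod_cast Real.pi_ne_zero
  have e1 : ∫ (x : ℝ), (fun ξ : ℝ => Complex.exp (Complex.I * (2 * y : ℝ) * ξ) /
      (w ^ 2 + (ξ : ℂ) ^ 2)) (2 * Real.pi * x) =
      (2 * w)⁻¹ * Complex.exp (-w * (|2 * y| : ℝ)) := by
    rw [← h, ← integral_const_mul]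
    congr 1; ext k
    simp only [smul_eq_mul]
    have := sq_add_sq_ne_zero hw (2 * Real.pi * k)
    have e2 : Complex.exp (Complex.I * (2 * y : ℝ) * (2 * Real.pi * k : ℝ)) =
        Complex.exp (↑(2 * Real.pi * inner ℝ k (2 * y)) * Complex.I) := by
      congr 1
      simp; ring
    rw [e2]
    field_simp
  rw [e1] at hs
  rw [abs_of_pos (by positivity : (0 : ℝ) < (2 * Real.pi)⁻¹), abs_mul, abs_two] at hs
  have hs' : ((2 * Real.pi : ℝ) : ℂ) * ((2 * w)⁻¹ * Complex.exp (-w * (2 * |y| : ℝ))) =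
      ∫ ξ : ℝ, Complex.exp (Complex.I * (2 * y : ℝ) * ξ) / (w ^ 2 + (ξ : ℂ) ^ 2) := by
    rw [hs, Complex.real_smul, ← mul_assoc, ← Complex.ofReal_mul,
      mul_inv_cancel₀ (by positivity), Complex.ofReal_one, one_mul]
  rw [← hs']
  push_cast
  field_simp

/-! ### Laplace transform of the Schrödinger kernel -/

/-- Writes the heat-type kernel as a superposition of exponentials in `t`, whose Laplace transforms
are elementary. -/
lemma gaussian_repr {θ : ℂ} (hθ : 0 < θ.re) (hθ2 : 0 < (θ ^ 2).re) (y : ℝ) {t : ℝ} (ht : 0 < t) :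
    ∫ ξ : ℝ, Complex.exp (Complex.I * (2 * y : ℝ) * ξ) * Complex.exp (-(t / θ ^ 2) * (ξ : ℂ) ^ 2) =
      θ * Real.sqrt Real.pi * ((t ^ (-(1 / 2) : ℝ) : ℝ) : ℂ) *
        Complex.exp (-(θ ^ 2 * (y : ℂ) ^ 2 / t)) := by
  have hθ0 := ne_zero_of_re_pos hθ
  have htc : (t : ℂ) ≠ 0 := by exact_mod_cast ht.ne'
  have hb : 0 < ((t : ℂ) / θ ^ 2).re := by
    rw [div_eq_mul_inv, Complex.re_ofReal_mul, Complex.inv_re]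
    have := Complex.normSq_pos.2 (pow_ne_zero 2 hθ0)
    positivity
  have h := fourierIntegral_gaussian hb ((2 * y : ℝ) : ℂ)
  rw [h]
  have e1 : (Real.pi : ℂ) / ((t : ℂ) / θ ^ 2) = (((Real.sqrt (Real.pi / t) : ℝ) : ℂ) * θ) ^ 2 := by
    rw [mul_pow, ← Complex.ofReal_pow, Real.sq_sqrt (by positivity)]
    push_cast
    field_simp
  -- `Re θ > 0` selects the principal branch of the square root.
  have e2 : ((Real.pi : ℂ) / ((t : ℂ) / θ ^ 2)) ^ (1 / 2 : ℂ) =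
      ((Real.sqrt (Real.pi / t) : ℝ) : ℂ) * θ := by
    rw [e1, one_div]
    refine Complex.sq_cpow_two_inv ?_
    rw [Complex.re_ofReal_mul]
    have : 0 < Real.sqrt (Real.pi / t) := Real.sqrt_pos.2 (by positivity)
    positivity
  rw [e2, Real.sqrt_div' _ ht.le, Real.rpow_neg ht.le, ← Real.sqrt_eq_rpow]
  have e3 : -((2 * y : ℝ) : ℂ) ^ 2 / (4 * ((t : ℂ) / θ ^ 2)) = -(θ ^ 2 * (y : ℂ) ^ 2 / t) := by
    push_cast
    field_simp
    ring
  rw [e3]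
  push_cast
  ring

/-- The arguments of `q` and `θ` are at most `π/4` in modulus, strictly for `q`, so their sum stays
inside `(-π/2, π/2)`. -/
lemma re_mul_pos_of_sq {q θ : ℂ} (hq : 0 < q.re) (hq2 : 0 < (q ^ 2).re) (hθ : 0 < θ.re)
    (hθ2 : 0 ≤ (θ ^ 2).re) : 0 < (q * θ).re := by
  have h1 : (q ^ 2).re = q.re ^ 2 - q.im ^ 2 := by rw [sq]; simp; ring
  have h2 : (θ ^ 2).re = θ.re ^ 2 - θ.im ^ 2 := by rw [sq]; simp; ring
  rw [h1] at hq2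
  rw [h2] at hθ2
  have a1 : |q.im| < q.re := abs_lt_of_sq_lt_sq (by linarith) hq.le
  have a2 : |θ.im| ≤ θ.re := abs_le_of_sq_le_sq (by linarith) hθ.le
  rw [Complex.mul_re]
  have : q.im * θ.im ≤ |q.im| * |θ.im| := by rw [← abs_mul]; exact le_abs_self _
  nlinarith [abs_nonneg q.im, abs_nonneg θ.im]

/-- Insert `gaussian_repr` and integrate in `t` first. This leaves a Lorentzian in `ξ` whose Fourier
integral is known. The condition `Re θ² > 0` makes the double integral absolutely convergent. -/
lemma laplace_gauss_aux {q θ : ℂ} (hq : 0 < q.re) (hq2 : 0 < (q ^ 2).re) (hθ : 0 < θ.re)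
    (hθ2 : 0 < (θ ^ 2).re) (y : ℝ) :
    ∫ t in Ioi (0 : ℝ), ((t ^ (-(1 / 2) : ℝ) : ℝ) : ℂ) *
        Complex.exp (-(θ ^ 2 * (y : ℂ) ^ 2 / t)) * Complex.exp (-q ^ 2 * t) =
      Real.sqrt Real.pi / q * Complex.exp (-(q * θ) * (2 * |y| : ℝ)) := by
  have hθ0 := ne_zero_of_re_pos hθ
  have hq0 := ne_zero_of_re_pos hq
  have hw := re_mul_pos_of_sq hq hq2 hθ hθ2.le
  have hpi : (Real.sqrt Real.pi : ℂ) ≠ 0 := by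
    exact_mod_cast (Real.sqrt_pos.2 Real.pi_pos).ne'
  have hb : 0 < ((θ ^ 2)⁻¹).re := by
    rw [Complex.inv_re]
    have := Complex.normSq_pos.2 (pow_ne_zero 2 hθ0)
    positivity
  set F : ℝ → ℝ → ℂ := fun t ξ => Complex.exp (Complex.I * (2 * y : ℝ) * ξ) *
    Complex.exp (-(q ^ 2 + (ξ : ℂ) ^ 2 / θ ^ 2) * t) with hF
  have hre : ∀ ξ : ℝ, (-(q ^ 2 + (ξ : ℂ) ^ 2 / θ ^ 2)).re =
      -((q ^ 2).re + ξ ^ 2 * ((θ ^ 2)⁻¹).re) := by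
    intro ξ
    rw [div_eq_mul_inv, ← Complex.ofReal_pow, Complex.neg_re, Complex.add_re,
      Complex.re_ofReal_mul]
  have hneg : ∀ ξ : ℝ, (-(q ^ 2 + (ξ : ℂ) ^ 2 / θ ^ 2)).re < 0 := by
    intro ξ
    rw [hre]
    have : 0 ≤ ξ ^ 2 * ((θ ^ 2)⁻¹).re := by positivity
    linarith
  have hnorm : ∀ t ξ : ℝ, ‖F t ξ‖ = Real.exp (-((q ^ 2).re + ξ ^ 2 * ((θ ^ 2)⁻¹).re) * t) := by
    intro t ξ
    have e : Complex.I * ((2 * y : ℝ) : ℂ) * ξ = ((2 * y * ξ : ℝ) : ℂ) * Complex.I := by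
      push_cast; ring
    rw [hF]
    simp only
    rw [norm_mul, e, Complex.norm_exp_ofReal_mul_I, one_mul, Complex.norm_exp, Complex.re_mul_ofReal,
      hre]
  have hmeas : AEStronglyMeasurable (Function.uncurry F)
      ((volume.restrict (Ioi (0 : ℝ))).prod volume) := by
    refine Continuous.aestronglyMeasurable ?_
    simp only [hF, Function.uncurry_def]
    fun_prop (disch := exact hθ0)
  have hfub : Integrable (Function.uncurry F) ((volume.restrict (Ioi (0 : ℝ))).prod volume) := by
    rw [integrable_prod_iff' hmeas]
    refine ⟨ae_of_all _ fun ξ => ?_, ?_⟩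
    · simp only [Function.uncurry_def, hF]
      exact (integrableOn_exp_mul_complex_Ioi (hneg ξ) 0).const_mul _
    · have e : ∀ ξ : ℝ, ∫ t in Ioi (0 : ℝ), ‖Function.uncurry F (t, ξ)‖ =
          ((q ^ 2).re + ξ ^ 2 * ((θ ^ 2)⁻¹).re)⁻¹ := by
        intro ξ
        simp only [Function.uncurry_apply_pair, hnorm]
        have hn := hneg ξ
        rw [hre] at hn
        rw [integral_exp_mul_Ioi hn 0]
        rw [mul_zero, Real.exp_zero, neg_div_neg_eq, one_div]
      simp only [e]
      refine Integrable.mono' ((integrable_inv_one_add_sq).const_mul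
        ((min (q ^ 2).re ((θ ^ 2)⁻¹).re)⁻¹)) (Measurable.aestronglyMeasurable (by fun_prop))
        (ae_of_all _ fun ξ => ?_)
      have hm : 0 < min (q ^ 2).re ((θ ^ 2)⁻¹).re := lt_min hq2 hb
      have h0 : min (q ^ 2).re ((θ ^ 2)⁻¹).re * (1 + ξ ^ 2) ≤
          (q ^ 2).re + ξ ^ 2 * ((θ ^ 2)⁻¹).re := by
        have := min_le_left (q ^ 2).re ((θ ^ 2)⁻¹).re
        have := min_le_right (q ^ 2).re ((θ ^ 2)⁻¹).re
        nlinarith [sq_nonneg ξ]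
      rw [Real.norm_of_nonneg (inv_nonneg.2 (le_trans (by positivity) h0)), ← mul_inv]
      exact inv_anti₀ (by positivity) h0
  have hswap := integral_integral_swap hfub
  have hL : ∫ t in Ioi (0 : ℝ), ∫ ξ, F t ξ = (θ * Real.sqrt Real.pi) *
      ∫ t in Ioi (0 : ℝ), ((t ^ (-(1 / 2) : ℝ) : ℝ) : ℂ) *
        Complex.exp (-(θ ^ 2 * (y : ℂ) ^ 2 / t)) * Complex.exp (-q ^ 2 * t) := by
    rw [← integral_const_mul]
    refine setIntegral_congr_fun measurableSet_Ioi fun t ht => ?_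
    have h := gaussian_repr hθ hθ2 y ht
    have e : ∀ ξ, F t ξ = (Complex.exp (Complex.I * (2 * y : ℝ) * ξ) *
        Complex.exp (-(t / θ ^ 2) * (ξ : ℂ) ^ 2)) * Complex.exp (-q ^ 2 * t) := by
      intro ξ
      simp only [hF]
      rw [← Complex.exp_add, ← Complex.exp_add, ← Complex.exp_add]
      congr 1
      ring
    simp only [e]
    rw [integral_mul_const, h]
    ring
  have hR : ∫ ξ, ∫ t in Ioi (0 : ℝ), F t ξ = θ ^ 2 *
      ∫ ξ : ℝ, Complex.exp (Complex.I * (2 * y : ℝ) * ξ) / ((q * θ) ^ 2 + (ξ : ℂ) ^ 2) := by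
    rw [← integral_const_mul]
    congr 1; ext ξ
    simp only [hF]
    rw [integral_const_mul, integral_exp_mul_complex_Ioi (hneg ξ) 0]
    have := sq_add_sq_ne_zero hw ξ
    have h2 : q ^ 2 + (ξ : ℂ) ^ 2 / θ ^ 2 = ((q * θ) ^ 2 + (ξ : ℂ) ^ 2) / θ ^ 2 := by
      field_simp
    rw [h2]
    simp only [Complex.ofReal_zero, mul_zero, Complex.exp_zero]
    rw [neg_div_neg_eq, one_div_div]
    ring
  rw [hL, hR, integral_lorentz_exp hw y] at hswap
  have hne : θ * (Real.sqrt Real.pi : ℂ) ≠ 0 := mul_ne_zero hθ0 hpi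
  refine mul_left_cancel₀ hne (hswap.trans ?_)
  have hs : (Real.pi : ℂ) = (Real.sqrt Real.pi : ℂ) ^ 2 := by
    rw [← Complex.ofReal_pow, Real.sq_sqrt Real.pi_pos.le]
  rw [hs]
  field_simp

lemma integrableOn_rpow_mul_exp {ε : ℝ} (hε : 0 < ε) :
    IntegrableOn (fun t : ℝ => t ^ (-(1 / 2) : ℝ) * Real.exp (-ε * t)) (Ioi 0) := by
  have h := integrableOn_rpow_mul_exp_neg_mul_rpow (s := -(1 / 2)) (p := 1) (b := ε)
    (by norm_num) one_pos hε
  simpa using h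

/-- `e^{-iπ/4}`. -/
def rotC : ℂ := ((Real.sqrt 2)⁻¹ : ℝ) * (1 - Complex.I)

lemma rotC_sq : rotC ^ 2 = -Complex.I := by
  unfold rotC
  rw [mul_pow, ← Complex.ofReal_pow, inv_pow, Real.sq_sqrt (by norm_num)]
  push_cast
  linear_combination (1 / 2 : ℂ) * Complex.I_sq

lemma rotC_re : 0 < rotC.re := by
  unfold rotC
  rw [Complex.re_ofReal_mul]
  simp

/-- The Laplace transform of `t^(-1/2) e^{ix²/(4t)}`. -/
lemma laplace_kernel {q : ℂ} (hq : 0 < q.re) (hq2 : 0 < (q ^ 2).re) (x : ℝ) :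
    ∫ t in Ioi (0 : ℝ), ((t ^ (-(1 / 2) : ℝ) : ℝ) : ℂ) *
        Complex.exp (Complex.I * ((x ^ 2 / (4 * t) : ℝ) : ℂ)) * Complex.exp (-q ^ 2 * t) =
      Real.sqrt Real.pi / q * Complex.exp (-(q * rotC) * (|x| : ℝ)) := by
  -- The kernel wanted corresponds to `rotC`, whose square `-i` has zero real part, so the
  -- absolutely convergent case does not apply. It is reached as `δ → 0+` through parameters with
  -- `Re θ² > 0`.
  set θ : ℝ → ℂ := fun δ => ((Real.sqrt 2)⁻¹ : ℝ) * (1 - (1 - δ : ℝ) * Complex.I) with hθ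
  have hθre : ∀ δ, 0 < (θ δ).re := fun δ => by
    simp only [hθ]
    rw [Complex.re_ofReal_mul]
    simp
  have hθ2 : ∀ δ ∈ Ioo (0 : ℝ) 1, 0 < ((θ δ) ^ 2).re := fun δ hδ => by
    have e : (θ δ) ^ 2 = ((1 / 2 : ℝ) : ℂ) * (1 - (1 - δ : ℝ) * Complex.I) ^ 2 := by
      simp only [hθ]
      rw [mul_pow, ← Complex.ofReal_pow, inv_pow, Real.sq_sqrt (by norm_num)]
      norm_num
    rw [e, Complex.re_ofReal_mul, sq, Complex.mul_re]
    simp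
    nlinarith [hδ.1, hδ.2]
  have hθlim : Tendsto θ (𝓝[>] 0) (𝓝 rotC) := by
    have hc : Continuous θ := by simp only [hθ]; fun_prop
    have h0 : θ 0 = rotC := by simp [hθ, rotC]
    rw [← h0]
    exact hc.continuousAt.tendsto.mono_left nhdsWithin_le_nhds
  have hmem : Ioo (0 : ℝ) 1 ∈ 𝓝[>] (0 : ℝ) := Ioo_mem_nhdsGT (by norm_num)
  have h1 : Tendsto (fun δ => ∫ t in Ioi (0 : ℝ), ((t ^ (-(1 / 2) : ℝ) : ℝ) : ℂ) *
        Complex.exp (-((θ δ) ^ 2 * ((x / 2 : ℝ) : ℂ) ^ 2 / t)) * Complex.exp (-q ^ 2 * t))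
      (𝓝[>] 0) (𝓝 (∫ t in Ioi (0 : ℝ), ((t ^ (-(1 / 2) : ℝ) : ℝ) : ℂ) *
        Complex.exp (Complex.I * ((x ^ 2 / (4 * t) : ℝ) : ℂ)) * Complex.exp (-q ^ 2 * t))) := by
    -- For `0 < δ < 1` the Gaussian factor has modulus at most one, so the majorant does not depend
    -- on `δ`.
    refine tendsto_integral_filter_of_dominated_convergence
      (fun t => t ^ (-(1 / 2) : ℝ) * Real.exp (-(q ^ 2).re * t)) ?_ ?_
      (integrableOn_rpow_mul_exp hq2) ?_
    · refine Eventually.of_forall fun δ => Measurable.aestronglyMeasurable ?_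
      fun_prop
    · filter_upwards [hmem] with δ hδ
      refine (ae_restrict_iff' measurableSet_Ioi).2 (ae_of_all _ fun t ht => ?_)
      have ht : 0 < t := ht
      rw [norm_mul, norm_mul, Complex.norm_real, Real.norm_of_nonneg (by positivity),
        Complex.norm_exp, Complex.norm_exp]
      have e1 : (-q ^ 2 * (t : ℂ)).re = -(q ^ 2).re * t := by
        rw [Complex.re_mul_ofReal, Complex.neg_re]
      have e2 : Real.exp (-((θ δ) ^ 2 * ((x / 2 : ℝ) : ℂ) ^ 2 / t)).re ≤ 1 := by
        rw [Real.exp_le_one_iff, Complex.neg_re, neg_nonpos, Complex.div_ofReal_re,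
          ← Complex.ofReal_pow, Complex.re_mul_ofReal]
        have := hθ2 δ hδ
        positivity
      rw [e1]
      gcongr
      exact mul_le_of_le_one_right (by positivity) e2
    · refine (ae_restrict_iff' measurableSet_Ioi).2 (ae_of_all _ fun t ht => ?_)
      have ht : 0 < t := ht
      have htc : (t : ℂ) ≠ 0 := by exact_mod_cast ht.ne'
      have e : Complex.I * ((x ^ 2 / (4 * t) : ℝ) : ℂ) =
          -(rotC ^ 2 * ((x / 2 : ℝ) : ℂ) ^ 2 / t) := by
        rw [rotC_sq]; push_cast; field_simp; ring
      rw [e]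
      refine (Tendsto.mul tendsto_const_nhds ?_).mul_const _
      exact (Complex.continuous_exp.tendsto _).comp
        ((((hθlim.pow 2).mul_const _).div_const _).neg)
  have h2 : Tendsto (fun δ => (Real.sqrt Real.pi : ℂ) / q *
      Complex.exp (-(q * θ δ) * (2 * |x / 2| : ℝ))) (𝓝[>] 0)
      (𝓝 (Real.sqrt Real.pi / q * Complex.exp (-(q * rotC) * (2 * |x / 2| : ℝ)))) :=
    Tendsto.mul tendsto_const_nhds ((Complex.continuous_exp.tendsto _).comp
      (((hθlim.const_mul q).neg).mul_const _))
  have h3 : ∀ᶠ δ in 𝓝[>] (0 : ℝ), (∫ t in Ioi (0 : ℝ), ((t ^ (-(1 / 2) : ℝ) : ℝ) : ℂ) *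
        Complex.exp (-((θ δ) ^ 2 * ((x / 2 : ℝ) : ℂ) ^ 2 / t)) * Complex.exp (-q ^ 2 * t)) =
      (Real.sqrt Real.pi : ℂ) / q * Complex.exp (-(q * θ δ) * (2 * |x / 2| : ℝ)) := by
    filter_upwards [hmem] with δ hδ
    exact laplace_gauss_aux hq hq2 (hθre δ) (hθ2 δ hδ) (x / 2)
  have h4 := tendsto_nhds_unique (h1.congr' h3) h2
  rw [h4]
  have e : 2 * |x / 2| = |x| := by rw [abs_div, abs_two]; ring
  rw [e]

/-! ### The boundary forcing operator as a convolution -/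

/-- The kernel `t^(-1/2) e^{ix²/(4t)}` for `t > 0`, extended by zero. -/
def kerK (x : ℝ) : ℝ → ℂ := indicator (Ioi 0) fun t =>
  ((t ^ (-(1 / 2) : ℝ) : ℝ) : ℂ) * Complex.exp (Complex.I * ((x ^ 2 / (4 * t) : ℝ) : ℂ))

/-- Convolution on the line. -/
def conv (a b : ℝ → ℂ) (t : ℝ) : ℂ := ∫ r, a r * b (t - r)

lemma conv_eq (a b : ℝ → ℂ) :
    conv a b = MeasureTheory.convolution a b (ContinuousLinearMap.mul ℝ ℂ) volume := rfl

lemma conv_swap (a b : ℝ → ℂ) (t : ℝ) : conv a b t = ∫ s, a (t - s) * b s := by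
  rw [conv, ← integral_sub_left_eq_self _ volume t]
  simp

lemma measurable_kerK_uncurry : Measurable fun z : ℝ × ℝ => kerK z.1 z.2 := by
  have : (fun z : ℝ × ℝ => kerK z.1 z.2) = indicator (Prod.snd ⁻¹' Ioi 0) fun z : ℝ × ℝ =>
      ((z.2 ^ (-(1 / 2) : ℝ) : ℝ) : ℂ) *
        Complex.exp (Complex.I * ((z.1 ^ 2 / (4 * z.2) : ℝ) : ℂ)) := by
    funext z
    simp only [kerK, indicator, mem_Ioi, mem_preimage]
  rw [this]
  refine Measurable.indicator (by fun_prop) (measurable_snd measurableSet_Ioi)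

lemma measurable_kerK (x : ℝ) : Measurable (kerK x) := by
  unfold kerK
  exact Measurable.indicator (by fun_prop) measurableSet_Ioi

lemma norm_kerK (x t : ℝ) :
    ‖kerK x t‖ = indicator (Ioi 0) (fun t : ℝ => t ^ (-(1 / 2) : ℝ)) t := by
  by_cases ht : 0 < t
  · rw [kerK, indicator_of_mem (mem_Ioi.2 ht), indicator_of_mem (mem_Ioi.2 ht), norm_mul,
      mul_comm Complex.I, Complex.norm_exp_ofReal_mul_I, mul_one, Complex.norm_real,
      Real.norm_of_nonneg (by positivity)]
  · rw [kerK, indicator_of_notMem (by simpa using ht), indicator_of_notMem (by simpa using ht),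
      norm_zero]

lemma kerK_of_nonpos (x : ℝ) {t : ℝ} (ht : t ≤ 0) : kerK x t = 0 := by
  rw [kerK, indicator_of_notMem (by simpa using ht)]

/-- Both factors are supported on a half-line, which confines the convolution to `[0, t]`. For `t <
0` both sides vanish. -/
lemma intervalIntegral_eq_conv {h : ℝ → ℂ} (hh : ∀ s < 0, h s = 0) (x t : ℝ) :
    ∫ s in (0 : ℝ)..t, (((t - s) ^ (-(1 / 2) : ℝ) : ℝ) : ℂ) *
      Complex.exp (Complex.I * ((x ^ 2 / (4 * (t - s)) : ℝ) : ℂ)) * h s = conv (kerK x) h t := by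
  rw [conv_swap]
  rcases le_or_gt 0 t with ht | ht
  · rw [intervalIntegral.integral_of_le ht, ← integral_Icc_eq_integral_Ioc,
      ← integral_indicator measurableSet_Icc]
    congr 1; ext s
    by_cases hs : s ∈ Icc 0 t
    · rw [indicator_of_mem hs]
      -- At `s = t` the power `0 ^ (-1/2)` has the default value `0`, in agreement with `kerK`.
      rcases eq_or_lt_of_le hs.2 with rfl | hst
      · rw [sub_self, kerK_of_nonpos x le_rfl, Real.zero_rpow (by norm_num)]
        simp
      · rw [kerK, indicator_of_mem (mem_Ioi.2 (sub_pos.2 hst))]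
    · rw [indicator_of_notMem hs]
      rcases lt_or_ge s 0 with h0 | h0
      · rw [hh s h0, mul_zero]
      · have : t < s := by
          by_contra hc
          exact hs ⟨h0, not_lt.1 hc⟩
        rw [kerK_of_nonpos x (by linarith), zero_mul]
  · rw [intervalIntegral.integral_of_ge ht.le, integral_Ioc_eq_integral_Ioo]
    have e1 : ∫ s in Ioo t 0, (((t - s) ^ (-(1 / 2) : ℝ) : ℝ) : ℂ) *
      Complex.exp (Complex.I * ((x ^ 2 / (4 * (t - s)) : ℝ) : ℂ)) * h s = ∫ s in Ioo t 0, 0 := by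
      refine setIntegral_congr_fun measurableSet_Ioo fun s hs => ?_
      simp only [hh s hs.2, mul_zero]
    have e2 : ∀ s, kerK x (t - s) * h s = 0 := fun s => by
      rcases lt_or_ge s 0 with h0 | h0
      · rw [hh s h0, mul_zero]
      · rw [kerK_of_nonpos x (by linarith), zero_mul]
    rw [e1]
    simp [e2]

/-- The factor `2√t` is `∫₀ᵗ r^(-1/2) dr`, the kernel having modulus `r^(-1/2)` for every `x`. -/
lemma norm_conv_kerK_le {h : ℝ → ℂ} (hh : ∀ s < 0, h s = 0) {B t : ℝ} (ht : 0 ≤ t)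
    (hB : ∀ s ≤ t, ‖h s‖ ≤ B) (x : ℝ) : ‖conv (kerK x) h t‖ ≤ 2 * Real.sqrt t * B := by
  have hB0 : 0 ≤ B := (norm_nonneg _).trans (hB t le_rfl)
  have hi : IntervalIntegrable (fun r : ℝ => B * r ^ (-(1 / 2) : ℝ)) volume 0 t :=
    (intervalIntegral.intervalIntegrable_rpow' (by norm_num)).const_mul B
  have hi' : Integrable (indicator (Ioc 0 t) fun r : ℝ => B * r ^ (-(1 / 2) : ℝ)) := by
    rw [integrable_indicator_iff measurableSet_Ioc]
    exact (intervalIntegrable_iff_integrableOn_Ioc_of_le ht).1 hi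
  refine (norm_integral_le_of_norm_le hi' (ae_of_all _ fun r => ?_)).trans ?_
  · rw [norm_mul, norm_kerK]
    by_cases hr : r ∈ Ioc 0 t
    · rw [indicator_of_mem hr, indicator_of_mem (mem_Ioi.2 hr.1), mul_comm]
      exact mul_le_mul_of_nonneg_right (hB (t - r) (by linarith [hr.1]))
        (Real.rpow_nonneg hr.1.le _)
    · rw [indicator_of_notMem hr]
      by_cases h0 : 0 < r
      · have : t < r := by
          by_contra hc
          exact hr ⟨h0, not_lt.1 hc⟩
        rw [hh (t - r) (by linarith), norm_zero, mul_zero]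
      · rw [indicator_of_notMem (by simpa using h0), zero_mul]
  · rw [integral_indicator measurableSet_Ioc, ← intervalIntegral.integral_of_le ht,
      intervalIntegral.integral_const_mul, integral_rpow (Or.inl (by norm_num)),
      Real.zero_rpow (by norm_num), Real.sqrt_eq_rpow]
    norm_num
    apply le_of_eq
    ring

lemma test_zero_of_neg {g : 𝓢(ℝ, ℂ)} (hg : IsTestHalfLine g) {s : ℝ} (hs : s < 0) : g s = 0 := by
  by_contra h
  have := hg.2 (subset_tsupport _ (Function.mem_support.2 h))
  exact absurd (mem_Ici.1 this) (not_le.2 hs)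

lemma deriv_test_zero_of_neg {g : 𝓢(ℝ, ℂ)} (hg : IsTestHalfLine g) {s : ℝ} (hs : s < 0) :
    deriv g s = 0 := by
  by_contra h
  have := hg.2 (support_deriv_subset (Function.mem_support.2 h))
  exact absurd (mem_Ici.1 this) (not_le.2 hs)

lemma locallyIntegrable_kerK (x : ℝ) : LocallyIntegrable (kerK x) := by
  intro t₀
  refine ⟨Iio (max t₀ 0 + 1), Iio_mem_nhds (by linarith [le_max_left t₀ 0]), ?_⟩
  set b := max t₀ 0 + 1
  have hb : 0 ≤ b := by have := le_max_right t₀ 0; simp only [b]; linarith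
  have hi : IntegrableOn (fun r : ℝ => r ^ (-(1 / 2) : ℝ)) (Ioc 0 b) :=
    (intervalIntegrable_iff_integrableOn_Ioc_of_le hb).1
      (intervalIntegral.intervalIntegrable_rpow' (by norm_num))
  have hi' : Integrable (indicator (Ioc 0 b) fun r : ℝ => r ^ (-(1 / 2) : ℝ)) := by
    rwa [integrable_indicator_iff measurableSet_Ioc]
  refine Integrable.mono' hi'.integrableOn (measurable_kerK x).aestronglyMeasurable ?_
  refine (ae_restrict_iff' measurableSet_Iio).2 (ae_of_all _ fun r hr => ?_)
  rw [norm_kerK]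
  by_cases h0 : 0 < r
  · rw [indicator_of_mem (mem_Ioi.2 h0), indicator_of_mem (show r ∈ Ioc 0 b from ⟨h0, le_of_lt hr⟩)]
  · rw [indicator_of_notMem (by simpa using h0)]
    exact indicator_nonneg (fun s hs => Real.rpow_nonneg hs.1.le _) r

lemma riemannLiouville_half {g : ℝ → ℂ} (hg : ∀ s < 0, g s = 0) (t : ℝ) :
    riemannLiouville (1 / 2) g t = ((Real.sqrt Real.pi)⁻¹ : ℝ) * conv (kerK 0) g t := by
  rw [riemannLiouville, Real.Gamma_one_half_eq, ← intervalIntegral_eq_conv hg 0 t]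
  congr 1
  congr 1
  ext s
  norm_num

lemma continuous_deriv_schwartz (g : 𝓢(ℝ, ℂ)) : Continuous (deriv g) :=
  (g.smooth 1).continuous_deriv le_rfl

/-- The derivative of the convolution is moved to `g`, which is smooth and compactly supported,
rather than to the singular kernel. -/
lemma halfDeriv_eq {g : 𝓢(ℝ, ℂ)} (hg : IsTestHalfLine g) (t : ℝ) :
    halfDeriv g t = ((Real.sqrt Real.pi)⁻¹ : ℝ) * conv (kerK 0) (deriv g) t := by
  have e : riemannLiouville (1 / 2) g = fun t => ((Real.sqrt Real.pi)⁻¹ : ℝ) * conv (kerK 0) g t :=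
    funext (riemannLiouville_half fun s hs => test_zero_of_neg hg hs)
  rw [halfDeriv, e]
  have h := hg.1.hasDerivAt_convolution_right (ContinuousLinearMap.mul ℝ ℂ)
    (locallyIntegrable_kerK 0) (g.smooth 1) t
  rw [← conv_eq, ← conv_eq] at h
  exact (h.const_mul _).deriv

lemma halfDeriv_zero_of_neg {g : 𝓢(ℝ, ℂ)} (hg : IsTestHalfLine g) {t : ℝ} (ht : t < 0) :
    halfDeriv g t = 0 := by
  rw [halfDeriv_eq hg, conv]
  have : ∀ r, kerK 0 r * deriv g (t - r) = 0 := fun r => by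
    rcases le_or_gt r 0 with h | h
    · rw [kerK_of_nonpos 0 h, zero_mul]
    · rw [deriv_test_zero_of_neg hg (by linarith), mul_zero]
  simp [this]

lemma continuous_halfDeriv {g : 𝓢(ℝ, ℂ)} (hg : IsTestHalfLine g) : Continuous (halfDeriv g) := by
  rw [funext (halfDeriv_eq hg)]
  refine continuous_const.mul ?_
  rw [conv_eq]
  exact (hg.1.deriv).continuous_convolution_right (ContinuousLinearMap.mul ℝ ℂ)
    (locallyIntegrable_kerK 0) (continuous_deriv_schwartz g)

lemma forcing_eq {g : 𝓢(ℝ, ℂ)} (hg : IsTestHalfLine g) (x t : ℝ) :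
    forcing g x t = ((1 / Real.sqrt Real.pi : ℝ) : ℂ) * conv (kerK x) (halfDeriv g) t := by
  rw [forcing, intervalIntegral_eq_conv (fun s hs => halfDeriv_zero_of_neg hg hs)]

lemma forcing_zero_of_neg {g : 𝓢(ℝ, ℂ)} (hg : IsTestHalfLine g) (x : ℝ) {t : ℝ} (ht : t < 0) :
    forcing g x t = 0 := by
  rw [forcing_eq hg, conv]
  have : ∀ r, kerK x r * halfDeriv g (t - r) = 0 := fun r => by
    rcases le_or_gt r 0 with h | h
    · rw [kerK_of_nonpos x h, zero_mul]
    · rw [halfDeriv_zero_of_neg hg (by linarith), mul_zero]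
  simp [this]

/-- Two convolutions with kernels of modulus `r^(-1/2)`, applied to the bounded function `g'`, give
two factors `√t`. Linear growth is enough for pairing with Schwartz functions. -/
lemma exists_forcing_bound {g : 𝓢(ℝ, ℂ)} (hg : IsTestHalfLine g) :
    ∃ C : ℝ, ∀ x t, ‖forcing g x t‖ ≤ C * |t| := by
  obtain ⟨B, hB⟩ := (hg.1.deriv).exists_bound_of_continuous (continuous_deriv_schwartz g)
  set a : ℝ := (Real.sqrt Real.pi)⁻¹ with ha
  have ha0 : 0 ≤ a := by positivity
  have hB0 : 0 ≤ B := (norm_nonneg _).trans (hB 0)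
  have h1 : ∀ t, 0 ≤ t → ‖halfDeriv g t‖ ≤ a * (2 * Real.sqrt t * B) := by
    intro t ht
    rw [halfDeriv_eq hg, norm_mul, Complex.norm_real, Real.norm_of_nonneg ha0]
    gcongr
    exact norm_conv_kerK_le (fun s hs => deriv_test_zero_of_neg hg hs) ht (fun s _ => hB s) 0
  refine ⟨a * (2 * (a * (2 * B))), fun x t => ?_⟩
  rcases lt_or_ge t 0 with ht | ht
  · rw [forcing_zero_of_neg hg x ht, norm_zero]; positivity
  rw [forcing_eq hg, norm_mul, Complex.norm_real, one_div, Real.norm_of_nonneg ha0, mul_assoc]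
  gcongr
  have h2 := norm_conv_kerK_le (fun s hs => halfDeriv_zero_of_neg hg hs) ht
    (B := a * (2 * Real.sqrt t * B)) (fun s hs => by
      rcases lt_or_ge s 0 with h0 | h0
      · rw [halfDeriv_zero_of_neg hg h0, norm_zero]; positivity
      · refine (h1 s h0).trans ?_
        gcongr) x
  refine h2.trans (le_of_eq ?_)
  rw [abs_of_nonneg ht]
  have := Real.mul_self_sqrt ht
  linear_combination (4 * a * B) * this

lemma stronglyMeasurable_forcing {g : 𝓢(ℝ, ℂ)} (hg : IsTestHalfLine g) :
    StronglyMeasurable fun z : ℝ × ℝ => forcing g z.1 z.2 := by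
  simp only [forcing_eq hg, conv]
  refine StronglyMeasurable.const_mul ?_ _
  refine StronglyMeasurable.integral_prod_right
    (f := fun (z : ℝ × ℝ) r => kerK z.1 r * halfDeriv g (z.2 - r)) ?_
  refine Measurable.stronglyMeasurable ?_
  have h1 : Measurable fun y : (ℝ × ℝ) × ℝ => kerK y.1.1 y.2 :=
    measurable_kerK_uncurry.comp (measurable_fst.fst.prodMk measurable_snd)
  exact h1.mul ((continuous_halfDeriv hg).measurable.comp
    (measurable_fst.snd.sub measurable_snd))

/-! ### Laplace transform of the forcing -/

/-- Exponentials are multiplicative, so damping passes to both factors. The damped kernels are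
integrable, and the Laplace transform of a convolution becomes a product. -/
lemma conv_mul_exp (a b : ℝ → ℂ) (p : ℂ) (t : ℝ) :
    conv a b t * Complex.exp (-p * t) =
      conv (fun t => a t * Complex.exp (-p * t)) (fun t => b t * Complex.exp (-p * t)) t := by
  rw [conv, conv, ← integral_mul_const]
  congr 1; ext r
  have : Complex.exp (-p * t) = Complex.exp (-p * r) * Complex.exp (-p * (t - r : ℝ)) := by
    rw [← Complex.exp_add]; congr 1; push_cast; ring
  rw [this]; ring

lemma integrable_conv {a b : ℝ → ℂ} (ha : Integrable a) (hb : Integrable b) :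
    Integrable (conv a b) := by
  rw [conv_eq]; exact ha.integrable_convolution _ hb

lemma integral_conv {a b : ℝ → ℂ} (ha : Integrable a) (hb : Integrable b) :
    ∫ t, conv a b t = (∫ t, a t) * ∫ t, b t := by
  rw [conv_eq, integral_convolution _ ha hb]; rfl

lemma integrable_kerK_mul_exp {p : ℂ} (hp : 0 < p.re) (x : ℝ) :
    Integrable fun t => kerK x t * Complex.exp (-p * t) := by
  have h := (integrable_indicator_iff measurableSet_Ioi).2 (integrableOn_rpow_mul_exp hp)
  refine Integrable.mono' h (Measurable.aestronglyMeasurable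
    ((measurable_kerK x).mul (by fun_prop))) (ae_of_all _ fun t => ?_)
  rw [norm_mul, norm_kerK, Complex.norm_exp]
  by_cases ht : 0 < t
  · rw [indicator_of_mem (mem_Ioi.2 ht), indicator_of_mem (mem_Ioi.2 ht)]
    simp
  · rw [indicator_of_notMem (by simpa using ht), indicator_of_notMem (by simpa using ht), zero_mul]

lemma integral_kerK_mul_exp {q : ℂ} (hq : 0 < q.re) (hq2 : 0 < (q ^ 2).re) (x : ℝ) :
    ∫ t, kerK x t * Complex.exp (-q ^ 2 * t) =
      Real.sqrt Real.pi / q * Complex.exp (-(q * rotC) * (|x| : ℝ)) := by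
  rw [← laplace_kernel hq hq2 x, ← integral_indicator measurableSet_Ioi]
  congr 1; ext t
  by_cases ht : 0 < t
  · rw [kerK, indicator_of_mem (mem_Ioi.2 ht), indicator_of_mem (mem_Ioi.2 ht)]
  · rw [kerK, indicator_of_notMem (by simpa using ht), indicator_of_notMem (by simpa using ht),
      zero_mul]

lemma integral_deriv_mul_exp {g : 𝓢(ℝ, ℂ)} (hg : HasCompactSupport g) (p : ℂ) :
    ∫ t, deriv g t * Complex.exp (-p * t) = p * ∫ t, g t * Complex.exp (-p * t) := by
  have hd : ∀ t : ℝ, HasDerivAt (fun t : ℝ => Complex.exp (-p * t)) (-p * Complex.exp (-p * t)) t := by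
    intro t
    have h1 : HasDerivAt (fun t : ℝ => -p * (t : ℂ)) (-p) t := by
      simpa using (Complex.ofRealCLM.hasDerivAt (x := t)).const_mul (-p)
    simpa [mul_comm] using h1.cexp
  have hgd : ∀ t, HasDerivAt g (deriv g t) t := fun t => (g.differentiable t).hasDerivAt
  have i1 : Integrable fun t => deriv g t * Complex.exp (-p * t) :=
    Continuous.integrable_of_hasCompactSupport
      ((continuous_deriv_schwartz g).mul (by fun_prop)) (hg.deriv.mul_right)
  have i2 : Integrable fun t => g t * (-p * Complex.exp (-p * t)) :=
    Continuous.integrable_of_hasCompactSupport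
      (g.continuous.mul (by fun_prop)) hg.mul_right
  have i3 : Integrable fun t => g t * Complex.exp (-p * t) :=
    Continuous.integrable_of_hasCompactSupport
      (g.continuous.mul (by fun_prop)) hg.mul_right
  have h := integral_mul_deriv_eq_deriv_mul_of_integrable (u := g)
    (v := fun t : ℝ => Complex.exp (-p * t)) (fun t _ => hgd t) (fun t _ => hd t) i2 i1 i3
  have e : ∫ t, g t * (-p * Complex.exp (-p * t)) = -p * ∫ t, g t * Complex.exp (-p * t) := by
    rw [← integral_const_mul]; congr 1; ext t; ring
  rw [e] at h
  linear_combination h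

lemma integrable_deriv_mul_exp {g : 𝓢(ℝ, ℂ)} (hg : HasCompactSupport g) (p : ℂ) :
    Integrable fun t => deriv g t * Complex.exp (-p * t) :=
  Continuous.integrable_of_hasCompactSupport
    ((continuous_deriv_schwartz g).mul (by fun_prop)) (hg.deriv.mul_right)

lemma forcing_mul_exp {g : 𝓢(ℝ, ℂ)} (hg : IsTestHalfLine g) (x : ℝ) (p : ℂ) :
    (fun t : ℝ => forcing g x t * Complex.exp (-p * t)) = fun t =>
      ((Real.pi)⁻¹ : ℝ) * conv (fun t => kerK x t * Complex.exp (-p * t))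
        (conv (fun t => kerK 0 t * Complex.exp (-p * t))
          (fun t => deriv g t * Complex.exp (-p * t))) t := by
  funext t
  have e1 : conv (fun t => kerK 0 t * Complex.exp (-p * t))
          (fun t => deriv g t * Complex.exp (-p * t)) =
      fun t => (Real.sqrt Real.pi : ℂ) * (halfDeriv g t * Complex.exp (-p * t)) := by
    funext t
    have hs : (Real.sqrt Real.pi : ℂ) ≠ 0 := by
      exact_mod_cast (Real.sqrt_pos.2 Real.pi_pos).ne'
    rw [← conv_mul_exp, halfDeriv_eq hg]
    push_cast
    field_simp
  have e2 : conv (fun t => kerK x t * Complex.exp (-p * t))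
      (fun t => (Real.sqrt Real.pi : ℂ) * (halfDeriv g t * Complex.exp (-p * t))) t =
      (Real.sqrt Real.pi : ℂ) * (conv (kerK x) (halfDeriv g) t * Complex.exp (-p * t)) := by
    rw [conv_mul_exp, conv, conv, ← integral_const_mul]
    congr 1; ext r; ring
  rw [e1, e2, forcing_eq hg]
  have hs : (Real.sqrt Real.pi : ℂ) ^ 2 = (Real.pi : ℂ) := by
    rw [← Complex.ofReal_pow, Real.sq_sqrt Real.pi_pos.le]
  have hs0 : (Real.sqrt Real.pi : ℂ) ≠ 0 := by
    exact_mod_cast (Real.sqrt_pos.2 Real.pi_pos).ne'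
  push_cast
  rw [← hs]
  field_simp

lemma integrable_forcing_mul_exp {g : 𝓢(ℝ, ℂ)} (hg : IsTestHalfLine g) (x : ℝ) {p : ℂ}
    (hp : 0 < p.re) : Integrable fun t : ℝ => forcing g x t * Complex.exp (-p * t) := by
  rw [forcing_mul_exp hg]
  exact (integrable_conv (integrable_kerK_mul_exp hp x) (integrable_conv
    (integrable_kerK_mul_exp hp 0) (integrable_deriv_mul_exp hg.1 p))).const_mul _

/-- The product of `π⁻¹`, of `√π/q` twice, and of `q²` from the derivative of `g` is one, leaving
only the exponential. -/
lemma laplace_forcing {g : 𝓢(ℝ, ℂ)} (hg : IsTestHalfLine g) (x : ℝ) {q : ℂ} (hq : 0 < q.re)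
    (hq2 : 0 < (q ^ 2).re) :
    ∫ t : ℝ, forcing g x t * Complex.exp (-q ^ 2 * t) =
      Complex.exp (-(q * rotC) * (|x| : ℝ)) * ∫ t, g t * Complex.exp (-q ^ 2 * t) := by
  rw [forcing_mul_exp hg, integral_const_mul, integral_conv (integrable_kerK_mul_exp hq2 x)
    (integrable_conv (integrable_kerK_mul_exp hq2 0) (integrable_deriv_mul_exp hg.1 _)),
    integral_conv (integrable_kerK_mul_exp hq2 0) (integrable_deriv_mul_exp hg.1 _),
    integral_kerK_mul_exp hq hq2, integral_kerK_mul_exp hq hq2, integral_deriv_mul_exp hg.1]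
  have hs : (Real.sqrt Real.pi : ℂ) ^ 2 = (Real.pi : ℂ) := by
    rw [← Complex.ofReal_pow, Real.sq_sqrt Real.pi_pos.le]
  have hs0 : (Real.sqrt Real.pi : ℂ) ≠ 0 := by
    exact_mod_cast (Real.sqrt_pos.2 Real.pi_pos).ne'
  have hq0 := ne_zero_of_re_pos hq
  simp only [abs_zero, Complex.ofReal_zero, mul_zero, Complex.exp_zero, mul_one]
  push_cast
  rw [← hs]
  field_simp

/-! ### The time Fourier transform of the forcing of a test function -/

/-- The principal square root, on the slit plane. -/
def csqrt (p : ℂ) : ℂ := Complex.exp (Complex.log p / 2)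

lemma csqrt_sq {p : ℂ} (hp : p ≠ 0) : csqrt p ^ 2 = p := by
  rw [csqrt, ← Complex.exp_nat_mul]
  convert Complex.exp_log hp using 2
  push_cast; ring

lemma csqrt_re_pos {p : ℂ} (hp : p ∈ Complex.slitPlane) : 0 < (csqrt p).re := by
  rw [csqrt, Complex.exp_re]
  have h1 := Complex.neg_pi_lt_arg p
  have h2 := (Complex.arg_le_pi p).lt_of_ne (Complex.mem_slitPlane_iff_arg.1 hp).1
  have e : (Complex.log p / 2).im = p.arg / 2 := by
    rw [show (2 : ℂ) = ((2 : ℝ) : ℂ) by norm_num, Complex.div_ofReal_im, Complex.log_im]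
  rw [e]
  exact mul_pos (Real.exp_pos _) (Real.cos_pos_of_mem_Ioo ⟨by linarith, by linarith⟩)

lemma continuousAt_csqrt {p : ℂ} (hp : p ∈ Complex.slitPlane) : ContinuousAt csqrt p := by
  unfold csqrt
  exact ((continuousAt_clog hp).div_const 2).cexp

lemma kap_sq (τ : ℝ) : kap τ ^ 2 = 2 * Real.pi * τ := by
  unfold kap
  rcases le_total 0 τ with h | h
  · have e : Real.sqrt (-(2 * Real.pi * τ)) = 0 := Real.sqrt_eq_zero_of_nonpos (by
      have := mul_nonneg Real.two_pi_pos.le h; linarith)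
    have e2 := Real.sq_sqrt (mul_nonneg Real.two_pi_pos.le h)
    have e3 : (Real.sqrt (2 * Real.pi * τ) : ℂ) ^ 2 = 2 * Real.pi * τ := by exact_mod_cast e2
    simp only [e] at *
    simpa using e3
  · have h' : 0 ≤ -(2 * Real.pi * τ) := by
      have := mul_nonneg Real.two_pi_pos.le (neg_nonneg.2 h); linarith
    have e : Real.sqrt (2 * Real.pi * τ) = 0 := Real.sqrt_eq_zero_of_nonpos (by linarith)
    have e2 := Real.sq_sqrt h'
    have e3 : (Real.sqrt (-(2 * Real.pi * τ)) : ℂ) ^ 2 = -(2 * Real.pi * τ) := by exact_mod_cast e2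
    simp only [e] at *
    rw [Complex.ofReal_zero, zero_sub, neg_sq, mul_pow, Complex.I_sq]
    linear_combination -e3

/-- Both sides have the same square. With the opposite sign the real part of `csqrt` would be
nonpositive, which is impossible for a principal root on the slit plane. -/
lemma csqrt_mul_rotC {τ : ℝ} (hτ : τ ≠ 0) :
    csqrt (2 * Real.pi * τ * Complex.I) * rotC = kap τ := by
  have hs : (2 * Real.pi * τ * Complex.I : ℂ) ∈ Complex.slitPlane := by
    rw [Complex.mem_slitPlane_iff]
    right
    simp [hτ, Real.pi_ne_zero]
  have h0 := Complex.slitPlane_ne_zero hs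
  have hre := csqrt_re_pos hs
  have hsq : (csqrt (2 * Real.pi * τ * Complex.I) * rotC) ^ 2 = kap τ ^ 2 := by
    rw [mul_pow, csqrt_sq h0, rotC_sq, kap_sq]
    linear_combination (-(2 * Real.pi * τ) : ℂ) * Complex.I_sq
  rcases sq_eq_sq_iff_eq_or_eq_neg.1 hsq with h | h
  · exact h
  · exfalso
    set q := csqrt (2 * Real.pi * τ * Complex.I)
    have h2 : q = -(kap τ * (((Real.sqrt 2)⁻¹ : ℝ) * (1 + Complex.I))) := by
      rw [← neg_mul, ← h, mul_assoc, rotC]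
      have : ((((Real.sqrt 2)⁻¹ : ℝ) : ℂ) * (1 - Complex.I)) *
          (((Real.sqrt 2)⁻¹ : ℝ) * (1 + Complex.I)) = 1 := by
        have e : (((Real.sqrt 2)⁻¹ : ℝ) : ℂ) ^ 2 = 1 / 2 := by
          rw [← Complex.ofReal_pow, inv_pow, Real.sq_sqrt (by norm_num)]; norm_num
        linear_combination (1 - Complex.I ^ 2) * e - (1 / 2 : ℂ) * Complex.I_sq
      rw [this, mul_one]
    have h3 : q.re = -((Real.sqrt 2)⁻¹ *
        (Real.sqrt (2 * Real.pi * τ) + Real.sqrt (-(2 * Real.pi * τ)))) := by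
      rw [h2, kap]
      generalize (Real.sqrt 2)⁻¹ = c
      simp
      ring
    rw [h3] at hre
    have : 0 ≤ (Real.sqrt 2)⁻¹ *
        (Real.sqrt (2 * Real.pi * τ) + Real.sqrt (-(2 * Real.pi * τ))) := by positivity
    linarith

lemma integrable_mul_forcing {g : 𝓢(ℝ, ℂ)} (hg : IsTestHalfLine g) (Ψ : 𝓢(ℝ × ℝ, ℂ)) :
    Integrable fun z : ℝ × ℝ => Ψ z * forcing g z.1 z.2 := by
  obtain ⟨C, hC⟩ := exists_forcing_bound hg
  have hi : Integrable fun z : ℝ × ℝ => C * (‖z‖ ^ 1 * ‖Ψ z‖) :=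
    (Ψ.integrable_pow_mul volume 1).const_mul C
  have hC0 : 0 ≤ C := by simpa using (norm_nonneg _).trans (hC 0 1)
  refine hi.mono' (Ψ.continuous.aestronglyMeasurable.mul
    (stronglyMeasurable_forcing hg).aestronglyMeasurable) (ae_of_all _ fun z => ?_)
  rw [norm_mul, pow_one]
  calc ‖Ψ z‖ * ‖forcing g z.1 z.2‖ ≤ ‖Ψ z‖ * (C * ‖z‖) := by
        gcongr
        refine (hC z.1 z.2).trans ?_
        gcongr
        exact norm_snd_le z
    _ = _ := by ring

/-- The forcing itself may grow linearly. Damped by `e^{-εt}` it is integrable, and its Fourier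
transform at `τ` is its Laplace transform at `ε + 2πiτ`. -/
lemma integral_test_mul_damped {g : 𝓢(ℝ, ℂ)} (hg : IsTestHalfLine g) (x : ℝ) (ψ : 𝓢(ℝ, ℂ))
    {ε : ℝ} (hε : 0 < ε) :
    ∫ t, ψ t * (forcing g x t * Complex.exp (-(ε : ℂ) * t)) =
      ∫ τ, (𝓕⁻ ψ : 𝓢(ℝ, ℂ)) τ *
        (Complex.exp (-(csqrt (ε + 2 * Real.pi * τ * Complex.I) * rotC) * (|x| : ℝ)) *
          ∫ t, g t * Complex.exp (-(ε + 2 * Real.pi * τ * Complex.I) * t)) := by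
  have hF := integrable_forcing_mul_exp hg x (p := ε) (by simpa using hε)
  have h1 := integral_fourier_mul_eq (𝓕⁻ ψ : 𝓢(ℝ, ℂ)).integrable hF
  rw [← SchwartzMap.fourier_coe, fourier_fourierInv_eq] at h1
  rw [h1]
  congr 1; ext τ
  congr 1
  have hre : 0 < ((ε : ℂ) + 2 * Real.pi * τ * Complex.I).re := by simpa using hε
  have hs : (ε : ℂ) + 2 * Real.pi * τ * Complex.I ∈ Complex.slitPlane :=
    Complex.mem_slitPlane_iff.2 (Or.inl hre)
  have hsq := csqrt_sq (Complex.slitPlane_ne_zero hs)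
  have h2 := laplace_forcing hg x (csqrt_re_pos hs) (by rw [hsq]; exact hre)
  rw [hsq] at h2
  rw [← h2, Real.fourier_real_eq_integral_exp_smul]
  congr 1; ext t
  rw [smul_eq_mul, mul_left_comm, ← Complex.exp_add]
  congr 2
  push_cast
  ring

lemma ofData_traceData_schwartz (σ x : ℝ) (g ψ : 𝓢(ℝ, ℂ)) :
    ofData σ (traceData x (schwartzData σ g)) ψ =
      ∫ τ, (𝓕⁻ ψ : 𝓢(ℝ, ℂ)) τ * (symb x τ * (𝓕 g : 𝓢(ℝ, ℂ)) τ) := by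
  rw [ofData_traceData_apply]
  apply integral_congr_ae
  filter_upwards [schwartzData_coe σ g] with τ hτ
  rw [hτ]
  have h2 : ((jw (-σ) τ : ℂ)) * (jw σ τ : ℂ) = 1 := by exact_mod_cast jw_neg_mul σ τ
  linear_combination (𝓕⁻ ψ : 𝓢(ℝ, ℂ)) τ * symb x τ * (𝓕 g : 𝓢(ℝ, ℂ)) τ * h2

lemma norm_exp_damped_le {ε t : ℝ} (hε : 0 ≤ ε) (ht : 0 ≤ t) (τ : ℝ) :
    ‖Complex.exp (-((ε : ℂ) + 2 * Real.pi * τ * Complex.I) * t)‖ ≤ 1 := by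
  rw [Complex.norm_exp, Real.exp_le_one_iff]
  simp
  positivity

lemma tendsto_integral_damped {g : 𝓢(ℝ, ℂ)} (hg : IsTestHalfLine g) (x : ℝ) (ψ : 𝓢(ℝ, ℂ)) :
    Tendsto (fun ε : ℝ => ∫ t, ψ t * (forcing g x t * Complex.exp (-(ε : ℂ) * t)))
    (𝓝[>] 0) (𝓝 (∫ t, ψ t * forcing g x t)) := by
  obtain ⟨C, hC⟩ := exists_forcing_bound hg
  have hC0 : 0 ≤ C := by simpa using (norm_nonneg _).trans (hC 0 1)
  have hmeas : StronglyMeasurable fun t => forcing g x t :=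
    (stronglyMeasurable_forcing hg).comp_measurable (g := fun t : ℝ => (x, t)) (by fun_prop)
  refine tendsto_integral_filter_of_dominated_convergence
    (fun t => C * (‖t‖ ^ 1 * ‖ψ t‖)) ?_ ?_ ((ψ.integrable_pow_mul volume 1).const_mul C) ?_
  · refine Eventually.of_forall fun ε => ?_
    exact ψ.continuous.aestronglyMeasurable.mul (hmeas.aestronglyMeasurable.mul
      (Continuous.aestronglyMeasurable (by fun_prop)))
  · filter_upwards [self_mem_nhdsWithin] with ε hε
    refine ae_of_all _ fun t => ?_
    rcases lt_or_ge t 0 with ht | ht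
    · rw [forcing_zero_of_neg hg x ht]
      simp
      positivity
    · have h1 : ‖Complex.exp (-(ε : ℂ) * t)‖ ≤ 1 := by
        have := norm_exp_damped_le (le_of_lt hε) ht 0
        simpa using this
      rw [norm_mul, norm_mul]
      calc _ ≤ ‖ψ t‖ * ((C * |t|) * 1) := by gcongr; exact hC x t
        _ = _ := by rw [Real.norm_eq_abs]; ring
  · refine ae_of_all _ fun t => ?_
    have : Continuous fun ε : ℝ => ψ t * (forcing g x t * Complex.exp (-(ε : ℂ) * t)) := by
      fun_prop
    have h := this.tendsto 0
    simp only [Complex.ofReal_zero, neg_zero, zero_mul, Complex.exp_zero, mul_one] at h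
    exact h.mono_left nhdsWithin_le_nhds

/-- Boundary values of the Laplace transform. On `Re p > 0` the exponential is at most one and the
transform of `g` is at most `∫ ‖g‖`, since `g` lives on `[0, ∞)`; a single majorant then serves all
`ε`. -/
lemma tendsto_integral_damped_symb {g : 𝓢(ℝ, ℂ)} (hg : IsTestHalfLine g) (x : ℝ) (ψ : 𝓢(ℝ, ℂ)) :
    Tendsto (fun ε : ℝ => ∫ τ, (𝓕⁻ ψ : 𝓢(ℝ, ℂ)) τ *
      (Complex.exp (-(csqrt (ε + 2 * Real.pi * τ * Complex.I) * rotC) * (|x| : ℝ)) *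
        ∫ t, g t * Complex.exp (-(ε + 2 * Real.pi * τ * Complex.I) * t)))
    (𝓝[>] 0) (𝓝 (∫ τ, (𝓕⁻ ψ : 𝓢(ℝ, ℂ)) τ * (symb x τ * (𝓕 g : 𝓢(ℝ, ℂ)) τ))) := by
  refine tendsto_integral_filter_of_dominated_convergence
    (fun τ => ‖(𝓕⁻ ψ : 𝓢(ℝ, ℂ)) τ‖ * ∫ t, ‖g t‖) ?_ ?_
      ((𝓕⁻ ψ : 𝓢(ℝ, ℂ)).integrable.norm.mul_const _) ?_
  · refine Eventually.of_forall fun ε => ?_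
    refine (𝓕⁻ ψ : 𝓢(ℝ, ℂ)).continuous.aestronglyMeasurable.mul ?_
    refine AEStronglyMeasurable.mul ?_ ?_
    · unfold csqrt
      exact Measurable.aestronglyMeasurable (by fun_prop)
    · refine StronglyMeasurable.aestronglyMeasurable ?_
      refine StronglyMeasurable.integral_prod_right (f := fun (τ t : ℝ) => g t *
        Complex.exp (-(ε + 2 * Real.pi * τ * Complex.I) * t)) ?_
      refine Continuous.stronglyMeasurable ?_
      have := g.continuous
      change Continuous fun z : ℝ × ℝ => g z.2 *
        Complex.exp (-(ε + 2 * Real.pi * z.1 * Complex.I) * z.2)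
      fun_prop
  · filter_upwards [self_mem_nhdsWithin] with ε hε
    refine ae_of_all _ fun τ => ?_
    have hε' : 0 < ε := hε
    have hre : 0 < ((ε : ℂ) + 2 * Real.pi * τ * Complex.I).re := by simpa using hε'
    have hs : (ε : ℂ) + 2 * Real.pi * τ * Complex.I ∈ Complex.slitPlane :=
      Complex.mem_slitPlane_iff.2 (Or.inl hre)
    have hsq := csqrt_sq (Complex.slitPlane_ne_zero hs)
    have hp := re_mul_pos_of_sq (csqrt_re_pos hs) (by rw [hsq]; exact hre) rotC_re
      (by rw [rotC_sq]; simp)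
    rw [norm_mul, norm_mul, norm_exp_abs]
    have h1 : Real.exp (-(csqrt (ε + 2 * Real.pi * τ * Complex.I) * rotC).re * |x|) ≤ 1 := by
      rw [Real.exp_le_one_iff, neg_mul, neg_nonpos]
      positivity
    have h2 : ‖∫ t, g t * Complex.exp (-(ε + 2 * Real.pi * τ * Complex.I) * t)‖ ≤
        ∫ t, ‖g t‖ := by
      refine norm_integral_le_of_norm_le g.integrable.norm (ae_of_all _ fun t => ?_)
      rcases lt_or_ge t 0 with ht | ht
      · rw [test_zero_of_neg hg ht]; simp
      · rw [norm_mul]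
        exact mul_le_of_le_one_right (norm_nonneg _) (norm_exp_damped_le hε'.le ht τ)
    calc _ ≤ ‖(𝓕⁻ ψ : 𝓢(ℝ, ℂ)) τ‖ * (1 * ∫ t, ‖g t‖) := by gcongr
      _ = _ := by rw [one_mul]
  -- The point `τ = 0` is excluded because the limit `0` of `p` is not in the slit plane.
  · have h0 : ∀ᵐ τ : ℝ, τ ≠ 0 := by
      rw [ae_iff]; simp
    filter_upwards [h0] with τ hτ
    refine Tendsto.const_mul _ (Tendsto.mul ?_ ?_)
    · have hs : (2 * Real.pi * τ * Complex.I : ℂ) ∈ Complex.slitPlane := by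
        rw [Complex.mem_slitPlane_iff]
        right
        simp [hτ, Real.pi_ne_zero]
      have hc : ContinuousAt (fun ε : ℝ => csqrt (ε + 2 * Real.pi * τ * Complex.I)) 0 := by
        refine ContinuousAt.comp (g := csqrt) (f := fun ε : ℝ => (ε : ℂ) + 2 * Real.pi * τ * Complex.I) ?_ (by fun_prop)
        simpa using continuousAt_csqrt hs
      have h := (((hc.mul_const rotC).neg.mul_const ((|x| : ℝ) : ℂ)).cexp).tendsto
      simp only [Pi.neg_apply, Complex.ofReal_zero, zero_add, csqrt_mul_rotC hτ] at h
      have e : symb x τ = Complex.exp (-kap τ * (|x| : ℝ)) := by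
        rw [symb]; congr 1; ring
      rw [e]
      exact h.mono_left nhdsWithin_le_nhds
    · have e : (𝓕 g : 𝓢(ℝ, ℂ)) τ =
          ∫ t, g t * Complex.exp (-(2 * Real.pi * τ * Complex.I) * t) := by
        rw [SchwartzMap.fourier_coe, Real.fourier_real_eq_integral_exp_smul]
        congr 1; ext t
        rw [smul_eq_mul, mul_comm]
        congr 2
        push_cast
        ring
      rw [e]
      refine tendsto_integral_filter_of_dominated_convergence (fun t => ‖g t‖) ?_ ?_
        g.integrable.norm ?_
      · refine Eventually.of_forall fun ε => ?_
        have := g.continuous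
        exact Continuous.aestronglyMeasurable (by fun_prop)
      · filter_upwards [self_mem_nhdsWithin] with ε hε
        refine ae_of_all _ fun t => ?_
        rcases lt_or_ge t 0 with ht | ht
        · rw [test_zero_of_neg hg ht]; simp
        · rw [norm_mul]
          exact mul_le_of_le_one_right (norm_nonneg _) (norm_exp_damped_le (le_of_lt hε) ht τ)
      · refine ae_of_all _ fun t => ?_
        have : Continuous fun ε : ℝ =>
            g t * Complex.exp (-(ε + 2 * Real.pi * τ * Complex.I) * t) := by fun_prop
        have h := this.tendsto 0
        simp only [Complex.ofReal_zero, zero_add] at h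
        exact h.mono_left nhdsWithin_le_nhds

/-- The bridge between the classical formula and the multiplier `symb`: the `ε → 0` limits of the
two sides of the damped identity. -/
lemma integral_test_mul_forcing (σ : ℝ) {g : 𝓢(ℝ, ℂ)} (hg : IsTestHalfLine g) (x : ℝ)
    (ψ : 𝓢(ℝ, ℂ)) :
    ∫ t, ψ t * forcing g x t = ofData σ (traceData x (schwartzData σ g)) ψ := by
  rw [ofData_traceData_schwartz]
  refine tendsto_nhds_unique (tendsto_integral_damped hg x ψ)
    ((tendsto_integral_damped_symb hg x ψ).congr' ?_)
  filter_upwards [self_mem_nhdsWithin] with ε hε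
  exact (integral_test_mul_damped hg x ψ hε).symm

lemma integral_mul_forcing (σ : ℝ) {g : 𝓢(ℝ, ℂ)} (hg : IsTestHalfLine g) (Ψ : 𝓢(ℝ × ℝ, ℂ)) :
    ∫ z : ℝ × ℝ, Ψ z * forcing g z.1 z.2 = forcingDist σ (schwartzData σ g) Ψ := by
  have hi := integrable_mul_forcing hg Ψ
  rw [Measure.volume_eq_prod] at hi ⊢
  rw [integral_prod _ hi, forcingDist_apply]
  congr 1; ext x
  rw [← integral_test_mul_forcing σ hg]
  rfl

lemma tendsto_data {σ : ℝ} {g : ℕ → 𝓢(ℝ, ℂ)} {Φ : Lp ℂ 2 (volume : Measure ℝ)}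
    (h : Tendsto (fun n => hENorm σ ((g n : 𝓢'(ℝ, ℂ)) - ofData σ Φ)) atTop (𝓝 0)) :
    Tendsto (fun n => schwartzData σ (g n)) atTop (𝓝 Φ) := by
  rw [tendsto_iff_edist_tendsto_0]
  refine h.congr fun n => ?_
  rw [← ofData_schwartzData σ, ← map_sub, hENorm_ofData, edist_eq_enorm_sub]

lemma isForcing_forcingDist (σ : ℝ) (Φ : Lp ℂ 2 (volume : Measure ℝ)) :
    IsForcing σ (ofData σ Φ) (forcingDist σ Φ) := by
  intro g hg hc Ψ
  refine ⟨fun n => integrable_mul_forcing (hg n) Ψ, ?_⟩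
  simp only [fun n => integral_mul_forcing σ (hg n) Ψ]
  exact tendsto_forcingDist (tendsto_data hc) Ψ

/-! ### Density of test functions in `H_0^σ` -/

open scoped Manifold in
-- The support only provides vanishing near each point. A partition of unity on the compact support
-- of `ψ` glues the local statements.
lemma apply_eq_zero_of_tsupport_neg {f : 𝓢'(ℝ, ℂ)} (hf : Distribution.dsupport f ⊆ Ici 0)
    {ψ : 𝓢(ℝ, ℂ)} (hc : HasCompactSupport ψ) (hs : tsupport ψ ⊆ Iio 0) : f ψ = 0 := by
  have hex : ∀ x : Iio (0 : ℝ), ∃ s : Set ℝ, Distribution.IsVanishingOn f s ∧ IsOpen s ∧ (x : ℝ) ∈ s := by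
    intro x
    refine (Distribution.notMem_dsupport_iff (x : ℝ)).1 fun h => ?_
    exact absurd (mem_Ici.1 (hf h)) (not_le.2 x.2)
  choose S hS1 hS2 hS3 using hex
  obtain ⟨ρ, hρ⟩ := SmoothPartitionOfUnity.exists_isSubordinate 𝓘(ℝ, ℝ) (isClosed_tsupport ψ) S
    hS2 (fun x hx => mem_iUnion.2 ⟨⟨x, hs hx⟩, hS3 _⟩)
  have hfin := ρ.locallyFinite.finite_nonempty_inter_compact hc
  have hsm : ∀ i, ContDiff ℝ ∞ fun x => (ρ i x : ℂ) * ψ x := fun i =>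
    (Complex.ofRealCLM.contDiff.comp (ρ i).contMDiff.contDiff).mul (ψ.smooth ⊤)
  let P : Iio (0 : ℝ) → 𝓢(ℝ, ℂ) := fun i =>
    HasCompactSupport.toSchwartzMap (f := fun x => (ρ i x : ℂ) * ψ x) hc.mul_left (hsm i)
  have hP : ∀ i x, P i x = (ρ i x : ℂ) * ψ x := fun i x => rfl
  have h0 : ∀ i, f (P i) = 0 := by
    intro i
    refine hS1 i (P i) (Subset.trans ?_ (hρ i))
    refine closure_mono fun x hx => ?_
    rw [Function.mem_support, hP] at hx
    exact Function.mem_support.2 fun h => hx (by rw [h]; simp)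
  have hsum : ψ = ∑ i ∈ hfin.toFinset, P i := by
    ext x
    rw [sum_apply]
    simp only [hP]
    rw [← Finset.sum_mul]
    by_cases hx : ψ x = 0
    · simp [hx]
    have hxs : x ∈ tsupport ψ := subset_tsupport _ (Function.mem_support.2 hx)
    have h1 := ρ.sum_eq_one hxs
    rw [finsum_eq_sum_of_support_subset _ (s := hfin.toFinset)] at h1
    · rw [← Complex.ofReal_sum, h1]; simp
    · intro i hi
      simp only [Finite.coe_toFinset, mem_ofPred_eq]
      exact ⟨x, hi, hxs⟩
  rw [hsum, map_sum]
  exact Finset.sum_eq_zero fun i _ => h0 i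

lemma integral_mul_eq_inner (q g : Lp ℂ 2 (volume : Measure ℝ)) :
    ∫ x, q x * g x = inner ℂ (star g) q := by
  rw [L2.inner_def]
  apply integral_congr_ae
  filter_upwards [Lp.coeFn_star g] with x hx
  rw [hx, RCLike.inner_apply]
  simp

/-- Plancherel, in bilinear form. -/
lemma integral_fourier_mul_fourierInv (q g : Lp ℂ 2 (volume : Measure ℝ)) :
    ∫ x, (𝓕 q : Lp ℂ 2 (volume : Measure ℝ)) x * (𝓕⁻ g : Lp ℂ 2 (volume : Measure ℝ)) x =
      ∫ x, q x * g x := by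
  simp only [integral_mul_eq_inner]
  refine DenseRange.induction_on (SchwartzMap.denseRange_toLpCLM (E := ℝ) (F := ℂ)
    (μ := (volume : Measure ℝ)) (p := 2) (by norm_num)) q (isClosed_eq ?_ ?_) fun ψ => ?_
  · have : Continuous fun q : Lp ℂ 2 (volume : Measure ℝ) => 𝓕 q :=
      (Lp.fourierTransformₗᵢ ℝ ℂ).continuous
    fun_prop
  · fun_prop
  · rw [SchwartzMap.toLpCLM_apply, SchwartzMap.toLp_fourier_eq, ← integral_mul_eq_inner,
      ← integral_mul_eq_inner]
    have h1 : ((𝓕⁻ g : Lp ℂ 2 (volume : Measure ℝ)) : 𝓢'(ℝ, ℂ)) (𝓕 ψ) = (g : 𝓢'(ℝ, ℂ)) ψ := by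
      rw [← Lp.fourierInv_toTemperedDistribution_eq, TemperedDistribution.fourierInv_apply,
        fourierInv_fourier_eq]
    rw [Lp.toTemperedDistribution_apply, Lp.toTemperedDistribution_apply] at h1
    have e1 : ∫ x, (𝓕 ψ).toLp 2 volume x * (𝓕⁻ g : Lp ℂ 2 (volume : Measure ℝ)) x =
        ∫ x, (𝓕 ψ) x • (𝓕⁻ g : Lp ℂ 2 (volume : Measure ℝ)) x := by
      apply integral_congr_ae
      filter_upwards [(𝓕 ψ).coeFn_toLp 2 volume] with x hx
      rw [hx, smul_eq_mul]
    have e2 : ∫ x, ψ.toLp 2 volume x * g x = ∫ x, ψ x • g x := by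
      apply integral_congr_ae
      filter_upwards [ψ.coeFn_toLp 2 volume] with x hx
      rw [hx, smul_eq_mul]
    rw [e1, e2, h1]

lemma integrable_schwartz_mul (N : 𝓢(ℝ, ℂ)) (Φ : Lp ℂ 2 (volume : Measure ℝ)) :
    Integrable fun τ => N τ * Φ τ :=
  (N.memLp 2 volume).integrable_mul (Lp.memLp Φ)

lemma exists_schwartz_bound (N : 𝓢(ℝ, ℂ)) : ∃ C, ∀ τ, ‖N τ‖ ≤ C :=
  ⟨SchwartzMap.seminorm ℝ 0 0 N, fun τ => by simpa using SchwartzMap.norm_le_seminorm ℝ N τ⟩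

lemma memLp_schwartz_mul (N : 𝓢(ℝ, ℂ)) (Φ : Lp ℂ 2 (volume : Measure ℝ)) :
    MemLp (fun τ => N τ * Φ τ) 2 := by
  obtain ⟨C, hC⟩ := exists_schwartz_bound N
  exact memLp_mul_of_bound N.continuous.measurable hC (Lp.memLp Φ)

/-- Functions in `L¹ ∩ L²` are orthogonal if `𝓕 Q` lives on `(-∞, 0)` and `𝓕⁻ G` on `[0, ∞)`. -/
lemma integral_mul_eq_zero_of_fourier {Q G : ℝ → ℂ} (hQ1 : Integrable Q) (hQ2 : MemLp Q 2)
    (hG1 : Integrable G) (hG2 : MemLp G 2) (hQ : ∀ y, 0 ≤ y → (𝓕 Q : ℝ → ℂ) y = 0)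
    (hG : ∀ y < 0, (𝓕⁻ G : ℝ → ℂ) y = 0) : ∫ τ, Q τ * G τ = 0 := by
  have h := integral_fourier_mul_fourierInv (hQ2.toLp Q) (hG2.toLp G)
  have e : ∫ τ, Q τ * G τ = ∫ τ, hQ2.toLp Q τ * hG2.toLp G τ := by
    apply integral_congr_ae
    filter_upwards [hQ2.coeFn_toLp, hG2.coeFn_toLp] with τ h1 h2
    rw [h1, h2]
  rw [e, ← h]
  refine integral_eq_zero_of_ae ?_
  filter_upwards [lp_fourier_ae_eq hQ1 hQ2, lp_fourierInv_ae_eq hG1 hG2] with y h1 h2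
  rw [h1, h2]
  rcases lt_or_ge y 0 with hy | hy
  · rw [hG y hy, mul_zero]; rfl
  · rw [hQ y hy, zero_mul]; rfl

/-- The data of Schwartz functions, as a continuous linear map. -/
def schwartzDataCLM (σ : ℝ) : 𝓢(ℝ, ℂ) →L[ℂ] Lp ℂ 2 (volume : Measure ℝ) :=
  SchwartzMap.toLpCLM ℂ ℂ 2 volume ∘L SchwartzMap.smulLeftCLM ℂ (fun k => (jw σ k : ℂ)) ∘L
    fourierCLM ℂ 𝓢(ℝ, ℂ)

/-- The space `C_{0,c}^∞(ℝ⁺)`. -/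
def testSubmodule : Submodule ℂ 𝓢(ℝ, ℂ) where
  carrier := {g | IsTestHalfLine g}
  zero_mem' := by
    have e : ((0 : 𝓢(ℝ, ℂ)) : ℝ → ℂ) = fun _ => 0 := rfl
    refine ⟨?_, ?_⟩
    · rw [e]; exact HasCompactSupport.zero
    · rw [e, show (fun _ : ℝ => (0 : ℂ)) = 0 from rfl, tsupport_zero]
      exact empty_subset _
  add_mem' := by
    rintro g g' ⟨h1, h2⟩ ⟨h1', h2'⟩
    refine ⟨h1.add h1', ?_⟩
    exact (tsupport_add (f := g) (g := g')).trans (union_subset h2 h2')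
  smul_mem' := by
    rintro c g ⟨h1, h2⟩
    refine ⟨h1.smul_left (f := fun _ => c), ?_⟩
    exact (tsupport_smul_subset_right (fun _ => c) g).trans h2

lemma fourier_translate (R : 𝓢(ℝ, ℂ)) (y τ : ℝ) :
    (𝓕 (R.compSubConstCLM ℂ y) : 𝓢(ℝ, ℂ)) τ =
      Complex.exp (((-2 * Real.pi * y * τ : ℝ) : ℂ) * Complex.I) * (𝓕 R : 𝓢(ℝ, ℂ)) τ := by
  rw [SchwartzMap.fourier_coe, SchwartzMap.fourier_coe, Real.fourier_real_eq_integral_exp_smul,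
    Real.fourier_real_eq_integral_exp_smul, ← integral_const_mul,
    ← integral_sub_right_eq_self (fun t => Complex.exp (((-2 * Real.pi * y * τ : ℝ) : ℂ) *
      Complex.I) * Complex.exp (((-2 * Real.pi * t * τ : ℝ) : ℂ) * Complex.I) • R t) y]
  congr 1; ext t
  rw [SchwartzMap.compSubConstCLM_apply, smul_eq_mul, smul_eq_mul, ← mul_assoc, ← Complex.exp_add]
  congr 2
  push_cast
  ring

lemma exists_reflected (R : 𝓢(ℝ, ℂ)) (hR : IsTestHalfLine R) {y : ℝ} (hy : y < 0) :
    ∃ ψ : 𝓢(ℝ, ℂ), HasCompactSupport ψ ∧ tsupport ψ ⊆ Iio 0 ∧ ∀ τ, (𝓕⁻ ψ : 𝓢(ℝ, ℂ)) τ =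
      Complex.exp (((2 * Real.pi * y * τ : ℝ) : ℂ) * Complex.I) * (𝓕 R : 𝓢(ℝ, ℂ)) τ := by
  have hc : HasCompactSupport fun t => R (y - t) :=
    hR.1.comp_homeomorph (Homeomorph.subLeft y)
  have hsm : ContDiff ℝ ∞ fun t => R (y - t) := (R.smooth ⊤).comp (by fun_prop)
  refine ⟨hc.toSchwartzMap hsm, hc, ?_, fun τ => ?_⟩
  · have h1 : Function.support (fun t => R (y - t)) ⊆ Iic y := by
      intro t ht
      by_contra h
      exact ht (test_zero_of_neg hR (by simpa using h))
    exact (closure_minimal h1 isClosed_Iic).trans (fun t ht => lt_of_le_of_lt ht hy)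
  · rw [SchwartzMap.fourierInv_coe, SchwartzMap.fourier_coe, Real.fourierInv_eq_fourier_neg,
      Real.fourier_real_eq_integral_exp_smul,
      Real.fourier_real_eq_integral_exp_smul, ← integral_const_mul,
      ← integral_sub_left_eq_self _ volume y]
    congr 1; ext t
    rw [HasCompactSupport.toSchwartzMap_toFun, sub_sub_cancel, smul_eq_mul, smul_eq_mul,
      ← mul_assoc, ← Complex.exp_add]
    congr 2
    push_cast
    ring

/-- The mollifier appears squared so that one factor `𝓕 R` can be given to `W` and the other to `Φ`.
The two products are in `L¹ ∩ L²`, and their transforms live on complementary half-lines, so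
Plancherel gives zero. The weights `jw σ` and `jw (-σ)` cancel in the product. -/
lemma integral_mul_mollified_eq_zero {σ : ℝ} {Φ W : Lp ℂ 2 (volume : Measure ℝ)}
    (hΦ : Distribution.dsupport (ofData σ Φ) ⊆ Ici 0)
    (hW : ∀ g : 𝓢(ℝ, ℂ), IsTestHalfLine g → ∫ τ, W τ * schwartzData σ g τ = 0)
    {R : 𝓢(ℝ, ℂ)} (hR : IsTestHalfLine R) :
    ∫ τ, (W τ * Φ τ) * ((𝓕 R : 𝓢(ℝ, ℂ)) τ) ^ 2 = 0 := by
  let N (a : ℝ) : 𝓢(ℝ, ℂ) := SchwartzMap.smulLeftCLM ℂ (fun k => (jw a k : ℂ)) (𝓕 R)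
  have hN : ∀ a τ, N a τ = (jw a τ : ℂ) * (𝓕 R : 𝓢(ℝ, ℂ)) τ := fun a τ => by
    simp only [N]
    rw [SchwartzMap.smulLeftCLM_apply_apply (jwC_hasTemperateGrowth a), smul_eq_mul]
  have h := integral_mul_eq_zero_of_fourier (integrable_schwartz_mul (N σ) W)
    (memLp_schwartz_mul (N σ) W) (integrable_schwartz_mul (N (-σ)) Φ)
    (memLp_schwartz_mul (N (-σ)) Φ) ?_ ?_
  · rw [← h]
    congr 1; ext τ
    rw [hN, hN]
    have h2 : ((jw (-σ) τ : ℂ)) * (jw σ τ : ℂ) = 1 := by exact_mod_cast jw_neg_mul σ τ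
    linear_combination -(W τ * Φ τ * ((𝓕 R : 𝓢(ℝ, ℂ)) τ) ^ 2) * h2
  -- The value at `y ≥ 0` is the pairing of `W` with the data of `R` translated to the right, again
  -- a test function.
  · intro y hy
    have ht : IsTestHalfLine (R.compSubConstCLM ℂ y) := by
      have e : ((R.compSubConstCLM ℂ y : 𝓢(ℝ, ℂ)) : ℝ → ℂ) = fun t => R (t - y) := rfl
      refine ⟨?_, ?_⟩
      · rw [e]; exact hR.1.comp_homeomorph (Homeomorph.subRight y)
      · rw [e]
        refine closure_minimal (fun t ht => ?_) isClosed_Ici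
        by_contra h'
        exact ht (test_zero_of_neg hR (by
          have : t < 0 := by simpa using h'
          linarith))
    rw [← hW _ ht, Real.fourier_real_eq_integral_exp_smul]
    apply integral_congr_ae
    filter_upwards [schwartzData_coe σ (R.compSubConstCLM ℂ y)] with τ hτ
    rw [hτ, fourier_translate, hN, smul_eq_mul]
    have : ((-2 * Real.pi * τ * y : ℝ) : ℂ) = ((-2 * Real.pi * y * τ : ℝ) : ℂ) := by
      push_cast; ring
    rw [this]
    ring
  -- The value at `y < 0` is the pairing of the distribution with the reflection `t ↦ R(y - t)`,
  -- supported in `(-∞, y]`.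
  · intro y hy
    obtain ⟨ψ, h1, h2, h3⟩ := exists_reflected R hR hy
    rw [← apply_eq_zero_of_tsupport_neg hΦ h1 h2, ofData_apply, Real.fourierInv_eq_fourier_neg,
      Real.fourier_real_eq_integral_exp_smul]
    congr 1; ext τ
    rw [h3, hN, smul_eq_mul]
    have : ((-2 * Real.pi * τ * -y : ℝ) : ℂ) = ((2 * Real.pi * y * τ : ℝ) : ℂ) := by
      push_cast; ring
    rw [this]
    ring

lemma exists_mollifier : ∃ R : ℕ → 𝓢(ℝ, ℂ), (∀ n, IsTestHalfLine (R n)) ∧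
    (∀ n τ, ‖(𝓕 (R n) : 𝓢(ℝ, ℂ)) τ‖ ≤ 1) ∧
    ∀ τ, Tendsto (fun n => (𝓕 (R n) : 𝓢(ℝ, ℂ)) τ) atTop (𝓝 1) := by
  let c : ℕ → ℝ := fun n => 1 / (n + 1)
  have hc : ∀ n, 0 < c n := fun n => by positivity
  -- Centre and outer radius coincide, so the bump is supported in `[0, 2 c n]`: an approximate
  -- identity from the right.
  let b (n : ℕ) : ContDiffBump (c n) := ⟨c n / 2, c n, by have := hc n; linarith,
    by have := hc n; linarith⟩
  let ρ (n : ℕ) : ℝ → ℝ := (b n).normed volume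
  have hρ0 : ∀ n t, 0 ≤ ρ n t := fun n t => (b n).nonneg_normed t
  have hρ1 : ∀ n, ∫ t, ρ n t = 1 := fun n => (b n).integral_normed
  have hρi : ∀ n, Integrable (ρ n) := fun n => (b n).integrable_normed
  have hρs : ∀ n t, ρ n t ≠ 0 → t ∈ Ioo 0 (2 * c n) := fun n t ht => by
    have : t ∈ Function.support (ρ n) := ht
    rw [show Function.support (ρ n) = _ from (b n).support_normed_eq, Real.ball_eq_Ioo] at this
    exact ⟨by have := this.1; simp only [b] at this; linarith,
      by have := this.2; simp only [b] at this; linarith⟩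
  have hcs : ∀ n, HasCompactSupport fun t => (ρ n t : ℂ) := fun n =>
    (b n).hasCompactSupport_normed.comp_left (g := fun r : ℝ => (r : ℂ)) Complex.ofReal_zero
  have hsm : ∀ n, ContDiff ℝ ∞ fun t => (ρ n t : ℂ) := fun n =>
    Complex.ofRealCLM.contDiff.comp (b n).contDiff_normed
  have hF : ∀ n τ, (𝓕 ((hcs n).toSchwartzMap (hsm n)) : 𝓢(ℝ, ℂ)) τ =
      ∫ t, Complex.exp (((-2 * Real.pi * t * τ : ℝ) : ℂ) * Complex.I) * (ρ n t : ℂ) := by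
    intro n τ
    rw [SchwartzMap.fourier_coe, Real.fourier_real_eq_integral_exp_smul]
    rfl
  refine ⟨fun n => (hcs n).toSchwartzMap (hsm n), fun n => ⟨hcs n, ?_⟩, fun n τ => ?_, fun τ => ?_⟩
  · refine closure_minimal (fun t ht => ?_) isClosed_Ici
    have : (ρ n t : ℂ) ≠ 0 := ht
    exact (hρs n t (by exact_mod_cast this)).1.le
  · rw [hF, ← hρ1 n]
    refine norm_integral_le_of_norm_le (hρi n) (ae_of_all _ fun t => ?_)
    rw [norm_mul, Complex.norm_exp_ofReal_mul_I, one_mul, Complex.norm_real,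
      Real.norm_of_nonneg (hρ0 n t)]
  · rw [tendsto_iff_norm_sub_tendsto_zero]
    have hb : ∀ n, ‖(𝓕 ((hcs n).toSchwartzMap (hsm n)) : 𝓢(ℝ, ℂ)) τ - 1‖ ≤
        2 * Real.pi * |τ| * (2 * c n) := by
      intro n
      have e1 : (1 : ℂ) = ∫ t, (ρ n t : ℂ) := by
        have h := integral_ofReal (𝕜 := ℂ) (μ := volume) (f := ρ n)
        rw [hρ1] at h
        simpa using h.symm
      have i1 : Integrable fun t => (ρ n t : ℂ) := (hρi n).ofReal
      have i2 : Integrable fun t =>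
          Complex.exp (((-2 * Real.pi * t * τ : ℝ) : ℂ) * Complex.I) * (ρ n t : ℂ) :=
        i1.bdd_mul (c := 1) (Continuous.aestronglyMeasurable (by fun_prop))
          (ae_of_all _ fun t => by rw [Complex.norm_exp_ofReal_mul_I])
      rw [hF, e1, ← integral_sub i2 i1]
      have h3 : 2 * Real.pi * |τ| * (2 * c n) = ∫ t, 2 * Real.pi * |τ| * (2 * c n) * ρ n t := by
        rw [integral_const_mul, hρ1, mul_one]
      rw [h3]
      refine norm_integral_le_of_norm_le ((hρi n).const_mul _) (ae_of_all _ fun t => ?_)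
      rw [← sub_one_mul, norm_mul, Complex.norm_real, Real.norm_of_nonneg (hρ0 n t)]
      by_cases ht : ρ n t = 0
      · rw [ht]; simp
      have ht' := hρs n t ht
      refine mul_le_mul_of_nonneg_right ?_ (hρ0 n t)
      have h4 := Real.norm_exp_I_mul_ofReal_sub_one_le (x := -2 * Real.pi * t * τ)
      rw [mul_comm Complex.I] at h4
      refine h4.trans ?_
      rw [Real.norm_eq_abs, abs_mul, abs_mul, abs_mul, abs_neg, abs_of_pos (two_pos (α := ℝ)),
        abs_of_pos Real.pi_pos, abs_of_pos ht'.1]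
      have := ht'.2.le
      calc 2 * Real.pi * t * |τ| = 2 * Real.pi * |τ| * t := by ring
        _ ≤ _ := by gcongr
    refine squeeze_zero (fun _ => norm_nonneg _) hb ?_
    have h5 : Tendsto c atTop (𝓝 0) := tendsto_one_div_add_atTop_nhds_zero_nat
    simpa using (h5.const_mul 2).const_mul (2 * Real.pi * |τ|)

lemma integral_mul_eq_zero_of_orthogonal {σ : ℝ} {Φ W : Lp ℂ 2 (volume : Measure ℝ)}
    (hΦ : Distribution.dsupport (ofData σ Φ) ⊆ Ici 0)
    (hW : ∀ g : 𝓢(ℝ, ℂ), IsTestHalfLine g → ∫ τ, W τ * schwartzData σ g τ = 0) :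
    ∫ τ, W τ * Φ τ = 0 := by
  obtain ⟨R, h1, h2, h3⟩ := exists_mollifier
  have hi : Integrable fun τ => W τ * Φ τ := (Lp.memLp W).integrable_mul (Lp.memLp Φ)
  have hlim : Tendsto (fun n => ∫ τ, (W τ * Φ τ) * ((𝓕 (R n) : 𝓢(ℝ, ℂ)) τ) ^ 2) atTop
      (𝓝 (∫ τ, W τ * Φ τ)) := by
    refine tendsto_integral_of_dominated_convergence (fun τ => ‖W τ * Φ τ‖) (fun n => ?_) hi.norm
      (fun n => ae_of_all _ fun τ => ?_) (ae_of_all _ fun τ => ?_)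
    · exact hi.aestronglyMeasurable.mul
        ((𝓕 (R n) : 𝓢(ℝ, ℂ)).continuous.pow 2).aestronglyMeasurable
    · rw [norm_mul, norm_pow]
      exact mul_le_of_le_one_right (norm_nonneg _) (pow_le_one₀ (norm_nonneg _) (h2 n τ))
    · simpa using ((h3 τ).pow 2).const_mul (W τ * Φ τ)
  simp only [fun n => integral_mul_mollified_eq_zero hΦ hW (h1 n)] at hlim
  exact (tendsto_nhds_unique hlim tendsto_const_nhds)

/-- Hahn-Banach in Hilbert form: `Φ` lies in the closure of the test data as soon as it is
orthogonal to everything orthogonal to them. `star` passes from the inner product to the bilinear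
pairing. -/
lemma exists_test_tendsto {σ : ℝ} {Φ : Lp ℂ 2 (volume : Measure ℝ)}
    (hΦ : Distribution.dsupport (ofData σ Φ) ⊆ Ici 0) :
    ∃ g : ℕ → 𝓢(ℝ, ℂ), (∀ n, IsTestHalfLine (g n)) ∧
      Tendsto (fun n => schwartzData σ (g n)) atTop (𝓝 Φ) := by
  set D : Submodule ℂ (Lp ℂ 2 (volume : Measure ℝ)) :=
    testSubmodule.map (schwartzDataCLM σ).toLinearMap
  have hmem : Φ ∈ Dᗮᗮ := by
    rw [Submodule.mem_orthogonal]
    intro w hw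
    rw [Submodule.mem_orthogonal'] at hw
    have h := integral_mul_eq_zero_of_orthogonal (W := star w) hΦ fun g hg => by
      have := hw (schwartzData σ g) ⟨g, hg, rfl⟩
      rw [← this, ← star_star w, ← integral_mul_eq_inner, star_star]
      simp only [mul_comm]
    rw [← star_star w, ← integral_mul_eq_inner, ← h]
    simp only [mul_comm]
  rw [Submodule.orthogonal_orthogonal_eq_closure] at hmem
  obtain ⟨u, hu, hlim⟩ := mem_closure_iff_seq_limit.1 (show Φ ∈ closure (D : Set _) from hmem)
  choose g hg hgu using hu
  refine ⟨g, hg, ?_⟩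
  have : u = fun n => schwartzData σ (g n) := funext fun n => (hgu n).symm
  rwa [← this]

lemma tendsto_hENorm_of_data {σ : ℝ} {g : ℕ → 𝓢(ℝ, ℂ)} {Φ : Lp ℂ 2 (volume : Measure ℝ)}
    (h : Tendsto (fun n => schwartzData σ (g n)) atTop (𝓝 Φ)) :
    Tendsto (fun n => hENorm σ ((g n : 𝓢'(ℝ, ℂ)) - ofData σ Φ)) atTop (𝓝 0) := by
  rw [tendsto_iff_edist_tendsto_0] at h
  refine h.congr fun n => ?_
  rw [← ofData_schwartzData σ, ← map_sub, hENorm_ofData, edist_eq_enorm_sub]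

/-- `IsForcing` only speaks of approximating sequences; density provides one, and so excludes a
vacuous condition. -/
lemma isForcing_unique {σ : ℝ} {Φ : Lp ℂ 2 (volume : Measure ℝ)}
    (hΦ : Distribution.dsupport (ofData σ Φ) ⊆ Ici 0) {U : 𝓢'(ℝ × ℝ, ℂ)}
    (hU : IsForcing σ (ofData σ Φ) U) : U = forcingDist σ Φ := by
  obtain ⟨g, hg, hlim⟩ := exists_test_tendsto hΦ
  have hc := tendsto_hENorm_of_data hlim
  ext Ψ
  exact tendsto_nhds_unique (hU g hg hc Ψ).2 (isForcing_forcingDist σ Φ g hg hc Ψ).2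

lemma exists_data_of_isForcing {σ : ℝ} {f : 𝓢'(ℝ, ℂ)} {U : 𝓢'(ℝ × ℝ, ℂ)} (hf : MemH0 σ f)
    (hU : IsForcing σ f U) : ∃ Φ : Lp ℂ 2 (volume : Measure ℝ), f = ofData σ Φ ∧
      U = forcingDist σ Φ := by
  obtain ⟨Φ, rfl⟩ := exists_ofData hf.1
  exact ⟨Φ, rfl, isForcing_unique hf.2 hU⟩

theorem existsUnique_isForcing (σ : ℝ) (f : 𝓢'(ℝ, ℂ)) (hf : MemH0 σ f) :
    ∃! U : 𝓢'(ℝ × ℝ, ℂ), IsForcing σ f U := by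
  obtain ⟨Φ, rfl⟩ := exists_ofData hf.1
  exact ⟨forcingDist σ Φ, isForcing_forcingDist σ Φ, fun U hU => isForcing_unique hf.2 hU⟩

/-! ### Time traces -/

lemma tendsto_ofData_apply {σ : ℝ} {Φ : ℕ → Lp ℂ 2 (volume : Measure ℝ)}
    {Φ₀ : Lp ℂ 2 (volume : Measure ℝ)} (h : Tendsto Φ atTop (𝓝 Φ₀)) (ψ : 𝓢(ℝ, ℂ)) :
    Tendsto (fun n => ofData σ (Φ n) ψ) atTop (𝓝 (ofData σ Φ₀ ψ)) := by
  rw [tendsto_iff_norm_sub_tendsto_zero] at h ⊢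
  refine squeeze_zero (fun _ => norm_nonneg _) (fun n => ?_)
    (by simpa using h.mul_const ‖SchwartzMap.toLpCLM ℂ ℂ 2 volume (besselSCLM (-σ) ψ)‖)
  refine le_trans (le_of_eq ?_) (norm_ofData_apply_le σ (Φ n - Φ₀) ψ)
  rw [map_sub]
  rfl

/-- For test functions the trace vanishes at negative times by the classical formula, and vanishing
on an open set survives limits of the data. -/
lemma memH0_trace {σ : ℝ} {Φ : Lp ℂ 2 (volume : Measure ℝ)}
    (hΦ : Distribution.dsupport (ofData σ Φ) ⊆ Ici 0) (x : ℝ) :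
    MemH0 σ (ofData σ (traceData x Φ)) := by
  refine ⟨by rw [hENorm_ofData]; exact enorm_lt_top, ?_⟩
  obtain ⟨g, hg, hlim⟩ := exists_test_tendsto hΦ
  have hv : Distribution.IsVanishingOn (ofData σ (traceData x Φ)) (Ici (0 : ℝ))ᶜ := by
    intro ψ hψ
    have h1 := tendsto_ofData_apply (σ := σ)
      (((bmul (symb x) (measurable_symb x) 1 (norm_symb_le x)).continuous.tendsto Φ).comp hlim) ψ
    change Tendsto (fun n => ofData σ (traceData x (schwartzData σ (g n))) ψ) atTop
      (𝓝 (ofData σ (traceData x Φ) ψ)) at h1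
    have h2 : ∀ n, ofData σ (traceData x (schwartzData σ (g n))) ψ = 0 := by
      intro n
      rw [← integral_test_mul_forcing σ (hg n)]
      have : ∀ t, ψ t * forcing (g n) x t = 0 := fun t => by
        rcases lt_or_ge t 0 with ht | ht
        · rw [forcing_zero_of_neg (hg n) x ht, mul_zero]
        · have : ψ t = 0 := by
            by_contra h
            exact hψ (subset_tsupport _ (Function.mem_support.2 h)) ht
          rw [this, zero_mul]
      simp [this]
    simp only [h2] at h1
    exact (tendsto_nhds_unique h1 tendsto_const_nhds)
  intro y hy
  exact (Distribution.mem_dsupport_iff y).1 hy _ hv isClosed_Ici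

theorem time_traces {σ : ℝ} {f : 𝓢'(ℝ, ℂ)} {U : 𝓢'(ℝ × ℝ, ℂ)} (hf : MemH0 σ f)
    (hU : IsForcing σ f U) :
    ∃ w : ℝ → 𝓢'(ℝ, ℂ), HasSpaceSlices U w ∧ (∀ x, MemH0 σ (w x)) ∧ ContinuousIntoH σ w ∧
      ∀ x, hENorm σ (w x) ≤ hENorm σ f := by
  obtain ⟨Φ, rfl, rfl⟩ := exists_data_of_isForcing hf hU
  refine ⟨fun x => ofData σ (traceData x Φ), hasSpaceSlices_forcingDist σ Φ,
    memH0_trace hf.2, continuousIntoH_ofData (continuous_traceData Φ), fun x => ?_⟩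
  rw [hENorm_ofData, hENorm_ofData, ← ofReal_norm, ← ofReal_norm]
  exact ENNReal.ofReal_le_ofReal (norm_traceData_le x Φ)

/-! ### Superpositions in `L²` -/

/-- Cauchy-Schwarz for `c a = (c wt)^(1/2) (c wt⁻¹ a²)^(1/2)`. Taking `wt z` to be the `L²` size of
the `z`-th function turns this into Minkowski's inequality after one use of Tonelli. -/
lemma lintegral_sq_le_mul {c wt a : ℝ → ℝ≥0∞} (hc : Measurable c) (hwt : Measurable wt)
    (ha : Measurable a) (h0 : ∀ᵐ z, wt z ≠ 0 ∧ wt z ≠ ⊤) :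
    (∫⁻ z, c z * a z) ^ 2 ≤ (∫⁻ z, c z * wt z) * ∫⁻ z, c z * (wt z)⁻¹ * a z ^ 2 := by
  have hp : (2 : ℝ).HolderConjugate 2 := Real.HolderConjugate.two_two
  have h := ENNReal.lintegral_mul_le_Lp_mul_Lq (volume : Measure ℝ) hp
    (f := fun z => (c z * wt z) ^ (1 / 2 : ℝ)) (g := fun z => (c z * (wt z)⁻¹ * a z ^ 2) ^ (1 / 2 : ℝ))
    (by fun_prop) (by fun_prop)
  have e : ∫⁻ z, ((fun z => (c z * wt z) ^ (1 / 2 : ℝ)) *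
      fun z => (c z * (wt z)⁻¹ * a z ^ 2) ^ (1 / 2 : ℝ)) z = ∫⁻ z, c z * a z := by
    apply lintegral_congr_ae
    filter_upwards [h0] with z hz
    simp only [Pi.mul_apply]
    rw [← ENNReal.mul_rpow_of_nonneg _ _ (by norm_num)]
    have : c z * wt z * (c z * (wt z)⁻¹ * a z ^ 2) = (c z * a z) ^ 2 := by
      calc _ = (wt z * (wt z)⁻¹) * (c z * a z) ^ 2 := by ring
        _ = _ := by rw [ENNReal.mul_inv_cancel hz.1 hz.2, one_mul]
    rw [this, ← ENNReal.rpow_two, ← ENNReal.rpow_mul]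
    norm_num
  rw [e] at h
  have hs : ∀ x : ℝ≥0∞, (x ^ (1 / 2 : ℝ)) ^ (2 : ℝ) = x := fun x => by
    rw [← ENNReal.rpow_mul]; norm_num
  simp only [hs] at h
  refine (pow_le_pow_left₀ zero_le h 2).trans (le_of_eq ?_)
  rw [mul_pow, ← ENNReal.rpow_two, ← ENNReal.rpow_two, hs, hs]

/-- Minkowski's integral inequality for superpositions of functions with controlled `L²` norms. -/
lemma lintegral_sq_superposition {c wt : ℝ → ℝ≥0∞} {a : ℝ → ℝ → ℝ≥0∞} (hc : Measurable c)
    (hwt : Measurable wt) (ha : Measurable (Function.uncurry a)) (h0 : ∀ᵐ z, wt z ≠ 0 ∧ wt z ≠ ⊤)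
    {B : ℝ≥0∞} (hB : ∀ᵐ z, ∫⁻ η, a z η ^ 2 ≤ (B * wt z) ^ 2) :
    ∫⁻ η, (∫⁻ z, c z * a z η) ^ 2 ≤ (B * ∫⁻ z, c z * wt z) ^ 2 := by
  have hm : ∀ η, Measurable fun z => a z η := fun η =>
    ha.comp (measurable_id.prodMk measurable_const)
  calc ∫⁻ η, (∫⁻ z, c z * a z η) ^ 2
      ≤ ∫⁻ η, (∫⁻ z, c z * wt z) * ∫⁻ z, c z * (wt z)⁻¹ * a z η ^ 2 := by
        gcongr with η
        exact lintegral_sq_le_mul hc hwt (hm η) h0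
    _ = (∫⁻ z, c z * wt z) * ∫⁻ η, ∫⁻ z, c z * (wt z)⁻¹ * a z η ^ 2 := by
        rw [lintegral_const_mul]
        refine Measurable.lintegral_prod_right' (f := fun y : ℝ × ℝ =>
          c y.2 * (wt y.2)⁻¹ * a y.2 y.1 ^ 2) ?_
        exact ((hc.comp measurable_snd).mul (hwt.comp measurable_snd).inv).mul
          ((ha.comp measurable_swap).pow_const 2)
    _ = (∫⁻ z, c z * wt z) * ∫⁻ z, ∫⁻ η, c z * (wt z)⁻¹ * a z η ^ 2 := by
        rw [lintegral_lintegral_swap]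
        exact (((hc.comp measurable_snd).mul (hwt.comp measurable_snd).inv).mul
          ((ha.comp measurable_swap).pow_const 2)).aemeasurable
    _ ≤ (∫⁻ z, c z * wt z) * ∫⁻ z, B ^ 2 * (c z * wt z) := by
        gcongr 1
        apply lintegral_mono_ae
        filter_upwards [hB, h0] with z hz hz0
        have hz' : Measurable fun η => a z η ^ 2 :=
          (ha.comp (measurable_const.prodMk measurable_id)).pow_const 2
        rw [lintegral_const_mul _ hz']
        calc c z * (wt z)⁻¹ * ∫⁻ η, a z η ^ 2 ≤ c z * (wt z)⁻¹ * (B * wt z) ^ 2 := by gcongr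
          _ = (wt z * (wt z)⁻¹) * (B ^ 2 * (c z * wt z)) := by ring
          _ = _ := by rw [ENNReal.mul_inv_cancel hz0.1 hz0.2, one_mul]
    _ = _ := by
        have hm' : Measurable fun z => c z * wt z := by fun_prop
        rw [lintegral_const_mul _ hm']
        ring

lemma lintegral_comp_mul_right_eq {z : ℝ} (hz : z ≠ 0) (f : ℝ → ℝ≥0∞) :
    ∫⁻ η, f (η * z) = ENNReal.ofReal |z⁻¹| * ∫⁻ η, f η := by
  have h : ∫⁻ η, f η ∂(Measure.map (· * z) volume) = ∫⁻ η, f (η * z) :=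
    (Homeomorph.mulRight₀ z hz).measurableEmbedding.lintegral_map f
  rw [← h, Real.map_volume_mul_right hz, lintegral_smul_measure, smul_eq_mul]

lemma eLpNorm_two_sq (f : ℝ → ℂ) : eLpNorm f 2 volume ^ 2 = ∫⁻ x, ‖f x‖ₑ ^ 2 := by
  rw [eLpNorm_eq_lintegral_rpow_enorm_toReal (by norm_num) (by norm_num)]
  simp only [ENNReal.toReal_ofNat, ENNReal.rpow_two]
  rw [← ENNReal.rpow_two, ← ENNReal.rpow_mul]
  norm_num

/-- A kernel `M(z, η)` bounded by `c(z)`, where `c(z) |z|^(-1/2)` is integrable. -/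
structure DilKernel (M : ℝ → ℝ → ℂ) (c : ℝ → ℝ≥0∞) : Prop where
  measurable : Measurable (Function.uncurry M)
  measurable_bound : Measurable c
  bound : ∀ z, z ≠ 0 → ∀ η, ‖M z η‖ₑ ≤ c z
  finite : ∫⁻ z, c z * ENNReal.ofReal (|z| ^ (-(1 / 2) : ℝ)) ≠ ⊤

/-- The operator `G ↦ ∫ M(z, η) G(ηz) dz`. -/
def dilInt (M : ℝ → ℝ → ℂ) (G : ℝ → ℂ) (η : ℝ) : ℂ := ∫ z, M z η * G (η * z)

lemma ae_ne (a : ℝ) : ∀ᵐ z : ℝ, z ≠ a := by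
  rw [ae_iff]; simp

lemma measurable_weight (a : ℝ) : Measurable fun z : ℝ => ENNReal.ofReal (|z| ^ a) := by
  fun_prop

lemma weight_ne (a : ℝ) : ∀ᵐ z : ℝ, ENNReal.ofReal (|z| ^ a) ≠ 0 ∧ ENNReal.ofReal (|z| ^ a) ≠ ⊤ := by
  filter_upwards [ae_ne 0] with z hz
  exact ⟨(ENNReal.ofReal_pos.2 (Real.rpow_pos_of_pos (abs_pos.2 hz) _)).ne', ENNReal.ofReal_ne_top⟩

/-- The dilate `η ↦ G(ηz)` has `L²` norm `|z|^(-1/2) ‖G‖`, hence the weight. -/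
lemma lintegral_dil_sq_le {c : ℝ → ℝ≥0∞} (hc : Measurable c) {G : ℝ → ℂ} (hG : Measurable G) :
    ∫⁻ η, (∫⁻ z, c z * ‖G (η * z)‖ₑ) ^ 2 ≤
      (eLpNorm G 2 volume * ∫⁻ z, c z * ENNReal.ofReal (|z| ^ (-(1 / 2) : ℝ))) ^ 2 := by
  refine lintegral_sq_superposition (a := fun z η => ‖G (η * z)‖ₑ) hc (measurable_weight _) ?_
    (weight_ne _) ?_
  · exact (hG.comp (measurable_snd.mul measurable_fst)).enorm
  · filter_upwards [ae_ne 0] with z hz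
    rw [lintegral_comp_mul_right_eq hz (fun x => ‖G x‖ₑ ^ 2), mul_pow, eLpNorm_two_sq, mul_comm]
    gcongr
    rw [← ENNReal.ofReal_pow (by positivity)]
    apply le_of_eq
    congr 1
    rw [← Real.rpow_natCast, ← Real.rpow_mul (abs_nonneg z), abs_inv, ← Real.rpow_neg_one]
    norm_num

lemma enorm_dilInt_le {M : ℝ → ℝ → ℂ} {c : ℝ → ℝ≥0∞} (hM : DilKernel M c) (G : ℝ → ℂ) (η : ℝ) :
    ∫⁻ z, ‖M z η * G (η * z)‖ₑ ≤ ∫⁻ z, c z * ‖G (η * z)‖ₑ := by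
  apply lintegral_mono_ae
  filter_upwards [ae_ne 0] with z hz
  rw [enorm_mul]
  gcongr
  exact hM.bound z hz η

lemma measurable_dil_integrand {M : ℝ → ℝ → ℂ} {c : ℝ → ℝ≥0∞} (hM : DilKernel M c) {G : ℝ → ℂ}
    (hG : Measurable G) : Measurable fun y : ℝ × ℝ => M y.2 y.1 * G (y.1 * y.2) :=
  (hM.measurable.comp measurable_swap).mul (hG.comp (measurable_fst.mul measurable_snd))

lemma integrable_dil {M : ℝ → ℝ → ℂ} {c : ℝ → ℝ≥0∞} (hM : DilKernel M c) {G : ℝ → ℂ}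
    (hG : Measurable G) (hG2 : MemLp G 2) : ∀ᵐ η, Integrable fun z => M z η * G (η * z) := by
  have h := lintegral_dil_sq_le hM.measurable_bound hG
  have hfin : ∫⁻ η, (∫⁻ z, c z * ‖G (η * z)‖ₑ) ^ 2 ≠ ⊤ :=
    (h.trans_lt (ENNReal.pow_lt_top (ENNReal.mul_lt_top hG2.2 hM.finite.lt_top))).ne
  have hmeas : Measurable fun η => (∫⁻ z, c z * ‖G (η * z)‖ₑ) ^ 2 := by
    refine Measurable.pow_const ?_ 2
    refine Measurable.lintegral_prod_right' (f := fun y : ℝ × ℝ => c y.2 * ‖G (y.1 * y.2)‖ₑ) ?_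
    exact (hM.measurable_bound.comp measurable_snd).mul
      (hG.comp (measurable_fst.mul measurable_snd)).enorm
  filter_upwards [ae_lt_top hmeas hfin] with η hη
  refine ⟨((measurable_dil_integrand hM hG).comp
    (measurable_const.prodMk measurable_id)).aestronglyMeasurable, ?_⟩
  refine lt_of_le_of_lt (enorm_dilInt_le hM G η) ?_
  by_contra h'
  rw [not_lt, top_le_iff] at h'
  rw [h'] at hη
  simp at hη

lemma stronglyMeasurable_dilInt {M : ℝ → ℝ → ℂ} {c : ℝ → ℝ≥0∞} (hM : DilKernel M c) {G : ℝ → ℂ}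
    (hG : Measurable G) : StronglyMeasurable (dilInt M G) :=
  StronglyMeasurable.integral_prod_right (f := fun η z => M z η * G (η * z))
    (measurable_dil_integrand hM hG).stronglyMeasurable

lemma eLpNorm_dilInt_le {M : ℝ → ℝ → ℂ} {c : ℝ → ℝ≥0∞} (hM : DilKernel M c) {G : ℝ → ℂ}
    (hG : Measurable G) : eLpNorm (dilInt M G) 2 volume ≤
      (∫⁻ z, c z * ENNReal.ofReal (|z| ^ (-(1 / 2) : ℝ))) * eLpNorm G 2 volume := by
  rw [mul_comm]
  refine (ENNReal.pow_le_pow_left_iff two_ne_zero).1 ?_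
  rw [eLpNorm_two_sq]
  refine le_trans ?_ (lintegral_dil_sq_le hM.measurable_bound hG)
  gcongr with η
  exact (enorm_integral_le_lintegral_enorm _).trans (enorm_dilInt_le hM G η)

lemma memLp_dilInt {M : ℝ → ℝ → ℂ} {c : ℝ → ℝ≥0∞} (hM : DilKernel M c) {G : ℝ → ℂ}
    (hG : Measurable G) (hG2 : MemLp G 2) : MemLp (dilInt M G) 2 :=
  ⟨(stronglyMeasurable_dilInt hM hG).aestronglyMeasurable,
    (eLpNorm_dilInt_le hM hG).trans_lt (ENNReal.mul_lt_top hM.finite.lt_top hG2.2)⟩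

lemma ae_comp_mul_left {G G' : ℝ → ℂ} (h : G =ᵐ[volume] G') {η : ℝ} (hη : η ≠ 0) :
    (fun z => G (η * z)) =ᵐ[volume] fun z => G' (η * z) := by
  have hq : Measure.QuasiMeasurePreserving (fun z : ℝ => η * z) volume volume := by
    refine ⟨by fun_prop, ?_⟩
    rw [Real.map_volume_mul_left hη]
    exact Measure.smul_absolutelyContinuous
  exact hq.ae_eq_comp h

lemma dilInt_congr_ae {M : ℝ → ℝ → ℂ} {G G' : ℝ → ℂ} (h : G =ᵐ[volume] G') {η : ℝ} (hη : η ≠ 0) :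
    dilInt M G η = dilInt M G' η := by
  apply integral_congr_ae
  filter_upwards [ae_comp_mul_left h hη] with z hz
  rw [hz]

/-- The operator `G ↦ ∫ M(z, ·) G(·z) dz` on `L²`. -/
def dilOp {M : ℝ → ℝ → ℂ} {c : ℝ → ℝ≥0∞} (hM : DilKernel M c) :
    Lp ℂ 2 (volume : Measure ℝ) →L[ℂ] Lp ℂ 2 (volume : Measure ℝ) :=
  LinearMap.mkContinuous
    { toFun := fun G => (memLp_dilInt hM (Lp.stronglyMeasurable G).measurable (Lp.memLp G)).toLp _
      map_add' := fun G G' => by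
        rw [← MemLp.toLp_add]
        apply MemLp.toLp_congr
        filter_upwards [integrable_dil hM (Lp.stronglyMeasurable G).measurable (Lp.memLp G),
          integrable_dil hM (Lp.stronglyMeasurable G').measurable (Lp.memLp G'), ae_ne 0]
          with η h1 h2 hη
        rw [dilInt_congr_ae (Lp.coeFn_add G G') hη, Pi.add_apply, dilInt, dilInt, dilInt,
          ← integral_add h1 h2]
        congr 1; ext z
        rw [Pi.add_apply, mul_add]
      map_smul' := fun a G => by
        rw [RingHom.id_apply, ← MemLp.toLp_const_smul]
        apply MemLp.toLp_congr
        filter_upwards [ae_ne 0] with η hη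
        rw [dilInt_congr_ae (Lp.coeFn_smul a G) hη, Pi.smul_apply, dilInt, dilInt,
          ← integral_smul]
        congr 1; ext z
        simp only [Pi.smul_apply, smul_eq_mul]
        ring }
    (∫⁻ z, c z * ENNReal.ofReal (|z| ^ (-(1 / 2) : ℝ))).toReal
    (fun G => by
      change ‖(memLp_dilInt hM (Lp.stronglyMeasurable G).measurable (Lp.memLp G)).toLp _‖ ≤ _
      rw [Lp.norm_toLp, Lp.norm_def, ← ENNReal.toReal_mul]
      exact ENNReal.toReal_mono (ENNReal.mul_ne_top hM.finite (Lp.memLp G).2.ne)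
        (eLpNorm_dilInt_le hM (Lp.stronglyMeasurable G).measurable))

lemma dilOp_coe {M : ℝ → ℝ → ℂ} {c : ℝ → ℝ≥0∞} (hM : DilKernel M c)
    (G : Lp ℂ 2 (volume : Measure ℝ)) : dilOp hM G =ᵐ[volume] dilInt M G :=
  (memLp_dilInt hM (Lp.stronglyMeasurable G).measurable (Lp.memLp G)).coeFn_toLp

/-! ### Transposes with respect to the bilinear pairing of `L²` -/

/-- The transpose of an operator, for the pairing `∫ f g`. -/
def transp (T : Lp ℂ 2 (volume : Measure ℝ) →L[ℂ] Lp ℂ 2 (volume : Measure ℝ))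
    (f : Lp ℂ 2 (volume : Measure ℝ)) : Lp ℂ 2 (volume : Measure ℝ) :=
  star (ContinuousLinearMap.adjoint T (star f))

lemma integral_transp_mul (T : Lp ℂ 2 (volume : Measure ℝ) →L[ℂ] Lp ℂ 2 (volume : Measure ℝ))
    (f g : Lp ℂ 2 (volume : Measure ℝ)) : ∫ x, transp T f x * g x = ∫ x, f x * T g x := by
  simp only [mul_comm (transp T f _), mul_comm (f _)]
  rw [integral_mul_eq_inner, integral_mul_eq_inner, transp, star_star,
    ContinuousLinearMap.adjoint_inner_left]

lemma norm_lp_star (f : Lp ℂ 2 (volume : Measure ℝ)) : ‖star f‖ = ‖f‖ := by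
  rw [Lp.norm_def, Lp.norm_def]
  congr 1
  refine eLpNorm_congr_norm_ae ?_
  filter_upwards [Lp.coeFn_star f] with x hx
  rw [hx, Pi.star_apply, norm_star]

lemma lp_star_sub (f g : Lp ℂ 2 (volume : Measure ℝ)) : star (f - g) = star f - star g := by
  ext1
  filter_upwards [Lp.coeFn_star (f - g), Lp.coeFn_sub f g, Lp.coeFn_sub (star f) (star g),
    Lp.coeFn_star f, Lp.coeFn_star g] with x h1 h2 h3 h4 h5
  rw [h1, h3, Pi.star_apply, h2, Pi.sub_apply, Pi.sub_apply, h4, h5, star_sub]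
  rfl

lemma norm_transp_le (T : Lp ℂ 2 (volume : Measure ℝ) →L[ℂ] Lp ℂ 2 (volume : Measure ℝ))
    (f : Lp ℂ 2 (volume : Measure ℝ)) : ‖transp T f‖ ≤ ‖T‖ * ‖f‖ := by
  rw [transp, norm_lp_star]
  refine (ContinuousLinearMap.le_opNorm _ _).trans ?_
  rw [norm_lp_star, LinearIsometryEquiv.norm_map]

lemma transp_sub (T : Lp ℂ 2 (volume : Measure ℝ) →L[ℂ] Lp ℂ 2 (volume : Measure ℝ))
    (f g : Lp ℂ 2 (volume : Measure ℝ)) : transp T (f - g) = transp T f - transp T g := by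
  simp only [transp, lp_star_sub, map_sub]

lemma continuous_transp (T : Lp ℂ 2 (volume : Measure ℝ) →L[ℂ] Lp ℂ 2 (volume : Measure ℝ)) :
    Continuous (transp T) := by
  refine LipschitzWith.continuous (K := ‖T‖₊) (LipschitzWith.of_dist_le_mul fun f g => ?_)
  rw [dist_eq_norm, dist_eq_norm, ← transp_sub]
  exact norm_transp_le T _

/-! ### The space symbol -/

/-- Since `(X^a - 1)/(X^a + 1) = tanh(a log X / 2)`, this says that `tanh` is odd and increasing.
The proof uses only that `X^a` lies between `X⁻¹` and `X`. -/
lemma abs_rpow_sub_one_mul_le {X a : ℝ} (hX : 0 < X) (ha : |a| ≤ 1) :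
    |X ^ a - 1| * (X + 1) ≤ (X ^ a + 1) * |X - 1| := by
  obtain ⟨ha1, ha2⟩ := abs_le.1 ha
  have hY : 0 < X ^ a := Real.rpow_pos_of_pos hX a
  have hinv : X ^ (-1 : ℝ) * X = 1 := by rw [Real.rpow_neg_one, inv_mul_cancel₀ hX.ne']
  rcases le_total 1 X with h | h
  · have h1 : X ^ a ≤ X := by simpa using Real.rpow_le_rpow_of_exponent_le h ha2
    have h2 : X ^ (-1 : ℝ) ≤ X ^ a := Real.rpow_le_rpow_of_exponent_le h ha1
    have h3 : 1 ≤ X ^ a * X := by nlinarith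
    rw [abs_of_nonneg (by linarith : 0 ≤ X - 1)]
    rcases abs_cases (X ^ a - 1) with ⟨e, -⟩ | ⟨e, -⟩ <;> rw [e] <;> nlinarith
  · have h1 : X ≤ X ^ a := by simpa using Real.rpow_le_rpow_of_exponent_ge hX h ha2
    have h2 : X ^ a ≤ X ^ (-1 : ℝ) := Real.rpow_le_rpow_of_exponent_ge hX h ha1
    have h3 : X ^ a * X ≤ 1 := by nlinarith
    rw [abs_of_nonpos (by linarith : X - 1 ≤ 0)]
    rcases abs_cases (X ^ a - 1) with ⟨e, -⟩ | ⟨e, -⟩ <;> rw [e] <;> nlinarith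

lemma jw_div (s k η : ℝ) : jw s k / jw s η =
    ((1 + (2 * Real.pi * k) ^ 2) / (1 + (2 * Real.pi * η) ^ 2)) ^ (s / 2) := by
  rw [jw, jw, Real.div_rpow (by positivity) (by positivity)]

/-- The previous inequality for the ratio of the brackets at `k` and `η`, with exponent `s/2`; this
is where `|s| ≤ 2` enters. It says that the difference of weights vanishes at `k = ±η` fast enough
to cancel `1/(k² - η²)`. -/
lemma abs_jw_sub_mul_le {s : ℝ} (hs : |s| ≤ 2) (k η : ℝ) :
    |jw s k - jw s η| * (k ^ 2 + η ^ 2) ≤ (jw s k + jw s η) * |k ^ 2 - η ^ 2| := by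
  set A := 1 + (2 * Real.pi * k) ^ 2 with hA
  set B := 1 + (2 * Real.pi * η) ^ 2 with hB
  have hA0 : 0 < A := by positivity
  have hB0 : 0 < B := by positivity
  have hj := jw_pos s η
  have h := abs_rpow_sub_one_mul_le (X := A / B) (a := s / 2) (by positivity)
    (by rw [abs_div, abs_two]; linarith)
  rw [← jw_div] at h
  have e1 : jw s k / jw s η - 1 = (jw s k - jw s η) / jw s η := by field_simp
  have e2 : A / B - 1 = (A - B) / B := by field_simp
  have e3 : jw s k / jw s η + 1 = (jw s k + jw s η) / jw s η := by field_simp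
  have e4 : A / B + 1 = (A + B) / B := by field_simp
  rw [e1, e2, e3, e4, abs_div, abs_div, abs_of_pos hj, abs_of_pos hB0, div_mul_div_comm,
    div_mul_div_comm, div_le_div_iff_of_pos_right (by positivity)] at h
  have e5 : A - B = (4 * Real.pi ^ 2) * (k ^ 2 - η ^ 2) := by rw [hA, hB]; ring
  rw [e5, abs_mul, abs_of_pos (by positivity : (0 : ℝ) < 4 * Real.pi ^ 2)] at h
  have e6 : (4 * Real.pi ^ 2) * (k ^ 2 + η ^ 2) ≤ A + B := by rw [hA, hB]; nlinarith
  have h7 : |jw s k - jw s η| * ((4 * Real.pi ^ 2) * (k ^ 2 + η ^ 2)) ≤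
      (jw s k + jw s η) * ((4 * Real.pi ^ 2) * |k ^ 2 - η ^ 2|) :=
    (mul_le_mul_of_nonneg_left e6 (abs_nonneg _)).trans h
  have hp : 0 < 4 * Real.pi ^ 2 := by positivity
  nlinarith

/-- The ratio of the brackets lies between `1` and `z²`, so its power lies between `1` and `|z|^s`.
-/
lemma jw_div_le {s z : ℝ} (hz : z ≠ 0) (η : ℝ) : jw s (η * z) / jw s η ≤ 1 + |z| ^ s := by
  rw [jw_div]
  set b := (2 * Real.pi * η) ^ 2 with hb
  have hb0 : 0 ≤ b := by positivity
  have e : (2 * Real.pi * (η * z)) ^ 2 = b * z ^ 2 := by rw [hb]; ring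
  rw [e]
  have hz0 : 0 < |z| := abs_pos.2 hz
  have ez : |z| ^ s = (z ^ 2) ^ (s / 2) := by
    rw [← sq_abs, ← Real.rpow_natCast, ← Real.rpow_mul hz0.le]; congr 1; push_cast; ring
  have hzs : 0 < z ^ 2 := by positivity
  have hp : 0 ≤ |z| ^ s := by positivity
  rcases le_total 0 s with h | h
  · rcases le_total 1 (z ^ 2) with h1 | h1
    · have : (1 + b * z ^ 2) / (1 + b) ≤ z ^ 2 := by
        rw [div_le_iff₀ (by positivity)]; nlinarith
      have := Real.rpow_le_rpow (by positivity) this (by linarith : 0 ≤ s / 2)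
      rw [← ez] at this; linarith
    · have : (1 + b * z ^ 2) / (1 + b) ≤ 1 := by
        rw [div_le_iff₀ (by positivity)]; nlinarith
      have := Real.rpow_le_one (by positivity) this (by linarith : 0 ≤ s / 2)
      linarith
  · rcases le_total 1 (z ^ 2) with h1 | h1
    · have : 1 ≤ (1 + b * z ^ 2) / (1 + b) := by
        rw [le_div_iff₀ (by positivity)]; nlinarith
      have := Real.rpow_le_one_of_one_le_of_nonpos this (by linarith : s / 2 ≤ 0)
      linarith
    · have : z ^ 2 ≤ (1 + b * z ^ 2) / (1 + b) := by
        rw [le_div_iff₀ (by positivity)]; nlinarith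
      have := Real.rpow_le_rpow_of_nonpos hzs this (by linarith : s / 2 ≤ 0)
      rw [← ez] at this; linarith

/-- The kernel of the correction to the free evolution. -/
def spaceKer (s z η : ℝ) : ℂ :=
  if 0 < η then Complex.I / Real.pi * (((jw s (η * z) / jw s η - 1) / (1 - z ^ 2) : ℝ) : ℂ)
  else 1 / Real.pi * ((jw s (η * z) / jw s η / (1 + z ^ 2) : ℝ) : ℂ)

/-- The bound of the kernel. -/
def kerBound (s z : ℝ) : ℝ≥0∞ := ENNReal.ofReal ((2 + |z| ^ s) / (1 + z ^ 2))

lemma measurable_spaceKer (s : ℝ) : Measurable (Function.uncurry (spaceKer s)) := by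
  have hj := (continuous_jw s).measurable
  unfold spaceKer Function.uncurry
  refine Measurable.ite (measurable_snd measurableSet_Ioi) ?_ ?_ <;> fun_prop

/-- For `η > 0` the numerator cancels the poles at `z = ±1` by `abs_jw_sub_mul_le`, so `1 - z²` may
be replaced by `1 + z²` at the price of a plus sign in the numerator. For `η ≤ 0` there is no pole.
The bound is uniform in `η`. -/
lemma norm_spaceKer_le {s z : ℝ} (hs : |s| ≤ 2) (hz : z ≠ 0) (η : ℝ) :
    ‖spaceKer s z η‖ ≤ (2 + |z| ^ s) / (1 + z ^ 2) := by
  have hr := jw_div_le (s := s) hz η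
  have hr0 : 0 < jw s (η * z) / jw s η := div_pos (jw_pos _ _) (jw_pos _ _)
  have hpi : (1 : ℝ) / Real.pi ≤ 1 := by
    rw [div_le_one Real.pi_pos]; linarith [Real.pi_gt_three]
  unfold spaceKer
  split_ifs with h
  · rw [norm_mul, norm_div, Complex.norm_I, Complex.norm_real, Complex.norm_real,
      Real.norm_of_nonneg Real.pi_pos.le, Real.norm_eq_abs]
    refine (mul_le_of_le_one_left (abs_nonneg _) hpi).trans ?_
    -- At `z = ±1` division by zero gives the default value `0`.
    by_cases h1 : 1 - z ^ 2 = 0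
    · rw [h1, div_zero, abs_zero]; positivity
    rw [abs_div, div_le_div_iff₀ (abs_pos.2 h1) (by positivity)]
    have hj := abs_jw_sub_mul_le hs (η * z) η
    have e1 : (η * z) ^ 2 + η ^ 2 = η ^ 2 * (1 + z ^ 2) := by ring
    have e2 : (η * z) ^ 2 - η ^ 2 = η ^ 2 * (-(1 - z ^ 2)) := by ring
    rw [e1, e2, abs_mul, abs_neg, abs_of_pos (by positivity : 0 < η ^ 2)] at hj
    have hj' : |jw s (η * z) - jw s η| * (1 + z ^ 2) ≤ (jw s (η * z) + jw s η) * |1 - z ^ 2| := by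
      have : 0 < η ^ 2 := by positivity
      nlinarith
    have hη := jw_pos s η
    have e3 : jw s (η * z) / jw s η - 1 = (jw s (η * z) - jw s η) / jw s η := by field_simp
    have e4 : jw s (η * z) / jw s η + 1 = (jw s (η * z) + jw s η) / jw s η := by field_simp
    calc |jw s (η * z) / jw s η - 1| * (1 + z ^ 2)
        = (|jw s (η * z) - jw s η| * (1 + z ^ 2)) / jw s η := by
          rw [e3, abs_div, abs_of_pos hη]; ring
      _ ≤ ((jw s (η * z) + jw s η) * |1 - z ^ 2|) / jw s η := by gcongr
      _ = (jw s (η * z) / jw s η + 1) * |1 - z ^ 2| := by rw [e4]; ring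
      _ ≤ _ := mul_le_mul_of_nonneg_right (by linarith) (abs_nonneg _)
  · rw [norm_mul, norm_div, norm_one, Complex.norm_real, Complex.norm_real,
      Real.norm_of_nonneg Real.pi_pos.le, Real.norm_of_nonneg (by positivity)]
    refine (mul_le_of_le_one_left (by positivity) hpi).trans ?_
    gcongr
    linarith

lemma integrable_rpow_div_one_add_sq {a : ℝ} (h1 : -1 < a) (h2 : a < 1) :
    Integrable fun z : ℝ => |z| ^ a / (1 + z ^ 2) := by
  have hm : Measurable fun z : ℝ => |z| ^ a / (1 + z ^ 2) := by fun_prop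
  have hI : IntegrableOn (fun z : ℝ => |z| ^ a / (1 + z ^ 2)) (Ioi 0) := by
    rw [← Ioc_union_Ioi_eq_Ioi (zero_le_one (α := ℝ))]
    refine IntegrableOn.union ?_ ?_
    · have hi : IntegrableOn (fun z : ℝ => z ^ a) (Ioc 0 1) :=
        (intervalIntegrable_iff_integrableOn_Ioc_of_le zero_le_one).1
          (intervalIntegral.intervalIntegrable_rpow' h1)
      refine hi.mono' hm.aestronglyMeasurable ?_
      refine (ae_restrict_iff' measurableSet_Ioc).2 (ae_of_all _ fun z hz => ?_)
      rw [Real.norm_of_nonneg (by positivity), abs_of_pos hz.1]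
      exact div_le_self (Real.rpow_nonneg hz.1.le _) (by nlinarith)
    · have hi : IntegrableOn (fun z : ℝ => z ^ (a - 2)) (Ioi 1) :=
        integrableOn_Ioi_rpow_of_lt (by linarith) one_pos
      refine hi.mono' hm.aestronglyMeasurable ?_
      refine (ae_restrict_iff' measurableSet_Ioi).2 (ae_of_all _ fun z hz => ?_)
      have hz0 : 0 < z := lt_trans one_pos hz
      rw [Real.norm_of_nonneg (by positivity), abs_of_pos hz0, Real.rpow_sub hz0]
      gcongr
      rw [Real.rpow_two]
      linarith
  have hI' : IntegrableOn (fun z : ℝ => |z| ^ a / (1 + z ^ 2)) (Iic 0) := by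
    have h := (integrableOn_Ici_iff_integrableOn_Ioi (μ := volume)).2 hI
    have h3 := IntegrableOn.comp_neg h
    simpa using h3
  rw [← integrableOn_univ, ← Iic_union_Ioi (a := (0 : ℝ))]
  exact hI'.union hI

/-- The integrand consists of `|z|^(-b)` and `|z|^(s-b)` over `1 + z²`. Both exponents must lie in
`(-1, 1)`, for integrability at zero and at infinity. -/
lemma lintegral_kerBound_ne_top {s b : ℝ} (hb0 : 0 ≤ b) (hb1 : b < 1) (h1 : b - 1 < s)
    (h2 : s < 1 + b) : ∫⁻ z, kerBound s z * ENNReal.ofReal (|z| ^ (-b)) ≠ ⊤ := by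
  have hi := ((integrable_rpow_div_one_add_sq (a := -b) (by linarith) (by linarith)).const_mul 2).add
    (integrable_rpow_div_one_add_sq (a := s - b) (by linarith) (by linarith))
  have h := hi.lintegral_lt_top.ne
  convert h using 1
  apply lintegral_congr_ae
  filter_upwards [ae_ne 0] with z hz
  rw [kerBound, ← ENNReal.ofReal_mul (by positivity)]
  congr 1
  simp only [Pi.add_apply]
  rw [show s - b = s + -b by ring, Real.rpow_add (abs_pos.2 hz)]
  ring

/-- The dilation weight has `b = 1/2`, which yields precisely the range `-1/2 < s < 3/2`. -/
lemma dilKernel_spaceKer {s : ℝ} (h1 : -(1 / 2) < s) (h2 : s < 3 / 2) :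
    DilKernel (spaceKer s) (kerBound s) where
  measurable := measurable_spaceKer s
  measurable_bound := by unfold kerBound; fun_prop
  bound z hz η := by
    rw [← ofReal_norm]
    exact ENNReal.ofReal_le_ofReal
      (norm_spaceKer_le (abs_le.2 ⟨by linarith, by linarith⟩) hz η)
  finite := lintegral_kerBound_ne_top (by norm_num) (by norm_num) (by linarith) (by linarith)

/-! ### The Laplace transform of `J^s ψ` -/

lemma laplace_pairing {w : ℂ} (hw : 0 < w.re) (ψ : 𝓢(ℝ, ℂ)) :
    ∫ x : ℝ, Complex.exp (-w * (|x| : ℝ)) * ψ x =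
      ∫ k : ℝ, (2 * w / (w ^ 2 + ((2 * Real.pi * k : ℝ) : ℂ) ^ 2)) * (𝓕⁻ ψ : 𝓢(ℝ, ℂ)) k := by
  have h := integral_fourier_mul_eq (integrable_exp_neg_abs hw) (𝓕⁻ ψ : 𝓢(ℝ, ℂ)).integrable
  rw [← SchwartzMap.fourier_coe, fourier_fourierInv_eq] at h
  rw [← h]
  congr 1; ext k
  rw [fourier_exp_neg_abs hw]

/-- At `τ = -2πη|η|` the square root is explicit: imaginary for `η > 0`, a wave travelling away from
`x = 0`, and real for `η < 0`, an exponentially decaying profile. -/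
lemma kap_space_pos {η : ℝ} (hη : 0 < η) :
    kap (-(2 * Real.pi * η * |η|)) = -(2 * Real.pi * η * Complex.I) := by
  have e1 : 2 * Real.pi * -(2 * Real.pi * η * |η|) = -(2 * Real.pi * η) ^ 2 := by
    rw [abs_of_pos hη]; ring
  rw [kap, e1, neg_neg, Real.sqrt_eq_zero_of_nonpos (by nlinarith [sq_nonneg (2 * Real.pi * η)]),
    Real.sqrt_sq (by positivity)]
  push_cast
  ring

lemma kap_space_neg {η : ℝ} (hη : η < 0) :
    kap (-(2 * Real.pi * η * |η|)) = ((2 * Real.pi * |η| : ℝ) : ℂ) := by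
  have e1 : 2 * Real.pi * -(2 * Real.pi * η * |η|) = (2 * Real.pi * |η|) ^ 2 := by
    rw [abs_of_neg hη]; ring
  rw [kap, e1, Real.sqrt_eq_zero_of_nonpos (x := -(2 * Real.pi * |η|) ^ 2)
    (by nlinarith [sq_nonneg (2 * Real.pi * |η|)]), Real.sqrt_sq (by positivity)]
  push_cast
  ring

lemma integral_eq_integral_comp_mul {η : ℝ} (hη : η ≠ 0) (F : ℝ → ℂ) :
    ∫ k, F k = ∫ z, ((|η| : ℝ) : ℂ) * F (η * z) := by
  rw [integral_const_mul, Measure.integral_comp_mul_left F η, abs_inv, Complex.real_smul,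
    Complex.ofReal_inv, mul_inv_cancel_left₀]
  exact_mod_cast abs_ne_zero.2 hη

/-- Here `w = 2π|η|`. With `k = ηz` the Lorentzian `2w/(w² + (2πk)²) dk` becomes `dz/(π(1 + z²))`,
and the weight at `k` is divided by the weight at `η`. -/
lemma integral_symb_besselS_neg (s : ℝ) {η : ℝ} (hη : η < 0) (ψ : 𝓢(ℝ, ℂ)) :
    ∫ x, symb x (-(2 * Real.pi * η * |η|)) * besselS s ψ x =
      (jw s η : ℂ) * dilInt (spaceKer s) (𝓕⁻ ψ : 𝓢(ℝ, ℂ)) η := by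
  have e1 : ∀ x : ℝ, symb x (-(2 * Real.pi * η * |η|)) =
      Complex.exp (-((2 * Real.pi * |η| : ℝ) : ℂ) * (|x| : ℝ)) := fun x => by
    rw [symb, kap_space_neg hη]; congr 1; ring
  have hw : 0 < (((2 * Real.pi * |η| : ℝ) : ℂ)).re := by
    rw [Complex.ofReal_re]
    have := abs_pos.2 hη.ne
    positivity
  simp only [e1]
  rw [laplace_pairing hw, dilInt, ← integral_const_mul]
  have hη0 : |η| ≠ 0 := abs_ne_zero.2 hη.ne
  rw [integral_eq_integral_comp_mul hη.ne]
  congr 1; ext z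
  rw [fourierInv_besselS, spaceKer, if_neg (not_lt.2 hη.le)]
  have hj : (jw s η : ℂ) ≠ 0 := by exact_mod_cast jw_ne_zero s η
  have hpi : (Real.pi : ℂ) ≠ 0 := by exact_mod_cast Real.pi_ne_zero
  have h1 : (1 + (z : ℂ) ^ 2) ≠ 0 := by
    have : (1 + z ^ 2 : ℝ) ≠ 0 := by positivity
    exact_mod_cast this
  have ha : ((|η| : ℝ) : ℂ) ≠ 0 := by exact_mod_cast hη0
  have e2 : ((2 * Real.pi * |η| : ℝ) : ℂ) ^ 2 + ((2 * Real.pi * (η * z) : ℝ) : ℂ) ^ 2 =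
      (2 * Real.pi * (|η| : ℝ)) ^ 2 * (1 + (z : ℂ) ^ 2) := by
    have : ((η : ℝ) : ℂ) ^ 2 = ((|η| : ℝ) : ℂ) ^ 2 := by
      rw [← Complex.ofReal_pow, ← Complex.ofReal_pow, sq_abs]
    push_cast
    linear_combination (4 * (Real.pi : ℂ) ^ 2 * z ^ 2) * this
  rw [e2]
  push_cast
  field_simp

/-- Damping never shrinks the denominator: the square of `|k² - η² + δ² - 2iδη|` exceeds `(k² -
η²)²` by `2δ²k² + 2δ²η² + δ⁴`. -/
lemma norm_sq_shift_ge (k η : ℝ) {δ : ℝ} :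
    (2 * Real.pi) ^ 2 * |k ^ 2 - η ^ 2| ≤
      ‖(2 * Real.pi * (δ - η * Complex.I) : ℂ) ^ 2 + ((2 * Real.pi * k : ℝ) : ℂ) ^ 2‖ := by
  have e : (2 * Real.pi * (δ - η * Complex.I) : ℂ) ^ 2 + ((2 * Real.pi * k : ℝ) : ℂ) ^ 2 =
      (((2 * Real.pi) ^ 2 : ℝ) : ℂ) *
        (((k ^ 2 - η ^ 2 + δ ^ 2 : ℝ) : ℂ) + ((-2 * δ * η : ℝ) : ℂ) * Complex.I) := by
    push_cast
    linear_combination ((2 * Real.pi) ^ 2 * η ^ 2 : ℂ) * Complex.I_sq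
  rw [e, norm_mul, Complex.norm_real, Real.norm_of_nonneg (by positivity)]
  gcongr
  rw [Complex.norm_add_mul_I]
  apply Real.le_sqrt_of_sq_le
  rw [sq_abs]
  nlinarith [sq_nonneg (δ * k), sq_nonneg (δ * η), sq_nonneg (δ ^ 2)]

lemma tendsto_integral_shift_exp (η : ℝ) (ψ : 𝓢(ℝ, ℂ)) :
    Tendsto (fun δ : ℝ => ∫ x : ℝ,
      Complex.exp (-(2 * Real.pi * (δ - η * Complex.I)) * (|x| : ℝ)) * ψ x) (𝓝[>] 0)
      (𝓝 (∫ x : ℝ, Complex.exp (2 * Real.pi * η * Complex.I * (|x| : ℝ)) * ψ x)) := by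
  refine tendsto_integral_filter_of_dominated_convergence (fun x => ‖ψ x‖) ?_ ?_
    ψ.integrable.norm ?_
  · refine Eventually.of_forall fun δ => ?_
    have := ψ.continuous
    exact Continuous.aestronglyMeasurable (by fun_prop)
  · filter_upwards [self_mem_nhdsWithin] with δ hδ
    refine ae_of_all _ fun x => ?_
    have hδ' : 0 < δ := hδ
    rw [norm_mul, norm_exp_abs]
    refine mul_le_of_le_one_left (norm_nonneg _) ?_
    rw [Real.exp_le_one_iff]
    have : (2 * Real.pi * (δ - η * Complex.I) : ℂ).re = 2 * Real.pi * δ := by simp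
    rw [this]
    have : 0 ≤ 2 * Real.pi * δ * |x| := by positivity
    linarith
  · refine ae_of_all _ fun x => ?_
    have hc : Continuous fun δ : ℝ =>
        Complex.exp (-(2 * Real.pi * (δ - η * Complex.I)) * (|x| : ℝ)) * ψ x := by fun_prop
    have h := hc.tendsto 0
    have e : -(2 * Real.pi * (((0 : ℝ) : ℂ) - η * Complex.I)) * ((|x| : ℝ) : ℂ) =
        2 * Real.pi * η * Complex.I * ((|x| : ℝ) : ℂ) := by push_cast; ring
    rw [e] at h
    exact h.mono_left nhdsWithin_le_nhds

lemma integrable_jw_mul_schwartz (s : ℝ) (χ : 𝓢(ℝ, ℂ)) : Integrable fun k => (jw s k : ℂ) * χ k := by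
  have h := (SchwartzMap.smulLeftCLM ℂ (fun k => (jw s k : ℂ)) χ).integrable (μ := volume)
  refine h.congr (ae_of_all _ fun k => ?_)
  simp only
  rw [SchwartzMap.smulLeftCLM_apply_apply (jwC_hasTemperateGrowth s), smul_eq_mul]

/-- The undamped Lorentzian has nonintegrable poles at `k = ±η`. The factor `jw s k - jw s η`
vanishes there, and `norm_sq_shift_ge` with `abs_jw_sub_mul_le` gives a majorant independent of `δ`.
-/
lemma tendsto_integral_shift_lorentz {s : ℝ} (hs : |s| ≤ 2) {η : ℝ} (hη : 0 < η)
    (χ : 𝓢(ℝ, ℂ)) :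
    Tendsto (fun δ : ℝ => ∫ k : ℝ, 2 * (2 * Real.pi * (δ - η * Complex.I)) /
        ((2 * Real.pi * (δ - η * Complex.I)) ^ 2 + ((2 * Real.pi * k : ℝ) : ℂ) ^ 2) *
          (((jw s k - jw s η : ℝ) : ℂ) * χ k)) (𝓝[>] 0)
      (𝓝 (∫ k : ℝ, 2 * (2 * Real.pi * (-(η * Complex.I))) /
        ((2 * Real.pi * (-(η * Complex.I))) ^ 2 + ((2 * Real.pi * k : ℝ) : ℂ) ^ 2) *
          (((jw s k - jw s η : ℝ) : ℂ) * χ k))) := by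
  have hj := continuous_jw s
  have hχ := χ.continuous
  have hi : Integrable fun k => (1 + η) / (Real.pi * η ^ 2) *
      (‖(jw s k : ℂ) * χ k‖ + jw s η * ‖χ k‖) :=
    ((integrable_jw_mul_schwartz s χ).norm.add (χ.integrable.norm.const_mul _)).const_mul _
  refine tendsto_integral_filter_of_dominated_convergence _ ?_ ?_ hi ?_
  · refine Eventually.of_forall fun δ => ?_
    exact Measurable.aestronglyMeasurable (by fun_prop)
  · filter_upwards [Ioc_mem_nhdsGT (zero_lt_one (α := ℝ))] with δ hδ
    filter_upwards [ae_ne η, ae_ne (-η)] with k hk1 hk2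
    have hk : k ^ 2 - η ^ 2 ≠ 0 := by
      intro h
      rcases mul_eq_zero.1 (show (k - η) * (k + η) = 0 by linarith) with h | h
      · exact hk1 (by linarith)
      · exact hk2 (by linarith)
    have hD := norm_sq_shift_ge k η (δ := δ)
    have hk0 := abs_pos.2 hk
    have hnum : ‖(2 * (2 * Real.pi * (δ - η * Complex.I)) : ℂ)‖ ≤ 4 * Real.pi * (1 + η) := by
      have e : (2 * (2 * Real.pi * (δ - η * Complex.I)) : ℂ) =
          ((4 * Real.pi : ℝ) : ℂ) * (δ - η * Complex.I) := by push_cast; ring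
      rw [e, norm_mul, Complex.norm_real, Real.norm_of_nonneg (by positivity)]
      gcongr
      refine (norm_sub_le _ _).trans ?_
      rw [norm_mul, Complex.norm_I, mul_one, Complex.norm_real, Complex.norm_real,
        Real.norm_of_nonneg hδ.1.le, Real.norm_of_nonneg hη.le]
      linarith [hδ.2]
    have hjs := abs_jw_sub_mul_le hs k η
    have hjp : 0 < jw s k + jw s η := add_pos (jw_pos _ _) (jw_pos _ _)
    have ejw : ‖(jw s k : ℂ) * χ k‖ = jw s k * ‖χ k‖ := by
      rw [norm_mul, Complex.norm_real, Real.norm_of_nonneg (jw_pos s k).le]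
    rw [ejw, norm_mul, norm_div, norm_mul ((jw s k - jw s η : ℝ) : ℂ), Complex.norm_real,
      Real.norm_eq_abs]
    calc _ ≤ 4 * Real.pi * (1 + η) / ((2 * Real.pi) ^ 2 * |k ^ 2 - η ^ 2|) *
          (|jw s k - jw s η| * ‖χ k‖) := by gcongr
      _ ≤ 4 * Real.pi * (1 + η) / ((2 * Real.pi) ^ 2 * |k ^ 2 - η ^ 2|) *
          (((jw s k + jw s η) * |k ^ 2 - η ^ 2| / η ^ 2) * ‖χ k‖) := by
          -- Trading the difference of weights for `|k² - η²|/η²` removes the singular denominator.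
          gcongr
          rw [le_div_iff₀ (by positivity)]
          refine le_trans ?_ hjs
          gcongr
          nlinarith [sq_nonneg k]
      _ = _ := by
          field_simp
          ring
  · filter_upwards [ae_ne η, ae_ne (-η)] with k hk1 hk2
    refine Tendsto.mul_const _ ?_
    have hk : k ^ 2 - η ^ 2 ≠ 0 := by
      intro h
      rcases mul_eq_zero.1 (show (k - η) * (k + η) = 0 by linarith) with h | h
      · exact hk1 (by linarith)
      · exact hk2 (by linarith)
    have hne : (2 * Real.pi * (((0 : ℝ) : ℂ) - η * Complex.I) : ℂ) ^ 2 +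
        ((2 * Real.pi * k : ℝ) : ℂ) ^ 2 ≠ 0 := by
      have hD := norm_sq_shift_ge k η (δ := 0)
      have : 0 < (2 * Real.pi) ^ 2 * |k ^ 2 - η ^ 2| := by
        have := abs_pos.2 hk; positivity
      exact norm_pos_iff.1 (this.trans_le hD)
    have hc : ContinuousAt (fun δ : ℝ => 2 * (2 * Real.pi * (δ - η * Complex.I)) /
        ((2 * Real.pi * (δ - η * Complex.I) : ℂ) ^ 2 + ((2 * Real.pi * k : ℝ) : ℂ) ^ 2)) 0 :=
      ContinuousAt.div (by fun_prop) (by fun_prop) hne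
    have h := hc.tendsto
    simp only [Complex.ofReal_zero, zero_sub] at h
    exact h.mono_left nhdsWithin_le_nhds

/-- Now `w = -2πiη` is imaginary and the Lorentzian is not integrable. The main term is the same
pairing with `J^s` replaced by its value `jw s η` at the resonant frequency. Damping by `δ`
justifies the identity for the difference, and after `k = ηz` the limit kernel is `i/(π(1 - z²))`.
-/
lemma integral_symb_besselS_pos {s : ℝ} (hs : |s| ≤ 2) {η : ℝ} (hη : 0 < η) (ψ : 𝓢(ℝ, ℂ)) :
    ∫ x, symb x (-(2 * Real.pi * η * |η|)) * besselS s ψ x =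
      (jw s η : ℂ) * ((∫ x : ℝ, Complex.exp (2 * Real.pi * η * Complex.I * (|x| : ℝ)) * ψ x) +
        dilInt (spaceKer s) (𝓕⁻ ψ : 𝓢(ℝ, ℂ)) η) := by
  have e1 : ∀ x : ℝ, symb x (-(2 * Real.pi * η * |η|)) =
      Complex.exp (2 * Real.pi * η * Complex.I * (|x| : ℝ)) := fun x => by
    rw [symb, kap_space_pos hη]; congr 1; ring
  simp only [e1]
  have hfin : ∀ δ : ℝ, 0 < δ →
      (∫ x : ℝ, Complex.exp (-(2 * Real.pi * (δ - η * Complex.I)) * (|x| : ℝ)) * besselS s ψ x) -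
        (jw s η : ℂ) *
          ∫ x : ℝ, Complex.exp (-(2 * Real.pi * (δ - η * Complex.I)) * (|x| : ℝ)) * ψ x =
      ∫ k : ℝ, 2 * (2 * Real.pi * (δ - η * Complex.I)) /
        ((2 * Real.pi * (δ - η * Complex.I)) ^ 2 + ((2 * Real.pi * k : ℝ) : ℂ) ^ 2) *
          (((jw s k - jw s η : ℝ) : ℂ) * (𝓕⁻ ψ : 𝓢(ℝ, ℂ)) k) := by
    intro δ hδ
    have hw : 0 < (2 * Real.pi * (δ - η * Complex.I) : ℂ).re := by
      have : (2 * Real.pi * (δ - η * Complex.I) : ℂ).re = 2 * Real.pi * δ := by simp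
      rw [this]; positivity
    have hb : ∀ φ : 𝓢(ℝ, ℂ), Integrable fun k : ℝ => 2 * (2 * Real.pi * (δ - η * Complex.I)) /
        ((2 * Real.pi * (δ - η * Complex.I)) ^ 2 + ((2 * Real.pi * k : ℝ) : ℂ) ^ 2) * φ k := by
      intro φ
      obtain ⟨C, hC⟩ := exists_schwartz_bound φ
      exact (integrable_lorentz hw).mul_bdd (c := C) φ.continuous.aestronglyMeasurable
        (ae_of_all _ hC)
    rw [laplace_pairing hw, laplace_pairing hw, ← integral_const_mul,
      ← integral_sub (hb _) ((hb _).const_mul _)]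
    congr 1; ext k
    rw [fourierInv_besselS]
    push_cast
    ring
  have h1 := (tendsto_integral_shift_exp η (besselS s ψ)).sub
    ((tendsto_integral_shift_exp η ψ).const_mul (jw s η : ℂ))
  have h2 := tendsto_integral_shift_lorentz hs hη (𝓕⁻ ψ : 𝓢(ℝ, ℂ))
  have h3 := tendsto_nhds_unique (h1.congr' (by
    filter_upwards [self_mem_nhdsWithin] with δ hδ
    exact hfin δ hδ)) h2
  have h4 : ∫ k : ℝ, 2 * (2 * Real.pi * (-(η * Complex.I))) /
        ((2 * Real.pi * (-(η * Complex.I))) ^ 2 + ((2 * Real.pi * k : ℝ) : ℂ) ^ 2) *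
          (((jw s k - jw s η : ℝ) : ℂ) * (𝓕⁻ ψ : 𝓢(ℝ, ℂ)) k) =
      (jw s η : ℂ) * dilInt (spaceKer s) (𝓕⁻ ψ : 𝓢(ℝ, ℂ)) η := by
    rw [integral_eq_integral_comp_mul hη.ne', dilInt, ← integral_const_mul]
    apply integral_congr_ae
    filter_upwards [ae_ne 1, ae_ne (-1)] with z hz1 hz2
    rw [spaceKer, if_pos hη, abs_of_pos hη]
    have hz : (1 - (z : ℂ) ^ 2) ≠ 0 := by
      have : 1 - z ^ 2 ≠ 0 := by
        intro h
        rcases mul_eq_zero.1 (show (z - 1) * (z + 1) = 0 by linarith) with h | h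
        · exact hz1 (by linarith)
        · exact hz2 (by linarith)
      exact_mod_cast this
    have hj : (jw s η : ℂ) ≠ 0 := by exact_mod_cast jw_ne_zero s η
    have hpi : (Real.pi : ℂ) ≠ 0 := by exact_mod_cast Real.pi_ne_zero
    have ha : (η : ℂ) ≠ 0 := by exact_mod_cast hη.ne'
    have e2 : (2 * Real.pi * (-(η * Complex.I)) : ℂ) ^ 2 +
        ((2 * Real.pi * (η * z) : ℝ) : ℂ) ^ 2 =
        -((2 * Real.pi * η) ^ 2 * (1 - (z : ℂ) ^ 2)) := by
      push_cast
      linear_combination (4 * (Real.pi : ℂ) ^ 2 * η ^ 2) * Complex.I_sq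
    rw [e2]
    push_cast
    field_simp
  rw [h4] at h3
  linear_combination h3

/-! ### The change of variables `τ = -2πη|η|` -/

/-- The time frequency `-2πη|η|` of the space frequency `η`. -/
def dispTau (η : ℝ) : ℝ := -(2 * Real.pi * η * |η|)

lemma continuous_dispTau : Continuous dispTau := by unfold dispTau; fun_prop

lemma hasDerivAt_dispTau {η : ℝ} (hη : η ≠ 0) : HasDerivAt dispTau (-(4 * Real.pi * |η|)) η := by
  have h := (((hasDerivAt_id η).mul (hasDerivAt_abs hη)).const_mul (2 * Real.pi)).neg
  have e : dispTau = -fun y : ℝ => 2 * Real.pi * ((id : ℝ → ℝ) * fun x : ℝ => |x|) y := by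
    funext x
    simp only [dispTau, Pi.neg_apply, Pi.mul_apply, id]
    ring
  rw [e]
  refine h.congr_deriv ?_
  simp only [id, self_mul_sign]
  ring

lemma injOn_dispTau : InjOn dispTau {0}ᶜ := by
  intro η hη η' _ h
  have h1 : η * |η| = η' * |η'| := by
    have hp := Real.two_pi_pos
    unfold dispTau at h
    have : 2 * Real.pi * (η * |η|) = 2 * Real.pi * (η' * |η'|) := by linarith
    exact mul_left_cancel₀ hp.ne' this
  have h2 : |η| = |η'| := by
    have := congrArg abs h1
    rw [abs_mul, abs_mul, abs_abs, abs_abs] at this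
    exact (mul_self_inj (abs_nonneg _) (abs_nonneg _)).1 this
  rw [← h2] at h1
  exact mul_right_cancel₀ (abs_ne_zero.2 hη) h1

lemma image_dispTau : dispTau '' {0}ᶜ = {0}ᶜ := by
  have hp := Real.two_pi_pos
  ext τ
  constructor
  · rintro ⟨η, hη, rfl⟩
    have : η ≠ 0 := hη
    simp [dispTau, Real.pi_ne_zero, this]
  · intro hτ
    have hτ0 : τ ≠ 0 := hτ
    rcases lt_or_gt_of_ne hτ0 with h | h
    · have h1 : 0 < -τ / (2 * Real.pi) := div_pos (by linarith) hp
      refine ⟨Real.sqrt (-τ / (2 * Real.pi)), (Real.sqrt_pos.2 h1).ne', ?_⟩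
      rw [dispTau, abs_of_nonneg (Real.sqrt_nonneg _), mul_assoc, Real.mul_self_sqrt h1.le]
      field_simp
    · have h1 : 0 < τ / (2 * Real.pi) := div_pos h hp
      refine ⟨-Real.sqrt (τ / (2 * Real.pi)), (neg_lt_zero.2 (Real.sqrt_pos.2 h1)).ne, ?_⟩
      rw [dispTau, abs_neg, abs_of_nonneg (Real.sqrt_nonneg _), mul_neg, neg_mul, neg_neg,
        mul_assoc, Real.mul_self_sqrt h1.le]
      field_simp

lemma lintegral_dispTau (F : ℝ → ℝ≥0∞) :
    ∫⁻ η, ENNReal.ofReal (4 * Real.pi * |η|) * F (dispTau η) = ∫⁻ τ, F τ := by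
  have h := lintegral_image_eq_lintegral_abs_deriv_mul (f := dispTau)
    (f' := fun η => -(4 * Real.pi * |η|)) (measurableSet_singleton (0 : ℝ)).compl
    (fun η hη => (hasDerivAt_dispTau hη).hasDerivWithinAt) injOn_dispTau F
  rw [image_dispTau, restrict_compl_singleton] at h
  rw [h]
  congr 1; ext η
  rw [abs_neg, abs_of_nonneg (a := 4 * Real.pi * |η|) (by positivity)]

lemma integral_dispTau (F : ℝ → ℂ) :
    ∫ η, ((4 * Real.pi * |η| : ℝ) : ℂ) * F (dispTau η) = ∫ τ, F τ := by
  have h := integral_image_eq_integral_abs_deriv_smul (f := dispTau)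
    (f' := fun η => -(4 * Real.pi * |η|)) (measurableSet_singleton (0 : ℝ)).compl
    (fun η hη => (hasDerivAt_dispTau hη).hasDerivWithinAt) injOn_dispTau F
  rw [image_dispTau, restrict_compl_singleton] at h
  rw [h]
  congr 1; ext η
  rw [abs_neg, abs_of_nonneg (a := 4 * Real.pi * |η|) (by positivity), Complex.real_smul]

/-! ### The data in the space variable -/

/-- The factor of the change of data. -/
def dataFactor (s η : ℝ) : ℝ :=
  jw s η * (4 * Real.pi * |η|) * jw (-((2 * s + 1) / 4)) (dispTau η)

lemma continuous_dataFactor (s : ℝ) : Continuous (dataFactor s) := by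
  have h1 := continuous_jw s
  have h2 := (continuous_jw (-((2 * s + 1) / 4))).comp continuous_dispTau
  unfold dataFactor
  exact (h1.mul (by fun_prop)).mul h2

lemma dataFactor_nonneg (s η : ℝ) : 0 ≤ dataFactor s η := by
  have h1 := jw_pos s η
  have h2 := jw_pos (-((2 * s + 1) / 4)) (dispTau η)
  unfold dataFactor; positivity

lemma jw_sq (s k : ℝ) : jw s k ^ 2 = (1 + (2 * Real.pi * k) ^ 2) ^ s := by
  rw [jw, ← Real.rpow_natCast, ← Real.rpow_mul (by positivity)]
  congr 1; push_cast; ring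

/-- Put `a = (2πη)²`, so the time frequency contributes `a²`. With `σ = (2s+1)/4` the weights give
`(1 + a)^(s - 2σ) = (1 + a)^(-1/2)` up to a constant, which absorbs one factor `√a`. One factor
`4π|η|` is left, the Jacobian of the change of variables. -/
lemma dataFactor_sq_le {s : ℝ} (hs : -(1 / 2) ≤ s) (η : ℝ) :
    dataFactor s η ^ 2 ≤ 2 ^ (1 + (2 * s + 1) / 4) * (4 * Real.pi * |η|) := by
  set σ := (2 * s + 1) / 4 with hσ
  have hσ0 : 0 ≤ σ := by rw [hσ]; linarith
  set a := (2 * Real.pi * η) ^ 2 with ha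
  have ha0 : 0 ≤ a := by positivity
  have h1 : (2 * Real.pi * dispTau η) ^ 2 = a ^ 2 := by
    rw [dispTau, ha]
    have : |η| ^ 2 = η ^ 2 := sq_abs η
    linear_combination (16 * Real.pi ^ 4 * η ^ 2) * this
  have h2 : 4 * Real.pi * |η| = 2 * Real.sqrt a := by
    rw [ha, Real.sqrt_sq_eq_abs, abs_mul, abs_of_pos Real.two_pi_pos]; ring
  rw [dataFactor, mul_pow, mul_pow, jw_sq, jw_sq, h1]
  -- Uses `1 + a² ≥ (1 + a)²/2` and `σ ≥ 0`, that is `s ≥ -1/2`.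
  have h3 : (1 + a ^ 2) ^ (-σ) ≤ ((1 + a) ^ 2 / 2) ^ (-σ) :=
    Real.rpow_le_rpow_of_nonpos (by positivity) (by nlinarith [sq_nonneg (a - 1)]) (by linarith)
  have h4 : ((1 + a) ^ 2 / 2) ^ (-σ) = 2 ^ σ * (1 + a) ^ (-(2 * σ)) := by
    rw [Real.div_rpow (by positivity) (by norm_num), ← Real.rpow_natCast,
      ← Real.rpow_mul (by positivity), Real.rpow_neg (x := 2) (by norm_num), div_inv_eq_mul,
      mul_comm]
    congr 2; push_cast; ring
  have h5 : (1 + a) ^ s * (1 + a) ^ (-(2 * σ)) = (1 + a) ^ (-(1 / 2) : ℝ) := by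
    rw [← Real.rpow_add (by positivity)]; congr 1; rw [hσ]; ring
  have h6 : Real.sqrt a * (1 + a) ^ (-(1 / 2) : ℝ) ≤ 1 := by
    rw [Real.rpow_neg (by positivity), ← Real.sqrt_eq_rpow, ← div_eq_mul_inv]
    exact div_le_one_of_le₀ (Real.sqrt_le_sqrt (by linarith)) (Real.sqrt_nonneg _)
  have hpos : 0 ≤ (1 + a) ^ s := by positivity
  calc (1 + a) ^ s * (4 * Real.pi * |η|) ^ 2 * (1 + a ^ 2) ^ (-σ)
      ≤ (1 + a) ^ s * (4 * Real.pi * |η|) ^ 2 * (2 ^ σ * (1 + a) ^ (-(2 * σ))) := by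
        rw [← h4]; gcongr
    _ = 2 * 2 ^ σ * (4 * Real.pi * |η|) * (Real.sqrt a * ((1 + a) ^ s * (1 + a) ^ (-(2 * σ)))) := by
        rw [h2]; ring
    _ ≤ 2 * 2 ^ σ * (4 * Real.pi * |η|) * 1 := by rw [h5]; gcongr
    _ = _ := by rw [Real.rpow_add (by norm_num), Real.rpow_one]; ring

lemma lintegral_spaceData_le {s : ℝ} (hs : -(1 / 2) ≤ s) (Φ : ℝ → ℂ) :
    ∫⁻ η, ‖(dataFactor s η : ℂ) * Φ (dispTau η)‖ₑ ^ 2 ≤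
      ENNReal.ofReal (2 ^ (1 + (2 * s + 1) / 4)) * ∫⁻ τ, ‖Φ τ‖ₑ ^ 2 := by
  rw [← lintegral_dispTau fun τ => ‖Φ τ‖ₑ ^ 2, ← lintegral_const_mul' _ _ ENNReal.ofReal_ne_top]
  gcongr with η
  rw [enorm_mul, mul_pow, ← mul_assoc, ← ENNReal.ofReal_mul (by positivity)]
  gcongr
  rw [← ofReal_norm, Complex.norm_real, Real.norm_of_nonneg (dataFactor_nonneg s η),
    ← ENNReal.ofReal_pow (dataFactor_nonneg s η)]
  exact ENNReal.ofReal_le_ofReal (dataFactor_sq_le hs η)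

lemma memLp_spaceData {s : ℝ} (hs : -(1 / 2) ≤ s) (Φ : Lp ℂ 2 (volume : Measure ℝ)) :
    MemLp (fun η => (dataFactor s η : ℂ) * Φ (dispTau η)) 2 := by
  refine ⟨Measurable.aestronglyMeasurable ?_, ?_⟩
  · exact (Complex.measurable_ofReal.comp (continuous_dataFactor s).measurable).mul
      ((Lp.stronglyMeasurable Φ).measurable.comp continuous_dispTau.measurable)
  · have h := lintegral_spaceData_le hs Φ
    rw [← eLpNorm_two_sq, ← eLpNorm_two_sq] at h
    have : eLpNorm (fun η => (dataFactor s η : ℂ) * Φ (dispTau η)) 2 volume ^ 2 < ⊤ :=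
      h.trans_lt (ENNReal.mul_lt_top ENNReal.ofReal_lt_top (ENNReal.pow_lt_top (Lp.memLp Φ).2))
    exact lt_of_not_ge fun h' => by
      rw [top_le_iff] at h'
      rw [h'] at this
      simp at this

/-- The data `(1 + (2πη)²)^(s/2) 4π|η| f̂(-2πη|η|)` of the space traces. -/
def spaceData {s : ℝ} (hs : -(1 / 2) ≤ s) (Φ : Lp ℂ 2 (volume : Measure ℝ)) :
    Lp ℂ 2 (volume : Measure ℝ) := (memLp_spaceData hs Φ).toLp _

lemma spaceData_coe {s : ℝ} (hs : -(1 / 2) ≤ s) (Φ : Lp ℂ 2 (volume : Measure ℝ)) :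
    spaceData hs Φ =ᵐ[volume] fun η => (dataFactor s η : ℂ) * Φ (dispTau η) :=
  (memLp_spaceData hs Φ).coeFn_toLp

lemma norm_spaceData_le {s : ℝ} (hs : -(1 / 2) ≤ s) (Φ : Lp ℂ 2 (volume : Measure ℝ)) :
    ‖spaceData hs Φ‖ ≤ 2 ^ (1 + (2 * s + 1) / 4) * ‖Φ‖ := by
  have h := lintegral_spaceData_le hs Φ
  rw [← eLpNorm_two_sq, ← eLpNorm_two_sq] at h
  have h1 : (1 : ℝ) ≤ 2 ^ (1 + (2 * s + 1) / 4) := Real.one_le_rpow (by norm_num) (by linarith)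
  -- The constant is at least one, so it may replace its square root.
  have h2 : eLpNorm (fun η => (dataFactor s η : ℂ) * Φ (dispTau η)) 2 volume ≤
      ENNReal.ofReal (2 ^ (1 + (2 * s + 1) / 4)) * eLpNorm Φ 2 volume := by
    refine (ENNReal.pow_le_pow_left_iff two_ne_zero).1 (h.trans ?_)
    rw [mul_pow]
    gcongr
    exact le_self_pow₀ (by rw [← ENNReal.ofReal_one]; exact ENNReal.ofReal_le_ofReal h1) two_ne_zero
  rw [spaceData, Lp.norm_toLp, Lp.norm_def]
  refine (ENNReal.toReal_mono (ENNReal.mul_ne_top ENNReal.ofReal_ne_top (Lp.memLp Φ).2.ne) h2).trans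
    (le_of_eq ?_)
  rw [ENNReal.toReal_mul, ENNReal.toReal_ofReal (by positivity)]

/-! ### The space operator -/

/-- Folding `h ↦ 1_{x > 0} (h(x) + h(-x))`. -/
def foldFun (h : ℝ → ℂ) : ℝ → ℂ := indicator (Ioi 0) fun x => h x + h (-x)

lemma norm_indicator_one_le (S : Set ℝ) (x : ℝ) : ‖indicator S (fun _ => (1 : ℂ)) x‖ ≤ 1 := by
  by_cases h : x ∈ S
  · rw [indicator_of_mem h]; simp
  · rw [indicator_of_notMem h]; simp

/-- Restriction to positive arguments, on `L²`. -/
def posPart : Lp ℂ 2 (volume : Measure ℝ) →L[ℂ] Lp ℂ 2 (volume : Measure ℝ) :=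
  bmul (indicator (Ioi 0) fun _ => 1) (measurable_const.indicator measurableSet_Ioi) 1
    (norm_indicator_one_le _)

lemma posPart_coe (f : Lp ℂ 2 (volume : Measure ℝ)) :
    posPart f =ᵐ[volume] indicator (Ioi 0) f := by
  filter_upwards [bmul_coe (indicator (Ioi 0) fun _ => 1)
    (measurable_const.indicator measurableSet_Ioi) 1 (norm_indicator_one_le _) f] with x hx
  rw [posPart, hx]
  by_cases h : x ∈ Ioi (0 : ℝ)
  · rw [indicator_of_mem h, indicator_of_mem h, one_mul]
  · rw [indicator_of_notMem h, indicator_of_notMem h, zero_mul]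

/-- Reflection on `L²`. -/
def reflOp : Lp ℂ 2 (volume : Measure ℝ) →L[ℂ] Lp ℂ 2 (volume : Measure ℝ) :=
  (Lp.compMeasurePreservingₗᵢ ℂ (fun x : ℝ => -x)
    (Measure.measurePreserving_neg (volume : Measure ℝ))).toContinuousLinearMap

lemma reflOp_coe (f : Lp ℂ 2 (volume : Measure ℝ)) :
    reflOp f =ᵐ[volume] fun x => f (-x) :=
  Lp.coeFn_compMeasurePreserving f (Measure.measurePreserving_neg (volume : Measure ℝ))

/-- The main part of the space operator. -/
def mainOp : Lp ℂ 2 (volume : Measure ℝ) →L[ℂ] Lp ℂ 2 (volume : Measure ℝ) :=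
  posPart ∘L fourierInvCLM ℂ (Lp ℂ 2 (volume : Measure ℝ)) ∘L posPart ∘L
    (ContinuousLinearMap.id ℂ _ + reflOp)

lemma integrable_foldFun {h : ℝ → ℂ} (h1 : Integrable h) : Integrable (foldFun h) :=
  (h1.add h1.comp_neg).indicator measurableSet_Ioi

lemma memLp_comp_neg {h : ℝ → ℂ} {p : ℝ≥0∞} (h1 : MemLp h p) : MemLp (fun x => h (-x)) p :=
  h1.comp_measurePreserving (Measure.measurePreserving_neg (volume : Measure ℝ))

lemma memLp_foldFun {h : ℝ → ℂ} {p : ℝ≥0∞} (h1 : MemLp h p) : MemLp (foldFun h) p :=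
  (h1.add (memLp_comp_neg h1)).indicator measurableSet_Ioi

/-- A pairing with a function of `|x|` only sees the even part; folding it to the half-line makes it
an ordinary inverse transform. -/
lemma fourierInv_foldFun {h : ℝ → ℂ} (h1 : Integrable h) (η : ℝ) :
    (𝓕⁻ (foldFun h) : ℝ → ℂ) η =
      ∫ x : ℝ, Complex.exp (2 * Real.pi * η * Complex.I * (|x| : ℝ)) * h x := by
  have hb : ∀ {g : ℝ → ℂ}, Integrable g →
      Integrable fun x : ℝ => Complex.exp (2 * Real.pi * η * Complex.I * (|x| : ℝ)) * g x := by
    intro g hg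
    refine hg.bdd_mul (c := 1) (Continuous.aestronglyMeasurable (by fun_prop))
      (ae_of_all _ fun x => ?_)
    have e : (2 * Real.pi * η * Complex.I * ((|x| : ℝ) : ℂ)) =
        ((2 * Real.pi * η * |x| : ℝ) : ℂ) * Complex.I := by push_cast; ring
    rw [e, Complex.norm_exp_ofReal_mul_I]
  have e1 : (𝓕⁻ (foldFun h) : ℝ → ℂ) η = ∫ x in Ioi (0 : ℝ),
      Complex.exp (2 * Real.pi * η * Complex.I * (|x| : ℝ)) * (h x + h (-x)) := by
    rw [Real.fourierInv_eq_fourier_neg, Real.fourier_real_eq_integral_exp_smul,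
      ← integral_indicator measurableSet_Ioi]
    congr 1; ext x
    by_cases hx : x ∈ Ioi (0 : ℝ)
    · rw [foldFun, indicator_of_mem hx, indicator_of_mem hx, abs_of_pos hx, smul_eq_mul]
      congr 2
      push_cast
      ring
    · rw [foldFun, indicator_of_notMem hx, indicator_of_notMem hx, smul_zero]
  have e2 : ∫ x in Ioi (0 : ℝ), Complex.exp (2 * Real.pi * η * Complex.I * (|x| : ℝ)) * h (-x) =
      ∫ x in Iic (0 : ℝ), Complex.exp (2 * Real.pi * η * Complex.I * (|x| : ℝ)) * h x := by
    have := integral_comp_neg_Ioi (0 : ℝ)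
      (fun x : ℝ => Complex.exp (2 * Real.pi * η * Complex.I * (|x| : ℝ)) * h x)
    simpa using this
  rw [e1]
  simp only [mul_add]
  rw [integral_add (hb h1).integrableOn (hb h1.comp_neg).integrableOn, e2, add_comm,
    ← setIntegral_union (Iic_disjoint_Ioi le_rfl) measurableSet_Ioi (hb h1).integrableOn
      (hb h1).integrableOn, Iic_union_Ioi, setIntegral_univ]

lemma mainOp_toLp {h : ℝ → ℂ} (h1 : Integrable h) (h2 : MemLp h 2) :
    mainOp (h2.toLp h) =ᵐ[volume] indicator (Ioi 0) fun η =>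
      ∫ x : ℝ, Complex.exp (2 * Real.pi * η * Complex.I * (|x| : ℝ)) * h x := by
  have e : posPart (h2.toLp h + reflOp (h2.toLp h)) = (memLp_foldFun h2).toLp _ := by
    ext1
    have hq := (Measure.measurePreserving_neg (volume : Measure ℝ)).quasiMeasurePreserving.ae_eq_comp
      h2.coeFn_toLp
    filter_upwards [posPart_coe (h2.toLp h + reflOp (h2.toLp h)), (memLp_foldFun h2).coeFn_toLp,
      Lp.coeFn_add (h2.toLp h) (reflOp (h2.toLp h)), reflOp_coe (h2.toLp h), h2.coeFn_toLp, hq]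
      with x a1 a2 a3 a4 a5 a6
    rw [a1, a2, foldFun]
    by_cases hx : x ∈ Ioi (0 : ℝ)
    · rw [indicator_of_mem hx, indicator_of_mem hx, a3, Pi.add_apply, a4, a5]
      congr 1
    · rw [indicator_of_notMem hx, indicator_of_notMem hx]
  have e' : mainOp (h2.toLp h) = posPart (𝓕⁻ ((memLp_foldFun h2).toLp (foldFun h))) := by
    rw [← e]; rfl
  rw [e']
  filter_upwards [posPart_coe (𝓕⁻ ((memLp_foldFun h2).toLp (foldFun h))),
    lp_fourierInv_ae_eq (integrable_foldFun h1) (memLp_foldFun h2)] with η a1 a2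
  rw [a1]
  by_cases hη : η ∈ Ioi (0 : ℝ)
  · rw [indicator_of_mem hη, indicator_of_mem hη, a2, fourierInv_foldFun h1]
  · rw [indicator_of_notMem hη, indicator_of_notMem hη]

/-- The space operator with correction kernel `M`. -/
def spaceOp {M : ℝ → ℝ → ℂ} {c : ℝ → ℝ≥0∞} (hM : DilKernel M c) :
    Lp ℂ 2 (volume : Measure ℝ) →L[ℂ] Lp ℂ 2 (volume : Measure ℝ) :=
  mainOp + dilOp hM ∘L fourierInvCLM ℂ (Lp ℂ 2 (volume : Measure ℝ))

lemma spaceOp_toLp {M : ℝ → ℝ → ℂ} {c : ℝ → ℝ≥0∞} (hM : DilKernel M c) {h : ℝ → ℂ}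
    (h1 : Integrable h) (h2 : MemLp h 2) :
    spaceOp hM (h2.toLp h) =ᵐ[volume] fun η => indicator (Ioi 0) (fun η : ℝ =>
      ∫ x : ℝ, Complex.exp (2 * Real.pi * η * Complex.I * (|x| : ℝ)) * h x) η +
        dilInt M (𝓕⁻ h) η := by
  have e : spaceOp hM (h2.toLp h) = mainOp (h2.toLp h) + dilOp hM (𝓕⁻ (h2.toLp h)) := rfl
  rw [e]
  filter_upwards [Lp.coeFn_add (mainOp (h2.toLp h)) (dilOp hM (𝓕⁻ (h2.toLp h))),
    mainOp_toLp h1 h2, dilOp_coe hM (𝓕⁻ (h2.toLp h)), ae_ne 0] with η a1 a2 a3 hη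
  rw [a1, Pi.add_apply, a2, a3, dilInt_congr_ae (lp_fourierInv_ae_eq h1 h2) hη]

/-- Identifies the operator: at `η` it pairs `J^s ψ` with the spatial profile, normalized by `jw s
η`. Its transpose therefore sends data to `J^s` of the superposition of these profiles. -/
lemma spaceOp_schwartz {s : ℝ} (h1 : -(1 / 2) < s) (h2 : s < 3 / 2) (ψ : 𝓢(ℝ, ℂ)) :
    spaceOp (dilKernel_spaceKer h1 h2) (ψ.toLp 2 volume) =ᵐ[volume] fun η =>
      (jw s η : ℂ)⁻¹ * ∫ x, symb x (dispTau η) * besselS s ψ x := by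
  have hs : |s| ≤ 2 := abs_le.2 ⟨by linarith, by linarith⟩
  filter_upwards [spaceOp_toLp (dilKernel_spaceKer h1 h2) ψ.integrable (ψ.memLp 2 volume), ae_ne 0]
    with η hη hη0
  have e : spaceOp (dilKernel_spaceKer h1 h2) (ψ.toLp 2 volume) =
    spaceOp (dilKernel_spaceKer h1 h2) ((ψ.memLp 2 volume).toLp ψ) := rfl
  have hj : (jw s η : ℂ) ≠ 0 := by exact_mod_cast jw_ne_zero s η
  rw [e, hη, ← SchwartzMap.fourierInv_coe]
  rcases lt_or_gt_of_ne hη0 with h | h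
  · rw [indicator_of_notMem (by simpa using h.le), zero_add, dispTau,
      integral_symb_besselS_neg s h, inv_mul_cancel_left₀ hj]
  · rw [indicator_of_mem (mem_Ioi.2 h), dispTau, integral_symb_besselS_pos hs h,
      inv_mul_cancel_left₀ hj]

/-! ### Space traces -/

/-- The phase `e^{2πitτ}` at `τ = -2πη|η|`. -/
def phase (t η : ℝ) : ℂ := Complex.exp (((2 * Real.pi * (t * dispTau η) : ℝ) : ℂ) * Complex.I)

lemma norm_phase (t η : ℝ) : ‖phase t η‖ = 1 := Complex.norm_exp_ofReal_mul_I _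

lemma continuous_phase : Continuous fun z : ℝ × ℝ => phase z.1 z.2 := by
  have := continuous_dispTau
  unfold phase
  fun_prop

lemma measurable_phase (t : ℝ) : Measurable (phase t) := by
  have := continuous_dispTau.measurable
  unfold phase
  fun_prop

/-- Multiplication by the phase on `L²`. -/
def phaseOp (t : ℝ) : Lp ℂ 2 (volume : Measure ℝ) →L[ℂ] Lp ℂ 2 (volume : Measure ℝ) :=
  bmul (phase t) (measurable_phase t) 1 fun η => (norm_phase t η).le

lemma norm_phaseOp_le (t : ℝ) (φ : Lp ℂ 2 (volume : Measure ℝ)) : ‖phaseOp t φ‖ ≤ ‖φ‖ := by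
  have h := norm_bmul_le (phase t) (measurable_phase t) 1 (fun η => (norm_phase t η).le) φ
  rwa [one_mul] at h

lemma phaseOp_coe (t : ℝ) (φ : Lp ℂ 2 (volume : Measure ℝ)) :
    phaseOp t φ =ᵐ[volume] fun η => phase t η * φ η :=
  bmul_coe (phase t) (measurable_phase t) 1 (fun η => (norm_phase t η).le) φ

lemma continuous_phaseOp (φ : Lp ℂ 2 (volume : Measure ℝ)) : Continuous fun t => phaseOp t φ := by
  rw [continuous_iff_continuousAt]
  intro t₀
  refine tendsto_bmul measurable_phase (measurable_phase t₀) (fun t η => (norm_phase t η).le)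
    (fun η => (norm_phase t₀ η).le) (ae_of_all _ fun η => ?_) φ
  have : Continuous fun t => phase t η := by unfold phase; fun_prop
  exact this.tendsto t₀

/-- The profile `J^s ℒf(·, t)`, for the space operator `K`. -/
def profile (K : Lp ℂ 2 (volume : Measure ℝ) →L[ℂ] Lp ℂ 2 (volume : Measure ℝ))
    (φ : Lp ℂ 2 (volume : Measure ℝ)) (t : ℝ) : Lp ℂ 2 (volume : Measure ℝ) :=
  transp K (phaseOp t φ)

lemma norm_profile_le (K : Lp ℂ 2 (volume : Measure ℝ) →L[ℂ] Lp ℂ 2 (volume : Measure ℝ))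
    (φ : Lp ℂ 2 (volume : Measure ℝ)) (t : ℝ) : ‖profile K φ t‖ ≤ ‖K‖ * ‖φ‖ :=
  (norm_transp_le _ _).trans (mul_le_mul_of_nonneg_left (norm_phaseOp_le t φ) (norm_nonneg _))

lemma continuous_profile (K : Lp ℂ 2 (volume : Measure ℝ) →L[ℂ] Lp ℂ 2 (volume : Measure ℝ))
    (φ : Lp ℂ 2 (volume : Measure ℝ)) : Continuous (profile K φ) :=
  (continuous_transp K).comp (continuous_phaseOp φ)

lemma integral_norm_mul_le (f g : Lp ℂ 2 (volume : Measure ℝ)) :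
    ∫ x, ‖f x * g x‖ ≤ ‖f‖ * ‖g‖ := by
  change ∫ x, ‖((f : ℝ → ℂ) * g) x‖ ≤ _
  rw [integral_norm_eq_lintegral_enorm ((Lp.aestronglyMeasurable f).mul (Lp.aestronglyMeasurable g)),
    Lp.norm_def, Lp.norm_def, ← ENNReal.toReal_mul]
  refine ENNReal.toReal_mono (ENNReal.mul_ne_top (Lp.memLp f).2.ne (Lp.memLp g).2.ne) ?_
  have h := eLpNorm_smul_le_mul_eLpNorm (p := 2) (q := 2) (r := 1)
    (Lp.aestronglyMeasurable g) (Lp.aestronglyMeasurable f)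
  rw [eLpNorm_one_eq_lintegral_enorm] at h
  exact h

lemma integrable_lp_mul (f g : Lp ℂ 2 (volume : Measure ℝ)) : Integrable fun x => f x * g x :=
  (Lp.memLp f).integrable_mul (Lp.memLp g)

/-- The distribution `ℒf(·, t)`. -/
def spaceTrace {s : ℝ} (h1 : -(1 / 2) < s) (h2 : s < 3 / 2) (Φ : Lp ℂ 2 (volume : Measure ℝ))
    (t : ℝ) : 𝓢'(ℝ, ℂ) :=
  ofData s (𝓕 (profile (spaceOp (dilKernel_spaceKer h1 h2)) (spaceData h1.le Φ) t))

lemma bessel_spaceTrace {s : ℝ} (h1 : -(1 / 2) < s) (h2 : s < 3 / 2)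
    (Φ : Lp ℂ 2 (volume : Measure ℝ)) (t : ℝ) : bessel s (spaceTrace h1 h2 Φ t) =
      ((profile (spaceOp (dilKernel_spaceKer h1 h2)) (spaceData h1.le Φ) t :
        Lp ℂ 2 (volume : Measure ℝ)) : 𝓢'(ℝ, ℂ)) := by
  rw [spaceTrace, bessel_ofData, fourierInv_fourier_eq]

/-- The Laplace transform in space of a slice. -/
def slicePairing (Ψ : 𝓢(ℝ × ℝ, ℂ)) (t η : ℝ) : ℂ := ∫ x, symb x (dispTau η) * Ψ (x, t)

lemma measurable_slicePairing (Ψ : 𝓢(ℝ × ℝ, ℂ)) :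
    StronglyMeasurable fun z : ℝ × ℝ => slicePairing Ψ z.1 z.2 := by
  unfold slicePairing
  refine StronglyMeasurable.integral_prod_right (f := fun (z : ℝ × ℝ) (x : ℝ) =>
    symb x (dispTau z.2) * Ψ (x, z.1)) ?_
  refine Continuous.stronglyMeasurable ?_
  have e1 : Continuous fun y : (ℝ × ℝ) × ℝ => symb y.2 (dispTau y.1.2) :=
    continuous_symb.comp (continuous_snd.prodMk (continuous_dispTau.comp continuous_fst.snd))
  have e2 : Continuous fun y : (ℝ × ℝ) × ℝ => Ψ (y.2, y.1.1) :=
    Ψ.continuous.comp (continuous_snd.prodMk continuous_fst.fst)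
  exact e1.mul e2

lemma spaceTrace_slice {s : ℝ} (h1 : -(1 / 2) < s) (h2 : s < 3 / 2)
    (Φ : Lp ℂ 2 (volume : Measure ℝ)) (t : ℝ) (Ψ : 𝓢(ℝ × ℝ, ℂ)) :
    spaceTrace h1 h2 Φ t (timeSlice t Ψ) = ∫ η, phaseOp t (spaceData h1.le Φ) η *
      spaceOp (dilKernel_spaceKer h1 h2) ((besselS (-s) (timeSlice t Ψ)).toLp 2 volume) η := by
  have e : spaceTrace h1 h2 Φ t = bessel (-s) (bessel s (spaceTrace h1 h2 Φ t)) := by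
    rw [bessel_bessel, neg_add_cancel, bessel_zero]
  rw [e, bessel_spaceTrace, bessel_apply, Lp.toTemperedDistribution_apply,
    ← integral_transp_mul]
  apply integral_congr_ae
  filter_upwards [(besselS (-s) (timeSlice t Ψ)).coeFn_toLp 2 volume] with x hx
  rw [hx, smul_eq_mul, mul_comm]
  rfl

lemma spaceTrace_integrand_ae {s : ℝ} (h1 : -(1 / 2) < s) (h2 : s < 3 / 2)
    (Φ : Lp ℂ 2 (volume : Measure ℝ)) (t : ℝ) (Ψ : 𝓢(ℝ × ℝ, ℂ)) :
    (fun η => phaseOp t (spaceData h1.le Φ) η * spaceOp (dilKernel_spaceKer h1 h2)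
      ((besselS (-s) (timeSlice t Ψ)).toLp 2 volume) η) =ᵐ[volume] fun η =>
      (phase t η * ((dataFactor s η : ℂ) * Φ (dispTau η))) *
        ((jw s η : ℂ)⁻¹ * slicePairing Ψ t η) := by
  filter_upwards [phaseOp_coe t (spaceData h1.le Φ), spaceData_coe h1.le Φ,
    spaceOp_schwartz h1 h2 (besselS (-s) (timeSlice t Ψ))] with η a1 a2 a3
  rw [a1, a2, a3, besselS_besselS, add_neg_cancel, besselS_zero]
  rfl

lemma exists_spaceTrace_bound {s : ℝ} (h1 : -(1 / 2) < s) (h2 : s < 3 / 2)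
    (Φ : Lp ℂ 2 (volume : Measure ℝ)) (Ψ : 𝓢(ℝ × ℝ, ℂ)) :
    ∃ C : ℝ, ∀ t, ∫ η, ‖phaseOp t (spaceData h1.le Φ) η * spaceOp (dilKernel_spaceKer h1 h2)
      ((besselS (-s) (timeSlice t Ψ)).toLp 2 volume) η‖ ≤ C * (1 + t ^ 2)⁻¹ := by
  set K := spaceOp (dilKernel_spaceKer h1 h2)
  obtain ⟨p, -, h⟩ := exists_timeSlice_bound
    (SchwartzMap.toLpCLM ℂ ℂ 2 (volume : Measure ℝ) ∘L besselSCLM (-s))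
  refine ⟨‖spaceData h1.le Φ‖ * ‖K‖ * p Ψ, fun t => ?_⟩
  refine (integral_norm_mul_le _ _).trans ?_
  have h3 := h t Ψ
  calc _ ≤ ‖spaceData h1.le Φ‖ * (‖K‖ * (p Ψ * (1 + t ^ 2)⁻¹)) := by
        gcongr
        · exact norm_phaseOp_le t _
        · refine (K.le_opNorm _).trans ?_
          gcongr
          exact h3
    _ = _ := by ring

lemma integrable_spaceTrace_prod {s : ℝ} (h1 : -(1 / 2) < s) (h2 : s < 3 / 2)
    (Φ : Lp ℂ 2 (volume : Measure ℝ)) (Ψ : 𝓢(ℝ × ℝ, ℂ)) :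
    Integrable (fun z : ℝ × ℝ => (phase z.1 z.2 * ((dataFactor s z.2 : ℂ) * Φ (dispTau z.2))) *
        ((jw s z.2 : ℂ)⁻¹ * slicePairing Ψ z.1 z.2)) (volume.prod volume) := by
  have hm : StronglyMeasurable fun z : ℝ × ℝ =>
      (phase z.1 z.2 * ((dataFactor s z.2 : ℂ) * Φ (dispTau z.2))) *
        ((jw s z.2 : ℂ)⁻¹ * slicePairing Ψ z.1 z.2) := by
    refine (continuous_phase.stronglyMeasurable.mul (StronglyMeasurable.mul ?_ ?_)).mul
      (StronglyMeasurable.mul ?_ (measurable_slicePairing Ψ))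
    · exact (Complex.continuous_ofReal.comp
        ((continuous_dataFactor s).comp continuous_snd)).stronglyMeasurable
    · exact (Lp.stronglyMeasurable Φ).comp_measurable
        (continuous_dispTau.comp continuous_snd).measurable
    · exact ((Complex.continuous_ofReal.comp
        ((continuous_jw s).comp continuous_snd)).measurable.inv).stronglyMeasurable
  rw [integrable_prod_iff hm.aestronglyMeasurable]
  constructor
  · refine ae_of_all _ fun t => ?_
    exact (integrable_lp_mul _ _).congr (spaceTrace_integrand_ae h1 h2 Φ t Ψ)
  · obtain ⟨C, hC⟩ := exists_spaceTrace_bound h1 h2 Φ Ψ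
    refine (integrable_inv_one_add_sq.const_mul C).mono' ?_ (ae_of_all _ fun t => ?_)
    · exact (StronglyMeasurable.integral_prod_right (f := fun t η =>
        ‖(phase t η * ((dataFactor s η : ℂ) * Φ (dispTau η))) *
        ((jw s η : ℂ)⁻¹ * slicePairing Ψ t η)‖) hm.norm).aestronglyMeasurable
    · rw [Real.norm_of_nonneg (integral_nonneg fun η => norm_nonneg _)]
      refine le_trans (le_of_eq ?_) (hC t)
      apply integral_congr_ae
      filter_upwards [spaceTrace_integrand_ae h1 h2 Φ t Ψ] with η hη
      rw [hη]

lemma spaceTrace_slice' {s : ℝ} (h1 : -(1 / 2) < s) (h2 : s < 3 / 2)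
    (Φ : Lp ℂ 2 (volume : Measure ℝ)) (t : ℝ) (Ψ : 𝓢(ℝ × ℝ, ℂ)) :
    spaceTrace h1 h2 Φ t (timeSlice t Ψ) = ∫ η,
      (phase t η * ((dataFactor s η : ℂ) * Φ (dispTau η))) *
        ((jw s η : ℂ)⁻¹ * slicePairing Ψ t η) := by
  rw [spaceTrace_slice]
  exact integral_congr_ae (spaceTrace_integrand_ae h1 h2 Φ t Ψ)

/-- The Fourier-Laplace transform of a test function. -/
def fullPairing (Ψ : 𝓢(ℝ × ℝ, ℂ)) (τ : ℝ) : ℂ :=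
  ∫ x, symb x τ * (𝓕⁻ (spaceSlice x Ψ) : 𝓢(ℝ, ℂ)) τ

/-- Fubini: the phase at `η` is the kernel of the inverse time transform at the frequency `dispTau
η`. -/
lemma integral_phase_slicePairing (Ψ : 𝓢(ℝ × ℝ, ℂ)) (η : ℝ) :
    ∫ t, phase t η * slicePairing Ψ t η = fullPairing Ψ (dispTau η) := by
  have hi : Integrable (fun z : ℝ × ℝ => phase z.1 η * (symb z.2 (dispTau η) * Ψ (z.2, z.1)))
      (volume.prod volume) := by
    have hΨ : Integrable (fun z : ℝ × ℝ => Ψ z.swap) (volume.prod volume) := by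
      have := (Ψ.integrable (μ := volume)).swap
      exact this
    refine Integrable.mono' hΨ.norm ?_ (ae_of_all _ fun z => ?_)
    · refine Continuous.aestronglyMeasurable ?_
      have e1 : Continuous fun z : ℝ × ℝ => phase z.1 η :=
        continuous_phase.comp (continuous_fst.prodMk continuous_const)
      have e2 : Continuous fun z : ℝ × ℝ => symb z.2 (dispTau η) :=
        continuous_symb.comp (continuous_snd.prodMk continuous_const)
      have e3 : Continuous fun z : ℝ × ℝ => Ψ (z.2, z.1) :=
        Ψ.continuous.comp (continuous_snd.prodMk continuous_fst)
      exact e1.mul (e2.mul e3)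
    · rw [norm_mul, norm_mul, norm_phase, one_mul]
      exact mul_le_of_le_one_left (norm_nonneg _) (norm_symb_le _ _)
  simp only [slicePairing, fullPairing, ← integral_const_mul]
  rw [integral_integral_swap hi]
  congr 1; ext x
  rw [SchwartzMap.fourierInv_coe, Real.fourierInv_eq_fourier_neg,
    Real.fourier_real_eq_integral_exp_smul, ← integral_const_mul]
  congr 1; ext t
  rw [spaceSlice_apply, smul_eq_mul, mul_left_comm, phase]
  congr 3
  push_cast
  ring

lemma exists_spaceSlice_integral_bound (σ : ℝ) (Φ : Lp ℂ 2 (volume : Measure ℝ))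
    (Ψ : 𝓢(ℝ × ℝ, ℂ)) : ∃ C : ℝ, ∀ x,
      Integrable (fun τ => ((jw (-σ) τ : ℂ) * (𝓕⁻ (spaceSlice x Ψ) : 𝓢(ℝ, ℂ)) τ) * Φ τ) ∧
      ∫ τ, ‖((jw (-σ) τ : ℂ) * (𝓕⁻ (spaceSlice x Ψ) : 𝓢(ℝ, ℂ)) τ) * Φ τ‖ ≤
        C * (1 + x ^ 2)⁻¹ := by
  let A : 𝓢(ℝ, ℂ) →L[ℂ] 𝓢(ℝ, ℂ) :=
    SchwartzMap.smulLeftCLM ℂ (fun k => (jw (-σ) k : ℂ)) ∘L fourierInvCLM ℂ 𝓢(ℝ, ℂ)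
  have hA : ∀ ψ τ, A ψ τ = (jw (-σ) τ : ℂ) * (𝓕⁻ ψ : 𝓢(ℝ, ℂ)) τ := fun ψ τ => by
    change SchwartzMap.smulLeftCLM ℂ (fun k => (jw (-σ) k : ℂ)) (𝓕⁻ ψ) τ = _
    rw [SchwartzMap.smulLeftCLM_apply_apply (jwC_hasTemperateGrowth _), smul_eq_mul]
  obtain ⟨p, -, h⟩ := exists_spaceSlice_bound (SchwartzMap.toLpCLM ℂ ℂ 2 (volume : Measure ℝ) ∘L A)
  refine ⟨p Ψ * ‖Φ‖, fun x => ?_⟩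
  simp only [← hA]
  refine ⟨integrable_schwartz_mul _ _, ?_⟩
  have e : ∫ τ, ‖A (spaceSlice x Ψ) τ * Φ τ‖ =
      ∫ τ, ‖(A (spaceSlice x Ψ)).toLp 2 volume τ * Φ τ‖ := by
    apply integral_congr_ae
    filter_upwards [(A (spaceSlice x Ψ)).coeFn_toLp 2 volume] with τ hτ
    rw [hτ]
  rw [e]
  refine (integral_norm_mul_le _ _).trans ?_
  have h3 := h x Ψ
  calc _ ≤ (p Ψ * (1 + x ^ 2)⁻¹) * ‖Φ‖ := by gcongr; exact h3
    _ = _ := by ring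

/-- Integrating in `x` first leaves one integral over time frequencies, a form that both the space
and the time slices can be compared with. -/
lemma forcingDist_eq_integral (σ : ℝ) (Φ : Lp ℂ 2 (volume : Measure ℝ)) (Ψ : 𝓢(ℝ × ℝ, ℂ)) :
    forcingDist σ Φ Ψ = ∫ τ, (jw (-σ) τ : ℂ) * Φ τ * fullPairing Ψ τ := by
  rw [forcingDist_apply]
  simp only [ofData_traceData_apply]
  have hm : StronglyMeasurable fun z : ℝ × ℝ =>
      ((jw (-σ) z.2 : ℂ) * (𝓕⁻ (spaceSlice z.1 Ψ) : 𝓢(ℝ, ℂ)) z.2) * Φ z.2 := by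
    refine StronglyMeasurable.mul (StronglyMeasurable.mul ?_
      (stronglyMeasurable_fourierInv_spaceSlice Ψ)) ?_
    · exact (Complex.continuous_ofReal.comp
        ((continuous_jw _).comp continuous_snd)).stronglyMeasurable
    · exact (Lp.stronglyMeasurable Φ).comp_measurable measurable_snd
  have hi : Integrable (fun z : ℝ × ℝ =>
      ((jw (-σ) z.2 : ℂ) * (𝓕⁻ (spaceSlice z.1 Ψ) : 𝓢(ℝ, ℂ)) z.2) * Φ z.2)
      (volume.prod volume) := by
    obtain ⟨C, hC⟩ := exists_spaceSlice_integral_bound σ Φ Ψ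
    rw [integrable_prod_iff hm.aestronglyMeasurable]
    refine ⟨ae_of_all _ fun x => (hC x).1, ?_⟩
    refine (integrable_inv_one_add_sq.const_mul C).mono' ?_ (ae_of_all _ fun x => ?_)
    · exact (StronglyMeasurable.integral_prod_right (f := fun x τ =>
        ‖((jw (-σ) τ : ℂ) * (𝓕⁻ (spaceSlice x Ψ) : 𝓢(ℝ, ℂ)) τ) * Φ τ‖) hm.norm).aestronglyMeasurable
    · rw [Real.norm_of_nonneg (integral_nonneg fun η => norm_nonneg _)]
      exact (hC x).2
  have hi' : Integrable (fun z : ℝ × ℝ =>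
      ((jw (-σ) z.2 : ℂ) * (𝓕⁻ (spaceSlice z.1 Ψ) : 𝓢(ℝ, ℂ)) z.2) * (symb z.1 z.2 * Φ z.2))
      (volume.prod volume) := by
    have := hi.bdd_mul (c := 1) (continuous_symb.aestronglyMeasurable)
      (ae_of_all _ fun z => norm_symb_le z.1 z.2)
    refine this.congr (ae_of_all _ fun z => ?_)
    simp only
    ring
  rw [integral_integral_swap hi']
  congr 1; ext τ
  rw [fullPairing, ← integral_const_mul]
  congr 1; ext x
  ring

/-- After Fubini and the change of variables `τ = dispTau η` both sides are the same frequency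
integral. The weight `jw s η` in `dataFactor` cancels the inverse weight of the space operator, and
`4π|η|` is the Jacobian. -/
lemma hasTimeSlices_spaceTrace {s : ℝ} (h1 : -(1 / 2) < s) (h2 : s < 3 / 2)
    (Φ : Lp ℂ 2 (volume : Measure ℝ)) :
    HasTimeSlices (forcingDist ((2 * s + 1) / 4) Φ) (spaceTrace h1 h2 Φ) := by
  intro Ψ
  have hi := integrable_spaceTrace_prod h1 h2 Φ Ψ
  simp only [spaceTrace_slice']
  refine ⟨hi.integral_prod_left, ?_⟩
  rw [integral_integral_swap hi, forcingDist_eq_integral, ← integral_dispTau]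
  congr 1; ext η
  have hj : (jw s η : ℂ) ≠ 0 := by exact_mod_cast jw_ne_zero s η
  rw [← integral_phase_slicePairing, ← integral_const_mul, ← integral_const_mul]
  congr 1; ext t
  rw [dataFactor]
  push_cast
  field_simp

/-- The profiles are bounded in `L²` uniformly in `t`, so the cutoff contributes only `sup |θ|`. -/
theorem space_traces {s : ℝ} (h1 : -(1 / 2) < s) (h2 : s < 3 / 2) {θ : ℝ → ℂ} (hθ : Continuous θ)
    (hθs : HasCompactSupport θ) :
    ∃ c : ℝ≥0, ∀ (f : 𝓢'(ℝ, ℂ)) (U : 𝓢'(ℝ × ℝ, ℂ)),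
      MemH0 ((2 * s + 1) / 4) f → IsForcing ((2 * s + 1) / 4) f U →
      ∃ u : ℝ → 𝓢'(ℝ, ℂ), HasTimeSlices U u ∧
        ∀ T : ℝ, 0 < T →
          ContinuousIntoH s (fun t => θ (t * T⁻¹) • u t) ∧
          ∀ t, hENorm s (θ (t * T⁻¹) • u t) ≤
            c * ENNReal.ofReal (bracket T ^ (1 / 4 : ℝ)) * hENorm ((2 * s + 1) / 4) f := by
  obtain ⟨B, hB⟩ := hθs.exists_bound_of_continuous hθ
  have hB0 : 0 ≤ B := (norm_nonneg _).trans (hB 0)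
  set K := spaceOp (dilKernel_spaceKer h1 h2) with hK
  set c : ℝ := B * (‖K‖ * 2 ^ (1 + (2 * s + 1) / 4)) with hc
  have hc0 : 0 ≤ c := by positivity
  refine ⟨c.toNNReal, fun f U hf hU => ?_⟩
  obtain ⟨Φ, rfl, rfl⟩ := exists_data_of_isForcing hf hU
  refine ⟨spaceTrace h1 h2 Φ, hasTimeSlices_spaceTrace h1 h2 Φ, fun T hT => ?_⟩
  have e : ∀ t, θ (t * T⁻¹) • spaceTrace h1 h2 Φ t =
      ofData s (θ (t * T⁻¹) • 𝓕 (profile K (spaceData h1.le Φ) t)) := fun t => by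
    rw [map_smul, spaceTrace]
  simp only [e]
  have hcF : Continuous fun q : Lp ℂ 2 (volume : Measure ℝ) => 𝓕 q :=
    (Lp.fourierTransformₗᵢ ℝ ℂ).continuous
  refine ⟨continuousIntoH_ofData ((hθ.comp (by fun_prop)).smul
    (hcF.comp (continuous_profile K _))), fun t => ?_⟩
  rw [hENorm_ofData, hENorm_ofData]
  -- The bound just described does not grow with `T`; the stated factor is at least one.
  have hbr : 1 ≤ bracket T ^ (1 / 4 : ℝ) := by
    refine Real.one_le_rpow ?_ (by norm_num)
    rw [bracket, Real.one_le_sqrt]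
    nlinarith [sq_nonneg T]
  have h3 : ‖θ (t * T⁻¹) • 𝓕 (profile K (spaceData h1.le Φ) t)‖ ≤ c * ‖Φ‖ := by
    rw [norm_smul, Lp.norm_fourier_eq]
    calc _ ≤ B * (‖K‖ * (2 ^ (1 + (2 * s + 1) / 4) * ‖Φ‖)) := by
          gcongr
          · exact hB _
          · refine (norm_profile_le K _ t).trans ?_
            gcongr
            exact norm_spaceData_le h1.le Φ
      _ = _ := by rw [hc]; ring
  have h4 : c * ‖Φ‖ ≤ c * bracket T ^ (1 / 4 : ℝ) * ‖Φ‖ := by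
    gcongr
    exact le_mul_of_one_le_right hc0 hbr
  rw [← ofReal_norm, ← ofReal_norm]
  refine (ENNReal.ofReal_le_ofReal (h3.trans h4)).trans (le_of_eq ?_)
  rw [ENNReal.ofReal_mul (by positivity), ENNReal.ofReal_mul hc0]
  rfl

/-! ### Interpolation between `L¹ → L^∞` and `L² → L²` -/

/-- Measurable functions in `L¹ ∩ L²`. -/
structure MemL12 (f : ℝ → ℂ) : Prop where
  measurable : Measurable f
  integrable : Integrable f
  memLp : MemLp f 2

lemma MemL12.indicator {f : ℝ → ℂ} (hf : MemL12 f) {S : Set ℝ} (hS : MeasurableSet S) :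
    MemL12 (S.indicator f) :=
  ⟨hf.measurable.indicator hS, hf.integrable.indicator hS, hf.memLp.indicator hS⟩

lemma MemL12.integrable_sq {f : ℝ → ℂ} (hf : MemL12 f) : Integrable fun x => ‖f x‖ ^ 2 :=
  (memLp_two_iff_integrable_sq_norm hf.integrable.aestronglyMeasurable).1 hf.memLp

lemma MemL12.integrable_rpow {f : ℝ → ℂ} (hf : MemL12 f) {p : ℝ} (h1 : 1 ≤ p) (h2 : p ≤ 2) :
    Integrable fun x => ‖f x‖ ^ p := by
  refine (hf.integrable.norm.add hf.integrable_sq).mono'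
    (hf.measurable.norm.pow_const p).aestronglyMeasurable (ae_of_all _ fun x => ?_)
  rw [Real.norm_of_nonneg (by positivity), Pi.add_apply]
  have h0 := norm_nonneg (f x)
  rcases le_total ‖f x‖ 1 with h | h
  · have := Real.rpow_le_rpow_of_exponent_ge' h0 h zero_le_one h1
    rw [Real.rpow_one] at this
    nlinarith [sq_nonneg ‖f x‖]
  · have := Real.rpow_le_rpow_of_exponent_le h h2
    rw [Real.rpow_two] at this
    linarith

lemma setLIntegral_rpow_Ioc {a L : ℝ} (ha : -1 < a) (hL : 0 ≤ L) :
    ∫⁻ l in Ioc 0 L, ENNReal.ofReal (l ^ a) = ENNReal.ofReal (L ^ (a + 1) / (a + 1)) := by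
  have hi : IntegrableOn (fun l : ℝ => l ^ a) (Ioc 0 L) :=
    (intervalIntegrable_iff_integrableOn_Ioc_of_le hL).1
      (intervalIntegral.intervalIntegrable_rpow' ha)
  rw [← ofReal_integral_eq_lintegral_ofReal hi
    ((ae_restrict_iff' measurableSet_Ioc).2 (ae_of_all _ fun l hl => Real.rpow_nonneg hl.1.le _)),
    ← intervalIntegral.integral_of_le hL, integral_rpow (Or.inl ha),
    Real.zero_rpow (by linarith), sub_zero]

/-- Cut `f` at height `H`. The large part has so small an `L¹` norm that its image is at most `l/2`
everywhere, so the level set is controlled by Chebyshev applied to the image of the small part in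
`L²`. The factor `4 l⁻²` is `(l/2)⁻²`. -/
lemma measure_lt_le_of_split {T : (ℝ → ℂ) → ℝ → ℂ} {M p r : ℝ} (hr : 2 < r) (hp : p = r / (r - 1))
    (hM : 0 < M) (hTm : ∀ f, MemL12 f → Measurable (T f))
    (hadd : ∀ f g, MemL12 f → MemL12 g → ∀ y, T (f + g) y = T f y + T g y)
    (h1 : ∀ f, MemL12 f → ∀ y, ‖T f y‖ ≤ M * ∫ x, ‖f x‖)
    (h2 : ∀ f, MemL12 f → ∫⁻ y, ‖T f y‖ₑ ^ 2 ≤ ∫⁻ y, ‖f y‖ₑ ^ 2)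
    {f : ℝ → ℂ} (hf : MemL12 f) (hN : 0 < ∫ x, ‖f x‖ ^ p) {l : ℝ} (hl : 0 < l) :
    volume {y | l < ‖T f y‖} ≤ ENNReal.ofReal (4 * l ^ (-2 : ℝ)) *
      ∫⁻ x, indicator {x | ‖f x‖ ≤ (2 * M * (∫ x, ‖f x‖ ^ p) / l) ^ (r - 1)}
        (fun x => ‖f x‖ₑ ^ 2) x := by
  set N := ∫ x, ‖f x‖ ^ p with hNdef
  set H := (2 * M * N / l) ^ (r - 1) with hH
  have hH0 : 0 < H := by positivity
  have hp1 : 1 < p := by rw [hp, one_lt_div (by linarith)]; linarith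
  have hp2 : p ≤ 2 := by rw [hp, div_le_iff₀ (by linarith)]; linarith
  have hS : MeasurableSet {x | ‖f x‖ ≤ H} := hf.measurable.norm measurableSet_Iic
  set f2 := indicator {x | ‖f x‖ ≤ H} f with hf2
  set f1 := indicator {x | ‖f x‖ ≤ H}ᶜ f with hf1
  have hm1 : MemL12 f1 := hf.indicator hS.compl
  have hm2 : MemL12 f2 := hf.indicator hS
  have hsum : f = f1 + f2 := by rw [hf1, hf2]; exact (indicator_compl_add_self _ f).symm
  -- Where `‖f‖ > H`, one has `‖f‖ = ‖f‖^(1-p) ‖f‖^p ≤ H^(1-p) ‖f‖^p`, because `p > 1`.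
  have hb1 : ∫ x, ‖f1 x‖ ≤ H ^ (1 - p) * N := by
    rw [hNdef, ← integral_const_mul]
    refine integral_mono hm1.integrable.norm ((hf.integrable_rpow hp1.le hp2).const_mul _) fun x => ?_
    simp only [hf1]
    by_cases hx : ‖f x‖ ≤ H
    · rw [indicator_of_notMem (by simpa using hx), norm_zero]; positivity
    · rw [indicator_of_mem (by simpa using hx)]
      have hx' := not_le.1 hx
      have hx0 : 0 < ‖f x‖ := hH0.trans hx'
      calc ‖f x‖ = ‖f x‖ ^ (1 - p) * ‖f x‖ ^ p := by
            rw [← Real.rpow_add hx0]; simp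
        _ ≤ H ^ (1 - p) * ‖f x‖ ^ p := by
            refine mul_le_mul_of_nonneg_right ?_ (by positivity)
            exact Real.rpow_le_rpow_of_nonpos hH0 hx'.le (by linarith)
  -- The height `H` solves this equation, since `(r - 1)(1 - p) = -1`.
  have hHN : M * (H ^ (1 - p) * N) = l / 2 := by
    have e : (r - 1) * (1 - p) = -1 := by
      rw [hp]; field_simp [show r - 1 ≠ 0 by linarith]; ring
    rw [hH, ← Real.rpow_mul (by positivity), e, Real.rpow_neg_one]
    field_simp
  have hsub : {y | l < ‖T f y‖} ⊆ {y | ENNReal.ofReal ((l / 2) ^ 2) ≤ ‖T f2 y‖ₑ ^ 2} := by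
    intro y hy
    have hy' : l < ‖T f y‖ := hy
    have e1 : ‖T f1 y‖ ≤ l / 2 := by
      rw [← hHN]
      exact (h1 f1 hm1 y).trans (mul_le_mul_of_nonneg_left hb1 hM.le)
    have e2 : ‖T f y‖ ≤ ‖T f1 y‖ + ‖T f2 y‖ := by
      rw [hsum, hadd f1 f2 hm1 hm2]
      exact norm_add_le _ _
    have e3 : l / 2 ≤ ‖T f2 y‖ := by linarith
    change ENNReal.ofReal ((l / 2) ^ 2) ≤ ‖T f2 y‖ₑ ^ 2
    rw [← ofReal_norm, ← ENNReal.ofReal_pow (norm_nonneg _)]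
    exact ENNReal.ofReal_le_ofReal (pow_le_pow_left₀ (by positivity) e3 2)
  have hcheb := mul_meas_ge_le_lintegral (μ := (volume : Measure ℝ))
    (f := fun y => ‖T f2 y‖ₑ ^ 2) (by have := hTm f2 hm2; fun_prop) (ENNReal.ofReal ((l / 2) ^ 2))
  have e4 : ENNReal.ofReal (4 * l ^ (-2 : ℝ)) * ENNReal.ofReal ((l / 2) ^ 2) = 1 := by
    rw [← ENNReal.ofReal_mul (by positivity), ← ENNReal.ofReal_one]
    congr 1
    rw [Real.rpow_neg hl.le, Real.rpow_two]
    field_simp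
    norm_num
  have e5 : ∫⁻ y, ‖f2 y‖ₑ ^ 2 =
      ∫⁻ x, indicator {x | ‖f x‖ ≤ H} (fun x => ‖f x‖ₑ ^ 2) x := by
    congr 1; ext x
    simp only [hf2]
    by_cases hx : x ∈ {x | ‖f x‖ ≤ H}
    · rw [indicator_of_mem hx, indicator_of_mem hx]
    · rw [indicator_of_notMem hx, indicator_of_notMem hx]; simp
  calc volume {y | l < ‖T f y‖} ≤ volume {y | ENNReal.ofReal ((l / 2) ^ 2) ≤ ‖T f2 y‖ₑ ^ 2} :=
        measure_mono hsub
    _ = ENNReal.ofReal (4 * l ^ (-2 : ℝ)) * (ENNReal.ofReal ((l / 2) ^ 2) *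
          volume {y | ENNReal.ofReal ((l / 2) ^ 2) ≤ ‖T f2 y‖ₑ ^ 2}) := by
        rw [← mul_assoc, e4, one_mul]
    _ ≤ ENNReal.ofReal (4 * l ^ (-2 : ℝ)) * ∫⁻ y, ‖f2 y‖ₑ ^ 2 := by
        gcongr
        exact hcheb.trans (h2 f2 hm2)
    _ = _ := by rw [e5]

/-- The Marcinkiewicz interpolation theorem between `L¹ → L^∞` and `L² → L²`. -/
lemma marcinkiewicz {T : (ℝ → ℂ) → ℝ → ℂ} {M p r : ℝ} (hr : 2 < r) (hp : p = r / (r - 1))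
    (hM : 0 < M) (hTm : ∀ f, MemL12 f → Measurable (T f))
    (hadd : ∀ f g, MemL12 f → MemL12 g → ∀ y, T (f + g) y = T f y + T g y)
    (h1 : ∀ f, MemL12 f → ∀ y, ‖T f y‖ ≤ M * ∫ x, ‖f x‖)
    (h2 : ∀ f, MemL12 f → ∫⁻ y, ‖T f y‖ₑ ^ 2 ≤ ∫⁻ y, ‖f y‖ₑ ^ 2)
    {f : ℝ → ℂ} (hf : MemL12 f) :
    ∫⁻ y, ENNReal.ofReal (‖T f y‖ ^ r) ≤
      ENNReal.ofReal (r * (4 / (r - 2)) * (2 * M) ^ (r - 2) * (∫ x, ‖f x‖ ^ p) ^ (r - 1)) := by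
  set N := ∫ x, ‖f x‖ ^ p with hNdef
  have hp1 : 1 < p := by rw [hp, one_lt_div (by linarith)]; linarith
  have hp2 : p ≤ 2 := by rw [hp, div_le_iff₀ (by linarith)]; linarith
  have hip := hf.integrable_rpow hp1.le hp2
  have hN0 : 0 ≤ N := integral_nonneg fun x => by positivity
  rcases hN0.eq_or_lt with hN | hN
  · have hz : (fun x => ‖f x‖ ^ p) =ᵐ[volume] 0 :=
      (integral_eq_zero_iff_of_nonneg (fun x => by positivity) hip).1 hN.symm
    have hz' : ∫ x, ‖f x‖ = 0 := by
      refine integral_eq_zero_of_ae ?_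
      filter_upwards [hz] with x hx
      have hx' : ‖f x‖ ^ p = 0 := hx
      exact (Real.rpow_eq_zero (norm_nonneg _) (by linarith)).1 hx'
    have hT0 : ∀ y, ‖T f y‖ = 0 := fun y => by
      have := h1 f hf y
      rw [hz', mul_zero] at this
      exact le_antisymm this (norm_nonneg _)
    simp only [hT0, Real.zero_rpow (by linarith : r ≠ 0), ENNReal.ofReal_zero, lintegral_zero]
    exact zero_le
  -- Layer-cake formula; the level sets are then estimated separately for each `l`, and Tonelli
  -- brings the `l`-integral inside.
  rw [lintegral_rpow_eq_lintegral_meas_lt_mul volume (ae_of_all _ fun y => norm_nonneg (T f y))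
    (hTm f hf).norm.aemeasurable (by linarith)]
  have hmeasS : MeasurableSet {z : ℝ × ℝ | ‖f z.2‖ ≤ (2 * M * N / z.1) ^ (r - 1)} := by
    have := hf.measurable
    exact measurableSet_le (by fun_prop) (by fun_prop)
  set g : ℝ → ℝ → ℝ≥0∞ := fun l x => indicator {x | ‖f x‖ ≤ (2 * M * N / l) ^ (r - 1)}
    (fun x => ‖f x‖ₑ ^ 2) x with hg
  have hgm : Measurable (Function.uncurry g) := by
    have e : Function.uncurry g =
        indicator {z : ℝ × ℝ | ‖f z.2‖ ≤ (2 * M * N / z.1) ^ (r - 1)} fun z => ‖f z.2‖ₑ ^ 2 := by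
      funext z; rfl
    rw [e]
    have := hf.measurable
    exact Measurable.indicator (by fun_prop) hmeasS
  have step1 : ∫⁻ l in Ioi (0 : ℝ), volume {y | l < ‖T f y‖} * ENNReal.ofReal (l ^ (r - 1)) ≤
      ∫⁻ l in Ioi (0 : ℝ), ∫⁻ x, ENNReal.ofReal (4 * l ^ (r - 3)) * g l x := by
    refine setLIntegral_mono' measurableSet_Ioi fun l hl => ?_
    have hl0 : 0 < l := hl
    have hgl : Measurable fun x => g l x := hgm.comp (measurable_const.prodMk measurable_id)
    rw [lintegral_const_mul _ hgl]
    calc _ ≤ (ENNReal.ofReal (4 * l ^ (-2 : ℝ)) * ∫⁻ x, g l x) * ENNReal.ofReal (l ^ (r - 1)) := by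
          gcongr
          exact measure_lt_le_of_split hr hp hM hTm hadd h1 h2 hf hN hl0
      _ = (ENNReal.ofReal (4 * l ^ (-2 : ℝ)) * ENNReal.ofReal (l ^ (r - 1))) * ∫⁻ x, g l x := by ring
      _ = _ := by
          rw [← ENNReal.ofReal_mul (by positivity), mul_assoc, ← Real.rpow_add hl0]
          congr 4; ring
  have step2 : ∫⁻ l in Ioi (0 : ℝ), ∫⁻ x, ENNReal.ofReal (4 * l ^ (r - 3)) * g l x =
      ∫⁻ x, ∫⁻ l in Ioi (0 : ℝ), ENNReal.ofReal (4 * l ^ (r - 3)) * g l x := by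
    rw [lintegral_lintegral_swap]
    have e1 : Measurable fun z : ℝ × ℝ => ENNReal.ofReal (4 * z.1 ^ (r - 3)) := by fun_prop
    exact (e1.mul hgm).aemeasurable
  have step3 : ∀ x, ∫⁻ l in Ioi (0 : ℝ), ENNReal.ofReal (4 * l ^ (r - 3)) * g l x ≤
      ENNReal.ofReal (4 / (r - 2) * (2 * M * N) ^ (r - 2) * ‖f x‖ ^ p) := by
    intro x
    by_cases hx : f x = 0
    · have : ∀ l, g l x = 0 := fun l => by
        simp only [hg, indicator, hx]; simp
      simp only [this, mul_zero, lintegral_zero]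
      exact zero_le
    have hx0 : 0 < ‖f x‖ := norm_pos_iff.2 hx
    -- For fixed `x`, the condition `‖f x‖ ≤ H` forces `l ≤ L`. The integral of `l^(r-3)` up to `L`
    -- converges at zero because `r > 2`.
    set L := 2 * M * N * ‖f x‖ ^ (-(1 / (r - 1))) with hL
    have hL0 : 0 < L := by positivity
    have hle : ∀ l ∈ Ioi (0 : ℝ), ENNReal.ofReal (4 * l ^ (r - 3)) * g l x ≤
        indicator (Ioc 0 L) (fun l => (ENNReal.ofReal 4 * ‖f x‖ₑ ^ 2) * ENNReal.ofReal (l ^ (r - 3))) l := by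
      intro l hl
      have hl0 : 0 < l := hl
      by_cases hxl : ‖f x‖ ≤ (2 * M * N / l) ^ (r - 1)
      · have hlL : l ≤ L := by
          have h3 : ‖f x‖ ^ (1 / (r - 1)) ≤ 2 * M * N / l := by
            have := Real.rpow_le_rpow hx0.le hxl (by
              have : 0 < r - 1 := by linarith
              positivity : 0 ≤ 1 / (r - 1))
            rwa [← Real.rpow_mul (by positivity), mul_one_div_cancel (by linarith), Real.rpow_one]
              at this
          rw [le_div_iff₀ hl0] at h3
          rw [hL, Real.rpow_neg hx0.le, ← div_eq_mul_inv, le_div_iff₀ (by positivity)]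
          linarith
        rw [indicator_of_mem (show l ∈ Ioc 0 L from ⟨hl0, hlL⟩)]
        have : g l x = ‖f x‖ₑ ^ 2 := indicator_of_mem (s := {x | ‖f x‖ ≤ (2 * M * N / l) ^ (r - 1)}) hxl _
        rw [this, ENNReal.ofReal_mul (by norm_num)]
        apply le_of_eq; ring
      · have : g l x = 0 := indicator_of_notMem (s := {x | ‖f x‖ ≤ (2 * M * N / l) ^ (r - 1)}) hxl _
        rw [this, mul_zero]
        exact zero_le
    refine (setLIntegral_mono' measurableSet_Ioi hle).trans ?_
    refine (setLIntegral_le_lintegral _ _).trans ?_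
    rw [lintegral_indicator measurableSet_Ioc,
      lintegral_const_mul _ (by fun_prop), setLIntegral_rpow_Ioc (by linarith) hL0.le,
      ← ofReal_norm, ← ENNReal.ofReal_pow (norm_nonneg _), ← ENNReal.ofReal_mul (by norm_num),
      ← ENNReal.ofReal_mul (by positivity)]
    apply le_of_eq
    congr 1
    have e1 : r - 3 + 1 = r - 2 := by ring
    have e2 : L ^ (r - 2) = (2 * M * N) ^ (r - 2) * ‖f x‖ ^ (p - 2) := by
      rw [hL, Real.mul_rpow (by positivity) (by positivity), ← Real.rpow_mul hx0.le]
      congr 2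
      rw [hp]; field_simp [show r - 1 ≠ 0 by linarith]; ring
    have e3 : ‖f x‖ ^ p = ‖f x‖ ^ 2 * ‖f x‖ ^ (p - 2) := by
      rw [← Real.rpow_natCast, ← Real.rpow_add hx0]; congr 1; push_cast; ring
    rw [e1, e2, e3]
    ring
  calc ENNReal.ofReal r * ∫⁻ l in Ioi (0 : ℝ), volume {y | l < ‖T f y‖} * ENNReal.ofReal (l ^ (r - 1))
      ≤ ENNReal.ofReal r * ∫⁻ x, ENNReal.ofReal (4 / (r - 2) * (2 * M * N) ^ (r - 2) * ‖f x‖ ^ p) := by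
        gcongr 1
        refine step1.trans ?_
        rw [step2]
        exact lintegral_mono step3
    _ = _ := by
        have hr2 : 0 < r - 2 := by linarith
        rw [← ofReal_integral_eq_lintegral_ofReal (hip.const_mul _)
          (ae_of_all _ fun x => by positivity), integral_const_mul,
          ← ENNReal.ofReal_mul (by linarith)]
        congr 1
        rw [← hNdef, Real.mul_rpow (by positivity) hN0]
        have : N ^ (r - 1) = N ^ (r - 2) * N := by
          rw [← Real.rpow_add_one hN.ne']; congr 1; ring
        rw [this]
        ring

/-! ### The dispersive estimate -/

/-- The norm of `L^p`. -/
def pNorm (p : ℝ) (f : ℝ → ℂ) : ℝ≥0∞ := (∫⁻ x, ‖f x‖ₑ ^ p) ^ (1 / p)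

lemma enorm_rpow_eq_ofReal (w : ℂ) {p : ℝ} (hp : 0 ≤ p) : ‖w‖ₑ ^ p = ENNReal.ofReal (‖w‖ ^ p) := by
  rw [← ofReal_norm, ENNReal.ofReal_rpow_of_nonneg (norm_nonneg _) hp]

/-- The complex Gaussian `e^{-aη²}`. -/
def gauss (a : ℂ) (η : ℝ) : ℂ := Complex.exp (-a * (η : ℂ) ^ 2)

lemma norm_gauss (a : ℂ) (η : ℝ) : ‖gauss a η‖ = Real.exp (-a.re * η ^ 2) := by
  rw [gauss, Complex.norm_exp]
  congr 1
  rw [← Complex.ofReal_pow, Complex.re_mul_ofReal, Complex.neg_re]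

lemma norm_gauss_le {a : ℂ} (ha : 0 ≤ a.re) (η : ℝ) : ‖gauss a η‖ ≤ 1 := by
  rw [norm_gauss, Real.exp_le_one_iff]
  nlinarith [sq_nonneg η]

lemma continuous_gauss (a : ℂ) : Continuous (gauss a) := by unfold gauss; fun_prop

lemma integrable_gauss {a : ℂ} (ha : 0 < a.re) : Integrable (gauss a) := by
  have h := integrable_cexp_quadratic ha 0 0
  simp only [zero_mul, add_zero] at h
  exact h

/-- The transform of a complex Gaussian is a Gaussian with amplitude `|π/a|^(1/2)`. Bounding `|a|`
below by `|Im a|` makes the estimate independent of the regularization `Re a`. -/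
lemma norm_fourierInv_gauss_le {a : ℂ} (ha : 0 < a.re) (him : a.im ≠ 0) (x y : ℝ) :
    ‖(𝓕⁻ (fun η : ℝ => Complex.exp (-(2 * Real.pi * η * y : ℝ) * Complex.I) * gauss a η) : ℝ → ℂ) x‖ ≤
      (Real.pi / |a.im|) ^ (1 / 2 : ℝ) := by
  have ha0 : a ≠ 0 := fun h => by simp [h] at ha
  have e : (𝓕⁻ (fun η : ℝ => Complex.exp (-(2 * Real.pi * η * y : ℝ) * Complex.I) * gauss a η) :
      ℝ → ℂ) x = ∫ η : ℝ, Complex.exp (Complex.I * ((2 * Real.pi * (x - y) : ℝ) : ℂ) * η) *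
        Complex.exp (-a * (η : ℂ) ^ 2) := by
    rw [Real.fourierInv_eq_fourier_neg, Real.fourier_real_eq_integral_exp_smul]
    congr 1; ext η
    rw [smul_eq_mul, gauss, ← mul_assoc, ← Complex.exp_add]
    congr 2
    push_cast; ring
  rw [e, fourierIntegral_gaussian ha, norm_mul, Complex.norm_exp]
  have h1 : ‖((Real.pi : ℂ) / a) ^ (1 / 2 : ℂ)‖ ≤ (Real.pi / |a.im|) ^ (1 / 2 : ℝ) := by
    have := Complex.norm_cpow_real ((Real.pi : ℂ) / a) (1 / 2)
    push_cast at this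
    rw [this, norm_div, Complex.norm_real, Real.norm_of_nonneg Real.pi_pos.le]
    refine Real.rpow_le_rpow (by positivity) ?_ (by norm_num)
    exact div_le_div_of_nonneg_left Real.pi_pos.le (abs_pos.2 him) (Complex.abs_im_le_norm a)
  have h2 : Real.exp ((-((2 * Real.pi * (x - y) : ℝ) : ℂ) ^ 2 / (4 * a)).re) ≤ 1 := by
    rw [Real.exp_le_one_iff]
    have : (-((2 * Real.pi * (x - y) : ℝ) : ℂ) ^ 2 / (4 * a)) =
        ((-((2 * Real.pi * (x - y)) ^ 2 / 4) : ℝ) : ℂ) * a⁻¹ := by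
      push_cast; field_simp
    rw [this, Complex.re_ofReal_mul, Complex.inv_re]
    have h3 : 0 ≤ a.re / Complex.normSq a := div_nonneg ha.le (Complex.normSq_nonneg a)
    have h4 : 0 ≤ (2 * Real.pi * (x - y)) ^ 2 / 4 := by positivity
    nlinarith
  calc _ ≤ (Real.pi / |a.im|) ^ (1 / 2 : ℝ) * 1 :=
        mul_le_mul h1 h2 (Real.exp_pos _).le (by positivity)
    _ = _ := mul_one _

/-- The regularized Schrödinger propagator. -/
def heatOp (a : ℂ) (f : ℝ → ℂ) : ℝ → ℂ := 𝓕 fun η => gauss a η * (𝓕⁻ f : ℝ → ℂ) η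

lemma integrable_gauss_mul {a : ℂ} (ha : 0 < a.re) {f : ℝ → ℂ} (hf : Integrable f) :
    Integrable fun η => gauss a η * (𝓕⁻ f : ℝ → ℂ) η :=
  (integrable_gauss ha).mul_bdd (c := ∫ x, ‖f x‖) (continuous_fourierInv hf).aestronglyMeasurable
    (ae_of_all _ fun η => norm_fourierInv_le f η)

lemma norm_heatOp_le {a : ℂ} (ha : 0 < a.re) (him : a.im ≠ 0) {f : ℝ → ℂ} (hf : Integrable f)
    (y : ℝ) : ‖heatOp a f y‖ ≤ (Real.pi / |a.im|) ^ (1 / 2 : ℝ) * ∫ x, ‖f x‖ := by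
  have hi : Integrable fun η : ℝ =>
      Complex.exp (-(2 * Real.pi * η * y : ℝ) * Complex.I) * gauss a η := by
    refine (integrable_gauss ha).bdd_mul (c := 1) (by fun_prop) (ae_of_all _ fun η => ?_)
    rw [← Complex.ofReal_neg, Complex.norm_exp_ofReal_mul_I]
  have e : heatOp a f y = ∫ x, (𝓕⁻ (fun η : ℝ =>
      Complex.exp (-(2 * Real.pi * η * y : ℝ) * Complex.I) * gauss a η) : ℝ → ℂ) x * f x := by
    rw [integral_fourierInv_mul_eq hi hf, heatOp, Real.fourier_real_eq_integral_exp_smul]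
    congr 1; ext η
    rw [smul_eq_mul, ← mul_assoc]
    congr 3
    push_cast; ring
  rw [e, ← integral_const_mul]
  refine norm_integral_le_of_norm_le (hf.norm.const_mul _) (ae_of_all _ fun x => ?_)
  rw [norm_mul]
  exact mul_le_mul_of_nonneg_right (norm_fourierInv_gauss_le ha him x y) (norm_nonneg _)

lemma lintegral_heatOp_sq_le {a : ℂ} (ha : 0 < a.re) {f : ℝ → ℂ} (hf : MemL12 f) :
    ∫⁻ y, ‖heatOp a f y‖ₑ ^ 2 ≤ ∫⁻ y, ‖f y‖ₑ ^ 2 := by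
  have hi := integrable_gauss_mul ha hf.integrable
  have h2 : MemLp (fun η => gauss a η * (𝓕⁻ f : ℝ → ℂ) η) 2 :=
    memLp_mul_of_bound (continuous_gauss a).measurable (fun η => norm_gauss_le ha.le η)
      (memLp_fourierInv hf.integrable hf.memLp)
  calc ∫⁻ y, ‖heatOp a f y‖ₑ ^ 2
      = ∫⁻ y, ‖(𝓕⁻ (fun η => gauss a η * (𝓕⁻ f : ℝ → ℂ) η) : ℝ → ℂ) (y * -1)‖ₑ ^ 2 := by
        congr 1; ext y
        rw [heatOp, Real.fourierInv_eq_fourier_neg]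
        simp
    _ = ∫⁻ y, ‖(𝓕⁻ (fun η => gauss a η * (𝓕⁻ f : ℝ → ℂ) η) : ℝ → ℂ) y‖ₑ ^ 2 := by
        rw [lintegral_comp_mul_right_eq (by norm_num)
          (fun y => ‖(𝓕⁻ (fun η => gauss a η * (𝓕⁻ f : ℝ → ℂ) η) : ℝ → ℂ) y‖ₑ ^ 2)]
        norm_num
    _ = ∫⁻ η, ‖gauss a η * (𝓕⁻ f : ℝ → ℂ) η‖ₑ ^ 2 := by
        rw [← eLpNorm_two_sq, ← eLpNorm_two_sq, eLpNorm_fourierInv hi h2]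
    _ ≤ ∫⁻ η, ‖(𝓕⁻ f : ℝ → ℂ) η‖ₑ ^ 2 := by
        refine lintegral_mono fun η => pow_le_pow_left₀ zero_le ?_ 2
        rw [enorm_mul]
        have : ‖gauss a η‖ₑ ≤ 1 := by
          rw [← ofReal_norm, ← ENNReal.ofReal_one]
          exact ENNReal.ofReal_le_ofReal (norm_gauss_le ha.le η)
        calc _ ≤ 1 * ‖(𝓕⁻ f : ℝ → ℂ) η‖ₑ := by gcongr
          _ = _ := one_mul _
    _ = _ := by rw [← eLpNorm_two_sq, ← eLpNorm_two_sq, eLpNorm_fourierInv hf.integrable hf.memLp]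

/-- The constant in the dispersive estimate. -/
def dispConst (r : ℝ) : ℝ :=
  (r * (4 / (r - 2)) * (2 * Real.pi ^ (1 / 2 : ℝ)) ^ (r - 2)) ^ (1 / r)

lemma dispConst_nonneg {r : ℝ} (hr : 2 < r) : 0 ≤ dispConst r := by
  have : 0 < r - 2 := by linarith
  unfold dispConst; positivity

/-- `marcinkiewicz` with the dispersive constant `M = (π/|Im a|)^(1/2)`; `M` enters with the power
`(r-2)/r`, giving the decay `1/2 - 1/r`. -/
lemma pNorm_heatOp_le {r p : ℝ} (hr : 2 < r) (hp : p = r / (r - 1)) {a : ℂ} (ha : 0 < a.re)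
    (him : a.im ≠ 0) {f : ℝ → ℂ} (hf : MemL12 f) :
    pNorm r (heatOp a f) ≤
      ENNReal.ofReal (dispConst r * |a.im| ^ (-(1 / 2 - 1 / r))) * pNorm p f := by
  have hp1 : 1 < p := by rw [hp, one_lt_div (by linarith)]; linarith
  have hp2 : p ≤ 2 := by rw [hp, div_le_iff₀ (by linarith)]; linarith
  have hb : 0 < |a.im| := abs_pos.2 him
  have hr2 : 0 < r - 2 := by linarith
  have hr1 : r - 1 ≠ 0 := by linarith
  have key := marcinkiewicz (T := heatOp a) hr hp (M := (Real.pi / |a.im|) ^ (1 / 2 : ℝ))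
    (by have := Real.pi_pos; positivity)
    (fun f hf => (continuous_fourier (integrable_gauss_mul ha hf.integrable)).measurable)
    (fun f g hf hg y => by
      have e : (fun η => gauss a η * (𝓕⁻ (f + g) : ℝ → ℂ) η) =
          (fun η => gauss a η * (𝓕⁻ f : ℝ → ℂ) η) + fun η => gauss a η * (𝓕⁻ g : ℝ → ℂ) η := by
        funext η
        have : (𝓕⁻ (f + g) : ℝ → ℂ) η = (𝓕⁻ f : ℝ → ℂ) η + (𝓕⁻ g : ℝ → ℂ) η := by
          simp only [Real.fourierInv_eq_fourier_neg, Real.fourier_real_eq_integral_exp_smul,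
            smul_eq_mul, Pi.add_apply, mul_add]
          refine integral_add ?_ ?_
          · refine hf.integrable.bdd_mul (c := 1) (by fun_prop) (ae_of_all _ fun x => ?_)
            rw [Complex.norm_exp_ofReal_mul_I]
          · refine hg.integrable.bdd_mul (c := 1) (by fun_prop) (ae_of_all _ fun x => ?_)
            rw [Complex.norm_exp_ofReal_mul_I]
        rw [this, Pi.add_apply, mul_add]
      simp only [heatOp]
      rw [e]
      simp only [Real.fourier_real_eq_integral_exp_smul, smul_eq_mul, Pi.add_apply, mul_add]
      refine integral_add ?_ ?_
      · refine (integrable_gauss_mul ha hf.integrable).bdd_mul (c := 1) (by fun_prop)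
          (ae_of_all _ fun x => ?_)
        rw [Complex.norm_exp_ofReal_mul_I]
      · refine (integrable_gauss_mul ha hg.integrable).bdd_mul (c := 1) (by fun_prop)
          (ae_of_all _ fun x => ?_)
        rw [Complex.norm_exp_ofReal_mul_I])
    (fun f hf y => norm_heatOp_le ha him hf.integrable y)
    (fun f hf => lintegral_heatOp_sq_le ha hf) hf
  set N := ∫ x, ‖f x‖ ^ p with hN
  have hN0 : 0 ≤ N := integral_nonneg fun x => by positivity
  have eN : pNorm p f = ENNReal.ofReal (N ^ (1 / p)) := by
    unfold pNorm
    simp only [enorm_rpow_eq_ofReal _ (by linarith : (0 : ℝ) ≤ p)]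
    rw [← ofReal_integral_eq_lintegral_ofReal (hf.integrable_rpow hp1.le hp2)
      (ae_of_all _ fun x => by positivity), ENNReal.ofReal_rpow_of_nonneg hN0 (by positivity)]
  rw [eN, ← ENNReal.ofReal_mul (mul_nonneg (dispConst_nonneg hr) (by positivity))]
  unfold pNorm
  simp only [enorm_rpow_eq_ofReal _ (by linarith : (0 : ℝ) ≤ r)]
  refine (ENNReal.rpow_le_rpow key (by positivity)).trans (le_of_eq ?_)
  have hpi := Real.pi_pos
  rw [ENNReal.ofReal_rpow_of_nonneg (by positivity) (by positivity)]
  congr 1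
  have e1 : (2 * (Real.pi / |a.im|) ^ (1 / 2 : ℝ)) ^ (r - 2) =
      (2 * Real.pi ^ (1 / 2 : ℝ)) ^ (r - 2) * |a.im| ^ (-(1 / 2) * (r - 2)) := by
    rw [Real.div_rpow hpi.le hb.le, mul_div_assoc', Real.div_rpow (by positivity) (by positivity),
      ← Real.rpow_mul hb.le, div_eq_mul_inv, ← Real.rpow_neg hb.le]
    congr 2; ring
  rw [e1, ← mul_assoc, Real.mul_rpow (by positivity) (by positivity),
    Real.mul_rpow (by positivity) (by positivity), ← Real.rpow_mul hb.le, ← Real.rpow_mul hN0]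
  unfold dispConst
  have e2 : -(1 / 2) * (r - 2) * (1 / r) = -(1 / 2 - 1 / r) := by field_simp
  have e3 : (r - 1) * (1 / r) = 1 / p := by rw [hp]; field_simp
  rw [e2, e3]

lemma lintegral_mul_le_pNorm {r p : ℝ} (hr : 2 < r) (hp : p = r / (r - 1)) {f g : ℝ → ℂ}
    (hf : Measurable f) (hg : Measurable g) :
    ∫⁻ x, ‖f x * g x‖ₑ ≤ pNorm r f * pNorm p g := by
  have hpq : r.HolderConjugate p := by
    rw [Real.holderConjugate_iff]
    refine ⟨by linarith, ?_⟩
    rw [hp]; field_simp [show r - 1 ≠ 0 by linarith]; ring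
  simp only [enorm_mul]
  exact ENNReal.lintegral_mul_le_Lp_mul_Lq volume hpq (f := fun x => ‖f x‖ₑ)
    (g := fun x => ‖g x‖ₑ) hf.enorm.aemeasurable hg.enorm.aemeasurable

/-- The dispersive estimate, in bilinear form on the Fourier side. -/
lemma enorm_integral_gauss_le {r p : ℝ} (hr : 2 < r) (hp : p = r / (r - 1)) {a : ℂ}
    (ha : 0 < a.re) (him : a.im ≠ 0) {f g : ℝ → ℂ} (hf : MemL12 f) (hg : MemL12 g) :
    ‖∫ η, gauss a η * (𝓕⁻ f : ℝ → ℂ) η * (𝓕 g : ℝ → ℂ) η‖ₑ ≤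
      ENNReal.ofReal (dispConst r * |a.im| ^ (-(1 / 2 - 1 / r))) * pNorm p f * pNorm p g := by
  rw [← integral_fourier_mul_eq (integrable_gauss_mul ha hf.integrable) hg.integrable]
  refine (enorm_integral_le_lintegral_enorm _).trans ?_
  refine (lintegral_mul_le_pNorm hr hp
    (continuous_fourier (integrable_gauss_mul ha hf.integrable)).measurable hg.measurable).trans ?_
  gcongr
  exact pNorm_heatOp_le hr hp ha him hf

/-! ### The Hardy-Littlewood-Sobolev inequality -/

lemma lintegral_comp_abs_eq (g : ℝ → ℝ≥0∞) :
    ∫⁻ u, g |u| = 2 * ∫⁻ u in Ioi (0 : ℝ), g u := by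
  rw [← lintegral_add_compl _ (measurableSet_Ioi (a := (0 : ℝ))), two_mul]
  congr 1
  · exact setLIntegral_congr_fun measurableSet_Ioi fun u hu => by
      rw [abs_of_pos hu]
  · have h := lintegral_comp_mul_right_eq (z := -1) (by norm_num)
      (fun u => indicator (Ici (0 : ℝ)) g u)
    rw [abs_inv, abs_neg, abs_one, inv_one, ENNReal.ofReal_one, one_mul,
      lintegral_indicator measurableSet_Ici, setLIntegral_congr Ioi_ae_eq_Ici.symm] at h
    rw [← h, compl_Ioi, ← lintegral_indicator measurableSet_Iic]
    congr 1; ext u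
    by_cases hu : u ≤ 0
    · rw [indicator_of_mem (by exact hu), indicator_of_mem (by
        change 0 ≤ u * -1; linarith), abs_of_nonpos hu, mul_neg_one]
    · rw [indicator_of_notMem (by exact hu), indicator_of_notMem (by
        intro h'; have : 0 ≤ u * -1 := h'; apply hu; linarith)]

lemma lintegral_near {l R : ℝ} (hl : l < 1) (hR : 0 ≤ R) (t : ℝ) :
    ∫⁻ s, indicator (Iic R) (fun u => ENNReal.ofReal (u ^ (-l))) |t - s| =
      ENNReal.ofReal (2 * (R ^ (1 - l) / (1 - l))) := by
  rw [lintegral_sub_left_eq_self (μ := (volume : Measure ℝ))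
    (fun u : ℝ => indicator (Iic R) (fun u => ENNReal.ofReal (u ^ (-l))) |u|) t,
    lintegral_comp_abs_eq, ← lintegral_indicator measurableSet_Ioi]
  have e : ∀ u, indicator (Ioi (0 : ℝ)) (indicator (Iic R) fun u => ENNReal.ofReal (u ^ (-l))) u =
      indicator (Ioc 0 R) (fun u => ENNReal.ofReal (u ^ (-l))) u := fun u => by
    rw [indicator_indicator, Ioi_inter_Iic]
  simp only [e]
  rw [lintegral_indicator measurableSet_Ioc, setLIntegral_rpow_Ioc (by linarith) hR,
    ENNReal.ofReal_mul (by norm_num)]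
  congr 2
  · norm_num
  · rw [show -l + 1 = 1 - l by ring]

lemma lintegral_far {R : ℝ} (hR : 0 < R) (t : ℝ) :
    ∫⁻ s, indicator (Ioi R) (fun u => ENNReal.ofReal (u ^ (-2 : ℝ))) |t - s| =
      ENNReal.ofReal (2 / R) := by
  rw [lintegral_sub_left_eq_self (μ := (volume : Measure ℝ))
    (fun u : ℝ => indicator (Ioi R) (fun u => ENNReal.ofReal (u ^ (-2 : ℝ))) |u|) t,
    lintegral_comp_abs_eq, ← lintegral_indicator measurableSet_Ioi]
  have e : ∀ u, indicator (Ioi (0 : ℝ)) (indicator (Ioi R) fun u => ENNReal.ofReal (u ^ (-2 : ℝ))) u =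
      indicator (Ioi R) (fun u => ENNReal.ofReal (u ^ (-2 : ℝ))) u := fun u => by
    rw [indicator_indicator, inter_eq_right.2 (Ioi_subset_Ioi hR.le)]
  simp only [e]
  rw [lintegral_indicator measurableSet_Ioi, ← ofReal_integral_eq_lintegral_ofReal
    (integrableOn_Ioi_rpow_of_lt (by norm_num) hR)
    ((ae_restrict_iff' measurableSet_Ioi).2 (ae_of_all _ fun u hu =>
      Real.rpow_nonneg (hR.le.trans (le_of_lt hu)) _)),
    integral_Ioi_rpow_of_lt (by norm_num) hR]
  have e2 : -R ^ ((-2 : ℝ) + 1) / (-2 + 1) = R⁻¹ := by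
    rw [show (-2 : ℝ) + 1 = -1 by norm_num, Real.rpow_neg_one]; ring
  rw [e2, div_eq_mul_inv, ENNReal.ofReal_mul (by norm_num)]
  norm_num

/-- The constant in the Hardy-Littlewood-Sobolev inequality. -/
def hlsConst (q : ℝ) : ℝ := 2 * (2 / (1 - 2 / q) + 2 ^ (1 / q))

/-- Hedberg's splitting at distance `R`. Near `t` the truncated function is at most `A`, and far
from `t` Hölder applies with the kernel `u^(-2/q)`, whose `q`-th power `u⁻²` is integrable at
infinity. -/
lemma hls_pointwise {q p N A : ℝ} (hq : 2 < q) (hp : p = q / (q - 1)) (hN : 0 < N) (hA : 0 < A)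
    {a : ℝ → ℝ≥0∞} (ha : Measurable a) (haN : ∫⁻ s, a s ^ p = ENNReal.ofReal N) (t : ℝ) :
    ENNReal.ofReal A * ∫⁻ s, ENNReal.ofReal (|t - s| ^ (-(2 / q))) *
      indicator {s | a s ≤ ENNReal.ofReal A} a s ≤
      ENNReal.ofReal ((2 / (1 - 2 / q) + 2 ^ (1 / q)) * N ^ (1 - 2 / q) * A ^ p) := by
  have hq0 : 0 < q := by linarith
  have hq1 : q - 1 ≠ 0 := by linarith
  have hl : 2 / q < 1 := by rw [div_lt_one hq0]; exact hq
  have hl' : 0 < 1 - 2 / q := by linarith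
  have hpq : q.HolderConjugate p := by
    rw [Real.holderConjugate_iff]
    refine ⟨by linarith, ?_⟩
    rw [hp]; field_simp; ring
  -- This radius makes both contributions, after multiplication by `A`, proportional to `N^(1-2/q)
  -- A^p`.
  set R := N * A ^ (-p) with hR
  have hR0 : 0 < R := by positivity
  set f1 : ℝ → ℝ≥0∞ := fun s =>
    indicator (Iic R) (fun u => ENNReal.ofReal (u ^ (-(2 / q)))) |t - s| with hf1
  set f2 : ℝ → ℝ≥0∞ := fun s =>
    indicator (Ioi R) (fun u => ENNReal.ofReal (u ^ (-(2 / q)))) |t - s| with hf2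
  have hm1 : Measurable f1 :=
    Measurable.comp (g := indicator (Iic R) (fun u => ENNReal.ofReal (u ^ (-(2 / q)))))
      (Measurable.indicator (by fun_prop) measurableSet_Iic) (f := fun s => |t - s|) (by fun_prop)
  have hm2 : Measurable f2 :=
    Measurable.comp (g := indicator (Ioi R) (fun u => ENNReal.ofReal (u ^ (-(2 / q)))))
      (Measurable.indicator (by fun_prop) measurableSet_Ioi) (f := fun s => |t - s|) (by fun_prop)
  have hsplit : ∀ s, ENNReal.ofReal (|t - s| ^ (-(2 / q))) *
      indicator {s | a s ≤ ENNReal.ofReal A} a s ≤ f1 s * ENNReal.ofReal A + f2 s * a s := by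
    intro s
    by_cases hs : |t - s| ≤ R
    · have e1 : f1 s = ENNReal.ofReal (|t - s| ^ (-(2 / q))) :=
        indicator_of_mem (s := Iic R) hs _
      rw [e1]
      refine le_trans ?_ le_self_add
      gcongr
      by_cases h : s ∈ {s | a s ≤ ENNReal.ofReal A}
      · rw [indicator_of_mem h]; exact h
      · rw [indicator_of_notMem h]; exact zero_le
    · have e2 : f2 s = ENNReal.ofReal (|t - s| ^ (-(2 / q))) :=
        indicator_of_mem (s := Ioi R) (not_le.1 hs) _
      rw [e2]
      refine le_trans ?_ le_add_self
      gcongr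
      exact indicator_le_self _ _ _
  have hnear : ∫⁻ s, f1 s * ENNReal.ofReal A =
      ENNReal.ofReal (2 * (R ^ (1 - 2 / q) / (1 - 2 / q)) * A) := by
    rw [lintegral_mul_const _ hm1, lintegral_near hl hR0.le, ← ENNReal.ofReal_mul (by positivity)]
  have hfar : ∫⁻ s, f2 s * a s ≤ ENNReal.ofReal ((2 / R) ^ (1 / q) * N ^ (1 / p)) := by
    refine (ENNReal.lintegral_mul_le_Lp_mul_Lq volume hpq hm2.aemeasurable ha.aemeasurable).trans
      (le_of_eq ?_)
    have e : ∀ s, f2 s ^ q = indicator (Ioi R) (fun u => ENNReal.ofReal (u ^ (-2 : ℝ))) |t - s| := by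
      intro s
      simp only [hf2]
      by_cases hs : |t - s| ∈ Ioi R
      · have hs0 : 0 < |t - s| := hR0.trans hs
        rw [indicator_of_mem hs, indicator_of_mem hs, ENNReal.ofReal_rpow_of_pos (by positivity),
          ← Real.rpow_mul hs0.le]
        congr 2
        field_simp
      · rw [indicator_of_notMem hs, indicator_of_notMem hs, ENNReal.zero_rpow_of_pos hq0]
    simp only [e]
    have hp0 := hpq.symm.pos
    rw [lintegral_far hR0, haN, ENNReal.ofReal_rpow_of_pos (by positivity),
      ENNReal.ofReal_rpow_of_pos hN, ← ENNReal.ofReal_mul (by positivity)]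
  calc _ ≤ ENNReal.ofReal A * ∫⁻ s, (f1 s * ENNReal.ofReal A + f2 s * a s) := by
        gcongr with s
        exact hsplit s
    _ ≤ ENNReal.ofReal A * (ENNReal.ofReal (2 * (R ^ (1 - 2 / q) / (1 - 2 / q)) * A) +
          ENNReal.ofReal ((2 / R) ^ (1 / q) * N ^ (1 / p))) := by
        have : Measurable fun s => f1 s * ENNReal.ofReal A := by fun_prop
        rw [lintegral_add_left this, hnear]
        gcongr
    _ = _ := by
        rw [← ENNReal.ofReal_add (by positivity) (by positivity), ← ENNReal.ofReal_mul hA.le]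
        congr 1
        have hp0 := hpq.symm.pos
        have e1 : R ^ (1 - 2 / q) = N ^ (1 - 2 / q) * A ^ (p - 2) := by
          rw [hR, Real.mul_rpow hN.le (by positivity), ← Real.rpow_mul hA.le]
          congr 2
          rw [hp]; field_simp; ring
        have e2 : (2 / R) ^ (1 / q) = 2 ^ (1 / q) * (N ^ (-(1 / q)) * A ^ (p - 1)) := by
          rw [div_eq_mul_inv, Real.mul_rpow (by norm_num) (by positivity), hR,
            Real.inv_rpow (by positivity), Real.mul_rpow hN.le (by positivity), mul_inv,
            ← Real.rpow_neg hN.le, ← Real.rpow_neg (by positivity), ← Real.rpow_mul hA.le]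
          congr 3
          rw [hp]; field_simp; ring
        have e3 : N ^ (1 - 2 / q) = N ^ (-(1 / q)) * N ^ (1 / p) := by
          rw [← Real.rpow_add hN]
          congr 1
          rw [hp]; field_simp; ring
        have e4 : A ^ p = A ^ (p - 2) * A ^ 2 := by
          rw [← Real.rpow_natCast, ← Real.rpow_add hA]; congr 1; push_cast; ring
        have e5 : A ^ p = A ^ (p - 1) * A := by
          rw [← Real.rpow_add_one hA.ne']; congr 1; ring
        rw [e1, e2]
        calc _ = 2 / (1 - 2 / q) * N ^ (1 - 2 / q) * (A ^ (p - 2) * A ^ 2) +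
              2 ^ (1 / q) * (N ^ (-(1 / q)) * N ^ (1 / p)) * (A ^ (p - 1) * A) := by ring
          _ = _ := by rw [← e4, ← e5, ← e3]; ring

/-- The diagonal case of the Hardy-Littlewood-Sobolev inequality. -/
lemma hls {q p : ℝ} (hq : 2 < q) (hp : p = q / (q - 1)) {a : ℝ → ℝ≥0∞} (ha : Measurable a) :
    ∫⁻ t, ∫⁻ s, ENNReal.ofReal (|t - s| ^ (-(2 / q))) * (a t * a s) ≤
      ENNReal.ofReal (hlsConst q) * ((∫⁻ s, a s ^ p) ^ (1 / p)) ^ 2 := by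
  have hq0 : 0 < q := by linarith
  have hq1 : q - 1 ≠ 0 := by linarith
  have hl : 2 / q < 1 := by rw [div_lt_one hq0]; exact hq
  have hl' : 0 < 1 - 2 / q := by linarith
  have hp0 : 0 < p := by rw [hp]; exact div_pos hq0 (by linarith)
  have hC : 0 < hlsConst q := by unfold hlsConst; positivity
  rcases eq_or_ne (∫⁻ s, a s ^ p) ⊤ with htop | htop
  · rw [htop, ENNReal.top_rpow_of_pos (by positivity)]
    rw [show (⊤ : ℝ≥0∞) ^ 2 = ⊤ from by simp, ENNReal.mul_top (ENNReal.ofReal_pos.2 hC).ne']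
    exact le_top
  have hap : Measurable fun s => a s ^ p := ha.pow_const p
  rcases eq_or_ne (∫⁻ s, a s ^ p) 0 with hzero | hzero
  · have h0 : ∀ᵐ s, a s = 0 := by
      filter_upwards [(lintegral_eq_zero_iff hap).1 hzero] with s hs
      have : a s ^ p = 0 := hs
      simpa [hp0, hp0.not_gt] using this
    have : ∫⁻ t, ∫⁻ s, ENNReal.ofReal (|t - s| ^ (-(2 / q))) * (a t * a s) = 0 := by
      refine (lintegral_congr_ae (g := fun _ => 0) ?_).trans (by simp)
      filter_upwards [h0] with t ht
      simp [ht]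
    rw [this]; exact zero_le
  set N := (∫⁻ s, a s ^ p).toReal with hN
  have hN0 : 0 < N := ENNReal.toReal_pos hzero htop
  have haN : ∫⁻ s, a s ^ p = ENNReal.ofReal N := (ENNReal.ofReal_toReal htop).symm
  set w : ℝ → ℝ → ℝ≥0∞ := fun t s =>
    ENNReal.ofReal (|t - s| ^ (-(2 / q))) * indicator {s | a s ≤ a t} a s with hw
  have hwm : Measurable (Function.uncurry fun t s => a t * w t s) := by
    have e : (Function.uncurry fun t s => a t * w t s) = fun z : ℝ × ℝ => a z.1 *
        (ENNReal.ofReal (|z.1 - z.2| ^ (-(2 / q))) *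
          indicator {z : ℝ × ℝ | a z.2 ≤ a z.1} (fun z => a z.2) z) := by
      funext z; rfl
    rw [e]
    have h1 : Measurable (indicator {z : ℝ × ℝ | a z.2 ≤ a z.1} fun z => a z.2) :=
      Measurable.indicator (by fun_prop) (measurableSet_le (by fun_prop) (by fun_prop))
    fun_prop
  -- The form is symmetric, so it suffices to integrate over pairs with `a s ≤ a t`. There the
  -- pointwise bound with `A = a t` yields `a t ^ p`, which integrates to `N`.
  have hsym : ∀ t s, ENNReal.ofReal (|t - s| ^ (-(2 / q))) * (a t * a s) ≤
      a t * w t s + a s * w s t := by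
    intro t s
    simp only [hw]
    rcases le_total (a s) (a t) with h | h
    · rw [indicator_of_mem (s := {s | a s ≤ a t}) h]
      refine le_trans (le_of_eq ?_) le_self_add
      ring
    · rw [indicator_of_mem (s := {t | a t ≤ a s}) h, abs_sub_comm s t]
      refine le_trans (le_of_eq ?_) le_add_self
      ring
  have hmain : ∫⁻ t, ∫⁻ s, a t * w t s ≤
      ENNReal.ofReal ((2 / (1 - 2 / q) + 2 ^ (1 / q)) * N ^ (1 - 2 / q) * N) := by
    rw [ENNReal.ofReal_mul (by positivity), ← haN, ← lintegral_const_mul _ hap]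
    have hfin : ∀ᵐ t, a t ^ p < ⊤ := ae_lt_top hap htop
    refine lintegral_mono_ae ?_
    filter_upwards [hfin] with t ht
    have hwt : Measurable fun s => w t s := by
      have h1 : Measurable (indicator {s | a s ≤ a t} a) :=
        ha.indicator (measurableSet_le ha measurable_const)
      simp only [hw]
      fun_prop
    rw [lintegral_const_mul _ hwt]
    rcases eq_or_ne (a t) 0 with h0 | h0
    · rw [h0, zero_mul]; exact zero_le
    have hat : a t ≠ ⊤ := fun h => by rw [h, ENNReal.top_rpow_of_pos hp0] at ht; exact lt_irrefl _ ht
    have hA : 0 < (a t).toReal := ENNReal.toReal_pos h0 hat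
    have e : ENNReal.ofReal (a t).toReal = a t := ENNReal.ofReal_toReal hat
    have := hls_pointwise hq hp hN0 hA ha haN t
    rw [ENNReal.ofReal_mul (p := _ * _) (by positivity), ← ENNReal.ofReal_rpow_of_pos hA, e] at this
    exact this
  calc _ ≤ ∫⁻ t, ∫⁻ s, (a t * w t s + a s * w s t) := by
        gcongr with t s
        exact hsym t s
    _ = (∫⁻ t, ∫⁻ s, a t * w t s) + ∫⁻ t, ∫⁻ s, a s * w s t := by
        have h1 : ∀ t, Measurable fun s => a t * w t s := fun t =>
          hwm.comp (measurable_const.prodMk measurable_id)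
        have h2 : Measurable fun t => ∫⁻ s, a t * w t s := hwm.lintegral_prod_right'
        simp only [lintegral_add_left (h1 _)]
        rw [lintegral_add_left h2]
    _ = 2 * ∫⁻ t, ∫⁻ s, a t * w t s := by
        rw [lintegral_lintegral_swap (f := fun t s => a s * w s t), two_mul]
        exact (hwm.comp measurable_swap).aemeasurable
    _ ≤ 2 * ENNReal.ofReal ((2 / (1 - 2 / q) + 2 ^ (1 / q)) * N ^ (1 - 2 / q) * N) := by gcongr
    _ = _ := by
        rw [haN, ENNReal.ofReal_rpow_of_pos hN0, ← ENNReal.ofReal_pow (by positivity),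
          ← ENNReal.ofReal_mul hC.le, show (2 : ℝ≥0∞) = ENNReal.ofReal 2 by norm_num,
          ← ENNReal.ofReal_mul (by norm_num)]
        congr 1
        have e1 : (N ^ (1 / p)) ^ 2 = N ^ (1 - 2 / q) * N := by
          rw [← Real.rpow_add_one hN0.ne', ← Real.rpow_natCast, ← Real.rpow_mul hN0.le]
          congr 1
          rw [hp]; push_cast; field_simp; ring
        rw [e1, hlsConst]; ring

/-! ### The dual Strichartz estimate -/

/-- Bounded measurable space-time functions `h(t, x)` that vanish outside a bounded set. -/
structure IsNice (h : ℝ → ℝ → ℂ) : Prop where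
  measurable : Measurable (Function.uncurry h)
  bounded : ∃ B R : ℝ, 0 ≤ B ∧ ∀ t x, ‖h t x‖ ≤
    indicator (Icc (-R) R) (fun _ => B) t * indicator (Icc (-R) R) (fun _ => (1 : ℝ)) x

lemma integrable_indicator_Icc (R B : ℝ) : Integrable (indicator (Icc (-R) R) fun _ : ℝ => B) :=
  (integrable_indicator_iff measurableSet_Icc).2 (integrableOn_const (by simp))

lemma MemL12.of_bound {f : ℝ → ℂ} (hf : Measurable f) {B R : ℝ}
    (hb : ∀ x, ‖f x‖ ≤ Set.indicator (Icc (-R) R) (fun _ => B) x) : MemL12 f := by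
  have hi : Integrable f := (integrable_indicator_Icc R B).mono' hf.aestronglyMeasurable
    (ae_of_all _ hb)
  refine ⟨hf, hi, (memLp_two_iff_integrable_sq_norm hf.aestronglyMeasurable).2 ?_⟩
  refine (integrable_indicator_Icc R (B ^ 2)).mono' (by fun_prop) (ae_of_all _ fun x => ?_)
  have h := hb x
  rw [norm_pow, norm_norm]
  by_cases hx : x ∈ Icc (-R) R
  · rw [indicator_of_mem hx] at h ⊢
    exact pow_le_pow_left₀ (norm_nonneg _) h 2
  · rw [indicator_of_notMem hx] at h ⊢
    rw [le_antisymm h (norm_nonneg _)]; norm_num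

lemma IsNice.memL12 {h : ℝ → ℝ → ℂ} (hh : IsNice h) (t : ℝ) : MemL12 (h t) := by
  obtain ⟨B, R, hB, hb⟩ := hh.bounded
  have hm : Measurable (h t) := hh.measurable.comp (measurable_const.prodMk measurable_id)
  refine MemL12.of_bound hm (B := B) (R := R) fun x => (hb t x).trans ?_
  have h1 : indicator (Icc (-R) R) (fun _ => B) t ≤ B := indicator_le_self' (fun _ _ => hB) t
  by_cases hx : x ∈ Icc (-R) R
  · rw [indicator_of_mem hx, indicator_of_mem hx, mul_one]; exact h1
  · rw [indicator_of_notMem hx, indicator_of_notMem hx, mul_zero]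

lemma IsNice.measurable_fourierInv {h : ℝ → ℝ → ℂ} (hh : IsNice h) :
    Measurable fun y : ℝ × ℝ => (𝓕⁻ (h y.1) : ℝ → ℂ) y.2 := by
  have e : (fun y : ℝ × ℝ => (𝓕⁻ (h y.1) : ℝ → ℂ) y.2) = fun y : ℝ × ℝ =>
      ∫ x, Complex.exp ((-2 * Real.pi * x * (-y.2) : ℝ) * Complex.I) * h y.1 x := by
    funext y
    rw [Real.fourierInv_eq_fourier_neg, Real.fourier_real_eq_integral_exp_smul]
    simp only [smul_eq_mul]
  rw [e]
  have h1 : Measurable fun z : (ℝ × ℝ) × ℝ => h z.1.1 z.2 :=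
    hh.measurable.comp ((measurable_fst.comp measurable_fst).prodMk measurable_snd)
  have h2 : Measurable fun z : (ℝ × ℝ) × ℝ =>
      Complex.exp ((-2 * Real.pi * z.2 * (-z.1.2) : ℝ) * Complex.I) * h z.1.1 z.2 :=
    Measurable.mul (by fun_prop) h1
  exact (h2.stronglyMeasurable.integral_prod_right').measurable

lemma IsNice.exists_fourierInv_bound {h : ℝ → ℝ → ℂ} (hh : IsNice h) :
    ∃ B R : ℝ, 0 ≤ B ∧ ∀ t η, ‖(𝓕⁻ (h t) : ℝ → ℂ) η‖ ≤ indicator (Icc (-R) R) (fun _ => B) t := by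
  obtain ⟨B, R, hB, hb⟩ := hh.bounded
  set V := ∫ x, indicator (Icc (-R) R) (fun _ => (1 : ℝ)) x with hV
  have hV0 : 0 ≤ V := integral_nonneg fun x => indicator_nonneg (fun _ _ => zero_le_one) x
  refine ⟨B * V, R, by positivity, fun t η => (norm_fourierInv_le (h t) η).trans ?_⟩
  refine (integral_mono (hh.memL12 t).integrable.norm
    ((integrable_indicator_Icc R 1).const_mul _) fun x => hb t x).trans (le_of_eq ?_)
  rw [integral_const_mul, ← hV]
  by_cases ht : t ∈ Icc (-R) R
  · rw [indicator_of_mem ht, indicator_of_mem ht]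
  · rw [indicator_of_notMem ht, indicator_of_notMem ht, zero_mul]

/-- The adjoint of the free evolution with speed `c`. -/
def dualEvo (c : ℝ) (h : ℝ → ℝ → ℂ) (η : ℝ) : ℂ :=
  ∫ t, Complex.exp (((-(4 * Real.pi ^ 2 * c * t * η ^ 2) : ℝ) : ℂ) * Complex.I) *
    (𝓕⁻ (h t) : ℝ → ℂ) η

lemma IsNice.measurable_dualEvo {h : ℝ → ℝ → ℂ} (hh : IsNice h) {c : ℝ → ℝ} (hc : Measurable c) :
    Measurable fun y : ℝ × ℝ => dualEvo (c y.1) h y.2 := by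
  have h0 := hh.measurable_fourierInv
  have h1 : Measurable fun z : (ℝ × ℝ) × ℝ => (𝓕⁻ (h z.2) : ℝ → ℂ) z.1.2 :=
    Measurable.comp (g := fun y : ℝ × ℝ => (𝓕⁻ (h y.1) : ℝ → ℂ) y.2) h0
      (f := fun z : (ℝ × ℝ) × ℝ => (z.2, z.1.2)) (by fun_prop)
  have h2 : Measurable fun z : (ℝ × ℝ) × ℝ => Complex.exp
      (((-(4 * Real.pi ^ 2 * c z.1.1 * z.2 * z.1.2 ^ 2) : ℝ) : ℂ) * Complex.I) *
        (𝓕⁻ (h z.2) : ℝ → ℂ) z.1.2 :=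
    Measurable.mul (by fun_prop) h1
  exact (h2.stronglyMeasurable.integral_prod_right').measurable

lemma IsNice.measurable_dualEvo_const {h : ℝ → ℝ → ℂ} (hh : IsNice h) (c : ℝ) :
    Measurable (dualEvo c h) :=
  Measurable.comp (g := fun y : ℝ × ℝ => dualEvo c h y.2)
    (hh.measurable_dualEvo (c := fun _ => c) measurable_const)
    (f := fun η : ℝ => ((0 : ℝ), η)) (by fun_prop)

lemma fourierInv_conj (f : ℝ → ℂ) (η : ℝ) :
    starRingEnd ℂ ((𝓕⁻ f : ℝ → ℂ) η) = (𝓕 (fun x => starRingEnd ℂ (f x)) : ℝ → ℂ) η := by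
  rw [Real.fourierInv_eq_fourier_neg]
  simp only [Real.fourier_real_eq_integral_exp_smul, smul_eq_mul]
  rw [← integral_conj]
  congr 1; ext x
  rw [map_mul, ← Complex.exp_conj, map_mul, Complex.conj_I, Complex.conj_ofReal]
  congr 2
  push_cast; ring

lemma MemL12.conj {f : ℝ → ℂ} (hf : MemL12 f) : MemL12 fun x => starRingEnd ℂ (f x) := by
  have hm : Measurable fun x => starRingEnd ℂ (f x) :=
    (RCLike.continuous_conj (K := ℂ)).measurable.comp hf.measurable
  refine ⟨hm, ?_, ?_⟩
  · exact hf.integrable.norm.mono' hm.aestronglyMeasurable (ae_of_all _ fun x => by simp)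
  · exact hf.memLp.of_le hm.aestronglyMeasurable (ae_of_all _ fun x => by simp)

lemma pNorm_conj (p : ℝ) (f : ℝ → ℂ) : pNorm p (fun x => starRingEnd ℂ (f x)) = pNorm p f := by
  unfold pNorm
  congr 2; ext x
  rw [← ofReal_norm, ← ofReal_norm, RCLike.norm_conj]

/-- The norm of `L^{q}_t L^{p}_x`. -/
def mNorm (q p : ℝ) (h : ℝ → ℝ → ℂ) : ℝ≥0∞ := (∫⁻ t, pNorm p (h t) ^ q) ^ (1 / q)

lemma IsNice.measurable_pNorm {h : ℝ → ℝ → ℂ} (hh : IsNice h) (p : ℝ) :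
    Measurable fun t => pNorm p (h t) := by
  have h1 : Measurable fun z : ℝ × ℝ => ‖h z.1 z.2‖ₑ ^ p := (hh.measurable.enorm).pow_const p
  exact (h1.lintegral_prod_right').pow_const _

/-- The integrand whose integral in `(t, t')` and `η` is the regularized square norm. -/
def dualIntegrand (c δ : ℝ) (h : ℝ → ℝ → ℂ) (η : ℝ) (z : ℝ × ℝ) : ℂ :=
  gauss ((δ : ℂ) + ((4 * Real.pi ^ 2 * c * (z.1 - z.2) : ℝ) : ℂ) * Complex.I) η *
    (𝓕⁻ (h z.1) : ℝ → ℂ) η * (𝓕 (fun x => starRingEnd ℂ (h z.2 x)) : ℝ → ℂ) η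

/-- The modulus squared of a time integral is a double time integral: the phase at `t - t'` factors
into the phase at `t` and the conjugate phase at `t'`. -/
lemma integral_dualIntegrand (c δ : ℝ) (h : ℝ → ℝ → ℂ) (η : ℝ) :
    ∫ z, dualIntegrand c δ h η z =
      ((Real.exp (-δ * η ^ 2) * ‖dualEvo c h η‖ ^ 2 : ℝ) : ℂ) := by
  have e : ∀ z : ℝ × ℝ, dualIntegrand c δ h η z = (Real.exp (-δ * η ^ 2) : ℂ) *
      ((Complex.exp (((-(4 * Real.pi ^ 2 * c * z.1 * η ^ 2) : ℝ) : ℂ) * Complex.I) *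
        (𝓕⁻ (h z.1) : ℝ → ℂ) η) * starRingEnd ℂ
      (Complex.exp (((-(4 * Real.pi ^ 2 * c * z.2 * η ^ 2) : ℝ) : ℂ) * Complex.I) *
        (𝓕⁻ (h z.2) : ℝ → ℂ) η)) := by
    intro z
    rw [dualIntegrand, map_mul, fourierInv_conj, ← Complex.exp_conj, map_mul, Complex.conj_I,
      Complex.conj_ofReal, gauss, Complex.ofReal_exp]
    have : Complex.exp (-((δ : ℂ) + ((4 * Real.pi ^ 2 * c * (z.1 - z.2) : ℝ) : ℂ) * Complex.I) *
        (η : ℂ) ^ 2) = Complex.exp (((-δ * η ^ 2 : ℝ) : ℂ)) *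
        (Complex.exp (((-(4 * Real.pi ^ 2 * c * z.1 * η ^ 2) : ℝ) : ℂ) * Complex.I) *
        Complex.exp (((-(4 * Real.pi ^ 2 * c * z.2 * η ^ 2) : ℝ) : ℂ) * -Complex.I)) := by
      rw [← Complex.exp_add, ← Complex.exp_add]
      congr 1
      push_cast; ring
    rw [this]; ring
  simp only [e]
  rw [integral_const_mul, Measure.volume_eq_prod,
    integral_prod_mul (μ := (volume : Measure ℝ)) (ν := (volume : Measure ℝ))
    (f := fun t => Complex.exp (((-(4 * Real.pi ^ 2 * c * t * η ^ 2) : ℝ) : ℂ) * Complex.I) *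
        (𝓕⁻ (h t) : ℝ → ℂ) η)
    (g := fun t => starRingEnd ℂ
      (Complex.exp (((-(4 * Real.pi ^ 2 * c * t * η ^ 2) : ℝ) : ℂ) * Complex.I) *
        (𝓕⁻ (h t) : ℝ → ℂ) η)), integral_conj]
  change (Real.exp (-δ * η ^ 2) : ℂ) * (dualEvo c h η * starRingEnd ℂ (dualEvo c h η)) = _
  rw [Complex.mul_conj, Complex.normSq_eq_norm_sq]
  push_cast; ring

lemma IsNice.integrable_dualIntegrand {h : ℝ → ℝ → ℂ} (hh : IsNice h) (c : ℝ) {δ : ℝ} (hδ : 0 < δ) :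
    Integrable (Function.uncurry (dualIntegrand c δ h)) := by
  obtain ⟨B, R, hB, hb⟩ := hh.exists_fourierInv_bound
  have hg : Integrable fun η : ℝ => Real.exp (-δ * η ^ 2) := integrable_exp_neg_mul_sq hδ
  have hi := integrable_indicator_Icc R B
  have hm := hh.measurable_fourierInv
  have hm1 : Measurable fun y : ℝ × ℝ × ℝ => (𝓕⁻ (h y.2.1) : ℝ → ℂ) y.1 :=
    Measurable.comp (g := fun y : ℝ × ℝ => (𝓕⁻ (h y.1) : ℝ → ℂ) y.2) hm
      (f := fun y : ℝ × ℝ × ℝ => (y.2.1, y.1)) (by fun_prop)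
  have hm2 : Measurable fun y : ℝ × ℝ × ℝ =>
      (𝓕 (fun x => starRingEnd ℂ (h y.2.2 x)) : ℝ → ℂ) y.1 := by
    simp only [← fourierInv_conj]
    have h1 : Measurable fun y : ℝ × ℝ × ℝ => (𝓕⁻ (h y.2.2) : ℝ → ℂ) y.1 :=
      Measurable.comp (g := fun y : ℝ × ℝ => (𝓕⁻ (h y.1) : ℝ → ℂ) y.2) hm
        (f := fun y : ℝ × ℝ × ℝ => (y.2.2, y.1)) (by fun_prop)
    exact (RCLike.continuous_conj (K := ℂ)).measurable.comp h1
  have hm3 : Measurable fun y : ℝ × ℝ × ℝ =>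
      gauss ((δ : ℂ) + ((4 * Real.pi ^ 2 * c * (y.2.1 - y.2.2) : ℝ) : ℂ) * Complex.I) y.1 := by
    unfold gauss; fun_prop
  refine (hg.mul_prod (hi.mul_prod hi)).mono' ((hm3.mul hm1).mul hm2).aestronglyMeasurable
    (ae_of_all _ fun y => ?_)
  obtain ⟨η, t, s⟩ := y
  simp only [Function.uncurry, dualIntegrand]
  rw [← fourierInv_conj, norm_mul, norm_mul, RCLike.norm_conj, norm_gauss, mul_assoc]
  have e : -((δ : ℂ) + ((4 * Real.pi ^ 2 * c * (t - s) : ℝ) : ℂ) * Complex.I).re = -δ := by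
    rw [Complex.add_re, Complex.ofReal_re, Complex.re_ofReal_mul, Complex.I_re]; ring
  rw [e]
  have h0 : 0 ≤ indicator (Icc (-R) R) (fun _ => B) t := indicator_nonneg (fun _ _ => hB) t
  gcongr
  · exact hb t η
  · exact hb s η

/-- The constant in the dual Strichartz estimate. -/
def strConst (q r : ℝ) : ℝ := dispConst r * (4 * Real.pi ^ 2) ^ (-(2 / q)) * hlsConst q

lemma hlsConst_pos {q : ℝ} (hq : 2 < q) : 0 < hlsConst q := by
  have hl : 2 / q < 1 := by rw [div_lt_one (by linarith)]; exact hq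
  have hl' : 0 < 1 - 2 / q := by linarith
  unfold hlsConst; positivity

lemma strConst_nonneg {q r : ℝ} (hq : 2 < q) (hr : 2 < r) : 0 ≤ strConst q r := by
  have := hlsConst_pos hq
  have := dispConst_nonneg hr
  unfold strConst; positivity

/-- The `TT*` argument. The square norm is a double time integral of pairings of the propagator at
time `t - t'`. The dispersive estimate bounds each by `|c (t - t')|^(-2/q)`, and `hls` sums them.
The damping `δ` makes Fubini legitimate and does not enter the bound. -/
lemma IsNice.lintegral_dualEvo_gauss_le {q r q' p : ℝ} (hq : 2 < q) (hr : 2 < r)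
    (hqr : 1 / 2 - 1 / r = 2 / q) (hp : p = r / (r - 1)) (hq' : q' = q / (q - 1))
    {h : ℝ → ℝ → ℂ} (hh : IsNice h) {c : ℝ} (hc : c ≠ 0) {δ : ℝ} (hδ : 0 < δ) :
    ∫⁻ η, ENNReal.ofReal (Real.exp (-δ * η ^ 2) * ‖dualEvo c h η‖ ^ 2) ≤
      ENNReal.ofReal (strConst q r * |c| ^ (-(2 / q))) * mNorm q' p h ^ 2 := by
  have hi := hh.integrable_dualIntegrand c hδ
  have hpi := Real.pi_pos
  have hreal : Integrable fun η => Real.exp (-δ * η ^ 2) * ‖dualEvo c h η‖ ^ 2 := by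
    have := hi.integral_prod_left
    simp only [Function.uncurry_apply_pair, integral_dualIntegrand] at this
    exact this.re
  have e1 : ∫⁻ η, ENNReal.ofReal (Real.exp (-δ * η ^ 2) * ‖dualEvo c h η‖ ^ 2) =
      ‖∫ η, ∫ z, dualIntegrand c δ h η z‖ₑ := by
    rw [← ofReal_integral_eq_lintegral_ofReal hreal (ae_of_all _ fun η => by positivity)]
    simp only [integral_dualIntegrand]
    have := integral_ofReal (𝕜 := ℂ) (μ := (volume : Measure ℝ))
      (f := fun η => Real.exp (-δ * η ^ 2) * ‖dualEvo c h η‖ ^ 2)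
    rw [show ∫ η, ((Real.exp (-δ * η ^ 2) * ‖dualEvo c h η‖ ^ 2 : ℝ) : ℂ) = _ from this,
      ← ofReal_norm]
    congr 1
    change _ = ‖((∫ η, Real.exp (-δ * η ^ 2) * ‖dualEvo c h η‖ ^ 2 : ℝ) : ℂ)‖
    rw [Complex.norm_real, Real.norm_of_nonneg (integral_nonneg fun η => by positivity)]
  rw [e1, integral_integral_swap hi]
  have hne : ∀ t : ℝ, ∀ᵐ s : ℝ, s ≠ t := fun t => ae_ne t
  have hbound : ∀ t s, s ≠ t → ‖∫ η, dualIntegrand c δ h η (t, s)‖ₑ ≤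
      ENNReal.ofReal (dispConst r * |4 * Real.pi ^ 2 * c * (t - s)| ^ (-(2 / q))) *
        pNorm p (h t) * pNorm p (h s) := by
    intro t s hts
    have hts' : t - s ≠ 0 := sub_ne_zero.2 hts.symm
    set a : ℂ := (δ : ℂ) + ((4 * Real.pi ^ 2 * c * (t - s) : ℝ) : ℂ) * Complex.I with ha
    have hre : a.re = δ := by
      rw [ha, Complex.add_re, Complex.ofReal_re, Complex.re_ofReal_mul, Complex.I_re]; ring
    have him : a.im = 4 * Real.pi ^ 2 * c * (t - s) := by
      rw [ha, Complex.add_im, Complex.ofReal_im, Complex.im_ofReal_mul, Complex.I_im]; ring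
    have h0 := enorm_integral_gauss_le hr hp (a := a) (by rw [hre]; exact hδ)
      (by rw [him]; positivity) (hh.memL12 t) (hh.memL12 s).conj
    rw [pNorm_conj, him, hqr] at h0
    exact h0
  calc ‖∫ z : ℝ × ℝ, ∫ η, dualIntegrand c δ h η z‖ₑ
      ≤ ∫⁻ z : ℝ × ℝ, ‖∫ η, dualIntegrand c δ h η z‖ₑ := enorm_integral_le_lintegral_enorm _
    _ = ∫⁻ t, ∫⁻ s, ‖∫ η, dualIntegrand c δ h η (t, s)‖ₑ := by
        rw [Measure.volume_eq_prod, lintegral_prod]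
        exact hi.integral_prod_right.aestronglyMeasurable.enorm
    _ ≤ ∫⁻ t, ∫⁻ s, ENNReal.ofReal (dispConst r * |4 * Real.pi ^ 2 * c * (t - s)| ^ (-(2 / q))) *
        pNorm p (h t) * pNorm p (h s) := by
        refine lintegral_mono fun t => lintegral_mono_ae ?_
        filter_upwards [hne t] with s hs
        exact hbound t s hs
    _ = ∫⁻ t, ∫⁻ s, ENNReal.ofReal (dispConst r * (4 * Real.pi ^ 2) ^ (-(2 / q)) * |c| ^ (-(2 / q))) *
        (ENNReal.ofReal (|t - s| ^ (-(2 / q))) * (pNorm p (h t) * pNorm p (h s))) := by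
        congr 1; ext t; congr 1; ext s
        have hd := dispConst_nonneg hr
        rw [abs_mul, abs_mul, abs_of_nonneg (a := 4 * Real.pi ^ 2) (by positivity),
          Real.mul_rpow (by positivity) (by positivity), Real.mul_rpow (by positivity) (by positivity),
          ← mul_assoc, ← mul_assoc, ENNReal.ofReal_mul (by positivity)]
        ring
    _ = ENNReal.ofReal (dispConst r * (4 * Real.pi ^ 2) ^ (-(2 / q)) * |c| ^ (-(2 / q))) *
        ∫⁻ t, ∫⁻ s, (ENNReal.ofReal (|t - s| ^ (-(2 / q))) * (pNorm p (h t) * pNorm p (h s))) := by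
        have h1 := hh.measurable_pNorm p
        have h2 : ∀ t, Measurable fun s => ENNReal.ofReal (|t - s| ^ (-(2 / q))) *
            (pNorm p (h t) * pNorm p (h s)) := fun t => by fun_prop
        have h3 : Measurable fun z : ℝ × ℝ => ENNReal.ofReal (|z.1 - z.2| ^ (-(2 / q))) *
            (pNorm p (h z.1) * pNorm p (h z.2)) :=
          Measurable.mul (by fun_prop) ((h1.comp measurable_fst).mul (h1.comp measurable_snd))
        simp only [lintegral_const_mul _ (h2 _)]
        rw [lintegral_const_mul _ h3.lintegral_prod_right']
    _ ≤ ENNReal.ofReal (dispConst r * (4 * Real.pi ^ 2) ^ (-(2 / q)) * |c| ^ (-(2 / q))) *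
        (ENNReal.ofReal (hlsConst q) * mNorm q' p h ^ 2) := by
        gcongr
        exact hls hq hq' (hh.measurable_pNorm p)
    _ = _ := by
        have hd := dispConst_nonneg hr
        rw [← mul_assoc, ← ENNReal.ofReal_mul (by positivity), strConst]
        congr 2; ring

/-- The dual Strichartz estimate. -/
lemma IsNice.lintegral_dualEvo_sq_le {q r q' p : ℝ} (hq : 2 < q) (hr : 2 < r)
    (hqr : 1 / 2 - 1 / r = 2 / q) (hp : p = r / (r - 1)) (hq' : q' = q / (q - 1))
    {h : ℝ → ℝ → ℂ} (hh : IsNice h) {c : ℝ} (hc : c ≠ 0) :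
    ∫⁻ η, ‖dualEvo c h η‖ₑ ^ 2 ≤
      ENNReal.ofReal (strConst q r * |c| ^ (-(2 / q))) * mNorm q' p h ^ 2 := by
  have hm := hh.measurable_dualEvo_const c
  -- The damping is removed by Fatou's lemma along `δ = 1/(n+1)`.
  have hlim : ∀ η, liminf (fun n : ℕ => ENNReal.ofReal
      (Real.exp (-(1 / ((n : ℝ) + 1)) * η ^ 2) * ‖dualEvo c h η‖ ^ 2)) atTop =
      ‖dualEvo c h η‖ₑ ^ 2 := by
    intro η
    apply Tendsto.liminf_eq
    have e : ‖dualEvo c h η‖ₑ ^ 2 =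
        ENNReal.ofReal (Real.exp (-0 * η ^ 2) * ‖dualEvo c h η‖ ^ 2) := by
      rw [← ofReal_norm, ← ENNReal.ofReal_pow (norm_nonneg _)]; simp
    rw [e]
    refine ENNReal.tendsto_ofReal (Tendsto.mul_const _ ?_)
    refine (Real.continuous_exp.tendsto _).comp (Tendsto.mul_const _ ?_)
    exact tendsto_one_div_add_atTop_nhds_zero_nat.neg
  simp only [← hlim]
  refine (lintegral_liminf_le fun n => by fun_prop).trans ?_
  refine liminf_le_of_frequently_le' (Eventually.frequently (Eventually.of_forall fun n => ?_))
  exact hh.lintegral_dualEvo_gauss_le hq hr hqr hp hq' hc (by positivity)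

/-! ### The dual estimate for the space operator -/

lemma IsNice.fold {h : ℝ → ℝ → ℂ} (hh : IsNice h) : IsNice fun t => foldFun (h t) := by
  obtain ⟨B, R, hB, hb⟩ := hh.bounded
  refine ⟨?_, 2 * B, R, by positivity, fun t x => ?_⟩
  · have e : (Function.uncurry fun t => foldFun (h t)) =
        indicator {z : ℝ × ℝ | 0 < z.2} fun z => h z.1 z.2 + h z.1 (-z.2) := by
      funext z
      simp only [Function.uncurry, foldFun, indicator]
      rfl
    rw [e]
    refine Measurable.indicator (Measurable.add ?_ ?_) (measurable_snd measurableSet_Ioi)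
    · exact hh.measurable
    · exact Measurable.comp (g := Function.uncurry h) hh.measurable
        (f := fun z : ℝ × ℝ => (z.1, -z.2)) (by fun_prop)
  · have h0 : 0 ≤ indicator (Icc (-R) R) (fun _ => B) t := indicator_nonneg (fun _ _ => hB) t
    have h1 : 0 ≤ indicator (Icc (-R) R) (fun _ => (1 : ℝ)) x :=
      indicator_nonneg (fun _ _ => zero_le_one) x
    have e0 : indicator (Icc (-R) R) (fun _ => 2 * B) t = 2 * indicator (Icc (-R) R) (fun _ => B) t := by
      by_cases ht : t ∈ Icc (-R) R
      · rw [indicator_of_mem ht, indicator_of_mem ht]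
      · rw [indicator_of_notMem ht, indicator_of_notMem ht, mul_zero]
    have e1 : indicator (Icc (-R) R) (fun _ => (1 : ℝ)) (-x) =
        indicator (Icc (-R) R) (fun _ => (1 : ℝ)) x := by
      have : -x ∈ Icc (-R) R ↔ x ∈ Icc (-R) R := by
        simp only [mem_Icc]
        constructor <;> rintro ⟨a, b⟩ <;> constructor <;> linarith
      by_cases hx : x ∈ Icc (-R) R
      · rw [indicator_of_mem hx, indicator_of_mem (this.2 hx)]
      · rw [indicator_of_notMem hx, indicator_of_notMem (fun h => hx (this.1 h))]
    rw [e0]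
    have h2 := hb t x
    have h3 := hb t (-x)
    rw [e1] at h3
    by_cases hx : x ∈ Ioi (0 : ℝ)
    · rw [foldFun, indicator_of_mem hx]
      exact (norm_add_le _ _).trans (by linarith)
    · rw [foldFun, indicator_of_notMem hx, norm_zero]
      positivity

lemma pNorm_foldFun_le {p : ℝ} (hp : 1 ≤ p) {f : ℝ → ℂ} (hf : Measurable f) :
    pNorm p (foldFun f) ≤ 2 * pNorm p f := by
  have hp0 : 0 < p := by linarith
  have h1 : ∀ x, ‖foldFun f x‖ₑ ^ p ≤ 2 ^ (p - 1) * (‖f x‖ₑ ^ p + ‖f (x * -1)‖ₑ ^ p) := by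
    intro x
    by_cases hx : x ∈ Ioi (0 : ℝ)
    · rw [foldFun, indicator_of_mem hx, mul_neg_one]
      refine (ENNReal.rpow_le_rpow (enorm_add_le _ _) hp0.le).trans ?_
      exact ENNReal.rpow_add_le_mul_rpow_add_rpow _ _ hp
    · rw [foldFun, indicator_of_notMem hx, enorm_zero, ENNReal.zero_rpow_of_pos hp0]
      exact zero_le
  have h2 : ∫⁻ x, ‖foldFun f x‖ₑ ^ p ≤ 2 ^ p * ∫⁻ x, ‖f x‖ₑ ^ p := by
    refine (lintegral_mono h1).trans (le_of_eq ?_)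
    have hm : Measurable fun x => ‖f x‖ₑ ^ p := by fun_prop
    rw [lintegral_const_mul _ (by fun_prop), lintegral_add_left hm,
      lintegral_comp_mul_right_eq (by norm_num) (fun x => ‖f x‖ₑ ^ p)]
    have : ENNReal.ofReal |(-1 : ℝ)⁻¹| = 1 := by norm_num
    rw [this, one_mul, ← two_mul, ← mul_assoc]
    congr 1
    have h3 := ENNReal.rpow_add (p - 1) 1 (x := 2) (by norm_num) (by norm_num)
    rw [ENNReal.rpow_one] at h3
    rw [← h3]; congr 1; ring
  unfold pNorm
  refine (ENNReal.rpow_le_rpow h2 (by positivity)).trans (le_of_eq ?_)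
  rw [ENNReal.mul_rpow_of_nonneg _ _ (by positivity), ← ENNReal.rpow_mul,
    mul_one_div_cancel hp0.ne', ENNReal.rpow_one]

lemma IsNice.mNorm_fold_le {q p : ℝ} (hq : 0 < q) (hp : 1 ≤ p) {h : ℝ → ℝ → ℂ} (hh : IsNice h) :
    mNorm q p (fun t => foldFun (h t)) ≤ 2 * mNorm q p h := by
  have hm := hh.measurable_pNorm p
  have h1 : ∫⁻ t, pNorm p (foldFun (h t)) ^ q ≤ 2 ^ q * ∫⁻ t, pNorm p (h t) ^ q := by
    have hm' : Measurable fun t => pNorm p (h t) ^ q := hm.pow_const q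
    rw [← lintegral_const_mul _ hm']
    gcongr with t
    rw [← ENNReal.mul_rpow_of_nonneg _ _ hq.le]
    exact ENNReal.rpow_le_rpow (pNorm_foldFun_le hp (hh.memL12 t).measurable) hq.le
  unfold mNorm
  refine (ENNReal.rpow_le_rpow h1 (by positivity)).trans (le_of_eq ?_)
  rw [ENNReal.mul_rpow_of_nonneg _ _ (by positivity), ← ENNReal.rpow_mul,
    mul_one_div_cancel hq.ne', ENNReal.rpow_one]

lemma phase_of_nonneg {η : ℝ} (hη : 0 ≤ η) (t : ℝ) :
    phase t η = Complex.exp (((-(4 * Real.pi ^ 2 * 1 * t * η ^ 2) : ℝ) : ℂ) * Complex.I) := by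
  rw [phase, dispTau, abs_of_nonneg hη]
  congr 1
  push_cast; ring

/-- The part of the dual evolution at the dilation `z`. -/
def dilEvo (h : ℝ → ℝ → ℂ) (z η : ℝ) : ℂ := ∫ t, phase t η * (𝓕⁻ (h t) : ℝ → ℂ) (η * z)

lemma dilEvo_of_nonneg (h : ℝ → ℝ → ℂ) {z η : ℝ} (hz : z ≠ 0) (hη : 0 ≤ η) :
    dilEvo h z η = dualEvo ((z ^ 2)⁻¹) h (η * z) := by
  unfold dilEvo dualEvo
  congr 1; ext t
  rw [phase, dispTau, abs_of_nonneg hη]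
  congr 2
  have : (z : ℂ) ≠ 0 := by exact_mod_cast hz
  push_cast; field_simp; ring

lemma dilEvo_of_neg (h : ℝ → ℝ → ℂ) {z η : ℝ} (hz : z ≠ 0) (hη : η < 0) :
    dilEvo h z η = dualEvo (-(z ^ 2)⁻¹) h (η * z) := by
  unfold dilEvo dualEvo
  congr 1; ext t
  rw [phase, dispTau, abs_of_neg hη]
  congr 2
  have : (z : ℂ) ≠ 0 := by exact_mod_cast hz
  push_cast; field_simp; ring

lemma IsNice.measurable_dilEvo {h : ℝ → ℝ → ℂ} (hh : IsNice h) :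
    Measurable (Function.uncurry (dilEvo h)) := by
  have h1 : Measurable fun y : (ℝ × ℝ) × ℝ => (𝓕⁻ (h y.2) : ℝ → ℂ) (y.1.2 * y.1.1) :=
    Measurable.comp (g := fun y : ℝ × ℝ => (𝓕⁻ (h y.1) : ℝ → ℂ) y.2) hh.measurable_fourierInv
      (f := fun y : (ℝ × ℝ) × ℝ => (y.2, y.1.2 * y.1.1)) (by fun_prop)
  have h2 : Measurable fun y : (ℝ × ℝ) × ℝ => phase y.2 y.1.2 :=
    Measurable.comp (g := fun z : ℝ × ℝ => phase z.1 z.2) continuous_phase.measurable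
      (f := fun y : (ℝ × ℝ) × ℝ => (y.2, y.1.2)) (by fun_prop)
  exact ((h2.mul h1).stronglyMeasurable.integral_prod_right').measurable

/-- In terms of `ηz` the phase at `η` is that of an evolution with speed `±z⁻²`. The dual Strichartz
bound gives `|z|^(4/q)` and the dilation gives `|z|⁻¹`; since `4/q = 1 - 2/r` the product is
`|z|^(-2/r)`. -/
lemma IsNice.lintegral_dilEvo_sq_le {q r q' p : ℝ} (hq : 2 < q) (hr : 2 < r)
    (hqr : 1 / 2 - 1 / r = 2 / q) (hp : p = r / (r - 1)) (hq' : q' = q / (q - 1))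
    {h : ℝ → ℝ → ℂ} (hh : IsNice h) {z : ℝ} (hz : z ≠ 0) :
    ∫⁻ η, ‖dilEvo h z η‖ₑ ^ 2 ≤ (ENNReal.ofReal (Real.sqrt (2 * strConst q r)) * mNorm q' p h *
      ENNReal.ofReal (|z| ^ (-(1 / r)))) ^ 2 := by
  have hS := strConst_nonneg hq hr
  have hz0 : 0 < |z| := abs_pos.2 hz
  have hz2 : (z ^ 2)⁻¹ ≠ 0 := by positivity
  have habs : |(z ^ 2)⁻¹| ^ (-(2 / q)) = |z| ^ (4 / q) := by
    rw [abs_inv, abs_pow, ← Real.rpow_natCast, ← Real.rpow_neg hz0.le, ← Real.rpow_mul hz0.le]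
    congr 1; push_cast; ring
  have h1 := hh.lintegral_dualEvo_sq_le hq hr hqr hp hq' hz2
  have h2 := hh.lintegral_dualEvo_sq_le hq hr hqr hp hq' (neg_ne_zero.2 hz2)
  rw [abs_neg] at h2
  rw [habs] at h1 h2
  have hm1 : Measurable fun η => ‖dualEvo ((z ^ 2)⁻¹) h (η * z)‖ₑ ^ 2 :=
    ((hh.measurable_dualEvo_const _).comp (measurable_id.mul_const z)).enorm.pow_const 2
  calc ∫⁻ η, ‖dilEvo h z η‖ₑ ^ 2
      -- The sign of the speed depends on the sign of `η`; adding the two whole-line integrals costs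
      -- only the factor `2`.
      ≤ ∫⁻ η, (‖dualEvo ((z ^ 2)⁻¹) h (η * z)‖ₑ ^ 2 + ‖dualEvo (-(z ^ 2)⁻¹) h (η * z)‖ₑ ^ 2) := by
        refine lintegral_mono fun η => ?_
        rcases le_or_gt 0 η with hη | hη
        · rw [dilEvo_of_nonneg h hz hη]; exact le_self_add
        · rw [dilEvo_of_neg h hz hη]; exact le_add_self
    _ = ENNReal.ofReal |z⁻¹| * ((∫⁻ η, ‖dualEvo ((z ^ 2)⁻¹) h η‖ₑ ^ 2) +
          ∫⁻ η, ‖dualEvo (-(z ^ 2)⁻¹) h η‖ₑ ^ 2) := by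
        rw [lintegral_add_left hm1,
          lintegral_comp_mul_right_eq hz (fun η => ‖dualEvo ((z ^ 2)⁻¹) h η‖ₑ ^ 2),
          lintegral_comp_mul_right_eq hz (fun η => ‖dualEvo (-(z ^ 2)⁻¹) h η‖ₑ ^ 2), mul_add]
    _ ≤ ENNReal.ofReal |z⁻¹| * (ENNReal.ofReal (strConst q r * |z| ^ (4 / q)) * mNorm q' p h ^ 2 +
          ENNReal.ofReal (strConst q r * |z| ^ (4 / q)) * mNorm q' p h ^ 2) := by gcongr
    _ = (ENNReal.ofReal |z⁻¹| * (2 * ENNReal.ofReal (strConst q r * |z| ^ (4 / q)))) *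
          mNorm q' p h ^ 2 := by ring
    _ = (ENNReal.ofReal (2 * strConst q r) * ENNReal.ofReal ((|z| ^ (-(1 / r))) ^ 2)) *
          mNorm q' p h ^ 2 := by
        congr 1
        rw [show (2 : ℝ≥0∞) = ENNReal.ofReal 2 by norm_num, ← ENNReal.ofReal_mul (by norm_num),
          ← ENNReal.ofReal_mul (by positivity), ← ENNReal.ofReal_mul (by positivity)]
        congr 1
        have : (|z| ^ (-(1 / r))) ^ 2 = |z|⁻¹ * |z| ^ (4 / q) := by
          rw [← Real.rpow_neg_one, ← Real.rpow_add hz0, ← Real.rpow_natCast, ← Real.rpow_mul hz0.le]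
          congr 1
          have : 4 / q = 2 * (2 / q) := by ring
          rw [this, ← hqr]; push_cast; ring
        rw [this, abs_inv]; ring
    _ = _ := by
        rw [mul_pow, mul_pow, ← ENNReal.ofReal_pow (Real.sqrt_nonneg _),
          Real.sq_sqrt (by positivity), ← ENNReal.ofReal_pow (by positivity)]
        ring

/-- The space operator, evaluated on the slices of `h`. -/
def kerEval (M : ℝ → ℝ → ℂ) (h : ℝ → ℝ → ℂ) (t η : ℝ) : ℂ :=
  indicator (Ioi 0) (𝓕⁻ (foldFun (h t)) : ℝ → ℂ) η + dilInt M (𝓕⁻ (h t)) η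

lemma IsNice.spaceOp_ae {M : ℝ → ℝ → ℂ} {c : ℝ → ℝ≥0∞} (hM : DilKernel M c) {h : ℝ → ℝ → ℂ}
    (hh : IsNice h) (t : ℝ) :
    spaceOp hM ((hh.memL12 t).memLp.toLp (h t)) =ᵐ[volume] kerEval M h t := by
  filter_upwards [spaceOp_toLp hM (hh.memL12 t).integrable (hh.memL12 t).memLp] with η hη
  rw [hη, kerEval]
  congr 2
  funext η
  rw [fourierInv_foldFun (hh.memL12 t).integrable]

lemma IsNice.measurable_dilIntegrand {M : ℝ → ℝ → ℂ} {c : ℝ → ℝ≥0∞} (hM : DilKernel M c)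
    {h : ℝ → ℝ → ℂ} (hh : IsNice h) :
    Measurable fun y : (ℝ × ℝ) × ℝ => M y.2 y.1.2 * (𝓕⁻ (h y.1.1) : ℝ → ℂ) (y.1.2 * y.2) := by
  have h1 : Measurable fun y : (ℝ × ℝ) × ℝ => (𝓕⁻ (h y.1.1) : ℝ → ℂ) (y.1.2 * y.2) :=
    Measurable.comp (g := fun y : ℝ × ℝ => (𝓕⁻ (h y.1) : ℝ → ℂ) y.2) hh.measurable_fourierInv
      (f := fun y : (ℝ × ℝ) × ℝ => (y.1.1, y.1.2 * y.2)) (by fun_prop)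
  have h2 : Measurable fun y : (ℝ × ℝ) × ℝ => M y.2 y.1.2 :=
    Measurable.comp (g := Function.uncurry M) hM.measurable
      (f := fun y : (ℝ × ℝ) × ℝ => (y.2, y.1.2)) (by fun_prop)
  exact h2.mul h1

lemma IsNice.measurable_kerEval {M : ℝ → ℝ → ℂ} {c : ℝ → ℝ≥0∞} (hM : DilKernel M c)
    {h : ℝ → ℝ → ℂ} (hh : IsNice h) : Measurable (Function.uncurry (kerEval M h)) := by
  have e : Function.uncurry (kerEval M h) = fun y : ℝ × ℝ =>
      indicator {y : ℝ × ℝ | 0 < y.2} (fun y => (𝓕⁻ (foldFun (h y.1)) : ℝ → ℂ) y.2) y +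
        ∫ z, M z y.2 * (𝓕⁻ (h y.1) : ℝ → ℂ) (y.2 * z) := by
    funext y
    simp only [Function.uncurry, kerEval, indicator]
    rfl
  rw [e]
  refine Measurable.add (Measurable.indicator hh.fold.measurable_fourierInv
    (measurable_snd measurableSet_Ioi)) ?_
  exact ((hh.measurable_dilIntegrand hM).stronglyMeasurable.integral_prod_right').measurable

lemma IsNice.exists_lintegral_sq_bound {h : ℝ → ℝ → ℂ} (hh : IsNice h) :
    ∃ B R : ℝ, 0 ≤ B ∧ ∀ t, ∫⁻ x, ‖h t x‖ₑ ^ 2 ≤ (indicator (Icc (-R) R) (fun _ => ENNReal.ofReal B) t) ^ 2 := by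
  obtain ⟨B, R, hB, hb⟩ := hh.bounded
  set V := ∫⁻ x, ENNReal.ofReal (indicator (Icc (-R) R) (fun _ => (1 : ℝ)) x) with hV
  have hVf : V ≠ ⊤ := by
    have h1 := integrable_indicator_Icc R 1
    rw [hV, ← ofReal_integral_eq_lintegral_ofReal h1
      (ae_of_all _ fun x => indicator_nonneg (fun _ _ => zero_le_one) x)]
    exact ENNReal.ofReal_ne_top
  refine ⟨B * Real.sqrt V.toReal, R, by positivity, fun t => ?_⟩
  by_cases ht : t ∈ Icc (-R) R
  · rw [indicator_of_mem ht, ← ENNReal.ofReal_pow (by positivity), mul_pow,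
      Real.sq_sqrt ENNReal.toReal_nonneg, ENNReal.ofReal_mul (by positivity),
      ENNReal.ofReal_toReal hVf, hV, ← lintegral_const_mul' _ _ ENNReal.ofReal_ne_top]
    gcongr with x
    have h1 := hb t x
    rw [indicator_of_mem ht] at h1
    rw [← ofReal_norm, ← ENNReal.ofReal_pow (norm_nonneg _), ← ENNReal.ofReal_mul (by positivity)]
    refine ENNReal.ofReal_le_ofReal ?_
    by_cases hx : x ∈ Icc (-R) R
    · rw [indicator_of_mem hx, mul_one] at h1 ⊢
      exact pow_le_pow_left₀ (norm_nonneg _) h1 2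
    · rw [indicator_of_notMem hx, mul_zero] at h1 ⊢
      rw [le_antisymm h1 (norm_nonneg _)]; norm_num
  · have : ∀ x, ‖h t x‖ₑ = 0 := fun x => by
      have h1 := hb t x
      rw [indicator_of_notMem ht, zero_mul] at h1
      simpa using h1
    simp [this]

/-- A qualitative bound: moduli are taken inside the time integral, so the size depends on `h`. It
serves only to justify exchanging the integrals in `t` and `z`. -/
lemma IsNice.lintegral_sup_sq_lt_top {c : ℝ → ℝ≥0∞} (hc : Measurable c)
    (hfin : ∫⁻ z, c z * ENNReal.ofReal (|z| ^ (-(1 / 2) : ℝ)) ≠ ⊤) {h : ℝ → ℝ → ℂ} (hh : IsNice h) :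
    ∫⁻ η, (∫⁻ z, c z * ∫⁻ t, ‖(𝓕⁻ (h t) : ℝ → ℂ) (η * z)‖ₑ) ^ 2 < ⊤ := by
  set g : ℝ → ℝ≥0∞ := fun ξ => ∫⁻ t, ‖(𝓕⁻ (h t) : ℝ → ℂ) ξ‖ₑ with hg
  have hgm : Measurable g := by
    have h1 : Measurable fun y : ℝ × ℝ => ‖(𝓕⁻ (h y.2) : ℝ → ℂ) y.1‖ₑ :=
      (Measurable.comp (g := fun y : ℝ × ℝ => (𝓕⁻ (h y.1) : ℝ → ℂ) y.2) hh.measurable_fourierInv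
        (f := fun y : ℝ × ℝ => (y.2, y.1)) (by fun_prop)).enorm
    exact h1.lintegral_prod_right'
  have hg2 : ∃ D : ℝ≥0∞, D ≠ ⊤ ∧ ∫⁻ ξ, g ξ ^ 2 ≤ D ^ 2 := by
    obtain ⟨B, R, hB, hb⟩ := hh.exists_lintegral_sq_bound
    have hm : Measurable (indicator (Icc (-R) R) fun _ : ℝ => (1 : ℝ≥0∞)) :=
      measurable_const.indicator measurableSet_Icc
    have h1 := lintegral_sq_superposition (c := indicator (Icc (-R) R) fun _ => 1)
      (wt := fun _ => 1) (a := fun t ξ => ‖(𝓕⁻ (h t) : ℝ → ℂ) ξ‖ₑ) hm measurable_const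
      hh.measurable_fourierInv.enorm (ae_of_all _ fun _ => ⟨one_ne_zero, ENNReal.one_ne_top⟩)
      (B := ENNReal.ofReal B) (ae_of_all _ fun t => by
        rw [← eLpNorm_two_sq, eLpNorm_fourierInv (hh.memL12 t).integrable (hh.memL12 t).memLp,
          eLpNorm_two_sq, mul_one]
        refine (hb t).trans (pow_le_pow_left₀ zero_le ?_ 2)
        exact indicator_le_self _ (fun _ => ENNReal.ofReal B) t)
    refine ⟨_, ?_, le_trans (lintegral_mono fun ξ => pow_le_pow_left₀ zero_le ?_ 2) h1⟩
    · refine ENNReal.mul_ne_top ENNReal.ofReal_ne_top ?_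
      simp [lintegral_indicator]
    · simp only [hg]
      refine lintegral_mono_ae (ae_of_all _ fun t => ?_)
      by_cases ht : t ∈ Icc (-R) R
      · rw [indicator_of_mem ht, one_mul]
      · have h2 := hb t
        rw [indicator_of_notMem ht, zero_pow two_ne_zero, nonpos_iff_eq_zero,
          lintegral_eq_zero_iff ((hh.memL12 t).measurable.enorm.pow_const 2)] at h2
        have h3 : h t =ᵐ[volume] 0 := by
          filter_upwards [h2] with x hx
          simpa using hx
        have h4 : (𝓕⁻ (h t) : ℝ → ℂ) ξ = 0 := by
          rw [Real.fourierInv_eq_fourier_neg, Real.fourier_real_eq_integral_exp_smul]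
          refine integral_eq_zero_of_ae ?_
          filter_upwards [h3] with x hx
          simp [hx]
        rw [h4, enorm_zero]
        exact zero_le
  obtain ⟨D, hD, hgD⟩ := hg2
  refine lt_of_le_of_lt (lintegral_sq_superposition (a := fun z η => g (η * z)) (B := D) hc
    (measurable_weight (-(1 / 2))) ?_ (weight_ne _) ?_)
    (ENNReal.pow_lt_top (ENNReal.mul_lt_top hD.lt_top hfin.lt_top))
  · exact hgm.comp (measurable_snd.mul measurable_fst)
  · filter_upwards [ae_ne 0] with z hz
    rw [lintegral_comp_mul_right_eq hz (fun x => g x ^ 2), mul_pow, mul_comm]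
    gcongr
    rw [← ENNReal.ofReal_pow (by positivity)]
    apply le_of_eq
    congr 1
    rw [← Real.rpow_natCast, ← Real.rpow_mul (abs_nonneg z), abs_inv, ← Real.rpow_neg_one]
    norm_num

/-- The adjoint of `φ ↦ profile φ`, applied to `h`. -/
def kerAdj (M : ℝ → ℝ → ℂ) (h : ℝ → ℝ → ℂ) (η : ℝ) : ℂ := ∫ t, phase t η * kerEval M h t η

lemma measurable_phase_left (η : ℝ) : Measurable fun t => phase t η :=
  Measurable.comp (g := fun z : ℝ × ℝ => phase z.1 z.2) continuous_phase.measurable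
    (f := fun t : ℝ => (t, η)) (by fun_prop)

lemma IsNice.integrable_phase_mul {h : ℝ → ℝ → ℂ} (hh : IsNice h) (η ξ : ℝ) :
    Integrable fun t => phase t η * (𝓕⁻ (h t) : ℝ → ℂ) ξ := by
  obtain ⟨B, R, hB, hb⟩ := hh.exists_fourierInv_bound
  have hm : Measurable fun t => (𝓕⁻ (h t) : ℝ → ℂ) ξ :=
    Measurable.comp (g := fun y : ℝ × ℝ => (𝓕⁻ (h y.1) : ℝ → ℂ) y.2) hh.measurable_fourierInv
      (f := fun t : ℝ => (t, ξ)) (by fun_prop)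
  refine (integrable_indicator_Icc R B).mono'
    ((measurable_phase_left η).mul hm).aestronglyMeasurable (ae_of_all _ fun t => ?_)
  rw [norm_mul, norm_phase, one_mul]
  exact hb t ξ

lemma IsNice.integrable_dilIntegrand {M : ℝ → ℝ → ℂ} {c : ℝ → ℝ≥0∞} (hM : DilKernel M c)
    {h : ℝ → ℝ → ℂ} (hh : IsNice h) {η : ℝ}
    (hη : ∫⁻ z, c z * ∫⁻ t, ‖(𝓕⁻ (h t) : ℝ → ℂ) (η * z)‖ₑ < ⊤) :
    Integrable (fun y : ℝ × ℝ => phase y.1 η * (M y.2 η * (𝓕⁻ (h y.1) : ℝ → ℂ) (η * y.2)))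
      (volume.prod volume) := by
  have h1 : Measurable fun y : ℝ × ℝ => M y.2 η * (𝓕⁻ (h y.1) : ℝ → ℂ) (η * y.2) :=
    Measurable.comp (g := fun y : (ℝ × ℝ) × ℝ => M y.2 y.1.2 * (𝓕⁻ (h y.1.1) : ℝ → ℂ) (y.1.2 * y.2))
      (hh.measurable_dilIntegrand hM) (f := fun y : ℝ × ℝ => ((y.1, η), y.2)) (by fun_prop)
  have h2 : Measurable fun y : ℝ × ℝ => phase y.1 η := (measurable_phase_left η).comp measurable_fst
  have hm : Measurable fun y : ℝ × ℝ =>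
      phase y.1 η * (M y.2 η * (𝓕⁻ (h y.1) : ℝ → ℂ) (η * y.2)) := h2.mul h1
  refine ⟨hm.aestronglyMeasurable, ?_⟩
  refine lt_of_le_of_lt ?_ hη
  rw [lintegral_prod_symm' _ hm.enorm]
  refine lintegral_mono_ae ?_
  filter_upwards [ae_ne 0] with z hz
  have h3 : Measurable fun t => ‖(𝓕⁻ (h t) : ℝ → ℂ) (η * z)‖ₑ :=
    (Measurable.comp (g := fun y : ℝ × ℝ => (𝓕⁻ (h y.1) : ℝ → ℂ) y.2) hh.measurable_fourierInv
      (f := fun t : ℝ => (t, η * z)) (by fun_prop)).enorm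
  rw [← lintegral_const_mul _ h3]
  refine lintegral_mono fun t => ?_
  simp only [enorm_mul]
  rw [← ofReal_norm (phase t η), norm_phase, ENNReal.ofReal_one, one_mul]
  gcongr
  exact hM.bound z hz η

/-- The main part contributes a free dual evolution of speed one of the folded function. The
correction becomes a superposition over `z` of dual evolutions, once the time integral is done
first. -/
lemma IsNice.enorm_kerAdj_le {M : ℝ → ℝ → ℂ} {c : ℝ → ℝ≥0∞} (hM : DilKernel M c)
    {h : ℝ → ℝ → ℂ} (hh : IsNice h) : ∀ᵐ η, ‖kerAdj M h η‖ₑ ≤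
      ‖dualEvo 1 (fun t => foldFun (h t)) η‖ₑ + ∫⁻ z, c z * ‖dilEvo h z η‖ₑ := by
  have hfin := hh.lintegral_sup_sq_lt_top hM.measurable_bound hM.finite
  have hmeas : Measurable fun η => (∫⁻ z, c z * ∫⁻ t, ‖(𝓕⁻ (h t) : ℝ → ℂ) (η * z)‖ₑ) ^ 2 := by
    have h1 : Measurable fun y : (ℝ × ℝ) × ℝ => ‖(𝓕⁻ (h y.2) : ℝ → ℂ) (y.1.1 * y.1.2)‖ₑ :=
      (Measurable.comp (g := fun y : ℝ × ℝ => (𝓕⁻ (h y.1) : ℝ → ℂ) y.2) hh.measurable_fourierInv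
        (f := fun y : (ℝ × ℝ) × ℝ => (y.2, y.1.1 * y.1.2)) (by fun_prop)).enorm
    have h2 : Measurable fun y : ℝ × ℝ => c y.2 * ∫⁻ t, ‖(𝓕⁻ (h t) : ℝ → ℂ) (y.1 * y.2)‖ₑ :=
      (hM.measurable_bound.comp measurable_snd).mul h1.lintegral_prod_right'
    exact (h2.lintegral_prod_right').pow_const 2
  filter_upwards [ae_lt_top hmeas hfin.ne] with η hη
  have hη' : ∫⁻ z, c z * ∫⁻ t, ‖(𝓕⁻ (h t) : ℝ → ℂ) (η * z)‖ₑ < ⊤ := by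
    by_contra h'
    rw [not_lt, top_le_iff] at h'
    rw [h'] at hη
    simp at hη
  have hI := hh.integrable_dilIntegrand hM hη'
  have e1 : ∫ t, phase t η * dilInt M (𝓕⁻ (h t)) η = ∫ z, M z η * dilEvo h z η := by
    simp only [dilInt, ← integral_const_mul]
    rw [integral_integral_swap hI]
    congr 1; ext z
    rw [dilEvo, ← integral_const_mul]
    congr 1; ext t
    ring
  have hI2 : Integrable fun t => phase t η * dilInt M (𝓕⁻ (h t)) η := by
    have := hI.integral_prod_left
    simp only [integral_const_mul] at this
    exact this
  have hI1 : Integrable fun t => phase t η * indicator (Ioi 0) (𝓕⁻ (foldFun (h t)) : ℝ → ℂ) η := by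
    by_cases hp : η ∈ Ioi (0 : ℝ)
    · simp only [indicator_of_mem hp]
      exact hh.fold.integrable_phase_mul η η
    · simp only [indicator_of_notMem hp, mul_zero]
      exact integrable_zero _ _ _
  have e2 : kerAdj M h η = (∫ t, phase t η * indicator (Ioi 0) (𝓕⁻ (foldFun (h t)) : ℝ → ℂ) η) +
      ∫ z, M z η * dilEvo h z η := by
    rw [← e1, ← integral_add hI1 hI2, kerAdj]
    congr 1; ext t
    rw [kerEval, mul_add]
  rw [e2]
  refine (enorm_add_le _ _).trans (add_le_add ?_ ?_)
  · by_cases hp : η ∈ Ioi (0 : ℝ)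
    · simp only [indicator_of_mem hp, phase_of_nonneg (le_of_lt hp)]
      exact le_rfl
    · simp only [indicator_of_notMem hp, mul_zero, integral_zero, enorm_zero]
      exact zero_le
  · refine (enorm_integral_le_lintegral_enorm _).trans (lintegral_mono_ae ?_)
    filter_upwards [ae_ne 0] with z hz
    rw [enorm_mul]
    gcongr
    exact hM.bound z hz η

/-- The constant in the dual estimate for the space operator. -/
def adjConst (q r : ℝ) (c : ℝ → ℝ≥0∞) : ℝ≥0∞ :=
  2 * (4 * ENNReal.ofReal (strConst q r) + ENNReal.ofReal (2 * strConst q r) *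
    (∫⁻ z, c z * ENNReal.ofReal (|z| ^ (-(1 / r)))) ^ 2)

lemma ennreal_add_sq_le (a b : ℝ≥0∞) : (a + b) ^ 2 ≤ 2 * (a ^ 2 + b ^ 2) := by
  have h := ENNReal.rpow_add_le_mul_rpow_add_rpow a b (p := 2) (by norm_num)
  simp only [ENNReal.rpow_two] at h
  refine h.trans (le_of_eq ?_)
  norm_num

/-- Minkowski over the dilations, each weighted by `|z|^(-1/r)`. The `4` in `adjConst` is the
squared cost of folding, the outer `2` that of squaring a sum. -/
lemma IsNice.lintegral_kerAdj_sq_le {q r q' p : ℝ} (hq : 2 < q) (hr : 2 < r)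
    (hqr : 1 / 2 - 1 / r = 2 / q) (hp : p = r / (r - 1)) (hq' : q' = q / (q - 1))
    {M : ℝ → ℝ → ℂ} {c : ℝ → ℝ≥0∞} (hM : DilKernel M c) {h : ℝ → ℝ → ℂ} (hh : IsNice h) :
    ∫⁻ η, ‖kerAdj M h η‖ₑ ^ 2 ≤ adjConst q r c * mNorm q' p h ^ 2 := by
  have hp1 : 1 ≤ p := by rw [hp, one_le_div (by linarith)]; linarith
  have hq0 : 0 < q' := by rw [hq']; exact div_pos (by linarith) (by linarith)
  have hS := strConst_nonneg hq hr
  have h1 : ∫⁻ η, ‖dualEvo 1 (fun t => foldFun (h t)) η‖ₑ ^ 2 ≤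
      ENNReal.ofReal (strConst q r) * (2 * mNorm q' p h) ^ 2 := by
    refine (hh.fold.lintegral_dualEvo_sq_le hq hr hqr hp hq' one_ne_zero).trans ?_
    rw [abs_one, Real.one_rpow, mul_one]
    gcongr
    exact hh.mNorm_fold_le hq0 hp1
  have h2 := lintegral_sq_superposition (a := fun z η => ‖dilEvo h z η‖ₑ)
    (wt := fun z => ENNReal.ofReal (|z| ^ (-(1 / r)))) hM.measurable_bound (measurable_weight _)
    hh.measurable_dilEvo.enorm (weight_ne _)
    (B := ENNReal.ofReal (Real.sqrt (2 * strConst q r)) * mNorm q' p h) (by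
      filter_upwards [ae_ne 0] with z hz
      exact hh.lintegral_dilEvo_sq_le hq hr hqr hp hq' hz)
  have hm1 : Measurable fun η => ‖dualEvo 1 (fun t => foldFun (h t)) η‖ₑ ^ 2 :=
    (hh.fold.measurable_dualEvo_const 1).enorm.pow_const 2
  have hm2 : Measurable fun η => (∫⁻ z, c z * ‖dilEvo h z η‖ₑ) ^ 2 := by
    have h3 : Measurable fun y : ℝ × ℝ => c y.2 * ‖dilEvo h y.2 y.1‖ₑ :=
      (hM.measurable_bound.comp measurable_snd).mul (hh.measurable_dilEvo.comp measurable_swap).enorm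
    exact (h3.lintegral_prod_right').pow_const 2
  calc _ ≤ ∫⁻ η, 2 * (‖dualEvo 1 (fun t => foldFun (h t)) η‖ₑ ^ 2 +
          (∫⁻ z, c z * ‖dilEvo h z η‖ₑ) ^ 2) := by
        refine lintegral_mono_ae ?_
        filter_upwards [hh.enorm_kerAdj_le hM] with η hη
        exact (pow_le_pow_left₀ zero_le hη 2).trans (ennreal_add_sq_le _ _)
    _ = 2 * ((∫⁻ η, ‖dualEvo 1 (fun t => foldFun (h t)) η‖ₑ ^ 2) +
          ∫⁻ η, (∫⁻ z, c z * ‖dilEvo h z η‖ₑ) ^ 2) := by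
        rw [lintegral_const_mul' _ _ ENNReal.ofNat_ne_top, lintegral_add_left hm1]
    _ ≤ 2 * (ENNReal.ofReal (strConst q r) * (2 * mNorm q' p h) ^ 2 +
          (ENNReal.ofReal (Real.sqrt (2 * strConst q r)) * mNorm q' p h *
            ∫⁻ z, c z * ENNReal.ofReal (|z| ^ (-(1 / r)))) ^ 2) := by gcongr
    _ = _ := by
        rw [mul_pow (_ * _), mul_pow (ENNReal.ofReal _), ← ENNReal.ofReal_pow (Real.sqrt_nonneg _),
          Real.sq_sqrt (by positivity), adjConst]
        ring

lemma IsNice.integral_profile_mul {M : ℝ → ℝ → ℂ} {c : ℝ → ℝ≥0∞} (hM : DilKernel M c)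
    {h : ℝ → ℝ → ℂ} (hh : IsNice h) (φ : Lp ℂ 2 (volume : Measure ℝ)) (t : ℝ) :
    ∫ x, profile (spaceOp hM) φ t x * h t x = ∫ η, φ η * (phase t η * kerEval M h t η) := by
  have e : ∫ x, profile (spaceOp hM) φ t x * h t x =
      ∫ x, transp (spaceOp hM) (phaseOp t φ) x * ((hh.memL12 t).memLp.toLp (h t)) x := by
    apply integral_congr_ae
    filter_upwards [(hh.memL12 t).memLp.coeFn_toLp] with x hx
    rw [hx, profile]
  rw [e, integral_transp_mul]
  apply integral_congr_ae
  filter_upwards [phaseOp_coe t φ, hh.spaceOp_ae hM t] with η a1 a2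
  rw [a1, a2]; ring

lemma IsNice.integrable_pairing {M : ℝ → ℝ → ℂ} {c : ℝ → ℝ≥0∞} (hM : DilKernel M c)
    {h : ℝ → ℝ → ℂ} (hh : IsNice h) (φ : Lp ℂ 2 (volume : Measure ℝ)) :
    Integrable (fun y : ℝ × ℝ => φ y.2 * (phase y.1 y.2 * kerEval M h y.1 y.2))
      (volume.prod volume) := by
  have hm : Measurable fun y : ℝ × ℝ => φ y.2 * (phase y.1 y.2 * kerEval M h y.1 y.2) := by
    have h1 : Measurable fun y : ℝ × ℝ => φ y.2 :=
      (Lp.stronglyMeasurable φ).measurable.comp measurable_snd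
    have h2 : Measurable fun y : ℝ × ℝ => phase y.1 y.2 := continuous_phase.measurable
    exact h1.mul (h2.mul (hh.measurable_kerEval hM))
  obtain ⟨B, R, hB, hb⟩ := hh.exists_lintegral_sq_bound
  have hae : ∀ t, (fun η => φ η * (phase t η * kerEval M h t η)) =ᵐ[volume] fun η =>
      phaseOp t φ η * spaceOp hM ((hh.memL12 t).memLp.toLp (h t)) η := fun t => by
    filter_upwards [phaseOp_coe t φ, hh.spaceOp_ae hM t] with η a1 a2
    rw [a1, a2]; ring
  rw [integrable_prod_iff hm.aestronglyMeasurable]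
  refine ⟨ae_of_all _ fun t => (integrable_lp_mul _ _).congr (hae t).symm, ?_⟩
  refine ((integrable_indicator_Icc R B).const_mul (‖φ‖ * ‖spaceOp hM‖)).mono'
    (hm.norm.stronglyMeasurable.integral_prod_right').aestronglyMeasurable (ae_of_all _ fun t => ?_)
  rw [Real.norm_of_nonneg (integral_nonneg fun η => norm_nonneg _)]
  have e : ∫ η, ‖φ η * (phase t η * kerEval M h t η)‖ = ∫ η, ‖phaseOp t φ η *
      spaceOp hM ((hh.memL12 t).memLp.toLp (h t)) η‖ := by
    apply integral_congr_ae
    filter_upwards [hae t] with η hη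
    rw [hη]
  have hn : ‖(hh.memL12 t).memLp.toLp (h t)‖ ≤ indicator (Icc (-R) R) (fun _ => B) t := by
    rw [Lp.norm_toLp]
    have h1 := hb t
    rw [← eLpNorm_two_sq, ENNReal.pow_le_pow_left_iff two_ne_zero] at h1
    have e2 : indicator (Icc (-R) R) (fun _ => ENNReal.ofReal B) t =
        ENNReal.ofReal (indicator (Icc (-R) R) (fun _ => B) t) := by
      by_cases ht : t ∈ Icc (-R) R
      · rw [indicator_of_mem ht, indicator_of_mem ht]
      · rw [indicator_of_notMem ht, indicator_of_notMem ht, ENNReal.ofReal_zero]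
    rw [e2] at h1
    exact ENNReal.toReal_le_of_le_ofReal (indicator_nonneg (fun _ _ => hB) t) h1
  rw [e]
  calc _ ≤ ‖phaseOp t φ‖ * ‖spaceOp hM ((hh.memL12 t).memLp.toLp (h t))‖ := integral_norm_mul_le _ _
    _ ≤ ‖φ‖ * (‖spaceOp hM‖ * indicator (Icc (-R) R) (fun _ => B) t) := by
        gcongr
        · exact norm_phaseOp_le t φ
        · exact (ContinuousLinearMap.le_opNorm _ _).trans (by gcongr)
    _ = _ := by ring

/-- Strichartz' estimate in dual form. -/
lemma IsNice.enorm_pairing_le {q r q' p : ℝ} (hq : 2 < q) (hr : 2 < r)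
    (hqr : 1 / 2 - 1 / r = 2 / q) (hp : p = r / (r - 1)) (hq' : q' = q / (q - 1))
    {M : ℝ → ℝ → ℂ} {c : ℝ → ℝ≥0∞} (hM : DilKernel M c) {h : ℝ → ℝ → ℂ} (hh : IsNice h)
    (φ : Lp ℂ 2 (volume : Measure ℝ)) :
    ‖∫ t, ∫ x, profile (spaceOp hM) φ t x * h t x‖ₑ ≤
      ‖φ‖ₑ * adjConst q r c ^ (1 / 2 : ℝ) * mNorm q' p h := by
  simp only [hh.integral_profile_mul hM φ]
  rw [integral_integral_swap (hh.integrable_pairing hM φ)]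
  simp only [integral_const_mul]
  change ‖∫ η, φ η * kerAdj M h η‖ₑ ≤ _
  have hmA : Measurable (kerAdj M h) := by
    have h1 : Measurable fun y : ℝ × ℝ => phase y.2 y.1 * kerEval M h y.2 y.1 :=
      (continuous_phase.measurable.comp measurable_swap).mul
        ((hh.measurable_kerEval hM).comp measurable_swap)
    exact (h1.stronglyMeasurable.integral_prod_right').measurable
  refine (enorm_integral_le_lintegral_enorm _).trans ?_
  simp only [enorm_mul]
  refine (ENNReal.lintegral_mul_le_Lp_mul_Lq volume Real.HolderConjugate.two_two
    (f := fun η => ‖φ η‖ₑ) (g := fun η => ‖kerAdj M h η‖ₑ)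
    (Lp.stronglyMeasurable φ).measurable.enorm.aemeasurable hmA.enorm.aemeasurable).trans ?_
  simp only [ENNReal.rpow_two]
  rw [mul_assoc]
  refine mul_le_mul' (le_of_eq ?_) ?_
  · rw [← eLpNorm_two_sq, ← ENNReal.rpow_two, ← ENNReal.rpow_mul, Lp.enorm_def]
    norm_num
  · refine (ENNReal.rpow_le_rpow (hh.lintegral_kerAdj_sq_le hq hr hqr hp hq' hM)
      (by norm_num)).trans (le_of_eq ?_)
    rw [ENNReal.mul_rpow_of_nonneg _ _ (by norm_num), ← ENNReal.rpow_two, ← ENNReal.rpow_mul]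
    norm_num

/-! ### Duality -/

lemma lp_locallyIntegrable (f : Lp ℂ 2 (volume : Measure ℝ)) : LocallyIntegrable f volume :=
  (Lp.memLp f).locallyIntegrable (by norm_num)

/-- A continuous curve in `L²` has a jointly measurable representative. -/
lemma exists_measurable_version {v : ℝ → Lp ℂ 2 (volume : Measure ℝ)} (hv : Continuous v) :
    ∃ V : ℝ → ℝ → ℂ, Measurable (Function.uncurry V) ∧ ∀ t, V t =ᵐ[volume] v t := by
  -- The primitive in `x` does not depend on representatives. It is continuous in `t`, being an
  -- inner product with an indicator, and continuous in `x`, hence jointly measurable. Lebesgue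
  -- differentiation recovers the curve almost everywhere in `x`.
  set P : ℝ → ℝ → ℂ := fun t x => ∫ y in (0 : ℝ)..x, v t y with hP
  have hii : ∀ t a b, IntervalIntegrable (v t) volume a b := fun t a b =>
    intervalIntegrable_iff.2 (((lp_locallyIntegrable (v t)).integrableOn_isCompact
      isCompact_uIcc).mono_set uIoc_subset_uIcc)
  have hPm : StronglyMeasurable (Function.uncurry P) := by
    refine stronglyMeasurable_uncurry_of_continuous_of_stronglyMeasurable (fun x => ?_) fun t => ?_
    · have hset : ∀ a b : ℝ, Continuous fun t => ∫ y in Ioc a b, v t y := fun a b => by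
        have hfin : (volume : Measure ℝ) (Ioc a b) ≠ ⊤ := by simp
        simp only [← L2.inner_indicatorConstLp_one (𝕜 := ℂ) measurableSet_Ioc hfin]
        exact continuous_const.inner hv
      simp only [hP, intervalIntegral]
      exact (hset 0 x).sub (hset x 0)
    · exact (intervalIntegral.continuous_primitive (hii t) 0).stronglyMeasurable
  set ε : ℕ → ℝ := fun n => 1 / ((n : ℝ) + 1) with hε
  set F : ℕ → ℝ × ℝ → ℂ := fun n z => (ε n)⁻¹ • (P z.1 (z.2 + ε n) - P z.1 z.2) with hF
  have hFm : ∀ n, StronglyMeasurable (F n) := fun n => by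
    have h1 : StronglyMeasurable fun z : ℝ × ℝ => P z.1 (z.2 + ε n) :=
      hPm.comp_measurable (g := fun z : ℝ × ℝ => (z.1, z.2 + ε n)) (by fun_prop)
    have h2 : StronglyMeasurable fun z : ℝ × ℝ => P z.1 (z.2 + ε n) - P z.1 z.2 := h1.sub hPm
    exact h2.const_smul ((ε n)⁻¹)
  have hlim : Measurable fun z : ℝ × ℝ => limUnder atTop fun n => F n z :=
    (StronglyMeasurable.limUnder hFm).measurable
  refine ⟨fun t x => limUnder atTop fun n => F n (t, x), hlim, fun t => ?_⟩
  filter_upwards [LocallyIntegrable.ae_hasDerivAt_integral (lp_locallyIntegrable (v t))] with x hx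
  have h1 := (hasDerivAt_iff_tendsto_slope_zero.1 (hx 0))
  have h2 : Tendsto ε atTop (𝓝[≠] 0) := by
    refine tendsto_nhdsWithin_iff.2 ⟨tendsto_one_div_add_atTop_nhds_zero_nat,
      Eventually.of_forall fun n => ?_⟩
    have : (0 : ℝ) < ε n := by simp only [hε]; positivity
    exact this.ne'
  exact (h1.comp h2).limUnder_eq

/-- The exponent used below is `q/r - 1`, which may have either sign, so both ends of the interval
appear in the bound. -/
lemma rpow_le_add_of_mem {n d Y e : ℝ} (hd : 0 < d) (h1 : d ≤ n) (h2 : n ≤ Y) :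
    n ^ e ≤ d ^ e + Y ^ e := by
  have hn : 0 < n := hd.trans_le h1
  have hY : 0 < Y := hn.trans_le h2
  rcases le_total 0 e with he | he
  · have := Real.rpow_le_rpow hn.le h2 he
    have h3 : 0 ≤ d ^ e := by positivity
    linarith
  · have := Real.rpow_le_rpow_of_nonpos hd h1 he
    have h3 : 0 ≤ Y ^ e := by positivity
    linarith

/-- The `r`-th power of the `L^r` norm of the slices. -/
def sliceNorm (r : ℝ) (g : ℝ → ℝ → ℂ) (t : ℝ) : ℝ := ∫ x, ‖g t x‖ ^ r

lemma sliceNorm_nonneg (r : ℝ) (g : ℝ → ℝ → ℂ) (t : ℝ) : 0 ≤ sliceNorm r g t :=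
  integral_nonneg fun x => by positivity

lemma IsNice.measurable_sliceNorm {g : ℝ → ℝ → ℂ} (hg : IsNice g) (r : ℝ) :
    Measurable (sliceNorm r g) := by
  have h1 : Measurable fun z : ℝ × ℝ => ‖g z.1 z.2‖ ^ r := (hg.measurable.norm).pow_const r
  exact (h1.stronglyMeasurable.integral_prod_right').measurable

lemma IsNice.exists_slice_bound {g : ℝ → ℝ → ℂ} (hg : IsNice g) {r : ℝ} (hr : 0 < r) :
    (∀ t, Integrable fun x => ‖g t x‖ ^ r) ∧
    ∃ Y R : ℝ, 0 ≤ Y ∧ ∀ t, sliceNorm r g t ≤ indicator (Icc (-R) R) (fun _ => Y) t := by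
  obtain ⟨B, R, hB, hb⟩ := hg.bounded
  have hp : ∀ t x, ‖g t x‖ ^ r ≤ indicator (Icc (-R) R) (fun _ => B ^ r) t *
      indicator (Icc (-R) R) (fun _ => (1 : ℝ)) x := by
    intro t x
    have h1 := hb t x
    by_cases ht : t ∈ Icc (-R) R
    · by_cases hx : x ∈ Icc (-R) R
      · rw [indicator_of_mem ht, indicator_of_mem hx, mul_one] at h1 ⊢
        exact Real.rpow_le_rpow (norm_nonneg _) h1 hr.le
      · rw [indicator_of_notMem hx, mul_zero] at h1 ⊢
        rw [le_antisymm h1 (norm_nonneg _), Real.zero_rpow hr.ne']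
    · rw [indicator_of_notMem ht, zero_mul] at h1 ⊢
      rw [le_antisymm h1 (norm_nonneg _), Real.zero_rpow hr.ne']
  have hi : ∀ t, Integrable fun x => indicator (Icc (-R) R) (fun _ => B ^ r) t *
      indicator (Icc (-R) R) (fun _ => (1 : ℝ)) x := fun t =>
    (integrable_indicator_Icc R 1).const_mul _
  have hinteg : ∀ t, Integrable fun x => ‖g t x‖ ^ r := fun t => by
    refine (hi t).mono' ((hg.memL12 t).measurable.norm.pow_const r).aestronglyMeasurable
      (ae_of_all _ fun x => ?_)
    rw [Real.norm_of_nonneg (by positivity)]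
    exact hp t x
  have hV0 : 0 ≤ ∫ x, indicator (Icc (-R) R) (fun _ => (1 : ℝ)) x :=
    integral_nonneg fun x => indicator_nonneg (fun _ _ => zero_le_one) x
  refine ⟨hinteg, B ^ r * ∫ x, indicator (Icc (-R) R) (fun _ => (1 : ℝ)) x, R, by positivity,
    fun t => ?_⟩
  refine (integral_mono (hinteg t) (hi t) fun x => hp t x).trans (le_of_eq ?_)
  rw [integral_const_mul]
  by_cases ht : t ∈ Icc (-R) R
  · rw [indicator_of_mem ht, indicator_of_mem ht]
  · rw [indicator_of_notMem ht, indicator_of_notMem ht, zero_mul]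

/-- The time weight of the dual function. -/
def dualWeight (q r d : ℝ) (g : ℝ → ℝ → ℂ) : ℝ → ℝ :=
  indicator {t | d ≤ sliceNorm r g t} fun t => sliceNorm r g t ^ (q / r - 1)

/-- The function that is dual to `g` in the mixed norm. -/
def dualFun (q r d : ℝ) (g : ℝ → ℝ → ℂ) (t x : ℝ) : ℂ :=
  ((dualWeight q r d g t * ‖g t x‖ ^ (r - 2) : ℝ) : ℂ) * starRingEnd ℂ (g t x)

lemma dualWeight_nonneg (q r d : ℝ) (g : ℝ → ℝ → ℂ) (t : ℝ) : 0 ≤ dualWeight q r d g t :=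
  indicator_nonneg (fun t _ => Real.rpow_nonneg (sliceNorm_nonneg r g t) _) t

lemma IsNice.measurable_dualWeight {g : ℝ → ℝ → ℂ} (hg : IsNice g) (q r d : ℝ) :
    Measurable (dualWeight q r d g) :=
  ((hg.measurable_sliceNorm r).pow_const _).indicator
    (measurableSet_le measurable_const (hg.measurable_sliceNorm r))

lemma norm_dualFun {q r d : ℝ} (hr : 2 < r) (g : ℝ → ℝ → ℂ) (t x : ℝ) :
    ‖dualFun q r d g t x‖ = dualWeight q r d g t * ‖g t x‖ ^ (r - 1) := by
  have h0 := dualWeight_nonneg q r d g t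
  rw [dualFun, norm_mul, RCLike.norm_conj, Complex.norm_real, Real.norm_of_nonneg (by positivity),
    mul_assoc, ← Real.rpow_add_one' (norm_nonneg _) (by linarith)]
  congr 2; ring

/-- The cutoff `d > 0` keeps the time weight bounded when `q < r`, where it is a negative power of
the slice norm. -/
lemma IsNice.dual {q r d : ℝ} (hr : 2 < r) (hd : 0 < d) {g : ℝ → ℝ → ℂ} (hg : IsNice g) :
    IsNice (dualFun q r d g) := by
  obtain ⟨-, Y, R', hY, hn⟩ := hg.exists_slice_bound (r := r) (by linarith)
  obtain ⟨B, R, hB, hb⟩ := hg.bounded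
  have hw : ∀ t, dualWeight q r d g t ≤ d ^ (q / r - 1) + Y ^ (q / r - 1) := fun t => by
    unfold dualWeight
    by_cases ht : t ∈ {t | d ≤ sliceNorm r g t}
    · rw [indicator_of_mem ht]
      exact rpow_le_add_of_mem hd ht ((hn t).trans (indicator_le_self' (fun _ _ => hY) t))
    · rw [indicator_of_notMem ht]; positivity
  refine ⟨?_, (d ^ (q / r - 1) + Y ^ (q / r - 1)) * B ^ (r - 1), R, by positivity, fun t x => ?_⟩
  · have h1 : Measurable fun z : ℝ × ℝ => dualWeight q r d g z.1 :=
      (hg.measurable_dualWeight q r d).comp measurable_fst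
    have h2 : Measurable fun z : ℝ × ℝ => ‖g z.1 z.2‖ ^ (r - 2) :=
      (hg.measurable.norm).pow_const _
    have h3 : Measurable fun z : ℝ × ℝ => starRingEnd ℂ (g z.1 z.2) :=
      (RCLike.continuous_conj (K := ℂ)).measurable.comp hg.measurable
    exact (Complex.measurable_ofReal.comp (h1.mul h2)).mul h3
  · rw [norm_dualFun hr]
    have h0 := dualWeight_nonneg q r d g t
    have h1 := hb t x
    have hr1 : r - 1 ≠ 0 := by linarith
    by_cases ht : t ∈ Icc (-R) R
    · by_cases hx : x ∈ Icc (-R) R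
      · rw [indicator_of_mem ht, indicator_of_mem hx, mul_one] at h1 ⊢
        have h2 := Real.rpow_le_rpow (norm_nonneg _) h1 (by linarith : 0 ≤ r - 1)
        exact mul_le_mul (hw t) h2 (by positivity) (by positivity)
      · rw [indicator_of_notMem hx, mul_zero] at h1 ⊢
        rw [le_antisymm h1 (norm_nonneg _), Real.zero_rpow hr1, mul_zero]
    · rw [indicator_of_notMem ht, zero_mul] at h1 ⊢
      rw [le_antisymm h1 (norm_nonneg _), Real.zero_rpow hr1, mul_zero]

/-- The integrand of the mixed norm, cut off where the slice norm is small. -/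
def cutPow (q r d : ℝ) (g : ℝ → ℝ → ℂ) : ℝ → ℝ :=
  indicator {t | d ≤ sliceNorm r g t} fun t => sliceNorm r g t ^ (q / r)

lemma cutPow_nonneg (q r d : ℝ) (g : ℝ → ℝ → ℂ) (t : ℝ) : 0 ≤ cutPow q r d g t :=
  indicator_nonneg (fun t _ => Real.rpow_nonneg (sliceNorm_nonneg r g t) _) t

lemma dualWeight_mul_sliceNorm {q r d : ℝ} (hd : 0 < d) (g : ℝ → ℝ → ℂ) (t : ℝ) :
    dualWeight q r d g t * sliceNorm r g t = cutPow q r d g t := by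
  unfold dualWeight cutPow
  by_cases ht : t ∈ {t | d ≤ sliceNorm r g t}
  · have h0 : 0 < sliceNorm r g t := hd.trans_le ht
    rw [indicator_of_mem ht, indicator_of_mem ht, ← Real.rpow_add_one h0.ne']
    congr 1; ring
  · rw [indicator_of_notMem ht, indicator_of_notMem ht, zero_mul]

lemma IsNice.integrable_cutPow {q r d : ℝ} (hq : 0 < q) (hr : 0 < r) {g : ℝ → ℝ → ℂ}
    (hg : IsNice g) : Integrable (cutPow q r d g) := by
  obtain ⟨-, Y, R, hY, hn⟩ := hg.exists_slice_bound (r := r) hr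
  have hm : Measurable (cutPow q r d g) := ((hg.measurable_sliceNorm r).pow_const _).indicator
    (measurableSet_le measurable_const (hg.measurable_sliceNorm r))
  refine (integrable_indicator_Icc R (Y ^ (q / r))).mono' hm.aestronglyMeasurable
    (ae_of_all _ fun t => ?_)
  rw [Real.norm_of_nonneg (cutPow_nonneg q r d g t)]
  have h1 : cutPow q r d g t ≤ sliceNorm r g t ^ (q / r) :=
    indicator_le_self' (fun t _ => Real.rpow_nonneg (sliceNorm_nonneg r g t) _) t
  refine h1.trans ?_
  have h2 := hn t
  by_cases ht : t ∈ Icc (-R) R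
  · rw [indicator_of_mem ht] at h2 ⊢
    exact Real.rpow_le_rpow (sliceNorm_nonneg r g t) h2 (by positivity)
  · rw [indicator_of_notMem ht] at h2 ⊢
    rw [le_antisymm h2 (sliceNorm_nonneg r g t), Real.zero_rpow (by positivity)]

/-- The dual function is the extremizer in Hölder's inequality. Since `(r - 1)p = r` and `(q - 1)q'
= q`, its dual norm is a power of the quantity being estimated. -/
lemma IsNice.pNorm_dualFun_rpow {q r q' p d : ℝ} (hq : 2 < q) (hr : 2 < r) (hp : p = r / (r - 1))
    (hq' : q' = q / (q - 1)) (hd : 0 < d) {g : ℝ → ℝ → ℂ} (hg : IsNice g) (t : ℝ) :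
    pNorm p (dualFun q r d g t) ^ q' = ENNReal.ofReal (cutPow q r d g t) := by
  have hp0 : 0 < p := by rw [hp]; exact div_pos (by linarith) (by linarith)
  have hq0 : 0 < q' := by rw [hq']; exact div_pos (by linarith) (by linarith)
  have hr1 : r - 1 ≠ 0 := by linarith
  have hq1 : q - 1 ≠ 0 := by linarith
  have hw := dualWeight_nonneg q r d g t
  have hn := sliceNorm_nonneg r g t
  obtain ⟨hi, -⟩ := hg.exists_slice_bound (r := r) (by linarith)
  have e1 : ∀ x, ‖dualFun q r d g t x‖ₑ ^ p =
      ENNReal.ofReal (dualWeight q r d g t ^ p * ‖g t x‖ ^ r) := fun x => by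
    rw [enorm_rpow_eq_ofReal _ hp0.le, norm_dualFun hr, Real.mul_rpow hw (by positivity),
      ← Real.rpow_mul (norm_nonneg _)]
    congr 3
    rw [hp]; field_simp
  have e2 : ∫⁻ x, ‖dualFun q r d g t x‖ₑ ^ p =
      ENNReal.ofReal (dualWeight q r d g t ^ p * sliceNorm r g t) := by
    simp only [e1]
    rw [← ofReal_integral_eq_lintegral_ofReal ((hi t).const_mul _)
      (ae_of_all _ fun x => by positivity), integral_const_mul, sliceNorm]
  rw [pNorm, e2, ENNReal.ofReal_rpow_of_nonneg (by positivity) (by positivity),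
    ENNReal.ofReal_rpow_of_nonneg (by positivity) hq0.le]
  congr 1
  rw [Real.mul_rpow (by positivity) hn, ← Real.rpow_mul hw, mul_one_div_cancel hp0.ne',
    Real.rpow_one, Real.mul_rpow hw (by positivity), ← Real.rpow_mul hn]
  unfold dualWeight cutPow
  by_cases ht : t ∈ {t | d ≤ sliceNorm r g t}
  · have h0 : 0 < sliceNorm r g t := hd.trans_le ht
    rw [indicator_of_mem ht, indicator_of_mem ht, ← Real.rpow_mul hn, ← Real.rpow_add h0]
    congr 1
    rw [hp, hq']; field_simp; ring
  · rw [indicator_of_notMem ht, indicator_of_notMem ht, Real.zero_rpow hq0.ne', zero_mul]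

/-- Tested against its dual function the profile gives the integral `J` itself, while the dual norm
is `J^(1-1/q)`. The dual estimate thus reads `J ≤ C J^(1-1/q)`. The hypothesis `hv` allows `g` to be
a truncation of the profile. -/
lemma IsNice.lintegral_cutPow_le {q r : ℝ} (hq : 2 < q) (hr : 2 < r)
    (hqr : 1 / 2 - 1 / r = 2 / q) {M : ℝ → ℝ → ℂ} {c : ℝ → ℝ≥0∞} (hM : DilKernel M c)
    (φ : Lp ℂ 2 (volume : Measure ℝ)) {g : ℝ → ℝ → ℂ} (hg : IsNice g)
    (hv : ∀ t, ∀ᵐ x, profile (spaceOp hM) φ t x * starRingEnd ℂ (g t x) = ((‖g t x‖ ^ 2 : ℝ) : ℂ))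
    {d : ℝ} (hd : 0 < d) :
    ∫⁻ t, ENNReal.ofReal (cutPow q r d g t) ≤ (‖φ‖ₑ * adjConst q r c ^ (1 / 2 : ℝ)) ^ q := by
  have hr0 : 0 < r := by linarith
  have hq0 : 0 < q := by linarith
  have hq1 : q - 1 ≠ 0 := by linarith
  have hh := hg.dual (q := q) hr hd
  have hi := hg.integrable_cutPow (q := q) (d := d) hq0 hr0
  have key := hh.enorm_pairing_le hq hr hqr rfl rfl hM φ
  set J := ∫⁻ t, ENNReal.ofReal (cutPow q r d g t) with hJ
  have hJ' : J = ENNReal.ofReal (∫ t, cutPow q r d g t) :=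
    (ofReal_integral_eq_lintegral_ofReal hi (ae_of_all _ (cutPow_nonneg q r d g))).symm
  have hJtop : J ≠ ⊤ := by rw [hJ']; exact ENNReal.ofReal_ne_top
  have e1 : ∀ t, ∫ x, profile (spaceOp hM) φ t x * dualFun q r d g t x =
      (cutPow q r d g t : ℂ) := fun t => by
    have e : ∫ x, profile (spaceOp hM) φ t x * dualFun q r d g t x =
        ∫ x, ((dualWeight q r d g t * ‖g t x‖ ^ r : ℝ) : ℂ) := by
      apply integral_congr_ae
      filter_upwards [hv t] with x hx
      rw [dualFun, mul_left_comm, hx, ← Complex.ofReal_mul, mul_assoc]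
      congr 2
      rw [← Real.rpow_natCast, ← Real.rpow_add' (norm_nonneg _) (by push_cast; linarith)]
      congr 1; push_cast; ring
    rw [e, ← dualWeight_mul_sliceNorm hd, sliceNorm, ← integral_const_mul]
    exact integral_ofReal (𝕜 := ℂ)
  have e2 : ‖∫ t, ∫ x, profile (spaceOp hM) φ t x * dualFun q r d g t x‖ₑ = J := by
    simp only [e1]
    have : ∫ t, (cutPow q r d g t : ℂ) = ((∫ t, cutPow q r d g t : ℝ) : ℂ) :=
      integral_ofReal (𝕜 := ℂ)
    rw [this, hJ', ← ofReal_norm, Complex.norm_real,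
      Real.norm_of_nonneg (integral_nonneg (cutPow_nonneg q r d g))]
  have e3 : mNorm (q / (q - 1)) (r / (r - 1)) (dualFun q r d g) =
      J ^ (1 / (q / (q - 1))) := by
    rw [mNorm]
    simp only [hg.pNorm_dualFun_rpow hq hr rfl rfl hd]
    rfl
  rw [e2, e3] at key
  rcases eq_or_ne J 0 with h0 | h0
  · rw [h0]; exact zero_le
  have hsplit : J = J ^ (1 / q) * J ^ (1 / (q / (q - 1))) := by
    rw [← ENNReal.rpow_add _ _ h0 hJtop]
    have : 1 / q + 1 / (q / (q - 1)) = 1 := by field_simp; ring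
    rw [this, ENNReal.rpow_one]
  have hne0 : J ^ (1 / (q / (q - 1))) ≠ 0 := by
    rw [Ne, ENNReal.rpow_eq_zero_iff]
    rintro (⟨h, -⟩ | ⟨h, -⟩)
    · exact h0 h
    · exact hJtop h
  have hnet : J ^ (1 / (q / (q - 1))) ≠ ⊤ :=
    ENNReal.rpow_ne_top_of_nonneg (by
      have : 0 < q - 1 := by linarith
      positivity) hJtop
  -- Cancelling the power of `J` is legitimate because the truncation makes `J` finite.
  have h4 : J ^ (1 / q) ≤ ‖φ‖ₑ * adjConst q r c ^ (1 / 2 : ℝ) := by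
    have key' : J ^ (1 / q) * J ^ (1 / (q / (q - 1))) ≤
        ‖φ‖ₑ * adjConst q r c ^ (1 / 2 : ℝ) * J ^ (1 / (q / (q - 1))) := by
      rw [← hsplit]; exact key
    exact (ENNReal.mul_le_mul_iff_left hne0 hnet).1 key'
  calc J = (J ^ (1 / q)) ^ q := by
        rw [← ENNReal.rpow_mul, one_div_mul_cancel hq0.ne', ENNReal.rpow_one]
    _ ≤ _ := ENNReal.rpow_le_rpow h4 hq0.le

lemma IsNice.lintegral_sliceNorm_le {q r : ℝ} (hq : 2 < q) (hr : 2 < r)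
    (hqr : 1 / 2 - 1 / r = 2 / q) {M : ℝ → ℝ → ℂ} {c : ℝ → ℝ≥0∞} (hM : DilKernel M c)
    (φ : Lp ℂ 2 (volume : Measure ℝ)) {g : ℝ → ℝ → ℂ} (hg : IsNice g)
    (hv : ∀ t, ∀ᵐ x, profile (spaceOp hM) φ t x * starRingEnd ℂ (g t x) = ((‖g t x‖ ^ 2 : ℝ) : ℂ)) :
    ∫⁻ t, ENNReal.ofReal (sliceNorm r g t ^ (q / r)) ≤
      (‖φ‖ₑ * adjConst q r c ^ (1 / 2 : ℝ)) ^ q := by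
  have hlim : ∀ t, liminf (fun n : ℕ => ENNReal.ofReal (cutPow q r (1 / ((n : ℝ) + 1)) g t)) atTop =
      ENNReal.ofReal (sliceNorm r g t ^ (q / r)) := by
    intro t
    apply Tendsto.liminf_eq
    rcases (sliceNorm_nonneg r g t).eq_or_lt with h0 | h0
    · have e : ∀ n : ℕ, cutPow q r (1 / ((n : ℝ) + 1)) g t = 0 := fun n => by
        unfold cutPow
        refine indicator_of_notMem (fun h => ?_) _
        have h' : 1 / ((n : ℝ) + 1) ≤ sliceNorm r g t := h
        rw [← h0] at h'
        have : 0 < 1 / ((n : ℝ) + 1) := by positivity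
        linarith
      have hqr0 : q / r ≠ 0 := by positivity
      simp only [e, ← h0, Real.zero_rpow hqr0]
      exact tendsto_const_nhds
    · refine Tendsto.congr' ?_ tendsto_const_nhds
      filter_upwards [(tendsto_one_div_add_atTop_nhds_zero_nat (𝕜 := ℝ)).eventually
        (eventually_le_nhds h0)] with n hn
      unfold cutPow
      rw [indicator_of_mem (s := {t | 1 / ((n : ℝ) + 1) ≤ sliceNorm r g t}) hn]
  simp only [← hlim]
  have hm : ∀ n : ℕ, Measurable fun t => ENNReal.ofReal (cutPow q r (1 / ((n : ℝ) + 1)) g t) :=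
    fun n => ENNReal.measurable_ofReal.comp
      (((hg.measurable_sliceNorm r).pow_const _).indicator
        (measurableSet_le measurable_const (hg.measurable_sliceNorm r)))
  refine (lintegral_liminf_le hm).trans ?_
  -- Fatou as the cutoff `d = 1/(n+1)` tends to zero; the bound does not depend on `d`.
  refine liminf_le_of_frequently_le' (Eventually.frequently (Eventually.of_forall fun n => ?_))
  exact hg.lintegral_cutPow_le hq hr hqr hM φ hv (by positivity)

/-! ### The mixed norm -/

/-- The set where a space-time function is cut off. -/
def truncSet (V : ℝ → ℝ → ℂ) (N : ℕ) : Set (ℝ × ℝ) :=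
  {z | z.1 ∈ Icc (-(N : ℝ)) N ∧ z.2 ∈ Icc (-(N : ℝ)) N ∧ ‖V z.1 z.2‖ ≤ N}

/-- A bounded truncation of a space-time function. -/
def trunc (V : ℝ → ℝ → ℂ) (N : ℕ) (t x : ℝ) : ℂ :=
  indicator (truncSet V N) (Function.uncurry V) (t, x)

lemma isNice_trunc {V : ℝ → ℝ → ℂ} (hV : Measurable (Function.uncurry V)) (N : ℕ) :
    IsNice (trunc V N) := by
  have hS : MeasurableSet (truncSet V N) := by
    refine (measurable_fst measurableSet_Icc).inter ((measurable_snd measurableSet_Icc).inter ?_)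
    exact measurableSet_le hV.norm measurable_const
  refine ⟨hV.indicator hS, N, N, by positivity, fun t x => ?_⟩
  unfold trunc
  by_cases h : (t, x) ∈ truncSet V N
  · rw [indicator_of_mem h, indicator_of_mem h.1, indicator_of_mem h.2.1, mul_one]
    exact h.2.2
  · rw [indicator_of_notMem h, norm_zero]
    exact mul_nonneg (indicator_nonneg (fun _ _ => by positivity) t)
      (indicator_nonneg (fun _ _ => zero_le_one) x)

lemma monotone_truncSet (V : ℝ → ℝ → ℂ) : Monotone (truncSet V) := by
  intro N N' h z hz
  have h' : (N : ℝ) ≤ N' := by exact_mod_cast h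
  obtain ⟨⟨a1, a2⟩, ⟨b1, b2⟩, c⟩ := hz
  exact ⟨⟨by linarith, by linarith⟩, ⟨by linarith, by linarith⟩, by linarith⟩

lemma eventually_mem_truncSet (V : ℝ → ℝ → ℂ) (z : ℝ × ℝ) : ∀ᶠ N in atTop, z ∈ truncSet V N := by
  obtain ⟨N, hN⟩ := exists_nat_ge (max (max |z.1| |z.2|) ‖V z.1 z.2‖)
  filter_upwards [eventually_ge_atTop N] with N' hN'
  refine monotone_truncSet V hN' ⟨?_, ?_, ?_⟩
  · exact abs_le.1 ((le_max_left _ _).trans ((le_max_left _ _).trans hN))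
  · exact abs_le.1 ((le_max_right _ _).trans ((le_max_left _ _).trans hN))
  · exact (le_max_right _ _).trans hN

/-- Strichartz' estimate for the profiles. -/
lemma lintegral_mixed_le {q r : ℝ} (hq : 2 < q) (hr : 2 < r) (hqr : 1 / 2 - 1 / r = 2 / q)
    {M : ℝ → ℝ → ℂ} {c : ℝ → ℝ≥0∞} (hM : DilKernel M c) (φ : Lp ℂ 2 (volume : Measure ℝ))
    {V : ℝ → ℝ → ℂ} (hV : Measurable (Function.uncurry V))
    (hVp : ∀ t, V t =ᵐ[volume] profile (spaceOp hM) φ t) :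
    ∫⁻ t, (∫⁻ x, ‖V t x‖ₑ ^ r) ^ (q / r) ≤ (‖φ‖ₑ * adjConst q r c ^ (1 / 2 : ℝ)) ^ q := by
  have hr0 : 0 < r := by linarith
  have hq0 : 0 < q := by linarith
  have hpoint : ∀ N t x, ‖trunc V N t x‖ₑ ^ r =
      indicator (truncSet V N) (fun z => ‖V z.1 z.2‖ₑ ^ r) (t, x) := by
    intro N t x
    unfold trunc
    by_cases h : (t, x) ∈ truncSet V N
    · rw [indicator_of_mem h, indicator_of_mem h]; rfl
    · rw [indicator_of_notMem h, indicator_of_notMem h, enorm_zero, ENNReal.zero_rpow_of_pos hr0]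
  have hslice : ∀ N t, ENNReal.ofReal (sliceNorm r (trunc V N) t ^ (q / r)) =
      (∫⁻ x, ‖trunc V N t x‖ₑ ^ r) ^ (q / r) := by
    intro N t
    obtain ⟨hi, -⟩ := (isNice_trunc hV N).exists_slice_bound (r := r) hr0
    rw [← ENNReal.ofReal_rpow_of_nonneg (sliceNorm_nonneg _ _ _) (by positivity), sliceNorm,
      ofReal_integral_eq_lintegral_ofReal (hi t) (ae_of_all _ fun x => by positivity)]
    simp only [enorm_rpow_eq_ofReal _ hr0.le]
  have hlim : ∀ t, Tendsto (fun N => ∫⁻ x, ‖trunc V N t x‖ₑ ^ r) atTop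
      (𝓝 (∫⁻ x, ‖V t x‖ₑ ^ r)) := by
    intro t
    refine lintegral_tendsto_of_tendsto_of_monotone (fun N => ?_) (ae_of_all _ fun x => ?_)
      (ae_of_all _ fun x => ?_)
    · exact (((isNice_trunc hV N).memL12 t).measurable.enorm.pow_const r).aemeasurable
    · intro N N' h
      simp only [hpoint]
      exact indicator_le_indicator_of_subset (monotone_truncSet V h) (fun _ => zero_le) _
    · refine Tendsto.congr' ?_ tendsto_const_nhds
      filter_upwards [eventually_mem_truncSet V (t, x)] with N hN
      rw [hpoint, indicator_of_mem hN]
  have hlim' : ∀ t, liminf (fun N => (∫⁻ x, ‖trunc V N t x‖ₑ ^ r) ^ (q / r)) atTop =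
      (∫⁻ x, ‖V t x‖ₑ ^ r) ^ (q / r) := fun t =>
    (((ENNReal.continuous_rpow_const (y := q / r)).tendsto _).comp (hlim t)).liminf_eq
  -- The truncations increase to `V`: monotone convergence in `x`, then Fatou in `t`, pass from nice
  -- functions to the profile.
  simp only [← hlim']
  refine (lintegral_liminf_le fun N => ?_).trans ?_
  · have h1 : Measurable fun z : ℝ × ℝ => ‖trunc V N z.1 z.2‖ₑ ^ r :=
      ((isNice_trunc hV N).measurable.enorm).pow_const r
    exact (h1.lintegral_prod_right').pow_const _
  refine liminf_le_of_frequently_le' (Eventually.frequently (Eventually.of_forall fun N => ?_))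
  simp only [← hslice]
  refine (isNice_trunc hV N).lintegral_sliceNorm_le hq hr hqr hM φ fun t => ?_
  filter_upwards [hVp t] with x hx
  rw [← hx]
  unfold trunc
  by_cases h : (t, x) ∈ truncSet V N
  · rw [indicator_of_mem h]
    change V t x * starRingEnd ℂ (V t x) = ((‖V t x‖ ^ 2 : ℝ) : ℂ)
    rw [Complex.mul_conj, Complex.normSq_eq_norm_sq]
  · rw [indicator_of_notMem h]; simp

/-! ### Measurability of curves in `L^r`, and the mixed norm estimate. -/

/-- In a second countable metric space every open set is a countable union of balls, whose preimages
are sublevel sets of distances. -/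
lemma measurable_of_measurable_dist {E : Type*} [MetricSpace E] [SecondCountableTopology E]
    [MeasurableSpace E] [BorelSpace E] {w : ℝ → E} (h : ∀ g, Measurable fun t => dist (w t) g) :
    Measurable w := by
  refine measurable_of_isOpen fun U hU => ?_
  obtain ⟨T, hTc, hT⟩ := TopologicalSpace.isOpen_iUnion_countable
    (fun p : {p : E × ℝ // Metric.ball p.1 p.2 ⊆ U} => Metric.ball p.1.1 p.1.2)
    fun _ => Metric.isOpen_ball
  have e : U = ⋃ p ∈ T, Metric.ball p.1.1 p.1.2 := by
    rw [hT]
    ext x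
    simp only [mem_iUnion]
    constructor
    · intro hx
      obtain ⟨ε, hε, hb⟩ := Metric.isOpen_iff.1 hU x hx
      exact ⟨⟨(x, ε), hb⟩, Metric.mem_ball_self hε⟩
    · rintro ⟨p, hp⟩
      exact p.2 hp
  rw [e, preimage_iUnion₂]
  refine MeasurableSet.biUnion hTc fun p _ => ?_
  exact h p.1.1 measurableSet_Iio

lemma eLpNorm_eq_lintegral_toReal {r : ℝ≥0∞} (h0 : r ≠ 0) (hr : r ≠ ⊤) (f : ℝ → ℂ) :
    eLpNorm f r volume = (∫⁻ x, ‖f x‖ₑ ^ r.toReal) ^ (1 / r.toReal) :=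
  eLpNorm_eq_lintegral_rpow_enorm_toReal h0 hr

/-- A jointly measurable function whose slices are in `L^r` is strongly measurable as a map
into `L^r`. -/
lemma aestronglyMeasurable_toLp {r : ℝ≥0∞} [Fact (1 ≤ r)] (hr : r ≠ ⊤) {V : ℝ → ℝ → ℂ}
    (hV : Measurable (Function.uncurry V)) (hmem : ∀ t, MemLp (V t) r volume) :
    AEStronglyMeasurable (fun t => (hmem t).toLp (V t)) volume := by
  have h0 : r ≠ 0 := (zero_lt_one.trans_le (Fact.out : 1 ≤ r)).ne'
  have : Fact (r ≠ ⊤) := ⟨hr⟩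
  borelize ↥(Lp ℂ r (volume : Measure ℝ))
  refine (measurable_of_measurable_dist fun g => ?_).aestronglyMeasurable
  have e : ∀ t, dist ((hmem t).toLp (V t)) g =
      ((∫⁻ x, ‖V t x - g x‖ₑ ^ r.toReal) ^ (1 / r.toReal)).toReal := by
    intro t
    rw [dist_eq_norm, Lp.norm_def, eLpNorm_eq_lintegral_toReal h0 hr]
    congr 2
    apply lintegral_congr_ae
    filter_upwards [Lp.coeFn_sub ((hmem t).toLp (V t)) g, (hmem t).coeFn_toLp] with x h1 h2
    rw [h1, Pi.sub_apply, h2]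
  simp only [e]
  have hg : Measurable fun z : ℝ × ℝ => g z.2 :=
    (Lp.stronglyMeasurable g).measurable.comp measurable_snd
  have h1 : Measurable fun z : ℝ × ℝ => ‖V z.1 z.2 - g z.2‖ₑ ^ r.toReal :=
    ((hV.sub hg).enorm).pow_const _
  exact ((h1.lintegral_prod_right').pow_const _).ennreal_toReal

lemma toTD_congr {p r : ℝ≥0∞} [Fact (1 ≤ p)] [Fact (1 ≤ r)] {f : Lp ℂ p (volume : Measure ℝ)}
    {g : Lp ℂ r (volume : Measure ℝ)} (h : f =ᵐ[volume] g) : (f : 𝓢'(ℝ, ℂ)) = (g : 𝓢'(ℝ, ℂ)) := by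
  ext ψ
  rw [Lp.toTemperedDistribution_apply, Lp.toTemperedDistribution_apply]
  apply integral_congr_ae
  filter_upwards [h] with x hx
  rw [hx]

lemma mixedENorm_le_of_profile {q r : ℝ≥0∞} [Fact (1 ≤ r)] (hqt : q ≠ ⊤) (hrt : r ≠ ⊤)
    (hq : 2 < q.toReal) (hr : 2 < r.toReal) (hqr : 1 / 2 - 1 / r.toReal = 2 / q.toReal)
    {s : ℝ} {M : ℝ → ℝ → ℂ} {c : ℝ → ℝ≥0∞} (hM : DilKernel M c)
    (hC : adjConst q.toReal r.toReal c ≠ ⊤) (φ : Lp ℂ 2 (volume : Measure ℝ))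
    {u : ℝ → 𝓢'(ℝ, ℂ)} (hu : ∀ t, bessel s (u t) =
      ((profile (spaceOp hM) φ t : Lp ℂ 2 (volume : Measure ℝ)) : 𝓢'(ℝ, ℂ))) :
    mixedENorm q s r u ≤ ‖φ‖ₑ * adjConst q.toReal r.toReal c ^ (1 / 2 : ℝ) := by
  set q₁ := q.toReal with hq₁
  set r₁ := r.toReal with hr₁
  have hr0 : 0 < r₁ := by linarith
  have hq0 : 0 < q₁ := by linarith
  have hrz : r ≠ 0 := (zero_lt_one.trans_le (Fact.out : 1 ≤ r)).ne'
  have hqz : q ≠ 0 := fun h => by rw [hq₁, h] at hq0; simp at hq0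
  obtain ⟨V, hV, hVp⟩ := exists_measurable_version (continuous_profile (spaceOp hM) φ)
  have key := lintegral_mixed_le hq hr hqr hM φ hV hVp
  set A := ‖φ‖ₑ * adjConst q₁ r₁ c ^ (1 / 2 : ℝ) with hA
  have hAt : A ≠ ⊤ := ENNReal.mul_ne_top enorm_ne_top
    (ENNReal.rpow_ne_top_of_nonneg (by norm_num) hC)
  set W : ℝ → ℝ≥0∞ := fun t => ∫⁻ x, ‖V t x‖ₑ ^ r₁ with hW
  have hWm : Measurable W := by
    have h1 : Measurable fun z : ℝ × ℝ => ‖V z.1 z.2‖ₑ ^ r₁ := (hV.enorm).pow_const _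
    exact h1.lintegral_prod_right'
  have hWfin : ∀ᵐ t, W t < ⊤ := by
    have h1 := ae_lt_top (hWm.pow_const (q₁ / r₁))
      (key.trans_lt (ENNReal.rpow_lt_top_of_nonneg hq0.le hAt)).ne
    filter_upwards [h1] with t ht
    by_contra h'
    rw [not_lt, top_le_iff] at h'
    rw [h', ENNReal.top_rpow_of_pos (by positivity)] at ht
    exact lt_irrefl _ ht
  -- The slices are in `L^r` only for almost every `t`. Setting the others to zero gives a map into
  -- `L^r` defined for all times, without changing the integral.
  set V' : ℝ → ℝ → ℂ := fun t x => indicator {z : ℝ × ℝ | W z.1 < ⊤} (Function.uncurry V) (t, x)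
    with hV'
  have hV'm : Measurable (Function.uncurry V') :=
    hV.indicator (measurableSet_lt (hWm.comp measurable_fst) measurable_const)
  have hV'eq : ∀ t, W t < ⊤ → V' t = V t := fun t ht => by
    funext x
    exact indicator_of_mem (s := {z : ℝ × ℝ | W z.1 < ⊤}) (a := (t, x)) ht _
  have hV'zero : ∀ t, ¬ W t < ⊤ → V' t = 0 := fun t ht => by
    funext x
    exact indicator_of_notMem (s := {z : ℝ × ℝ | W z.1 < ⊤}) (a := (t, x)) ht _
  have hmem : ∀ t, MemLp (V' t) r volume := fun t => by
    by_cases ht : W t < ⊤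
    · rw [hV'eq t ht]
      refine ⟨(hV.comp (measurable_const.prodMk measurable_id)).aestronglyMeasurable, ?_⟩
      rw [eLpNorm_eq_lintegral_toReal hrz hrt]
      exact ENNReal.rpow_lt_top_of_nonneg (by positivity) ht.ne
    · rw [hV'zero t ht]; exact MemLp.zero
  refine iInf_le_of_le (fun t => (hmem t).toLp (V' t)) (iInf_le_of_le
    (aestronglyMeasurable_toLp hrt hV'm hmem) (iInf_le_of_le ?_ ?_))
  · filter_upwards [hWfin] with t ht
    rw [hu t]
    refine toTD_congr ?_
    filter_upwards [hVp t, (hmem t).coeFn_toLp] with x h1 h2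
    rw [h2, hV'eq t ht, h1]
  · rw [eLpNorm_eq_lintegral_rpow_enorm_toReal hqz hqt]
    have h1 : ∀ᵐ t, ‖(hmem t).toLp (V' t)‖ₑ ^ q₁ = W t ^ (q₁ / r₁) := by
      filter_upwards [hWfin] with t ht
      rw [Lp.enorm_def, eLpNorm_congr_ae (hmem t).coeFn_toLp, hV'eq t ht,
        eLpNorm_eq_lintegral_toReal hrz hrt, ← ENNReal.rpow_mul, ← hr₁]
      congr 1
      field_simp
    rw [lintegral_congr_ae h1]
    refine (ENNReal.rpow_le_rpow key (by positivity)).trans (le_of_eq ?_)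
    rw [← ENNReal.rpow_mul, mul_one_div_cancel hq0.ne', ENNReal.rpow_one]

lemma mixedENorm_top_le_of_profile {s : ℝ}
    (K : Lp ℂ 2 (volume : Measure ℝ) →L[ℂ] Lp ℂ 2 (volume : Measure ℝ))
    (φ : Lp ℂ 2 (volume : Measure ℝ)) {u : ℝ → 𝓢'(ℝ, ℂ)} (hu : ∀ t, bessel s (u t) =
      ((profile K φ t : Lp ℂ 2 (volume : Measure ℝ)) : 𝓢'(ℝ, ℂ))) :
    mixedENorm ⊤ s 2 u ≤ ENNReal.ofReal (‖K‖ * ‖φ‖) := by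
  refine iInf_le_of_le (profile K φ) (iInf_le_of_le
    (continuous_profile K φ).aestronglyMeasurable (iInf_le_of_le (ae_of_all _ hu) ?_))
  rw [eLpNorm_exponent_top]
  exact eLpNormEssSup_le_of_ae_bound (ae_of_all _ fun t => norm_profile_le K φ t)

/-- The profiles are the same `L²` curves as for the space traces; only their size in `L^r` is new.
The relation between the exponents is used in the form `1/2 - 1/r = 2/q`. -/
theorem mixed_norm {s : ℝ} (h0 : 0 ≤ s) (h1 : s ≤ 1) (q r : ℝ≥0∞) [Fact (1 ≤ r)]
    (hr : 2 ≤ r) (hrt : r ≠ ⊤) (hqr : 1 / q + 1 / (2 * r) = 1 / 4) :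
    ∃ c : ℝ≥0, ∀ (f : 𝓢'(ℝ, ℂ)) (U : 𝓢'(ℝ × ℝ, ℂ)),
      MemH0 ((2 * s + 1) / 4) f → IsForcing ((2 * s + 1) / 4) f U →
      ∃ u : ℝ → 𝓢'(ℝ, ℂ), HasTimeSlices U u ∧
        mixedENorm q s r u ≤ c * hENorm ((2 * s + 1) / 4) f := by
  have hs1 : -(1 / 2) < s := by linarith
  have hs2 : s < 3 / 2 := by linarith
  have hM := dilKernel_spaceKer hs1 hs2
  set b : ℝ := 2 ^ (1 + (2 * s + 1) / 4) with hb
  have hb0 : 0 ≤ b := by positivity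
  have hφ : ∀ Φ : Lp ℂ 2 (volume : Measure ℝ), ‖spaceData hs1.le Φ‖ₑ ≤ ENNReal.ofReal b * ‖Φ‖ₑ := by
    intro Φ
    rw [← ofReal_norm, ← ofReal_norm, ← ENNReal.ofReal_mul hb0]
    exact ENNReal.ofReal_le_ofReal (norm_spaceData_le hs1.le Φ)
  -- At `r = 2` the relation forces `q = ∞`, outside the reach of Hardy-Littlewood-Sobolev, and the
  -- uniform `L²` bound is used. For `2 < r < ∞` it gives `4 < q < ∞`.
  rcases hr.eq_or_lt with hr2 | hr2
  · subst hr2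
    have hq : q = ⊤ := by
      have h4 : (1 : ℝ≥0∞) / (2 * 2) = 1 / 4 := by norm_num
      rw [h4] at hqr
      have h5 : 1 / q + 1 / 4 = 0 + 1 / 4 := by rw [hqr, zero_add]
      have h6 : 1 / q = 0 := (ENNReal.add_left_inj (by simp)).1 h5
      simpa using h6
    subst hq
    refine ⟨(‖spaceOp hM‖ * b).toNNReal, fun f U hf hU => ?_⟩
    obtain ⟨Φ, rfl, rfl⟩ := exists_data_of_isForcing hf hU
    refine ⟨spaceTrace hs1 hs2 Φ, hasTimeSlices_spaceTrace hs1 hs2 Φ, ?_⟩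
    refine (mixedENorm_top_le_of_profile (spaceOp hM) (spaceData hs1.le Φ)
      (bessel_spaceTrace hs1 hs2 Φ)).trans ?_
    rw [hENorm_ofData, ← ofReal_norm]
    change _ ≤ ENNReal.ofReal (‖spaceOp hM‖ * b) * _
    rw [← ENNReal.ofReal_mul (by positivity)]
    refine ENNReal.ofReal_le_ofReal ?_
    rw [mul_assoc]
    exact mul_le_mul_of_nonneg_left (norm_spaceData_le hs1.le Φ) (norm_nonneg _)
  · have hr2' : 2 < r.toReal := by
      have := (ENNReal.toReal_lt_toReal (by norm_num) hrt).2 hr2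
      simpa using this
    have hqt : q ≠ ⊤ := by
      rintro rfl
      rw [ENNReal.div_top, zero_add] at hqr
      have h3 := congrArg ENNReal.toReal hqr
      simp only [ENNReal.toReal_div, ENNReal.toReal_one, ENNReal.toReal_mul,
        ENNReal.toReal_ofNat] at h3
      have : r.toReal ≠ 0 := by linarith
      field_simp at h3
      linarith
    have hqz : q ≠ 0 := by
      rintro rfl
      rw [ENNReal.div_zero one_ne_zero, top_add] at hqr
      have : (1 / 4 : ℝ≥0∞) ≠ ⊤ := by simp
      exact this hqr.symm
    have hq0 : 0 < q.toReal := ENNReal.toReal_pos hqz hqt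
    have hreal : 1 / q.toReal + 1 / (2 * r.toReal) = 1 / 4 := by
      have h3 := congrArg ENNReal.toReal hqr
      rw [ENNReal.toReal_add (by simp [hqz]) (ENNReal.div_ne_top ENNReal.one_ne_top (by
        intro h; rw [mul_eq_zero] at h
        rcases h with h | h
        · norm_num at h
        · rw [h] at hr2; simp at hr2))] at h3
      simpa only [ENNReal.toReal_div, ENNReal.toReal_one, ENNReal.toReal_mul,
        ENNReal.toReal_ofNat] using h3
    have hr0 : 0 < 1 / (2 * r.toReal) := by positivity
    have hq2 : 2 < q.toReal := by
      have h3 : 1 / q.toReal < 1 / 4 := by linarith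
      have h4 := (one_div_lt_one_div hq0 (by norm_num)).1 h3
      linarith
    have hqr' : 1 / 2 - 1 / r.toReal = 2 / q.toReal := by
      have e1 : 1 / (2 * r.toReal) = 1 / 2 * (1 / r.toReal) := by field_simp
      have e2 : 2 / q.toReal = 2 * (1 / q.toReal) := by field_simp
      rw [e1] at hreal
      rw [e2]
      linarith
    -- With dilation weight `b = 1/r` the kernel is integrable for `1/r - 1 < s < 1 + 1/r`. This
    -- contains `[0, 1]` because `1 < r < ∞`.
    have hC : adjConst q.toReal r.toReal (kerBound s) ≠ ⊤ := by
      have hb1 : 0 < 1 / r.toReal := by positivity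
      have hb2 : 1 / r.toReal < 1 := by rw [div_lt_one (by linarith)]; linarith
      have h3 := lintegral_kerBound_ne_top (s := s) (b := 1 / r.toReal) hb1.le hb2 (by linarith)
        (by linarith)
      unfold adjConst
      finiteness
    have hC' : adjConst q.toReal r.toReal (kerBound s) ^ (1 / 2 : ℝ) ≠ ⊤ :=
      ENNReal.rpow_ne_top_of_nonneg (by norm_num) hC
    set a := adjConst q.toReal r.toReal (kerBound s) ^ (1 / 2 : ℝ) with ha
    refine ⟨(a * ENNReal.ofReal b).toNNReal, fun f U hf hU => ?_⟩
    obtain ⟨Φ, rfl, rfl⟩ := exists_data_of_isForcing hf hU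
    refine ⟨spaceTrace hs1 hs2 Φ, hasTimeSlices_spaceTrace hs1 hs2 Φ, ?_⟩
    refine (mixedENorm_le_of_profile hqt hrt hq2 hr2' hqr' hM hC (spaceData hs1.le Φ)
      (bessel_spaceTrace hs1 hs2 Φ)).trans ?_
    rw [hENorm_ofData, ENNReal.coe_toNNReal (ENNReal.mul_ne_top hC' ENNReal.ofReal_ne_top), ← ha,
      mul_comm, mul_assoc]
    gcongr
    exact hφ Φ

end NLSHalfLine

end

/-! ### The main theorem. -/

open NLSHalfLine in
theorem lemma6p3 :
    -- the operator is well defined on `H_0^σ(ℝ⁺)`, for every real `σ`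
    (∀ (σ : ℝ) (f : 𝓢'(ℝ, ℂ)), MemH0 σ f → ∃! U : 𝓢'(ℝ × ℝ, ℂ), IsForcing σ f U) ∧
    -- space traces
    (∀ s : ℝ, -(1 / 2) < s → s < 3 / 2 →
      ∀ θ : ℝ → ℂ, ContDiff ℝ ∞ θ → (∀ t ∈ Icc (-1 : ℝ) 1, θ t = 1) →
        tsupport θ ⊆ Icc (-2) 2 →
      ∃ c : ℝ≥0, ∀ (f : 𝓢'(ℝ, ℂ)) (U : 𝓢'(ℝ × ℝ, ℂ)),
        MemH0 ((2 * s + 1) / 4) f → IsForcing ((2 * s + 1) / 4) f U →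
        ∃ u : ℝ → 𝓢'(ℝ, ℂ), HasTimeSlices U u ∧
          ∀ T : ℝ, 0 < T →
            ContinuousIntoH s (fun t => θ (t * T⁻¹) • u t) ∧
            ∀ t, hENorm s (θ (t * T⁻¹) • u t) ≤
              c * ENNReal.ofReal (bracket T ^ (1 / 4 : ℝ)) * hENorm ((2 * s + 1) / 4) f) ∧
    -- time traces
    (∀ s : ℝ, ∃ c : ℝ≥0, ∀ (f : 𝓢'(ℝ, ℂ)) (U : 𝓢'(ℝ × ℝ, ℂ)),
        MemH0 ((2 * s + 1) / 4) f → IsForcing ((2 * s + 1) / 4) f U →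
        ∃ w : ℝ → 𝓢'(ℝ, ℂ), HasSpaceSlices U w ∧
          (∀ x, MemH0 ((2 * s + 1) / 4) (w x)) ∧
          ContinuousIntoH ((2 * s + 1) / 4) w ∧
          ∀ x, hENorm ((2 * s + 1) / 4) (w x) ≤ c * hENorm ((2 * s + 1) / 4) f) ∧
    -- mixed norm
    (∀ s : ℝ, 0 ≤ s → s ≤ 1 →
      ∀ (q r : ℝ≥0∞) [Fact (1 ≤ r)], 2 ≤ q → 2 ≤ r → r ≠ ⊤ →
        1 / q + 1 / (2 * r) = 1 / 4 →
      ∃ c : ℝ≥0, ∀ (f : 𝓢'(ℝ, ℂ)) (U : 𝓢'(ℝ × ℝ, ℂ)),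
        MemH0 ((2 * s + 1) / 4) f → IsForcing ((2 * s + 1) / 4) f U →
        ∃ u : ℝ → 𝓢'(ℝ, ℂ), HasTimeSlices U u ∧
          mixedENorm q s r u ≤ c * hENorm ((2 * s + 1) / 4) f) := by
  refine ⟨existsUnique_isForcing, ?_, ?_, ?_⟩
  · intro s h1 h2 θ hθ _ hθs
    exact space_traces h1 h2 hθ.continuous
      (HasCompactSupport.of_support_subset_isCompact isCompact_Icc
        ((subset_tsupport θ).trans hθs))
  · intro s
    -- The constant is one because the multiplier `symb x` has modulus at most one.
    refine ⟨1, fun f U hf hU => ?_⟩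
    obtain ⟨w, hw1, hw2, hw3, hw4⟩ := time_traces hf hU
    refine ⟨w, hw1, hw2, hw3, fun x => ?_⟩
    simpa using hw4 x
  · intro s h0 h1 q r _ _ hr hrt hqr
    exact mixed_norm h0 h1 q r hr hrt hqr
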